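/- Let $n\in\{1,2\}$, $g(x,u)=\log|x-u|^{-1}$ and $\vartheta(x)=\log(1+|x|)$ on $\mathbb R^n$, and let $V:\mathbb R^n\to\mathbb R$ be a $C^2$ function such that for every $\kappa\ge 0$ $$\inf_{x\in\mathbb R^n}\{V(x)-\kappa\,\vartheta(x)\}>-\infty \quad\text{and}\quad \int_{\mathbb R^n}|x|^{\kappa}e^{-V(x)}\,dx<\infty .$$ Let $\gamma\ge 0$ and let $\beta=\beta_N>0$ satisfy $\beta_N N\to\gamma$ as $N\to\infty$. Let $\mathbb P_N$ be the Gibbs probability measure on $(\mathbb R^n)^N$ with density proportional to $$\exp\Big(-\beta_N\sum_{1\le i<j\le N}g(x_i,x_j)-\sum_{1\le j\le N}V(x_j)\Big)$$ with respect to Lebesgue measure. Let $\nu_\gamma$ be the probability measure with density proportional to $e^{-(V-\gamma\vartheta)}$, let $\mathrm H(\mu|\nu_\gamma)$ be the relative entropy, and let $\mu_\gamma$ be the unique minimizer, among all probability measures $\mu$ on $\mathbb R^n$, of the free energy $$\mathscr F_\gamma(\mu)=\frac{\gamma}{2}\iint\big(g(x,z)+\vartheta(x)+\vartheta(z)\big)\,\mu(dz)\,\mu(dx)+\mathrm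 H(\mu|\nu_\gamma).$$ Let $\mathscr U^{\mu_\gamma}(x)=\int g(x,z)\,\mu_\gamma(dz)$ and let $\mathrm L_\gamma=\int_{\mathbb R^n} e^{-\gamma\,\mathscr U^{\mu_\gamma}(x)-V(x)}\,dx>0$, that is, the constant in the self-consistent equation $\mu_\gamma(dx)=\mathrm L_\gamma^{-1}e^{-\gamma\,\mathscr U^{\mu_\gamma}(x)-V(x)}\,dx$. Let $E_N\in\mathbb R^n$ with $|E_N|\to\infty$, and write $\nabla V(E_N)=\alpha_N\upsilon_N$ with $\alpha_N>0$ and $|\upsilon_N|=1$. Suppose that, as $N\to\infty$, $$\frac{N e^{-V(E_N)+\beta_N N\log|E_N|}}{\mathrm L_\gamma\,\alpha_N^{\,n}}\to 1,\qquad \upsilon_N\to\upsilon,\qquad N^{-1}\log\alpha_N\to 0,\qquad \alpha_N|E_N|\to\infty .$$ Let $\psi:\mathbb R^n\to\mathbb R^n$ be a $C^1$ diffeomorphism with Jacobian $|\det D\psi|\equiv 1$, put $\varphi_N(x)=E_N+\alpha_N^{-1}\psi(x)$, and suppose that for every compact set $\mathcal K\subset\mathbb R^n$ $$\alpha_N^{-2}\sup_{x\in\mathcal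 K}\big\|\nabla^2V(\varphi_N(x))\big\|\to 0 .$$ Then, under $\mathbb P_N$, the point process $\Xi_N=\sum_{j=1}^N\delta_{\varphi_N^{-1}(x_j)}$ converges in distribution, as $N\to\infty$, to a Poisson point process $\Xi$ on $\mathbb R^n$ with intensity $\theta(x)=e^{-\upsilon\cdot\psi(x)}$ with respect to Lebesgue measure. Here convergence in distribution means that $\mathbb E_N[e^{-\Xi_N(f)}]\to\mathbb E[e^{-\Xi(f)}]$ for every continuous compactly supported $f:\mathbb R^n\to[0,\infty)$, where $\Xi(f)=\int f\,d\Xi$, and a Poisson point process with intensity $\theta$ is a simple, locally finite point process with $\mathbb E[e^{-\Xi(f)}]=\exp\big(\int(e^{-f(x)}-1)\,\theta(x)\,dx\big)$ for every Borel function $f:\mathbb R^n\to[0,\infty)$. -/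

import Mathlib

open MeasureTheory Filter Topology
open scoped NNReal ENNReal Manifold

noncomputable section

namespace LogGas

/-- Euclidean space `ℝⁿ`. -/
abbrev Euc (n : ℕ) : Type := EuclideanSpace ℝ (Fin n)

variable {n : ℕ}

/-! ### The log gas -/

/-- The logarithmic kernel `g(x,u) = log |x-u|⁻¹`, with values in `(-∞, +∞]`. -/
def logKernel (x u : Euc n) : EReal :=
  if x = u then ⊤ else ((Real.log ‖x - u‖⁻¹ : ℝ) : EReal)

/-- The weight `ϑ(x) = log (1 + |x|)`. -/
def logWeight (x : Euc n) : ℝ := Real.log (1 + ‖x‖)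

/-- The energy `H_N(x) = β ∑_{i<j} g(x_i, x_j) + ∑_j V(x_j)` of a configuration. -/
def energy (V : Euc n → ℝ) (β : ℝ) (N : ℕ) (x : Fin N → Euc n) : EReal :=
  (β : EReal) * (∑ i : Fin N, ∑ j ∈ Finset.Ioi i, logKernel (x i) (x j))
    + ∑ j : Fin N, (V (x j) : EReal)

/-- The Boltzmann weight `e^{-H_N(x)}`. -/
def boltzmann (V : Euc n → ℝ) (β : ℝ) (N : ℕ) (x : Fin N → Euc n) : ℝ≥0∞ :=
  EReal.exp (-energy V β N x)

/-- The partition function `Z_N`. -/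
def partitionFunction (V : Euc n → ℝ) (β : ℝ) (N : ℕ) : ℝ≥0∞ :=
  ∫⁻ x : Fin N → Euc n, boltzmann V β N x

/-- The Gibbs measure `P_N(dx) = Z_N⁻¹ e^{-H_N(x)} dx_1 ⋯ dx_N`. -/
def gibbs (V : Euc n → ℝ) (β : ℝ) (N : ℕ) : Measure (Fin N → Euc n) :=
  (partitionFunction V β N)⁻¹ • volume.withDensity (boltzmann V β N)

/-! ### The free energy, the equilibrium measure and the constant `L_γ` -/

/-- The nonnegative kernel `g(x,u) + ϑ(x) + ϑ(u)`. -/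
def weightedKernel (x u : Euc n) : ℝ≥0∞ :=
  (logKernel x u + (logWeight x : EReal) + (logWeight u : EReal)).toENNReal

/-- The weighted energy `∬ (g(x,z) + ϑ(x) + ϑ(z)) μ(dz) μ(dx)`. -/
def weightedEnergy (μ : Measure (Euc n)) : ℝ≥0∞ :=
  ∫⁻ x, ∫⁻ z, weightedKernel x z ∂μ ∂μ

/-- The unnormalised measure `e^{-(V - γ ϑ)} dx`. -/
def preReference (V : Euc n → ℝ) (γ : ℝ) : Measure (Euc n) :=
  volume.withDensity fun x => ENNReal.ofReal (Real.exp (-(V x - γ * logWeight x)))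

/-- The reference probability measure `ν_γ(dx) = C_γ⁻¹ e^{-(V - γ ϑ)(x)} dx`. -/
def referenceMeasure (V : Euc n → ℝ) (γ : ℝ) : Measure (Euc n) :=
  (preReference V γ Set.univ)⁻¹ • preReference V γ

/-- The free energy: `γ/2` times the weighted energy plus the entropy relative to `ν_γ`. -/
def freeEnergy (V : Euc n → ℝ) (γ : ℝ) (μ : Measure (Euc n)) : ℝ≥0∞ :=
  ENNReal.ofReal (γ / 2) * weightedEnergy μ
    + InformationTheory.klDiv μ (referenceMeasure V γ)

/-- The equilibrium measure `μ_γ`: the minimizer of the free energy among probability measures. -/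
def equilibriumMeasure (V : Euc n → ℝ) (γ : ℝ) : ProbabilityMeasure (Euc n) :=
  Classical.epsilon fun μ : ProbabilityMeasure (Euc n) =>
    ∀ μ' : ProbabilityMeasure (Euc n),
      freeEnergy V γ (μ : Measure (Euc n)) ≤ freeEnergy V γ (μ' : Measure (Euc n))

/-- The potential `U^μ(x) = ∫ g(x,z) μ(dz)`. -/
def logPotential (μ : Measure (Euc n)) (x : Euc n) : ℝ :=
  ∫ z, (logKernel x z).toReal ∂μ

/-- The constant `L_γ`, that is, the normalisation in the self-consistent equation
`μ_γ(dx) = L_γ⁻¹ e^{-γ U^{μ_γ}(x) - V(x)} dx` of the equilibrium measure. -/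
def eqConst (V : Euc n → ℝ) (γ : ℝ) : ℝ :=
  ∫ x, Real.exp (-(γ * logPotential (equilibriumMeasure V γ : Measure (Euc n)) x) - V x)

/-! ### Point processes -/

/-- A (simple) point process: a random measure `∑_{p ∈ Λ} δ_p` where almost surely the random
set `Λ` has finitely many points in every compact set. -/
def IsPointProcess {Ω : Type*} [MeasurableSpace Ω] (Q : Measure Ω)
    (Ξ : Ω → Measure (Euc n)) : Prop :=
  Measurable Ξ ∧ ∀ᵐ ω ∂Q, ∃ Λ : Set (Euc n), (∀ K : Set (Euc n), IsCompact K → (Λ ∩ K).Finite) ∧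
    Ξ ω = Measure.sum fun p : Λ => Measure.dirac (p : Euc n)

/-- The Laplace functional `f ↦ 𝔼[e^{-Ξ(f)}]` of a random measure. -/
def laplace {Ω : Type*} [MeasurableSpace Ω] (Q : Measure Ω)
    (Ξ : Ω → Measure (Euc n)) (f : Euc n → ℝ≥0) : ℝ≥0∞ :=
  ∫⁻ ω, EReal.exp (-((∫⁻ x, (f x : ℝ≥0∞) ∂Ξ ω : ℝ≥0∞) : EReal)) ∂Q

/-- A Poisson point process with intensity measure `θ`: its Laplace functional is
`exp (∫ (e^{-f} - 1) dθ)` for every Borel function `f ≥ 0`. -/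
def IsPoissonProcess {Ω : Type*} [MeasurableSpace Ω] (Q : Measure Ω)
    (Ξ : Ω → Measure (Euc n)) (θ : Measure (Euc n)) : Prop :=
  IsPointProcess Q Ξ ∧ ∀ f : Euc n → ℝ≥0, Measurable f →
    laplace Q Ξ f =
      EReal.exp (-((∫⁻ x, ENNReal.ofReal (1 - Real.exp (-(f x : ℝ))) ∂θ : ℝ≥0∞) : EReal))

/-- Convergence in distribution of point processes: the Laplace functionals converge at every
continuous compactly supported function `f ≥ 0`. The processes may live on different spaces. -/
def ConvergesInDistribution {Ω : ℕ → Type*} [∀ N, MeasurableSpace (Ω N)]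
    (Q : ∀ N, Measure (Ω N)) (Ξ : ∀ N, Ω N → Measure (Euc n))
    {Ω' : Type*} [MeasurableSpace Ω'] (Q' : Measure Ω') (Ξ' : Ω' → Measure (Euc n)) : Prop :=
  ∀ f : Euc n → ℝ≥0, Continuous f → HasCompactSupport f →
    Tendsto (fun N => laplace (Q N) (Ξ N) f) atTop (𝓝 (laplace Q' Ξ' f))

/-! ### Zooming -/

/-- The zoom map `φ(x) = e + a⁻¹ ψ(x)`, for a `C¹` diffeomorphism `ψ` of `ℝⁿ`. -/
def zoom (e : Euc n) (a : ℝ) (ψ : Diffeomorph 𝓘(ℝ, Euc n) 𝓘(ℝ, Euc n) (Euc n) (Euc n) 1)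
    (x : Euc n) : Euc n :=
  e + a⁻¹ • ψ x

/-- The inverse `φ⁻¹(y) = ψ⁻¹(a (y - e))` of the zoom map. -/
def zoomInv (e : Euc n) (a : ℝ) (ψ : Diffeomorph 𝓘(ℝ, Euc n) 𝓘(ℝ, Euc n) (Euc n) (Euc n) 1)
    (y : Euc n) : Euc n :=
  ψ.symm (a • (y - e))

theorem zoomInv_zoom (e : Euc n) {a : ℝ} (ha : 0 < a)
    (ψ : Diffeomorph 𝓘(ℝ, Euc n) 𝓘(ℝ, Euc n) (Euc n) (Euc n) 1) (x : Euc n) :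
    zoomInv e a ψ (zoom e a ψ x) = x := by
  simp [zoomInv, zoom, smul_smul, mul_inv_cancel₀ ha.ne']

theorem zoom_zoomInv (e : Euc n) {a : ℝ} (ha : 0 < a)
    (ψ : Diffeomorph 𝓘(ℝ, Euc n) 𝓘(ℝ, Euc n) (Euc n) (Euc n) 1) (y : Euc n) :
    zoom e a ψ (zoomInv e a ψ y) = y := by
  simp [zoomInv, zoom, smul_smul, inv_mul_cancel₀ ha.ne']

/-- The zoomed configuration `∑_j δ_{φ⁻¹(x_j)}`. -/
def edgeProcess (e : Euc n) (a : ℝ)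
    (ψ : Diffeomorph 𝓘(ℝ, Euc n) 𝓘(ℝ, Euc n) (Euc n) (Euc n) 1) (N : ℕ)
    (x : Fin N → Euc n) : Measure (Euc n) :=
  ∑ j : Fin N, Measure.dirac (zoomInv e a ψ (x j))

end LogGas

end

noncomputable section

namespace LogGas

variable {n : ℕ}

/-! ### The weight `ϑ` and the singular kernel `|u|^{-1/2}` -/

/-! The Laplace functional of the zoomed gas at `f` is `E ∏_j (1 - k(x_j))`, where `k = (1 - e^{-f})
∘ φ_N⁻¹` lives in a small neighbourhood of `E_N`. Interpolate with `G(s) = E ∏_j (1 - s k(x_j))`.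
Differentiation singles out one particle; with `M = N - 1` others at the same `β_N`, `-G'(s) = N
(Z_M / Z_N) ∫∫ e^{-V(y)} ∏_j |y - x_j|^β k(y) ∏_j (1 - s k(x_j)) dy dP_M(x)`. Three facts turn this
into `G' ≈ -Θ G` with `Θ = ∫ e^{-υ·ψ} (1 - e^{-f})`, and then `G(0) = 1` gives `G(1) ≈ e^{-Θ}`.

(a) Seen from `E_N`, all other particles sit near the origin: the interaction factor is `|E_N|^{β
M}` times a variable tending to `1` in `L¹(P_M)` (`tendsto_lintegral_inter_edge`). (b) `Z_{M+1} /
Z_M → L_γ` (`IsEquilibrium.tendsto_ratio`). With the edge condition, the change of variables `φ_N`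
and the first order expansion of `V`, the prefactor tends to `Θ`. (c) A particle added to `M` others
becomes independent of them, with law `μ_γ`, so the products over `M` and over `M + 1` particles
have nearly the same mean. The resulting differential inequality is `abs_integral_thin_sub_le`.

For (b) and (c) the interaction factor `exp(β ∑_j log|y - x_j|)` at a fixed `y` must converge in
`L¹` to `e^{-γ U(y)}`. This follows from a law of large numbers
(`IsEquilibrium.tendsto_lintegral_gibbs`) and uniform second moments. For the first, conditional
positivity of the logarithm bounds `P_M` by `e^{εM} ∏_j (1 + |x_j|)^ε μ_γ^{⊗M}`, and an exponential
Chebyshev inequality under the product measure beats this factor. For the second, the law of one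
particle given all others is bounded by one fixed finite measure with all moments
(`exists_isDominating`): the factors `(1 + |x_j|)^b` in the upper bound for the conditional density
cancel against a lower bound for its normalisation, given by Jensen's inequality on the unit ball.

The self-consistent equation for `μ_γ` is solved by minimizing the free energy among bounded
densities, where it is uniformly convex. By conditional positivity the relative entropy of any
competitor with respect to the solution is at most the excess of its free energy
(`eq_of_freeEnergy_le`), so the solution is the unique global minimizer. The limiting Poisson
process is built from independent Poisson numbers of independent points in the annuli `k ≤ |x| < k +
1`. -/

lemma one_le_one_add_norm (x : Euc n) : 1 ≤ 1 + ‖x‖ := by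
  have := norm_nonneg x
  linarith

lemma logWeight_nonneg (x : Euc n) : 0 ≤ logWeight x :=
  Real.log_nonneg (one_le_one_add_norm x)

lemma exp_logWeight (x : Euc n) : Real.exp (logWeight x) = 1 + ‖x‖ :=
  Real.exp_log (by have := norm_nonneg x; linarith)

lemma exp_mul_logWeight (κ : ℝ) (x : Euc n) : Real.exp (κ * logWeight x) = (1 + ‖x‖) ^ κ := by
  rw [Real.rpow_def_of_pos (by have := norm_nonneg x; linarith), logWeight, mul_comm]

lemma continuous_logWeight : Continuous (logWeight : Euc n → ℝ) := by
  unfold logWeight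
  exact Continuous.log (by fun_prop) fun x => by have := norm_nonneg x; linarith

@[fun_prop]
lemma measurable_logWeight : Measurable (logWeight : Euc n → ℝ) :=
  continuous_logWeight.measurable

lemma norm_sub_le_mul (x z : Euc n) : ‖x - z‖ ≤ (1 + ‖x‖) * (1 + ‖z‖) := by
  have h1 := norm_sub_le x z
  nlinarith [norm_nonneg x, norm_nonneg z, mul_nonneg (norm_nonneg x) (norm_nonneg z)]

lemma log_norm_sub_le (x z : Euc n) : Real.log ‖x - z‖ ≤ logWeight x + logWeight z := by
  have hx := one_le_one_add_norm x
  have hz := one_le_one_add_norm z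
  rw [logWeight, logWeight, ← Real.log_mul (by linarith) (by linarith)]
  rcases (norm_nonneg (x - z)).eq_or_lt with h | h
  · rw [← h, Real.log_zero]
    exact Real.log_nonneg (by nlinarith)
  · exact Real.log_le_log h (norm_sub_le_mul x z)

/-- The singular kernel `|u|^{-1/2}`, which dominates the logarithm near the origin. -/
def sing (u : Euc n) : ℝ := ‖u‖ ^ (-(1 / 2) : ℝ)

lemma sing_nonneg (u : Euc n) : 0 ≤ sing u := Real.rpow_nonneg (norm_nonneg _) _

@[fun_prop]
lemma measurable_sing : Measurable (sing : Euc n → ℝ) := by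
  unfold sing
  fun_prop

/-- Follows from `1 + s ≤ (1 + √s)²`. The exponent `1/2` is chosen so that the singularity stays
integrable in every dimension `n ≥ 1`. -/
lemma log_one_add_le (s : ℝ) (hs : 0 ≤ s) : Real.log (1 + s) ≤ 2 * s ^ (1 / 2 : ℝ) := by
  rw [← Real.sqrt_eq_rpow]
  have h1 := Real.sqrt_nonneg s
  have h2 : 1 + s ≤ (1 + √s) ^ 2 := by nlinarith [Real.sq_sqrt hs]
  calc Real.log (1 + s) ≤ Real.log ((1 + √s) ^ 2) := Real.log_le_log (by linarith) h2
    _ = 2 * Real.log (1 + √s) := by rw [Real.log_pow]; norm_num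
    _ ≤ 2 * √s := by
        have := Real.log_le_sub_one_of_pos (show 0 < 1 + √s by linarith)
        linarith

lemma sing_eq_inv {u : Euc n} : sing u = (‖u‖⁻¹) ^ (1 / 2 : ℝ) := by
  rw [sing, Real.rpow_neg (norm_nonneg _), Real.inv_rpow (norm_nonneg _)]

/-- Logarithmic singularities are absorbed through this bound. The scale `s` is kept because a small
`s` measures the error of a regularisation. -/
lemma log_one_add_inv_le (u : Euc n) (s : ℝ) (hs : 0 ≤ s) :
    Real.log (1 + s * ‖u‖⁻¹) ≤ 2 * s ^ (1 / 2 : ℝ) * sing u := by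
  have h := log_one_add_le (s * ‖u‖⁻¹) (by positivity)
  rwa [Real.mul_rpow hs (by positivity), ← sing_eq_inv, ← mul_assoc] at h

lemma neg_log_norm_le (u : Euc n) : -Real.log ‖u‖ ≤ 2 * sing u := by
  rcases (norm_nonneg u).eq_or_lt with h | h
  · rw [← h, Real.log_zero]
    have := sing_nonneg u
    linarith
  · have h1 := log_one_add_inv_le u 1 zero_le_one
    have h2 : Real.log ‖u‖⁻¹ ≤ Real.log (1 + 1 * ‖u‖⁻¹) :=
      Real.log_le_log (by positivity) (by linarith)
    rw [Real.log_inv] at h2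
    norm_num at h1 h2
    linarith

lemma abs_log_norm_sub_le (x z : Euc n) :
    |Real.log ‖x - z‖| ≤ logWeight x + logWeight z + 2 * sing (x - z) := by
  have h1 := log_norm_sub_le x z
  have h2 := neg_log_norm_le (x - z)
  have h3 := sing_nonneg (x - z)
  have h4 := logWeight_nonneg x
  have h5 := logWeight_nonneg z
  rw [abs_le]
  constructor <;> linarith

/-- The exponent `1/2` is smaller than the dimension as soon as `n ≥ 1`. -/
lemma lintegral_ball_sing_lt_top [NeZero n] :
    ∫⁻ u in Metric.ball (0 : Euc n) 1, ENNReal.ofReal (sing u) < ∞ := by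
  have hn : 1 ≤ n := Nat.one_le_iff_ne_zero.mpr (NeZero.ne n)
  have h : IntegrableOn (sing : Euc n → ℝ) (Metric.ball 0 1) :=
    integrableOn_ball_of_norm_le_rpow (α := 1 / 2) (C := 1) (by simpa using hn)
      (by simp only [finrank_euclideanSpace, Fintype.card_fin]
          have : (1 : ℝ) ≤ n := by exact_mod_cast hn
          linarith)
      (ae_of_all _ fun x => by
        rw [Real.norm_of_nonneg (sing_nonneg x), one_mul, sing])
      measurable_sing.aestronglyMeasurable
  rw [← ofReal_integral_eq_lintegral_ofReal h (ae_of_all _ sing_nonneg)]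
  exact ENNReal.ofReal_lt_top

/-- The constant `∫_{|u|<1} |u|^{-1/2} du`. -/
def singConst (n : ℕ) [NeZero n] : ℝ≥0 :=
  (∫⁻ u in Metric.ball (0 : Euc n) 1, ENNReal.ofReal (sing u)).toNNReal

lemma sing_le_one {u : Euc n} (h : u ∉ Metric.ball (0 : Euc n) 1) : sing u ≤ 1 := by
  have : 1 ≤ ‖u‖ := by simpa using h
  exact Real.rpow_le_one_of_one_le_of_nonpos this (by norm_num)

/-- Uniform in `x`: on the unit ball around `x` the density of `μ` is at most `A`, and outside it
the kernel is at most `1`. -/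
lemma lintegral_sing_le [NeZero n] {μ : Measure (Euc n)} {A : ℝ≥0}
    (hμ : μ ≤ (A : ℝ≥0∞) • volume) (x : Euc n) :
    ∫⁻ z, ENNReal.ofReal (sing (x - z)) ∂μ ≤ A * singConst n + μ Set.univ := by
  have hpt : ∀ z, ENNReal.ofReal (sing (x - z)) ≤
      (Metric.ball (0 : Euc n) 1).indicator (fun u => ENNReal.ofReal (sing u)) (x - z) + 1 := by
    intro z
    by_cases h : x - z ∈ Metric.ball (0 : Euc n) 1
    · rw [Set.indicator_of_mem h]; exact le_self_add
    · rw [Set.indicator_of_notMem h, zero_add]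
      exact ENNReal.ofReal_le_one.mpr (sing_le_one h)
  have hm : Measurable fun u : Euc n =>
      (Metric.ball (0 : Euc n) 1).indicator (fun u => ENNReal.ofReal (sing u)) u :=
    (by fun_prop : Measurable fun u : Euc n => ENNReal.ofReal (sing u)).indicator
      measurableSet_ball
  calc ∫⁻ z, ENNReal.ofReal (sing (x - z)) ∂μ
      ≤ ∫⁻ z, ((Metric.ball (0 : Euc n) 1).indicator (fun u => ENNReal.ofReal (sing u)) (x - z)
          + 1) ∂μ := lintegral_mono hpt
    _ = ∫⁻ z, (Metric.ball (0 : Euc n) 1).indicator (fun u => ENNReal.ofReal (sing u)) (x - z) ∂μ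
          + μ Set.univ := by
        rw [lintegral_add_right _ measurable_const]; simp
    _ ≤ A * singConst n + μ Set.univ := by
        gcongr
        refine (lintegral_mono' hμ le_rfl).trans ?_
        rw [lintegral_smul_measure, lintegral_sub_left_eq_self
          (fun u => (Metric.ball (0 : Euc n) 1).indicator (fun u => ENNReal.ofReal (sing u)) u),
          lintegral_indicator measurableSet_ball, smul_eq_mul, singConst,
          ENNReal.coe_toNNReal lintegral_ball_sing_lt_top.ne]

lemma integrable_sing [NeZero n] {μ : Measure (Euc n)} [IsFiniteMeasure μ] {A : ℝ≥0}
    (hμ : μ ≤ (A : ℝ≥0∞) • volume) (x : Euc n) : Integrable (fun z => sing (x - z)) μ := by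
  refine ⟨(by fun_prop : Measurable fun z => sing (x - z)).aestronglyMeasurable, ?_⟩
  rw [hasFiniteIntegral_iff_ofReal (ae_of_all _ fun z => sing_nonneg _)]
  exact (lintegral_sing_le hμ x).trans_lt
    (ENNReal.add_lt_top.mpr ⟨ENNReal.mul_lt_top (by simp) (by simp), measure_lt_top _ _⟩)

lemma integral_sing_le [NeZero n] {μ : Measure (Euc n)} [IsProbabilityMeasure μ] {A : ℝ≥0}
    (hμ : μ ≤ (A : ℝ≥0∞) • volume) (x : Euc n) :
    ∫ z, sing (x - z) ∂μ ≤ A * singConst n + 1 := by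
  rw [integral_eq_lintegral_of_nonneg_ae (ae_of_all _ fun z => sing_nonneg _)
    (by fun_prop : Measurable fun z => sing (x - z)).aestronglyMeasurable]
  refine ENNReal.toReal_le_of_le_ofReal (by positivity) ((lintegral_sing_le hμ x).trans ?_)
  rw [measure_univ, ENNReal.ofReal_add (by positivity) zero_le_one,
    ENNReal.ofReal_mul (by positivity)]
  simp

lemma integrable_log_norm_sub [NeZero n] {μ : Measure (Euc n)} [IsFiniteMeasure μ] {A : ℝ≥0}
    (hμ : μ ≤ (A : ℝ≥0∞) • volume) (hϑ : Integrable logWeight μ) (x : Euc n) :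
    Integrable (fun z => Real.log ‖x - z‖) μ :=
  (((integrable_const (logWeight x)).add hϑ).add ((integrable_sing hμ x).const_mul 2)).mono'
    (by fun_prop : Measurable fun z => Real.log ‖x - z‖).aestronglyMeasurable
    (ae_of_all _ fun z => abs_log_norm_sub_le x z)

lemma nontrivial_euc [NeZero n] : Nontrivial (Euc n) :=
  Module.nontrivial_of_finrank_pos (R := ℝ)
    (by simpa using Nat.pos_of_ne_zero (NeZero.ne n))

lemma nullSingletonClass_volume [NeZero n] :
    NullSingletonClass (volume : Measure (Euc n)) := by
  have : Nontrivial (Euc n) := nontrivial_euc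
  infer_instance

/-! ### The potential -/

section Potential

variable {V : Euc n → ℝ}

/-- `V` grows faster than every multiple of `ϑ`. -/
def SuperLog (V : Euc n → ℝ) : Prop :=
  ∀ κ : ℝ, 0 ≤ κ → BddBelow (Set.range fun x => V x - κ * logWeight x)

lemma SuperLog.exists_exp_neg_le (hV : SuperLog V) (κ : ℝ) (hκ : 0 ≤ κ) :
    ∃ C : ℝ, 0 < C ∧ ∀ x, Real.exp (-V x) * (1 + ‖x‖) ^ κ ≤ C := by
  obtain ⟨c, hc⟩ := hV κ hκ
  refine ⟨Real.exp (-c), Real.exp_pos _, fun x => ?_⟩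
  rw [← exp_mul_logWeight, ← Real.exp_add, Real.exp_le_exp]
  have := hc ⟨x, rfl⟩
  simp only at this
  linarith

lemma SuperLog.integrable (hV : SuperLog V) (hVc : Continuous V) (κ : ℝ) (hκ : 0 ≤ κ) :
    Integrable (fun x => Real.exp (-V x) * (1 + ‖x‖) ^ κ) := by
  -- The `n + 1` extra powers leave the integrable tail `(1 + ‖x‖) ^ (-(n + 1))`.
  obtain ⟨C, hC, h⟩ := hV.exists_exp_neg_le (κ + (n + 1)) (by positivity)
  have hi := (integrable_one_add_norm (E := Euc n) (μ := volume) (r := n + 1) (by simp)).const_mul C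
  refine hi.mono' ?_ (ae_of_all _ fun x => ?_)
  · have : Continuous fun x : Euc n => (1 + ‖x‖) ^ κ :=
      Continuous.rpow_const (by fun_prop) fun x => Or.inr hκ
    exact (by fun_prop : Continuous _).aestronglyMeasurable
  · have hx : 0 < 1 + ‖x‖ := by positivity
    rw [Real.norm_of_nonneg (by positivity), Real.rpow_neg hx.le, ← div_eq_mul_inv,
      le_div_iff₀ (by positivity), mul_assoc, ← Real.rpow_add hx]
    exact h x

end Potential

/-! ### Conditional positivity of the logarithmic kernel -/

/-- Positivity of a kernel, in a form that makes sense for `[0,∞]`-valued kernels. -/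
def IsPosKernel (k : Euc n → Euc n → ℝ≥0∞) : Prop :=
  ∀ (σ μ : Measure (Euc n)) [IsFiniteMeasure σ] [IsFiniteMeasure μ],
    2 * ∫⁻ x, ∫⁻ z, k x z ∂μ ∂σ ≤ ∫⁻ x, ∫⁻ z, k x z ∂σ ∂σ + ∫⁻ x, ∫⁻ z, k x z ∂μ ∂μ

lemma ENNReal.two_mul_mul_le (a b : ℝ≥0∞) : 2 * (a * b) ≤ a * a + b * b := by
  rcases eq_or_ne a ∞ with rfl | ha
  · simp
  rcases eq_or_ne b ∞ with rfl | hb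
  · simp
  lift a to ℝ≥0 using ha
  lift b to ℝ≥0 using hb
  norm_cast
  have := two_mul_le_add_sq a b
  simpa [mul_assoc, sq] using this

lemma IsPosKernel.mul_left {k : Euc n → Euc n → ℝ≥0∞} (hk : IsPosKernel k) (c : ℝ≥0∞)
    (hc : c ≠ ∞) : IsPosKernel fun x z => c * k x z := by
  intro σ μ _ _
  simp only [lintegral_const_mul' _ _ hc]
  rw [mul_left_comm, ← mul_add]
  gcongr
  exact hk σ μ

/-- Positivity is a family of inequalities linear in the kernel, so by Tonelli it survives averaging
over a parameter. -/
lemma IsPosKernel.mix {k : ℝ → Euc n → Euc n → ℝ≥0∞} {κ : Measure ℝ} [SFinite κ]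
    (hk : ∀ᵐ u ∂κ, IsPosKernel (k u))
    (hm : Measurable fun p : ℝ × Euc n × Euc n => k p.1 p.2.1 p.2.2) :
    IsPosKernel fun x z => ∫⁻ u, k u x z ∂κ := by
  have key : ∀ (σ μ : Measure (Euc n)) [IsFiniteMeasure σ] [IsFiniteMeasure μ],
      ∫⁻ x, ∫⁻ z, ∫⁻ u, k u x z ∂κ ∂μ ∂σ = ∫⁻ u, ∫⁻ x, ∫⁻ z, k u x z ∂μ ∂σ ∂κ := by
    intro σ μ _ _
    have h1 : ∀ x, ∫⁻ z, ∫⁻ u, k u x z ∂κ ∂μ = ∫⁻ u, ∫⁻ z, k u x z ∂μ ∂κ := fun x =>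
      lintegral_lintegral_swap
        (hm.comp (by fun_prop : Measurable fun p : Euc n × ℝ => (p.2, x, p.1))).aemeasurable
    simp_rw [h1]
    rw [lintegral_lintegral_swap]
    · exact (Measurable.lintegral_prod_right' (f := fun q : (Euc n × ℝ) × Euc n =>
        k q.1.2 q.1.1 q.2) (hm.comp (by fun_prop : Measurable fun q : (Euc n × ℝ) × Euc n =>
          (q.1.2, q.1.1, q.2)))).aemeasurable
  have hmm : ∀ (σ μ : Measure (Euc n)) [IsFiniteMeasure σ] [IsFiniteMeasure μ],
      Measurable fun u => ∫⁻ x, ∫⁻ z, k u x z ∂μ ∂σ := by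
    intro σ μ _ _
    refine Measurable.lintegral_prod_right' (f := fun q : ℝ × Euc n => ∫⁻ z, k q.1 q.2 z ∂μ) ?_
    exact Measurable.lintegral_prod_right' (f := fun q : (ℝ × Euc n) × Euc n =>
        k q.1.1 q.1.2 q.2) (hm.comp (by fun_prop : Measurable fun q : (ℝ × Euc n) × Euc n =>
          (q.1.1, q.1.2, q.2)))
  intro σ μ _ _
  rw [key, key, key, ← lintegral_const_mul _ (hmm σ μ), ← lintegral_add_left (hmm σ σ)]
  refine lintegral_mono_ae ?_
  filter_upwards [hk] with u hu
  exact hu σ μ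

/-- A Gaussian is a convolution square: by the parallelogram law `e^{-2t|x-w|²} e^{-2t|z-w|²} =
e^{-t|x-z|²} e^{-4t|w-(x+z)/2|²}`, and the integral over `w` of the last factor does not depend on
`x`, `z`. The mutual energy is then the integral over `w` of a product of two potentials, and `2ab ≤
a² + b²` applies for each `w`. -/
lemma isPosKernel_gaussian {t : ℝ} (ht : 0 < t) :
    IsPosKernel fun x z : Euc n => ENNReal.ofReal (Real.exp (-(t * ‖x - z‖ ^ 2))) := by
  set c : ℝ≥0∞ := ∫⁻ w : Euc n, ENNReal.ofReal (Real.exp (-(4 * t * ‖w‖ ^ 2))) with hc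
  have hc0 : c ≠ 0 := by
    rw [hc, ← pos_iff_ne_zero, lintegral_pos_iff_support (by fun_prop)]
    have : (Function.support fun w : Euc n =>
        ENNReal.ofReal (Real.exp (-(4 * t * ‖w‖ ^ 2)))) = Set.univ := by
      ext w; simp [Real.exp_pos]
    rw [this]
    exact isOpen_univ.measure_pos volume ⟨0, trivial⟩
  have hct : c ≠ ∞ := by
    have hi : Integrable fun w : Euc n => Real.exp (-(4 * t * ‖w‖ ^ 2)) := by
      have h := GaussianFourier.integral_rexp_neg_mul_sq_norm (V := Euc n)
        (show 0 < 4 * t by positivity)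
      refine Integrable.of_integral_ne_zero (fun h0 => ?_)
      simp only [neg_mul] at h
      rw [h] at h0
      exact (Real.rpow_pos_of_pos (by positivity) _).ne' h0
    rw [hc, ← ofReal_integral_eq_lintegral_ofReal hi (ae_of_all _ fun _ => (Real.exp_pos _).le)]
    exact ENNReal.ofReal_ne_top
  set e : Euc n → Euc n → ℝ≥0∞ := fun w x => ENNReal.ofReal (Real.exp (-(2 * t * ‖x - w‖ ^ 2)))
  have hsq : ∀ x z : Euc n, ENNReal.ofReal (Real.exp (-(t * ‖x - z‖ ^ 2))) =
      c⁻¹ * ∫⁻ w, e w x * e w z := by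
    intro x z
    have h1 : ∀ w, e w x * e w z = ENNReal.ofReal (Real.exp (-(t * ‖x - z‖ ^ 2))) *
        ENNReal.ofReal (Real.exp (-(4 * t * ‖(1 / 2 : ℝ) • (x + z) - w‖ ^ 2))) := by
      intro w
      simp only [e]
      rw [← ENNReal.ofReal_mul (Real.exp_pos _).le, ← ENNReal.ofReal_mul (Real.exp_pos _).le,
        ← Real.exp_add, ← Real.exp_add]
      congr 2
      have hp := parallelogram_law_with_norm ℝ (x - w) (z - w)
      have h2 : x - w + (z - w) = (2 : ℝ) • ((1 / 2 : ℝ) • (x + z) - w) := by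
        module
      have h3 : x - w - (z - w) = x - z := by abel
      rw [h2, h3, norm_smul, Real.norm_ofNat] at hp
      linear_combination t * hp
    simp_rw [h1]
    rw [lintegral_const_mul' _ _ ENNReal.ofReal_ne_top,
      lintegral_sub_left_eq_self (fun w : Euc n =>
        ENNReal.ofReal (Real.exp (-(4 * t * ‖w‖ ^ 2)))), ← hc, mul_left_comm,
      ENNReal.inv_mul_cancel hc0 hct, mul_one]
  have hfun : (fun x z : Euc n => ENNReal.ofReal (Real.exp (-(t * ‖x - z‖ ^ 2)))) =
      fun x z => c⁻¹ * ∫⁻ w, e w x * e w z := by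
    ext x z; exact hsq x z
  rw [hfun]
  refine IsPosKernel.mul_left ?_ _ (ENNReal.inv_ne_top.mpr hc0)
  have hem : Measurable fun p : Euc n × Euc n => e p.1 p.2 := by
    simp only [e]; fun_prop
  have hem1 : ∀ w, Measurable (e w) := fun w => by simp only [e]; fun_prop
  have hI : ∀ σ : Measure (Euc n), [IsFiniteMeasure σ] → Measurable fun w => ∫⁻ x, e w x ∂σ :=
    fun σ _ => hem.lintegral_prod_right'
  have hII : ∀ (σ μ : Measure (Euc n)) [IsFiniteMeasure σ] [IsFiniteMeasure μ],
      Measurable fun w => (∫⁻ x, e w x ∂σ) * ∫⁻ z, e w z ∂μ :=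
    fun σ μ _ _ => (hI σ).mul (hI μ)
  have key : ∀ (σ μ : Measure (Euc n)) [IsFiniteMeasure σ] [IsFiniteMeasure μ],
      ∫⁻ x, ∫⁻ z, ∫⁻ w, e w x * e w z ∂volume ∂μ ∂σ =
        ∫⁻ w, (∫⁻ x, e w x ∂σ) * ∫⁻ z, e w z ∂μ := by
    intro σ μ _ _
    have h1 : ∀ x, ∫⁻ z, ∫⁻ w, e w x * e w z ∂volume ∂μ = ∫⁻ w, e w x * ∫⁻ z, e w z ∂μ := by
      intro x
      rw [lintegral_lintegral_swap]
      · exact lintegral_congr fun w => lintegral_const_mul _ (hem1 w)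
      · exact (by simp only [e]; fun_prop :
          Measurable fun p : Euc n × Euc n => e p.2 x * e p.2 p.1).aemeasurable
    simp_rw [h1]
    rw [lintegral_lintegral_swap]
    · exact lintegral_congr fun w => lintegral_mul_const _ (hem1 w)
    · exact ((hem.comp measurable_swap).mul ((hI μ).comp measurable_snd)).aemeasurable
  intro σ μ _ _
  rw [key, key, key, ← lintegral_const_mul _ (hII σ μ), ← lintegral_add_left (hII σ σ)]
  exact lintegral_mono fun w => ENNReal.two_mul_mul_le _ _

/-- A mixture of Gaussians: `1 / (r² + u) = ∫₀^∞ e^{-ut} e^{-t r²} dt`. -/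
lemma isPosKernel_resolvent {u : ℝ} (hu : 0 < u) :
    IsPosKernel fun x z : Euc n => ENNReal.ofReal ((‖x - z‖ ^ 2 + u)⁻¹) := by
  have h : (fun x z : Euc n => ENNReal.ofReal ((‖x - z‖ ^ 2 + u)⁻¹)) = fun x z =>
      ∫⁻ t in Set.Ioi (0 : ℝ), ENNReal.ofReal (Real.exp (-(u * t))) *
        ENNReal.ofReal (Real.exp (-(t * ‖x - z‖ ^ 2))) := by
    ext x z
    have hp : 0 < ‖x - z‖ ^ 2 + u := by positivity
    have h1 : ∀ t, ENNReal.ofReal (Real.exp (-(u * t))) *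
        ENNReal.ofReal (Real.exp (-(t * ‖x - z‖ ^ 2))) =
        ENNReal.ofReal (Real.exp (-(‖x - z‖ ^ 2 + u) * t)) := by
      intro t
      rw [← ENNReal.ofReal_mul (Real.exp_pos _).le, ← Real.exp_add]
      congr 2; ring
    simp_rw [h1]
    have hint := integrableOn_exp_mul_Ioi (neg_lt_zero.mpr hp) 0
    rw [← ofReal_integral_eq_lintegral_ofReal hint (ae_of_all _ fun _ => (Real.exp_pos _).le),
      integral_exp_mul_Ioi (neg_lt_zero.mpr hp) 0]
    congr 1
    rw [mul_zero, Real.exp_zero, neg_div_neg_eq, one_div]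
  rw [h]
  refine IsPosKernel.mix ?_ (by fun_prop)
  refine (ae_restrict_iff' measurableSet_Ioi).mpr (ae_of_all _ fun t ht => ?_)
  exact (isPosKernel_gaussian ht).mul_left _ ENNReal.ofReal_ne_top

/-- A mixture of resolvents: `log ((r² + R) / (r² + a)) = ∫_a^R du / (r² + u)`. -/
lemma isPosKernel_log {a R : ℝ} (ha : 0 < a) (haR : a ≤ R) :
    IsPosKernel fun x z : Euc n =>
      ENNReal.ofReal (Real.log ((‖x - z‖ ^ 2 + R) / (‖x - z‖ ^ 2 + a))) := by
  have h : (fun x z : Euc n =>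
      ENNReal.ofReal (Real.log ((‖x - z‖ ^ 2 + R) / (‖x - z‖ ^ 2 + a)))) = fun x z =>
      ∫⁻ u in Set.Ioc a R, ENNReal.ofReal ((‖x - z‖ ^ 2 + u)⁻¹) := by
    ext x z
    set r := ‖x - z‖ ^ 2
    have hr : 0 ≤ r := by positivity
    have hc : ContinuousOn (fun u => (r + u)⁻¹) (Set.uIcc a R) := by
      rw [Set.uIcc_of_le haR]
      exact ContinuousOn.inv₀ (by fun_prop) fun u hu => by have := hu.1; linarith
    have hii := hc.intervalIntegrable (μ := volume)
    rw [intervalIntegrable_iff_integrableOn_Ioc_of_le haR] at hii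
    rw [← ofReal_integral_eq_lintegral_ofReal hii
      ((ae_restrict_iff' measurableSet_Ioc).mpr (ae_of_all _ fun u hu => by
        have := hu.1
        have : 0 < r + u := by linarith
        simp only [Pi.zero_apply]; positivity)),
      ← intervalIntegral.integral_of_le haR]
    congr 1
    rw [intervalIntegral.integral_comp_add_left (fun u => u⁻¹), integral_inv]
    rw [Set.uIcc_of_le (by linarith)]
    intro h0
    have := h0.1
    linarith
  rw [h]
  refine IsPosKernel.mix ?_ (by fun_prop)
  refine (ae_restrict_iff' measurableSet_Ioc).mpr (ae_of_all _ fun u hu => ?_)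
  exact isPosKernel_resolvent (ha.trans hu.1)

/-- The regularised logarithmic kernel `-½ log(|x-z|² + a)`. -/
def gReg (a : ℝ) (x z : Euc n) : ℝ := -(1 / 2) * Real.log (‖x - z‖ ^ 2 + a)

@[fun_prop]
lemma measurable_gReg (a : ℝ) : Measurable fun p : Euc n × Euc n => gReg a p.1 p.2 := by
  unfold gReg
  fun_prop

/-- The bound does not depend on `R ≥ 1`; it is the domination that allows `R → ∞`. -/
lemma log_one_add_sq_div_le (x z : Euc n) {R : ℝ} (hR : 1 ≤ R) :
    Real.log (1 + ‖x - z‖ ^ 2 / R) ≤ 2 * logWeight x + 2 * logWeight z := by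
  have h0 := norm_nonneg (x - z)
  have h1 : 1 + ‖x - z‖ ^ 2 / R ≤ ((1 + ‖x‖) * (1 + ‖z‖)) ^ 2 := by
    have h2 : ‖x - z‖ ^ 2 / R ≤ ‖x - z‖ ^ 2 := div_le_self (by positivity) hR
    have h3 := norm_sub_le x z
    have h4 := norm_nonneg x
    have h5 := norm_nonneg z
    have h6 := mul_nonneg h4 h5
    have h7 : 1 + ‖x - z‖ ≤ (1 + ‖x‖) * (1 + ‖z‖) := by nlinarith
    nlinarith
  have hx := one_le_one_add_norm x
  have hz := one_le_one_add_norm z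
  refine (Real.log_le_log (by positivity) h1).trans (le_of_eq ?_)
  rw [Real.log_pow, Real.log_mul (by linarith) (by linarith), logWeight, logWeight]
  push_cast; ring

/-- A positive kernel, minus an error that vanishes as `R → ∞`, minus a constant. Between
probability measures the diverging constant cancels, which is why the logarithm is only
conditionally positive. -/
lemma two_mul_gReg {a R : ℝ} (ha : 0 < a) (hR : 0 < R) (x z : Euc n) :
    2 * gReg a x z = Real.log ((‖x - z‖ ^ 2 + R) / (‖x - z‖ ^ 2 + a))
      - Real.log (1 + ‖x - z‖ ^ 2 / R) - Real.log R := by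
  have hr : 0 ≤ ‖x - z‖ ^ 2 := by positivity
  have h1 : 1 + ‖x - z‖ ^ 2 / R = (‖x - z‖ ^ 2 + R) / R := by field_simp; ring
  rw [h1, Real.log_div (by positivity) (by positivity), Real.log_div (by positivity) hR.ne', gReg]
  ring

/-- The logarithmic kernel is conditionally positive: the regularised form. -/
theorem two_mul_integral_gReg_le {σ μ : Measure (Euc n)} [IsProbabilityMeasure σ]
    [IsProbabilityMeasure μ] (hσ : Integrable logWeight σ) (hμ : Integrable logWeight μ)
    {a : ℝ} (ha : 0 < a) :
    2 * ∫ p, gReg a p.1 p.2 ∂(σ.prod μ) ≤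
      ∫ p, gReg a p.1 p.2 ∂(σ.prod σ) + ∫ p, gReg a p.1 p.2 ∂(μ.prod μ) := by
  set F : ℝ → Euc n × Euc n → ℝ := fun R p =>
    Real.log ((‖p.1 - p.2‖ ^ 2 + R) / (‖p.1 - p.2‖ ^ 2 + a)) with hF
  set H : ℝ → Euc n × Euc n → ℝ := fun R p => Real.log (1 + ‖p.1 - p.2‖ ^ 2 / R) with hH
  have hFm : ∀ R, Measurable (F R) := fun R => by simp only [hF]; fun_prop
  have hHm : ∀ R, Measurable (H R) := fun R => by simp only [hH]; fun_prop
  have hF0 : ∀ R, a ≤ R → ∀ p, 0 ≤ F R p := by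
    intro R hR p
    refine Real.log_nonneg ?_
    rw [one_le_div (by positivity)]
    linarith
  have hFle : ∀ R, a ≤ R → ∀ p, F R p ≤ Real.log (R / a) := by
    intro R hR p
    have hR0 : 0 < R := ha.trans_le hR
    refine Real.log_le_log (by positivity) ?_
    rw [div_le_div_iff₀ (by positivity) ha]
    nlinarith [sq_nonneg ‖p.1 - p.2‖]
  have hFi : ∀ R, a ≤ R → ∀ (ρ : Measure (Euc n × Euc n)) [IsProbabilityMeasure ρ],
      Integrable (F R) ρ := fun R hR ρ _ =>
    (integrable_const (Real.log (R / a))).mono' (hFm R).aestronglyMeasurable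
      (ae_of_all _ fun p => by rw [Real.norm_of_nonneg (hF0 R hR p)]; exact hFle R hR p)
  have hdom : ∀ (σ μ : Measure (Euc n)) [IsProbabilityMeasure σ] [IsProbabilityMeasure μ],
      Integrable logWeight σ → Integrable logWeight μ →
      Integrable (fun p : Euc n × Euc n => 2 * logWeight p.1 + 2 * logWeight p.2) (σ.prod μ) := by
    intro σ μ _ _ hσ hμ
    exact ((hσ.comp_fst μ).const_mul 2).add ((hμ.comp_snd σ).const_mul 2)
  have hHb : ∀ R, 1 ≤ R → ∀ p : Euc n × Euc n,
      ‖H R p‖ ≤ 2 * logWeight p.1 + 2 * logWeight p.2 := by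
    intro R hR p
    rw [Real.norm_of_nonneg (Real.log_nonneg (by
      have : 0 ≤ ‖p.1 - p.2‖ ^ 2 / R := by positivity
      linarith))]
    exact log_one_add_sq_div_le p.1 p.2 hR
  have hHi : ∀ R, 1 ≤ R → ∀ (σ μ : Measure (Euc n)) [IsProbabilityMeasure σ]
      [IsProbabilityMeasure μ], Integrable logWeight σ → Integrable logWeight μ →
      Integrable (H R) (σ.prod μ) := fun R hR σ μ _ _ hσ hμ =>
    (hdom σ μ hσ hμ).mono' (hHm R).aestronglyMeasurable (ae_of_all _ (hHb R hR))
  have hG : ∀ R, 1 ≤ R → a ≤ R → ∀ (σ μ : Measure (Euc n)) [IsProbabilityMeasure σ]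
      [IsProbabilityMeasure μ], Integrable logWeight σ → Integrable logWeight μ →
      2 * ∫ p, gReg a p.1 p.2 ∂(σ.prod μ) =
        ∫ p, F R p ∂(σ.prod μ) - ∫ p, H R p ∂(σ.prod μ) - Real.log R := by
    intro R hR haR σ μ _ _ hσ hμ
    rw [← integral_const_mul]
    simp_rw [two_mul_gReg ha (show 0 < R by linarith)]
    rw [integral_sub (f := fun p => F R p - H R p)
      ((hFi R haR _).sub (hHi R hR σ μ hσ hμ)) (integrable_const _), integral_sub (hFi R haR _) (hHi R hR σ μ hσ hμ)]
    simp
  have hFpos : ∀ R, a ≤ R → 2 * ∫ p, F R p ∂(σ.prod μ) ≤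
      ∫ p, F R p ∂(σ.prod σ) + ∫ p, F R p ∂(μ.prod μ) := by
    intro R haR
    have hl : ∀ (σ μ : Measure (Euc n)) [IsProbabilityMeasure σ] [IsProbabilityMeasure μ],
        ENNReal.ofReal (∫ p, F R p ∂(σ.prod μ)) =
          ∫⁻ x, ∫⁻ z, ENNReal.ofReal (F R (x, z)) ∂μ ∂σ := by
      intro σ μ _ _
      rw [ofReal_integral_eq_lintegral_ofReal (hFi R haR _) (ae_of_all _ (hF0 R haR)),
        lintegral_prod _ (hFm R).ennreal_ofReal.aemeasurable]
    have h := isPosKernel_log (n := n) ha haR σ μ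
    have hnn : ∀ (σ μ : Measure (Euc n)), 0 ≤ ∫ p, F R p ∂(σ.prod μ) :=
      fun σ μ => integral_nonneg (hF0 R haR)
    have h' : ENNReal.ofReal 2 * ENNReal.ofReal (∫ p, F R p ∂(σ.prod μ)) ≤
        ENNReal.ofReal (∫ p, F R p ∂(σ.prod σ)) + ENNReal.ofReal (∫ p, F R p ∂(μ.prod μ)) := by
      rw [hl, hl, hl]; simpa [hF] using h
    rw [← ENNReal.ofReal_mul (by norm_num), ← ENNReal.ofReal_add (hnn _ _) (hnn _ _),
      ENNReal.ofReal_le_ofReal_iff (add_nonneg (hnn _ _) (hnn _ _))] at h'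
    exact h'
  have hlim : ∀ (σ μ : Measure (Euc n)) [IsProbabilityMeasure σ] [IsProbabilityMeasure μ],
      Integrable logWeight σ → Integrable logWeight μ →
      Tendsto (fun k : ℕ => ∫ p, H (k + 1) p ∂(σ.prod μ)) atTop (𝓝 0) := by
    intro σ μ _ _ hσ hμ
    have := tendsto_integral_of_dominated_convergence (μ := σ.prod μ)
      (F := fun (k : ℕ) p => H (k + 1) p) (f := fun _ => 0)
      (fun p : Euc n × Euc n => 2 * logWeight p.1 + 2 * logWeight p.2)
      (fun k => (hHm _).aestronglyMeasurable) (hdom σ μ hσ hμ)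
      (fun k => ae_of_all _ (hHb _ (by simp))) (ae_of_all _ fun p => ?_)
    · simpa using this
    · have h1 : Tendsto (fun k : ℕ => 1 + ‖p.1 - p.2‖ ^ 2 / ((k : ℝ) + 1)) atTop (𝓝 (1 + 0)) :=
        tendsto_const_nhds.add (tendsto_const_nhds.div_atTop
          (tendsto_atTop_add_const_right _ _ tendsto_natCast_atTop_atTop))
      rw [add_zero] at h1
      have h2 := (Real.continuousAt_log one_ne_zero).tendsto.comp h1
      rw [Real.log_one] at h2
      exact h2
  -- With `R = k + 1`, positivity of the first piece of the kernel; `2 log R` appears on both sides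
  -- and has been cancelled.
  have hev : ∀ᶠ k : ℕ in atTop, 2 * (2 * ∫ p, gReg a p.1 p.2 ∂(σ.prod μ)) +
      2 * ∫ p, H (k + 1) p ∂(σ.prod μ) ≤
      (2 * ∫ p, gReg a p.1 p.2 ∂(σ.prod σ) + ∫ p, H (k + 1) p ∂(σ.prod σ)) +
      (2 * ∫ p, gReg a p.1 p.2 ∂(μ.prod μ) + ∫ p, H (k + 1) p ∂(μ.prod μ)) := by
    filter_upwards [eventually_ge_atTop ⌈a⌉₊] with k hk
    have h1 : (1 : ℝ) ≤ (k : ℝ) + 1 := by simp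
    have h2 : a ≤ (k : ℝ) + 1 := by
      have := (Nat.le_ceil a).trans (Nat.cast_le.mpr hk)
      linarith
    rw [hG _ h1 h2 σ μ hσ hμ, hG _ h1 h2 σ σ hσ hσ, hG _ h1 h2 μ μ hμ hμ]
    have := hFpos _ h2
    linarith
  have := le_of_tendsto_of_tendsto
    (tendsto_const_nhds.add ((hlim σ μ hσ hμ).const_mul 2))
    ((tendsto_const_nhds.add (hlim σ σ hσ hσ)).add (tendsto_const_nhds.add (hlim μ μ hμ hμ))) hev
  linarith

/-- The logarithmic kernel as a real function (with value `0` on the diagonal). -/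
def logG (x z : Euc n) : ℝ := -Real.log ‖x - z‖

@[fun_prop]
lemma measurable_logG : Measurable fun p : Euc n × Euc n => logG p.1 p.2 := by
  unfold logG
  fun_prop

@[fun_prop]
lemma measurable_gReg_right (a : ℝ) (x : Euc n) : Measurable fun z : Euc n => gReg a x z := by
  unfold gReg
  fun_prop

lemma logG_comm (x z : Euc n) : logG x z = logG z x := by
  rw [logG, logG, norm_sub_rev]

lemma abs_logG_le (x z : Euc n) : |logG x z| ≤ logWeight x + logWeight z + 2 * sing (x - z) := by
  rw [logG, abs_neg]
  exact abs_log_norm_sub_le x z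

/-- The diagonal is excluded because `logG` is `0` there by the convention `log 0 = 0`, whereas the
regularised kernel is positive there for `a < 1`. -/
lemma gReg_le_logG {a : ℝ} (ha : 0 < a) {x z : Euc n} (h : x ≠ z) : gReg a x z ≤ logG x z := by
  have hr : 0 < ‖x - z‖ := norm_pos_iff.mpr (sub_ne_zero.mpr h)
  have h1 : Real.log (‖x - z‖ ^ 2) ≤ Real.log (‖x - z‖ ^ 2 + a) :=
    Real.log_le_log (by positivity) (by linarith)
  rw [Real.log_pow] at h1
  rw [gReg, logG]
  push_cast at h1
  linarith

/-- With `r = |x - z|` the difference is `½ log(1 + δ⁴/r²) ≤ log(1 + δ²/r)`. The regularisation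
parameter is a fourth power so that the error is linear in `δ`. -/
lemma logG_sub_gReg_le {δ : ℝ} (hδ : 0 < δ) (hδ1 : δ ≤ 1) (x z : Euc n) :
    logG x z - gReg (δ ^ 4) x z ≤ 2 * δ * sing (x - z) := by
  rw [gReg, logG]
  rcases (norm_nonneg (x - z)).eq_or_lt with h | h
  · rw [← h, Real.log_zero]
    have h1 : Real.log (0 ^ 2 + δ ^ 4) ≤ 0 :=
      Real.log_nonpos (by positivity) (by simpa using pow_le_one₀ hδ.le hδ1)
    have h2 : 0 ≤ 2 * δ * sing (x - z) := mul_nonneg (by positivity) (sing_nonneg _)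
    generalize Real.log (0 ^ 2 + δ ^ 4) = L at h1 ⊢
    linarith
  · have h1 := log_one_add_inv_le (x - z) (δ ^ 2) (by positivity)
    rw [← Real.sqrt_eq_rpow, Real.sqrt_sq hδ.le] at h1
    refine le_trans ?_ h1
    set r := ‖x - z‖
    have h3 : 1 + δ ^ 2 * r⁻¹ = (r + δ ^ 2) / r := by field_simp
    rw [h3, Real.log_div (by positivity) h.ne']
    have h4 : Real.log (r ^ 2 + δ ^ 4) ≤ Real.log ((r + δ ^ 2) ^ 2) :=
      Real.log_le_log (by positivity) (by nlinarith [mul_pos h (pow_pos hδ 2)])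
    rw [Real.log_pow] at h4
    push_cast at h4
    linarith

lemma abs_gReg_le {a : ℝ} (ha : 0 < a) (ha1 : a ≤ 1) (x z : Euc n) :
    |gReg a x z| ≤ -Real.log a + (logWeight x + logWeight z) := by
  have h1 : Real.log a ≤ 0 := Real.log_nonpos ha.le ha1
  have h2 : Real.log a ≤ Real.log (‖x - z‖ ^ 2 + a) :=
    Real.log_le_log ha (by nlinarith [sq_nonneg ‖x - z‖])
  have h3 : Real.log (‖x - z‖ ^ 2 + a) ≤ Real.log (1 + ‖x - z‖ ^ 2 / 1) :=
    Real.log_le_log (by positivity) (by rw [div_one]; linarith)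
  have h4 := log_one_add_sq_div_le x z le_rfl
  have h5 := logWeight_nonneg x
  have h6 := logWeight_nonneg z
  rw [gReg, abs_le]
  constructor <;> linarith

lemma integrable_logWeight_add {σ μ : Measure (Euc n)} [IsProbabilityMeasure σ]
    [IsProbabilityMeasure μ] (hσ : Integrable logWeight σ) (hμ : Integrable logWeight μ) :
    Integrable (fun p : Euc n × Euc n => logWeight p.1 + logWeight p.2) (σ.prod μ) :=
  (hσ.comp_fst μ).add (hμ.comp_snd σ)

lemma integrable_gReg {σ μ : Measure (Euc n)} [IsProbabilityMeasure σ]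
    [IsProbabilityMeasure μ] (hσ : Integrable logWeight σ) (hμ : Integrable logWeight μ)
    {a : ℝ} (ha : 0 < a) (ha1 : a ≤ 1) :
    Integrable (fun p : Euc n × Euc n => gReg a p.1 p.2) (σ.prod μ) :=
  ((integrable_const (-Real.log a)).add (integrable_logWeight_add hσ hμ)).mono'
    (measurable_gReg a).aestronglyMeasurable (ae_of_all _ fun p => abs_gReg_le ha ha1 p.1 p.2)

lemma integrable_sing_prod [NeZero n] {σ μ : Measure (Euc n)} [IsProbabilityMeasure σ]
    [IsProbabilityMeasure μ] {A : ℝ≥0} (hA : μ ≤ (A : ℝ≥0∞) • volume) :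
    Integrable (fun p : Euc n × Euc n => sing (p.1 - p.2)) (σ.prod μ) := by
  have hm : Measurable fun p : Euc n × Euc n => sing (p.1 - p.2) := by fun_prop
  rw [integrable_prod_iff hm.aestronglyMeasurable]
  refine ⟨ae_of_all _ fun x => integrable_sing hA x, ?_⟩
  refine (integrable_const ((A : ℝ) * singConst n + 1)).mono'
    (hm.norm.stronglyMeasurable.integral_prod_right').aestronglyMeasurable
    (ae_of_all _ fun x => ?_)
  simp only [Real.norm_of_nonneg (sing_nonneg _)]
  rw [Real.norm_of_nonneg (integral_nonneg fun z => sing_nonneg _)]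
  exact integral_sing_le hA x

lemma integral_sing_prod_le [NeZero n] {σ μ : Measure (Euc n)} [IsProbabilityMeasure σ]
    [IsProbabilityMeasure μ] {A : ℝ≥0} (hA : μ ≤ (A : ℝ≥0∞) • volume) :
    ∫ p : Euc n × Euc n, sing (p.1 - p.2) ∂(σ.prod μ) ≤ A * singConst n + 1 := by
  rw [integral_prod _ (integrable_sing_prod hA)]
  calc ∫ x, ∫ z, sing (x - z) ∂μ ∂σ ≤ ∫ _x : Euc n, ((A : ℝ) * singConst n + 1) ∂σ :=
        integral_mono (integrable_sing_prod hA).integral_prod_left (integrable_const _)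
          fun x => integral_sing_le hA x
    _ = _ := by simp

lemma integrable_logG_prod [NeZero n] {σ μ : Measure (Euc n)} [IsProbabilityMeasure σ]
    [IsProbabilityMeasure μ] (hσ : Integrable logWeight σ) (hμ : Integrable logWeight μ)
    {A : ℝ≥0} (hA : μ ≤ (A : ℝ≥0∞) • volume) :
    Integrable (fun p : Euc n × Euc n => logG p.1 p.2) (σ.prod μ) :=
  ((integrable_logWeight_add hσ hμ).add ((integrable_sing_prod hA).const_mul 2)).mono'
    measurable_logG.aestronglyMeasurable (ae_of_all _ fun p => abs_logG_le p.1 p.2)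

lemma integrable_logG [NeZero n] {μ : Measure (Euc n)} [IsFiniteMeasure μ] {A : ℝ≥0}
    (hμ : μ ≤ (A : ℝ≥0∞) • volume) (hϑ : Integrable logWeight μ) (x : Euc n) :
    Integrable (fun z => logG x z) μ :=
  (integrable_log_norm_sub hμ hϑ x).neg

lemma integrable_gReg_right {μ : Measure (Euc n)} [IsFiniteMeasure μ]
    (hϑ : Integrable logWeight μ) {a : ℝ} (ha : 0 < a) (ha1 : a ≤ 1) (x : Euc n) :
    Integrable (fun z => gReg a x z) μ :=
  ((integrable_const (-Real.log a)).add ((integrable_const (logWeight x)).add hϑ)).mono'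
    (measurable_gReg_right a x).aestronglyMeasurable (ae_of_all _ fun z => abs_gReg_le ha ha1 x z)

lemma ae_prod_ne {σ μ : Measure (Euc n)} [SFinite σ] [SFinite μ]
    (hμ : ∀ x, μ {x} = 0) : ∀ᵐ p ∂(σ.prod μ), p.1 ≠ p.2 := by
  have hm : MeasurableSet {p : Euc n × Euc n | p.1 ≠ p.2} :=
    (measurableSet_eq_fun measurable_fst measurable_snd).compl
  rw [ae_iff]
  have hs : {p : Euc n × Euc n | ¬ p.1 ≠ p.2} = {p | p.1 ≠ p.2}ᶜ := rfl
  rw [hs, Measure.measure_prod_null hm.compl]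
  refine ae_of_all _ fun x => ?_
  have : Prod.mk x ⁻¹' {p : Euc n × Euc n | p.1 ≠ p.2}ᶜ = {x} := by
    ext z; simp [eq_comm]
  simp only [this]
  exact hμ x

/-- The logarithmic kernel is conditionally positive. -/
theorem two_mul_integral_logG_le [NeZero n] {σ μ : Measure (Euc n)} [IsProbabilityMeasure σ]
    [IsProbabilityMeasure μ] (hσ : Integrable logWeight σ) (hμ : Integrable logWeight μ)
    {A : ℝ≥0} (hA : μ ≤ (A : ℝ≥0∞) • volume) (hσ0 : ∀ x, σ {x} = 0)
    (hσG : Integrable (fun p : Euc n × Euc n => logG p.1 p.2) (σ.prod σ)) :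
    2 * ∫ p, logG p.1 p.2 ∂(σ.prod μ) ≤
      ∫ p, logG p.1 p.2 ∂(σ.prod σ) + ∫ p, logG p.1 p.2 ∂(μ.prod μ) := by
  have hμ0 : ∀ x, μ {x} = 0 := fun x => by
    have := nullSingletonClass_volume (n := n)
    have h := hA {x}
    simpa using h
  set c : ℝ := A * singConst n + 1
  have hc : 0 ≤ c := by positivity
  -- Regularising only lowers the two self-energies, so they cost nothing. Only the mutual energy
  -- has to be compared in the other direction, and there the bounded density of `μ` alone controls
  -- the error.
  have key : ∀ δ : ℝ, 0 < δ → δ ≤ 1 → 2 * ∫ p, logG p.1 p.2 ∂(σ.prod μ) ≤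
      ∫ p, logG p.1 p.2 ∂(σ.prod σ) + ∫ p, logG p.1 p.2 ∂(μ.prod μ) + 4 * δ * c := by
    intro δ hδ hδ1
    have ha : 0 < δ ^ 4 := by positivity
    have ha1 : δ ^ 4 ≤ 1 := pow_le_one₀ hδ.le hδ1
    have h1 := two_mul_integral_gReg_le hσ hμ ha
    have h2 : ∫ p, gReg (δ ^ 4) p.1 p.2 ∂(σ.prod σ) ≤ ∫ p, logG p.1 p.2 ∂(σ.prod σ) := by
      refine integral_mono_ae (integrable_gReg hσ hσ ha ha1) hσG ?_
      filter_upwards [ae_prod_ne hσ0] with p hp using gReg_le_logG ha hp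
    have h3 : ∫ p, gReg (δ ^ 4) p.1 p.2 ∂(μ.prod μ) ≤ ∫ p, logG p.1 p.2 ∂(μ.prod μ) := by
      refine integral_mono_ae (integrable_gReg hμ hμ ha ha1) (integrable_logG_prod hμ hμ hA) ?_
      filter_upwards [ae_prod_ne hμ0] with p hp using gReg_le_logG ha hp
    have h4 : ∫ p, logG p.1 p.2 ∂(σ.prod μ) - ∫ p, gReg (δ ^ 4) p.1 p.2 ∂(σ.prod μ) ≤
        2 * δ * c := by
      rw [← integral_sub (integrable_logG_prod hσ hμ hA) (integrable_gReg hσ hμ ha ha1)]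
      calc _ ≤ ∫ p : Euc n × Euc n, 2 * δ * sing (p.1 - p.2) ∂(σ.prod μ) :=
            integral_mono ((integrable_logG_prod hσ hμ hA).sub (integrable_gReg hσ hμ ha ha1))
              ((integrable_sing_prod hA).const_mul _) fun p => logG_sub_gReg_le hδ hδ1 p.1 p.2
        _ ≤ 2 * δ * c := by
            rw [integral_const_mul]
            gcongr
            exact integral_sing_prod_le hA
    linarith
  have hlim : Tendsto (fun δ : ℝ => ∫ p, logG p.1 p.2 ∂(σ.prod σ) +
      ∫ p, logG p.1 p.2 ∂(μ.prod μ) + 4 * δ * c) (𝓝[>] 0)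
      (𝓝 (∫ p, logG p.1 p.2 ∂(σ.prod σ) + ∫ p, logG p.1 p.2 ∂(μ.prod μ) + 4 * 0 * c)) := by
    refine Tendsto.mono_left (Continuous.tendsto (by fun_prop) 0) nhdsWithin_le_nhds
  have := ge_of_tendsto hlim (by
    filter_upwards [Ioc_mem_nhdsGT (show (0 : ℝ) < 1 by norm_num)] with δ hδ
      using key δ hδ.1 hδ.2)
  simpa using this

/-! ### Mean-field fixed points -/

section MeanField

/-- The second derivative `1/t` of `t log t` is at least `1/C` on `(0, C]`. This strong convexity
gives uniform convexity of the entropy on bounded densities. -/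
lemma convexOn_mul_log_sub {C : ℝ} (hC : 0 < C) :
    ConvexOn ℝ (Set.Icc 0 C) fun t => t * Real.log t - t ^ 2 / (2 * C) := by
  refine convexOn_of_hasDerivWithinAt2_nonneg (convex_Icc 0 C)
    (f' := fun t => Real.log t + 1 - t / C) (f'' := fun t => t⁻¹ - 1 / C) ?_ ?_ ?_ ?_
  · exact (Real.continuous_mul_log.sub (by fun_prop)).continuousOn
  · intro x hx
    rw [interior_Icc] at hx
    have h := (Real.hasDerivAt_mul_log hx.1.ne').sub
      (((hasDerivAt_id x).pow 2).div_const (2 * C))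
    refine (h.congr_deriv ?_).hasDerivWithinAt
    simp only [id]
    field_simp
    ring
  · intro x hx
    rw [interior_Icc] at hx
    exact (((Real.hasDerivAt_log hx.1.ne').add_const 1).sub
      ((hasDerivAt_id x).div_const C)).hasDerivWithinAt
  · intro x hx
    rw [interior_Icc] at hx
    rw [sub_nonneg, one_div]
    exact inv_anti₀ hx.1 hx.2.le

lemma midpoint_mul_log_le {C a b : ℝ} (hC : 0 < C) (ha : a ∈ Set.Icc 0 C) (hb : b ∈ Set.Icc 0 C) :
    (a + b) / 2 * Real.log ((a + b) / 2) + (a - b) ^ 2 / (8 * C) ≤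
      (a * Real.log a + b * Real.log b) / 2 := by
  obtain ⟨-, h0⟩ := convexOn_mul_log_sub hC
  have h := h0 ha hb (by norm_num : (0 : ℝ) ≤ 1 / 2) (by norm_num : (0 : ℝ) ≤ 1 / 2) (by norm_num)
  simp only [smul_eq_mul] at h
  have e : 1 / 2 * a + 1 / 2 * b = (a + b) / 2 := by ring
  rw [e] at h
  have e2 : ((a + b) / 2) ^ 2 / (2 * C) + (a - b) ^ 2 / (8 * C) =
      (a ^ 2 / (2 * C) + b ^ 2 / (2 * C)) / 2 := by field_simp; ring
  linarith

lemma abs_mul_log_le {C t : ℝ} (hC : 1 ≤ C) (ht : 0 ≤ t) (htC : t ≤ C) :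
    |t * Real.log t| ≤ 1 + C * Real.log C := by
  have hlC := Real.log_nonneg hC
  have hCC : 0 ≤ C * Real.log C := by positivity
  rcases ht.eq_or_lt with rfl | ht
  · simp; linarith
  rw [abs_le]
  constructor
  · have := Real.one_sub_inv_le_log_of_pos ht
    have h2 : t * (1 - t⁻¹) ≤ t * Real.log t := by gcongr
    rw [mul_sub, mul_inv_cancel₀ ht.ne'] at h2
    linarith
  · rcases le_total 1 t with h1 | h1
    · have := Real.log_le_log ht htC
      have := Real.log_nonneg h1
      nlinarith
    · have := Real.log_nonpos ht.le h1
      nlinarith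

/-- The first order condition at a minimum: divide by `t` and let `t → 0`. -/
lemma nonneg_of_forall_quadratic {a b : ℝ} (h : ∀ t : ℝ, 0 < t → t ≤ 1 → 0 ≤ t * a + t ^ 2 * b) :
    0 ≤ a := by
  have hlim : Tendsto (fun t : ℝ => a + t * b) (𝓝[>] 0) (𝓝 (a + 0 * b)) :=
    Tendsto.mono_left (Continuous.tendsto (by fun_prop) 0) nhdsWithin_le_nhds
  have := ge_of_tendsto hlim (b := 0) (by
    filter_upwards [Ioc_mem_nhdsGT (show (0 : ℝ) < 1 by norm_num)] with t ht
    have h1 := h t ht.1 ht.2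
    have h2 : t * a + t ^ 2 * b = t * (a + t * b) := by ring
    rw [h2] at h1
    exact nonneg_of_mul_nonneg_right h1 ht.1)
  simpa using this

variable {X : Type*} [MeasurableSpace X] {ν : Measure X}
  {K : X → X → ℝ}

/-- Measurable probability densities with values in `[0, C]`. -/
structure IsDens (ν : Measure X) (C : ℝ) (u : X → ℝ) : Prop where
  meas : Measurable u
  nonneg : ∀ x, 0 ≤ u x
  le : ∀ x, u x ≤ C
  int : ∫ x, u x ∂ν = 1

/-- Bounded nonnegative symmetric potentials: the standing assumptions on a mean-field kernel. -/
structure IsMeanKernel (ν : Measure X) (K : X → X → ℝ) (C₁ : ℝ) : Prop where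
  meas : Measurable fun p : X × X => K p.1 p.2
  nonneg : ∀ x z, 0 ≤ K x z
  symm : ∀ x z, K x z = K z x
  integrable : ∀ x, Integrable (K x) ν
  le : ∀ x, ∫ z, K x z ∂ν ≤ C₁

/-- The mean-field potential of a density. -/
def kpot (ν : Measure X) (K : X → X → ℝ) (u : X → ℝ) (x : X) : ℝ := ∫ z, K x z * u z ∂ν

/-- The mutual energy of two densities. -/
def kform (ν : Measure X) (K : X → X → ℝ) (u v : X → ℝ) : ℝ := ∫ x, u x * kpot ν K v x ∂ν

/-- The mean-field free energy of a density. -/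
def kfree (ν : Measure X) (K : X → X → ℝ) (γ : ℝ) (u : X → ℝ) : ℝ :=
  ∫ x, u x * Real.log (u x) ∂ν + γ / 2 * kform ν K u u

namespace IsDens

variable {C : ℝ} {u v : X → ℝ}

lemma mem (hu : IsDens ν C u) (x : X) : u x ∈ Set.Icc 0 C := ⟨hu.nonneg x, hu.le x⟩

lemma norm_le (hu : IsDens ν C u) (x : X) : ‖u x‖ ≤ C := by
  rw [Real.norm_of_nonneg (hu.nonneg x)]; exact hu.le x

variable [IsProbabilityMeasure ν]

lemma integrable (hu : IsDens ν C u) : Integrable u ν :=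
  (integrable_const C).mono' hu.meas.aestronglyMeasurable (ae_of_all _ hu.norm_le)

lemma convex (hu : IsDens ν C u) (hv : IsDens ν C v) {s t : ℝ} (hs : 0 ≤ s) (ht : 0 ≤ t)
    (hst : s + t = 1) : IsDens ν C fun x => s * u x + t * v x where
  meas := (hu.meas.const_mul s).add (hv.meas.const_mul t)
  nonneg x := add_nonneg (mul_nonneg hs (hu.nonneg x)) (mul_nonneg ht (hv.nonneg x))
  le x := by
    have h1 := mul_le_mul_of_nonneg_left (hu.le x) hs
    have h2 := mul_le_mul_of_nonneg_left (hv.le x) ht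
    calc _ ≤ s * C + t * C := add_le_add h1 h2
      _ = C := by rw [← add_mul, hst, one_mul]
  int := by
    rw [integral_add (hu.integrable.const_mul s) (hv.integrable.const_mul t),
      integral_const_mul, integral_const_mul, hu.int, hv.int]
    linarith

lemma integrable_mul_log (hC : 1 ≤ C) (hu : IsDens ν C u) :
    Integrable (fun x => u x * Real.log (u x)) ν :=
  (integrable_const (1 + C * Real.log C)).mono'
    (hu.meas.mul hu.meas.log).aestronglyMeasurable
    (ae_of_all _ fun x => abs_mul_log_le hC (hu.nonneg x) (hu.le x))

end IsDens

namespace IsMeanKernel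

variable {C C₁ : ℝ} {u v w : X → ℝ}

lemma integrable_mul (hK : IsMeanKernel ν K C₁) (hu : IsDens ν C u) (x : X) :
    Integrable (fun z => K x z * u z) ν :=
  ((hK.integrable x).mul_const C).mono'
    ((hK.integrable x).aestronglyMeasurable.mul hu.meas.aestronglyMeasurable)
    (ae_of_all _ fun z => by
      rw [norm_mul, Real.norm_of_nonneg (hK.nonneg x z)]
      exact mul_le_mul_of_nonneg_left (hu.norm_le z) (hK.nonneg x z))

lemma kpot_nonneg (hK : IsMeanKernel ν K C₁) (hu : IsDens ν C u) (x : X) : 0 ≤ kpot ν K u x :=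
  integral_nonneg fun z => mul_nonneg (hK.nonneg x z) (hu.nonneg z)

lemma kpot_le (hK : IsMeanKernel ν K C₁) (hC : 0 ≤ C) (hu : IsDens ν C u) (x : X) :
    kpot ν K u x ≤ C₁ * C := by
  calc kpot ν K u x ≤ ∫ z, K x z * C ∂ν :=
        integral_mono (hK.integrable_mul hu x) ((hK.integrable x).mul_const C)
          fun z => mul_le_mul_of_nonneg_left (hu.le z) (hK.nonneg x z)
    _ ≤ C₁ * C := by
        rw [integral_mul_const]
        exact mul_le_mul_of_nonneg_right (hK.le x) hC

lemma norm_mul_kpot_le (hK : IsMeanKernel ν K C₁) (hC : 0 ≤ C) (hu : IsDens ν C u)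
    (hv : IsDens ν C v) (x : X) : ‖u x * kpot ν K v x‖ ≤ C * (C₁ * C) := by
  rw [norm_mul, Real.norm_of_nonneg (hK.kpot_nonneg hv x)]
  exact mul_le_mul (hu.norm_le x) (hK.kpot_le hC hv x) (hK.kpot_nonneg hv x) hC

lemma kform_nonneg (hK : IsMeanKernel ν K C₁) (hu : IsDens ν C u) (hv : IsDens ν C v) :
    0 ≤ kform ν K u v :=
  integral_nonneg fun x => mul_nonneg (hu.nonneg x) (hK.kpot_nonneg hv x)

variable [IsProbabilityMeasure ν]

lemma measurable_kpot (hK : IsMeanKernel ν K C₁) (hu : IsDens ν C u) : Measurable (kpot ν K u) :=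
  ((hK.meas.mul (hu.meas.comp measurable_snd)).stronglyMeasurable.integral_prod_right').measurable

lemma integrable_mul_kpot (hK : IsMeanKernel ν K C₁) (hC : 0 ≤ C) (hu : IsDens ν C u)
    (hv : IsDens ν C v) : Integrable (fun x => u x * kpot ν K v x) ν :=
  (integrable_const (C * (C₁ * C))).mono'
    (hu.meas.mul (hK.measurable_kpot hv)).aestronglyMeasurable
    (ae_of_all _ fun x => hK.norm_mul_kpot_le hC hu hv x)

lemma integrable_prod (hK : IsMeanKernel ν K C₁) :
    Integrable (fun p : X × X => K p.1 p.2) (ν.prod ν) := by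
  rw [integrable_prod_iff hK.meas.aestronglyMeasurable]
  refine ⟨ae_of_all _ hK.integrable, (integrable_const C₁).mono'
    (hK.meas.norm.stronglyMeasurable.integral_prod_right').aestronglyMeasurable
    (ae_of_all _ fun x => ?_)⟩
  simp only [Real.norm_of_nonneg (hK.nonneg _ _)]
  rw [Real.norm_of_nonneg (integral_nonneg (hK.nonneg x))]
  exact hK.le x

lemma integrable_prod_mul (hK : IsMeanKernel ν K C₁) (hu : IsDens ν C u) (hv : IsDens ν C v) :
    Integrable (fun p : X × X => u p.1 * (K p.1 p.2 * v p.2)) (ν.prod ν) := by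
  refine (hK.integrable_prod.mul_const (C * C)).mono'
    ((hu.meas.comp measurable_fst).mul (hK.meas.mul (hv.meas.comp measurable_snd))
      ).aestronglyMeasurable (ae_of_all _ fun p => ?_)
  rw [norm_mul, norm_mul, Real.norm_of_nonneg (hK.nonneg _ _)]
  calc ‖u p.1‖ * (K p.1 p.2 * ‖v p.2‖) = K p.1 p.2 * (‖u p.1‖ * ‖v p.2‖) := by ring
    _ ≤ K p.1 p.2 * (C * C) :=
        mul_le_mul_of_nonneg_left (mul_le_mul (hu.norm_le _) (hv.norm_le _) (norm_nonneg _)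
          ((norm_nonneg _).trans (hu.norm_le p.1))) (hK.nonneg _ _)

lemma kform_eq_prod (hK : IsMeanKernel ν K C₁) (hu : IsDens ν C u) (hv : IsDens ν C v) :
    kform ν K u v = ∫ p : X × X, u p.1 * (K p.1 p.2 * v p.2) ∂(ν.prod ν) := by
  rw [MeasureTheory.integral_prod _ (hK.integrable_prod_mul hu hv)]
  exact integral_congr_ae (ae_of_all _ fun x => (integral_const_mul _ _).symm)

lemma kform_comm (hK : IsMeanKernel ν K C₁) (hu : IsDens ν C u) (hv : IsDens ν C v) :
    kform ν K u v = kform ν K v u := by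
  rw [hK.kform_eq_prod hu hv, hK.kform_eq_prod hv hu, ← integral_prod_swap]
  refine integral_congr_ae (ae_of_all _ fun p => ?_)
  simp only [Prod.fst_swap, Prod.snd_swap]
  rw [hK.symm]
  ring

lemma kform_convex (hK : IsMeanKernel ν K C₁) (hC : 0 ≤ C) (hu : IsDens ν C u)
    (hv : IsDens ν C v) (s t : ℝ) :
    kform ν K (fun x => s * u x + t * v x) (fun x => s * u x + t * v x) =
      s ^ 2 * kform ν K u u + 2 * (s * t) * kform ν K u v + t ^ 2 * kform ν K v v := by
  have h1 : ∀ x, kpot ν K (fun x => s * u x + t * v x) x = s * kpot ν K u x + t * kpot ν K v x := by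
    intro x
    rw [kpot, kpot, kpot, ← integral_const_mul, ← integral_const_mul,
      ← integral_add ((hK.integrable_mul hu x).const_mul s) ((hK.integrable_mul hv x).const_mul t)]
    exact integral_congr_ae (ae_of_all _ fun z => by simp only; ring)
  have iuu := (hK.integrable_mul_kpot hC hu hu).const_mul (s ^ 2)
  have iuv := (hK.integrable_mul_kpot hC hu hv).const_mul (s * t)
  have ivu := (hK.integrable_mul_kpot hC hv hu).const_mul (s * t)
  have ivv := (hK.integrable_mul_kpot hC hv hv).const_mul (t ^ 2)
  have h2 : kform ν K (fun x => s * u x + t * v x) (fun x => s * u x + t * v x) =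
      ∫ x, (s ^ 2 * (u x * kpot ν K u x) + s * t * (u x * kpot ν K v x) +
        (s * t * (v x * kpot ν K u x) + t ^ 2 * (v x * kpot ν K v x))) ∂ν := by
    refine integral_congr_ae (ae_of_all _ fun x => ?_)
    simp only [h1]
    ring
  have e1 := integral_add (iuu.add iuv) (ivu.add ivv)
  simp only [Pi.add_apply] at e1
  rw [h2, e1, integral_add iuu iuv, integral_add ivu ivv]
  simp only [integral_const_mul]
  have h3 := hK.kform_comm hu hv
  simp only [kform] at h3 ⊢
  rw [← h3]
  ring

/-- The entropy is uniformly convex on densities bounded by `C` and, by `hpos`, the energy is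
convex. The midpoint gap therefore controls the `L²` distance, which makes minimizing sequences
Cauchy. -/
lemma kfree_midpoint (hK : IsMeanKernel ν K C₁) (hC : 1 ≤ C) (hu : IsDens ν C u)
    (hv : IsDens ν C v) {γ : ℝ} (hγ : 0 ≤ γ)
    (hpos : 2 * kform ν K u v ≤ kform ν K u u + kform ν K v v) :
    kfree ν K γ (fun x => 1 / 2 * u x + 1 / 2 * v x) + 1 / (8 * C) * ∫ x, (u x - v x) ^ 2 ∂ν ≤
      (kfree ν K γ u + kfree ν K γ v) / 2 := by
  have hC0 : 0 < C := by linarith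
  have hw := hu.convex hv (s := 1 / 2) (t := 1 / 2) (by norm_num) (by norm_num) (by norm_num)
  have hsq : Integrable (fun x => (u x - v x) ^ 2) ν :=
    (integrable_const (C ^ 2)).mono' ((hu.meas.sub hv.meas).pow_const 2).aestronglyMeasurable
      (ae_of_all _ fun x => by
        rw [Real.norm_of_nonneg (sq_nonneg _)]
        have h1 := hu.nonneg x
        have h2 := hv.nonneg x
        have h3 := hu.le x
        have h4 := hv.le x
        exact sq_le_sq' (by linarith) (by linarith))
  have hent : ∫ x, (1 / 2 * u x + 1 / 2 * v x) * Real.log (1 / 2 * u x + 1 / 2 * v x) ∂ν +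
      1 / (8 * C) * ∫ x, (u x - v x) ^ 2 ∂ν ≤
      (∫ x, u x * Real.log (u x) ∂ν + ∫ x, v x * Real.log (v x) ∂ν) / 2 := by
    rw [← integral_const_mul, ← integral_add (hw.integrable_mul_log hC) (hsq.const_mul _),
      ← integral_add (hu.integrable_mul_log hC) (hv.integrable_mul_log hC), ← integral_div]
    refine integral_mono ((hw.integrable_mul_log hC).add (hsq.const_mul _))
      (((hu.integrable_mul_log hC).add (hv.integrable_mul_log hC)).div_const 2) fun x => ?_
    have h := midpoint_mul_log_le hC0 (hu.mem x) (hv.mem x)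
    have e : 1 / 2 * u x + 1 / 2 * v x = (u x + v x) / 2 := by ring
    simp only [e]
    rw [one_div, inv_mul_eq_div]
    exact h
  have hE := hK.kform_convex hC0.le hu hv (1 / 2) (1 / 2)
  unfold kfree
  rw [hE]
  nlinarith

/-- The Boltzmann density of the mean-field potential of a density. -/
def boltzDens (ν : Measure X) (K : X → X → ℝ) (γ : ℝ) (u : X → ℝ) (x : X) : ℝ :=
  Real.exp (-(γ * kpot ν K u x)) / ∫ y, Real.exp (-(γ * kpot ν K u y)) ∂ν

lemma integrable_exp_kpot (hK : IsMeanKernel ν K C₁) (hu : IsDens ν C u) {γ : ℝ} (hγ : 0 ≤ γ) :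
    Integrable (fun x => Real.exp (-(γ * kpot ν K u x))) ν :=
  (integrable_const (1 : ℝ)).mono'
    ((hK.measurable_kpot hu).const_mul γ).neg.exp.aestronglyMeasurable
    (ae_of_all _ fun x => by
      rw [Real.norm_of_nonneg (Real.exp_pos _).le, Real.exp_le_one_iff]
      have := mul_nonneg hγ (hK.kpot_nonneg hu x)
      linarith)

/-- By symmetry of the kernel the `ν`-mean of the potential is the `u`-mean of the potential of `ν`,
hence at most `C₁`; then Jensen, in the form of a tangent line. The point is that the bound does not
involve `C`, so Boltzmann densities are bounded by `e^{γ C₁}` whatever the bound on `u`. -/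
lemma le_integral_exp_kpot (hK : IsMeanKernel ν K C₁) (hC : 1 ≤ C) (hu : IsDens ν C u) {γ : ℝ}
    (hγ : 0 ≤ γ) : Real.exp (-(γ * C₁)) ≤ ∫ x, Real.exp (-(γ * kpot ν K u x)) ∂ν := by
  have h1 : IsDens ν C fun _ => 1 := ⟨measurable_const, fun _ => zero_le_one, fun _ => hC, by simp⟩
  have hkp : Integrable (kpot ν K u) ν := by
    have := hK.integrable_mul_kpot (by linarith) h1 hu
    simpa using this
  have hle : ∫ x, kpot ν K u x ∂ν ≤ C₁ := by
    have e1 : ∫ x, kpot ν K u x ∂ν = kform ν K (fun _ => 1) u := by simp [kform]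
    rw [e1, hK.kform_comm h1 hu, kform]
    calc ∫ x, u x * kpot ν K (fun _ => 1) x ∂ν ≤ ∫ x, u x * C₁ ∂ν := by
          refine integral_mono (hK.integrable_mul_kpot (by linarith) hu h1)
            (hu.integrable.mul_const _) fun x => mul_le_mul_of_nonneg_left ?_ (hu.nonneg x)
          simpa [kpot] using hK.le x
      _ = C₁ := by rw [integral_mul_const, hu.int, one_mul]
  have hpt : ∀ x, Real.exp (-(γ * C₁)) * (1 + (γ * C₁ - γ * kpot ν K u x)) ≤
      Real.exp (-(γ * kpot ν K u x)) := by
    intro x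
    have h := Real.add_one_le_exp (γ * C₁ - γ * kpot ν K u x)
    have h2 : Real.exp (-(γ * kpot ν K u x)) =
        Real.exp (-(γ * C₁)) * Real.exp (γ * C₁ - γ * kpot ν K u x) := by
      rw [← Real.exp_add]; congr 1; ring
    rw [h2]
    exact mul_le_mul_of_nonneg_left (by linarith) (Real.exp_pos _).le
  have hi : Integrable (fun x => γ * C₁ - γ * kpot ν K u x) ν :=
    (integrable_const _).sub (hkp.const_mul γ)
  have hI := integral_mono (((integrable_const (1 : ℝ)).add hi).const_mul (Real.exp (-(γ * C₁))))
    (hK.integrable_exp_kpot hu hγ) hpt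
  refine le_trans ?_ hI
  rw [integral_const_mul]
  refine le_mul_of_one_le_right (Real.exp_pos _).le ?_
  simp only [Pi.add_apply]
  rw [integral_add (integrable_const _) hi, integral_sub (integrable_const _) (hkp.const_mul γ),
    integral_const_mul]
  simp
  rw [integral_const_mul]
  exact mul_le_mul_of_nonneg_left hle hγ

lemma integral_exp_kpot_pos (hK : IsMeanKernel ν K C₁) (hC : 1 ≤ C) (hu : IsDens ν C u) {γ : ℝ}
    (hγ : 0 ≤ γ) : 0 < ∫ x, Real.exp (-(γ * kpot ν K u x)) ∂ν :=
  (Real.exp_pos _).trans_le (hK.le_integral_exp_kpot hC hu hγ)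

lemma isDens_boltzDens (hK : IsMeanKernel ν K C₁) (hC : 1 ≤ C) (hu : IsDens ν C u) {γ : ℝ}
    (hγ : 0 ≤ γ) : IsDens ν (Real.exp (γ * C₁)) (boltzDens ν K γ u) where
  meas := ((hK.measurable_kpot hu).const_mul γ).neg.exp.div_const _
  nonneg x := div_nonneg (Real.exp_pos _).le (hK.integral_exp_kpot_pos hC hu hγ).le
  le x := by
    rw [boltzDens, div_le_iff₀ (hK.integral_exp_kpot_pos hC hu hγ)]
    have h1 : Real.exp (-(γ * kpot ν K u x)) ≤ 1 := by
      rw [Real.exp_le_one_iff]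
      have := mul_nonneg hγ (hK.kpot_nonneg hu x)
      linarith
    have h2 := mul_le_mul_of_nonneg_left (hK.le_integral_exp_kpot hC hu hγ)
      (Real.exp_pos (γ * C₁)).le
    rw [← Real.exp_add, add_neg_cancel, Real.exp_zero] at h2
    linarith
  int := by
    simp only [boltzDens]
    rw [integral_div, div_self (hK.integral_exp_kpot_pos hC hu hγ).ne']

end IsMeanKernel

end MeanField

/-! ### Existence of a solution of the self-consistent equation. -/

section MeanFieldExistence

variable {X : Type*} [MeasurableSpace X] {ν : Measure X} [IsProbabilityMeasure ν]
  {K : X → X → ℝ} {C C₁ : ℝ} {u v : X → ℝ}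

/-- The common bound `C` on the densities dominates every integrand, so the free energy is
continuous along almost everywhere convergence. -/
lemma IsMeanKernel.tendsto_kfree (hK : IsMeanKernel ν K C₁) (hC : 1 ≤ C) {γ : ℝ}
    {f : ℕ → X → ℝ} (hf : ∀ k, IsDens ν C (f k))
    (hlim : ∀ᵐ x ∂ν, Tendsto (fun k => f k x) atTop (𝓝 (u x))) :
    Tendsto (fun k => kfree ν K γ (f k)) atTop (𝓝 (kfree ν K γ u)) := by
  have hC0 : 0 ≤ C := by linarith
  have hent : Tendsto (fun k => ∫ x, f k x * Real.log (f k x) ∂ν) atTop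
      (𝓝 (∫ x, u x * Real.log (u x) ∂ν)) := by
    refine tendsto_integral_of_dominated_convergence (fun _ => 1 + C * Real.log C)
      (fun k => ((hf k).integrable_mul_log hC).aestronglyMeasurable) (integrable_const _)
      (fun k => ae_of_all _ fun x => abs_mul_log_le hC ((hf k).nonneg x) ((hf k).le x)) ?_
    filter_upwards [hlim] with x hx
    exact (Real.continuous_mul_log.tendsto (u x)).comp hx
  have hpot : ∀ x, Tendsto (fun k => kpot ν K (f k) x) atTop (𝓝 (kpot ν K u x)) := by
    intro x
    refine tendsto_integral_of_dominated_convergence (fun z => K x z * C)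
      (fun k => (hK.integrable_mul (hf k) x).aestronglyMeasurable) ((hK.integrable x).mul_const C)
      (fun k => ae_of_all _ fun z => ?_) ?_
    · rw [norm_mul, Real.norm_of_nonneg (hK.nonneg x z)]
      exact mul_le_mul_of_nonneg_left ((hf k).norm_le z) (hK.nonneg x z)
    · filter_upwards [hlim] with z hz using hz.const_mul _
  have hform : Tendsto (fun k => kform ν K (f k) (f k)) atTop (𝓝 (kform ν K u u)) := by
    refine tendsto_integral_of_dominated_convergence (fun _ => C * (C₁ * C))
      (fun k => (hK.integrable_mul_kpot hC0 (hf k) (hf k)).aestronglyMeasurable)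
      (integrable_const _) (fun k => ae_of_all _ (hK.norm_mul_kpot_le hC0 (hf k) (hf k))) ?_
    filter_upwards [hlim] with x hx using hx.mul (hpot x)
  exact hent.add (hform.const_mul _)

/-- The mean-field free energy has a minimizer among densities bounded by `C`. -/
lemma IsMeanKernel.exists_minimizer (hK : IsMeanKernel ν K C₁) (hC : 1 ≤ C) {γ : ℝ} (hγ : 0 ≤ γ)
    (hpos : ∀ u v, IsDens ν C u → IsDens ν C v →
      2 * kform ν K u v ≤ kform ν K u u + kform ν K v v) :
    ∃ u, IsDens ν C u ∧ ∀ v, IsDens ν C v → kfree ν K γ u ≤ kfree ν K γ v := by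
  have hC0 : 0 < C := by linarith
  set S : Set ℝ := kfree ν K γ '' {u | IsDens ν C u} with hS
  have hbdd : BddBelow S := by
    refine ⟨-(1 + C * Real.log C), ?_⟩
    rintro _ ⟨u, hu, rfl⟩
    have h1 : -(1 + C * Real.log C) ≤ ∫ x, u x * Real.log (u x) ∂ν := by
      have := integral_mono (μ := ν) (integrable_const (-(1 + C * Real.log C)))
        (hu.integrable_mul_log hC)
        fun x => (abs_le.mp (abs_mul_log_le hC (hu.nonneg x) (hu.le x))).1
      simpa using this
    have h2 := hK.kform_nonneg hu hu
    have h3 : 0 ≤ γ / 2 * kform ν K u u := by positivity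
    rw [kfree]
    linarith
  have hne : S.Nonempty :=
    ⟨_, fun _ => 1, ⟨measurable_const, fun _ => zero_le_one, fun _ => hC, by simp⟩, rfl⟩
  set m := sInf S
  have hm : ∀ v, IsDens ν C v → m ≤ kfree ν K γ v := fun v hv => csInf_le hbdd ⟨v, hv, rfl⟩
  -- Chosen so that the midpoint gap gives a squared `L²` distance of at most `(1/4)^N / 4` beyond
  -- rank `N`, hence a distance below the summable `2^{-N}`.
  set ε : ℕ → ℝ := fun k => (1 / 4) ^ k / (32 * C) with hε
  have hε0 : ∀ k, 0 < ε k := fun k => by positivity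
  have hex : ∀ k, ∃ u, IsDens ν C u ∧ kfree ν K γ u < m + ε k := by
    intro k
    obtain ⟨_, ⟨u, hu, rfl⟩, h⟩ := exists_lt_of_csInf_lt hne (lt_add_of_pos_right m (hε0 k))
    exact ⟨u, hu, h⟩
  choose f hf hfm using hex
  have hsq : ∀ N i j, N ≤ i → N ≤ j →
      ∫ x, (f i x - f j x) ^ 2 ∂ν ≤ (1 / 4) ^ N / 4 := by
    intro N i j hi hj
    have hmono : ∀ i, N ≤ i → ε i ≤ ε N := fun i hi =>
      div_le_div_of_nonneg_right (pow_le_pow_of_le_one (by norm_num) (by norm_num) hi)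
        (by positivity)
    have h1 := hK.kfree_midpoint hC (hf i) (hf j) hγ (hpos _ _ (hf i) (hf j))
    have h2 := hm _ ((hf i).convex (hf j) (s := 1 / 2) (t := 1 / 2) (by norm_num) (by norm_num)
      (by norm_num))
    have h3 := (hfm i).trans_le (add_le_add_right (hmono i hi) m)
    have h4 := (hfm j).trans_le (add_le_add_right (hmono j hj) m)
    have h5 : 1 / (8 * C) * ∫ x, (f i x - f j x) ^ 2 ∂ν ≤ ε N := by linarith
    rw [one_div, inv_mul_le_iff₀ (by positivity)] at h5
    refine h5.trans (le_of_eq ?_)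
    simp only [hε]
    field_simp
    norm_num
  have hcau : ∀ N i j : ℕ, N ≤ i → N ≤ j → eLpNorm (f i - f j) 2 ν < (2⁻¹ : ℝ≥0∞) ^ N := by
    intro N i j hi hj
    have hmem : MemLp (f i - f j) 2 ν := by
      refine MemLp.of_bound ((hf i).meas.sub (hf j).meas).aestronglyMeasurable (C + C)
        (ae_of_all _ fun x => (norm_sub_le _ _).trans
          (add_le_add ((hf i).norm_le x) ((hf j).norm_le x)))
    rw [hmem.eLpNorm_eq_integral_rpow_norm (by norm_num) (by norm_num)]
    have e1 : ∫ x, ‖(f i - f j) x‖ ^ (2 : ℝ≥0∞).toReal ∂ν = ∫ x, (f i x - f j x) ^ 2 ∂ν := by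
      refine integral_congr_ae (ae_of_all _ fun x => ?_)
      simp
    rw [e1]
    have e2 : ((2⁻¹ : ℝ≥0∞)) ^ N = ENNReal.ofReal ((1 / 2) ^ N) := by
      rw [ENNReal.ofReal_pow (by norm_num), one_div, ENNReal.ofReal_inv_of_pos (by norm_num)]
      simp
    rw [e2, ENNReal.ofReal_lt_ofReal_iff (by positivity)]
    have e3 : ((2 : ℝ≥0∞).toReal)⁻¹ = 1 / 2 := by simp
    rw [e3, ← Real.sqrt_eq_rpow, Real.sqrt_lt' (by positivity)]
    refine (hsq N i j hi hj).trans_lt ?_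
    have e4 : (((1 : ℝ) / 2) ^ N) ^ 2 = (1 / 4) ^ N := by
      rw [← pow_mul, mul_comm, pow_mul]; norm_num
    rw [e4]
    have : (0 : ℝ) < (1 / 4) ^ N := by positivity
    linarith
  -- Summable rates give almost everywhere convergence of the whole sequence, without extraction.
  have hae := Lp.ae_tendsto_of_cauchy_eLpNorm (fun k => (hf k).meas.aestronglyMeasurable)
    (by norm_num : (1 : ℝ≥0∞) ≤ 2) (B := fun N => (2⁻¹ : ℝ≥0∞) ^ N)
    (by rw [ENNReal.tsum_geometric]; simp) hcau
  obtain ⟨g, hgm, hg⟩ := measurable_limit_of_tendsto_metrizable_ae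
    (fun k => (hf k).meas.aemeasurable) hae
  -- `IsDens` bounds the density at every point, so the limit is clipped to `[0, C]`; this changes
  -- it on a null set only.
  set w : X → ℝ := fun x => max 0 (min C (g x)) with hw
  have hlim : ∀ᵐ x ∂ν, Tendsto (fun k => f k x) atTop (𝓝 (w x)) := by
    filter_upwards [hg] with x hx
    have h1 : 0 ≤ g x := ge_of_tendsto' hx fun k => (hf k).nonneg x
    have h2 : g x ≤ C := le_of_tendsto' hx fun k => (hf k).le x
    simp only [hw]
    rwa [min_eq_right h2, max_eq_right h1]
  have hwd : IsDens ν C w := by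
    refine ⟨measurable_const.max (measurable_const.min hgm), fun x => le_max_left _ _,
      fun x => max_le hC0.le (min_le_left _ _), ?_⟩
    have h1 : Tendsto (fun k => ∫ x, f k x ∂ν) atTop (𝓝 (∫ x, w x ∂ν)) :=
      tendsto_integral_of_dominated_convergence (fun _ => C)
        (fun k => (hf k).meas.aestronglyMeasurable) (integrable_const _)
        (fun k => ae_of_all _ (hf k).norm_le) hlim
    simp only [(hf _).int] at h1
    exact tendsto_nhds_unique h1 tendsto_const_nhds
  refine ⟨w, hwd, fun v hv => le_trans ?_ (hm v hv)⟩
  have hεlim : Tendsto (fun k => m + ε k) atTop (𝓝 (m + 0 / (32 * C))) :=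
    tendsto_const_nhds.add ((tendsto_pow_atTop_nhds_zero_of_lt_one (by norm_num)
      (by norm_num)).div_const _)
  rw [zero_div, add_zero] at hεlim
  exact le_of_tendsto_of_tendsto' (hK.tendsto_kfree hC hf hlim) hεlim fun k => (hfm k).le

/-- The integrand of a relative entropy: it equals `b · klFun (a / b)`, and `klFun` vanishes only at
`1`. -/
lemma mul_log_sub_nonneg {a b : ℝ} (ha : 0 ≤ a) (hb : 0 < b) :
    0 ≤ a * Real.log a - a * Real.log b - a + b ∧
      (a * Real.log a - a * Real.log b - a + b = 0 → a = b) := by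
  have h : a * Real.log a - a * Real.log b - a + b = b * InformationTheory.klFun (a / b) := by
    rw [InformationTheory.klFun]
    rcases ha.eq_or_lt with rfl | ha
    · simp
    · rw [Real.log_div ha.ne' hb.ne']
      field_simp
      ring
  have hab : 0 ≤ a / b := by positivity
  rw [h]
  refine ⟨mul_nonneg hb.le (InformationTheory.klFun_nonneg hab), fun h0 => ?_⟩
  rcases mul_eq_zero.mp h0 with h1 | h1
  · exact absurd h1 hb.ne'
  · rwa [InformationTheory.klFun_eq_zero_iff hab, div_eq_one_iff_eq hb.ne'] at h1

/-- A minimizer of the mean-field free energy solves the self-consistent equation. -/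
lemma IsMeanKernel.ae_eq_boltzDens (hK : IsMeanKernel ν K C₁) (hC : 1 ≤ C) {γ : ℝ} (hγ : 0 ≤ γ)
    (hCC : Real.exp (γ * C₁) ≤ C) (hu : IsDens ν C u)
    (hmin : ∀ v, IsDens ν C v → kfree ν K γ u ≤ kfree ν K γ v) :
    u =ᵐ[ν] IsMeanKernel.boltzDens ν K γ u := by
  have hC0 : 0 ≤ C := by linarith
  set v := IsMeanKernel.boltzDens ν K γ u with hvdef
  have hv' := hK.isDens_boltzDens hC hu hγ
  have hv : IsDens ν C v := ⟨hv'.meas, hv'.nonneg, fun x => (hv'.le x).trans hCC, hv'.int⟩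
  set Z := ∫ y, Real.exp (-(γ * kpot ν K u y)) ∂ν with hZ
  have hZ0 : 0 < Z := hK.integral_exp_kpot_pos hC hu hγ
  have hv0 : ∀ x, 0 < v x := fun x => div_pos (Real.exp_pos _) hZ0
  have hlog : ∀ x, Real.log (v x) = -(γ * kpot ν K u x) - Real.log Z := fun x => by
    rw [hvdef, IsMeanKernel.boltzDens, Real.log_div (Real.exp_pos _).ne' hZ0.ne', Real.log_exp]
  have iu := hu.integrable_mul_log hC
  have iv := hv.integrable_mul_log hC
  have h0 : 0 ≤ (∫ x, v x * Real.log (v x) ∂ν - ∫ x, u x * Real.log (u x) ∂ν) +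
      γ * (kform ν K u v - kform ν K u u) := by
    -- Move from the minimizer `u` towards `v`: convexity bounds the entropy of the mixture by its
    -- chord, and the energy is exactly quadratic in `t`.
    refine nonneg_of_forall_quadratic
      (b := γ / 2 * (kform ν K u u - 2 * kform ν K u v + kform ν K v v)) fun t ht ht1 => ?_
    have h1 := hmin _ (hu.convex hv (s := 1 - t) (t := t) (by linarith) ht.le (by ring))
    have h2 := hK.kform_convex hC0 hu hv (1 - t) t
    have h3 : ∫ x, ((1 - t) * u x + t * v x) * Real.log ((1 - t) * u x + t * v x) ∂ν ≤
        (1 - t) * ∫ x, u x * Real.log (u x) ∂ν + t * ∫ x, v x * Real.log (v x) ∂ν := by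
      rw [← integral_const_mul, ← integral_const_mul,
        ← integral_add (iu.const_mul _) (iv.const_mul _)]
      refine integral_mono ((hu.convex hv (s := 1 - t) (t := t) (by linarith) ht.le
        (by ring)).integrable_mul_log hC) ((iu.const_mul _).add (iv.const_mul _)) fun x => ?_
      obtain ⟨-, hc⟩ := Real.convexOn_mul_log
      exact hc (hu.nonneg x) (hv.nonneg x) (by linarith : 0 ≤ 1 - t) ht.le (by ring)
    rw [kfree, kfree, h2] at h1
    nlinarith
  have hEv : ∫ x, v x * Real.log (v x) ∂ν = -(γ * kform ν K v u) - Real.log Z := by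
    have e : ∀ x, v x * Real.log (v x) =
        -γ * (v x * kpot ν K u x) - Real.log Z * v x := fun x => by rw [hlog]; ring
    simp_rw [e]
    rw [integral_sub ((hK.integrable_mul_kpot hC0 hv hu).const_mul _) (hv.integrable.const_mul _),
      integral_const_mul, integral_const_mul, hv.int, kform]
    ring
  have hlogv : Integrable (fun x => u x * Real.log (v x)) ν := by
    have e : (fun x => u x * Real.log (v x)) = fun x =>
        -γ * (u x * kpot ν K u x) - Real.log Z * u x := by ext x; rw [hlog]; ring
    rw [e]
    exact ((hK.integrable_mul_kpot hC0 hu hu).const_mul _).sub (hu.integrable.const_mul _)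
  have hUv : ∫ x, u x * Real.log (v x) ∂ν = -(γ * kform ν K u u) - Real.log Z := by
    have e : ∀ x, u x * Real.log (v x) =
        -γ * (u x * kpot ν K u x) - Real.log Z * u x := fun x => by rw [hlog]; ring
    simp_rw [e]
    rw [integral_sub ((hK.integrable_mul_kpot hC0 hu hu).const_mul _) (hu.integrable.const_mul _),
      integral_const_mul, integral_const_mul, hu.int, kform]
    ring
  rw [hEv, hK.kform_comm hv hu] at h0
  have hnn : ∀ x, 0 ≤ u x * Real.log (u x) - u x * Real.log (v x) - u x + v x :=
    fun x => (mul_log_sub_nonneg (hu.nonneg x) (hv0 x)).1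
  have hint : Integrable (fun x => u x * Real.log (u x) - u x * Real.log (v x) - u x + v x) ν :=
    ((iu.sub hlogv).sub hu.integrable).add hv.integrable
  -- Since `log v` is explicit, the first order condition `h0` says that the relative entropy of `u`
  -- with respect to `v` is at most zero.
  have hI : ∫ x, (u x * Real.log (u x) - u x * Real.log (v x) - u x + v x) ∂ν = 0 := by
    refine le_antisymm ?_ (integral_nonneg hnn)
    have e1 := integral_add ((iu.sub hlogv).sub hu.integrable) hv.integrable
    have e2 := integral_sub (iu.sub hlogv) hu.integrable
    have e3 := integral_sub iu hlogv
    simp only [Pi.sub_apply] at e1 e2 e3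
    rw [e1, e2, e3, hUv, hu.int, hv.int]
    linarith
  have hz := (integral_eq_zero_iff_of_nonneg hnn hint).mp hI
  filter_upwards [hz] with x hx
  exact (mul_log_sub_nonneg (hu.nonneg x) (hv0 x)).2 hx

/-- The self-consistent equation has a bounded solution. -/
theorem IsMeanKernel.exists_fixedPoint (hK : IsMeanKernel ν K C₁) {γ : ℝ} (hγ : 0 ≤ γ)
    (hpos : ∀ C u v, IsDens ν C u → IsDens ν C v →
      2 * kform ν K u v ≤ kform ν K u u + kform ν K v v) :
    ∃ C u, 1 ≤ C ∧ IsDens ν C u ∧ ∀ x, u x = IsMeanKernel.boltzDens ν K γ u x := by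
  -- Large enough for the Boltzmann density of the minimizer to be an admissible competitor.
  set C := max 1 (Real.exp (γ * C₁))
  have hC : 1 ≤ C := le_max_left _ _
  obtain ⟨u, hu, hmin⟩ := hK.exists_minimizer hC hγ (hpos C)
  have hae := hK.ae_eq_boltzDens hC hγ (le_max_right _ _) hu hmin
  have hv' := hK.isDens_boltzDens hC hu hγ
  refine ⟨C, IsMeanKernel.boltzDens ν K γ u, hC, ⟨hv'.meas, hv'.nonneg,
    fun x => (hv'.le x).trans (le_max_right _ _), hv'.int⟩, fun x => ?_⟩
  -- The minimizer solves the equation only almost everywhere. Its Boltzmann density has the same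
  -- potential, hence solves it at every point.
  have hk : kpot ν K u = kpot ν K (IsMeanKernel.boltzDens ν K γ u) := by
    ext y
    refine integral_congr_ae ?_
    filter_upwards [hae] with z hz
    rw [hz]
  simp only [IsMeanKernel.boltzDens] at hk ⊢
  rw [← hk]

end MeanFieldExistence

/-! ### The reference measure -/

section Density

variable {X : Type*} [MeasurableSpace X] {ν : Measure X} {u : X → ℝ}

lemma integral_withDensity_ofReal (hu : Measurable u) (h0 : ∀ x, 0 ≤ u x) (f : X → ℝ) :
    ∫ x, f x ∂(ν.withDensity fun x => ENNReal.ofReal (u x)) = ∫ x, u x * f x ∂ν := by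
  rw [integral_withDensity_eq_integral_toReal_smul hu.ennreal_ofReal
    (ae_of_all _ fun x => ENNReal.ofReal_lt_top)]
  exact integral_congr_ae (ae_of_all _ fun x => by
    simp only [smul_eq_mul]; rw [ENNReal.toReal_ofReal (h0 x)])

lemma integrable_withDensity_ofReal (hu : Measurable u) (h0 : ∀ x, 0 ≤ u x) {f : X → ℝ} :
    Integrable f (ν.withDensity fun x => ENNReal.ofReal (u x)) ↔
      Integrable (fun x => u x * f x) ν := by
  rw [integrable_withDensity_iff_integrable_smul' hu.ennreal_ofReal
    (ae_of_all _ fun x => ENNReal.ofReal_lt_top)]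
  refine integrable_congr (ae_of_all _ fun x => ?_)
  simp only [smul_eq_mul]; rw [ENNReal.toReal_ofReal (h0 x)]

lemma withDensity_ofReal_le {A : ℝ≥0} (hA : ∀ x, u x ≤ A) :
    (ν.withDensity fun x => ENNReal.ofReal (u x)) ≤ (A : ℝ≥0∞) • ν := by
  rw [← withDensity_const]
  refine withDensity_mono (ae_of_all _ fun x => ?_)
  rw [← ENNReal.ofReal_coe_nnreal]
  exact ENNReal.ofReal_le_ofReal (hA x)

lemma isProbabilityMeasure_withDensity_ofReal (hu : Integrable u ν) (h0 : ∀ x, 0 ≤ u x)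
    (h1 : ∫ x, u x ∂ν = 1) :
    IsProbabilityMeasure (ν.withDensity fun x => ENNReal.ofReal (u x)) := by
  constructor
  rw [withDensity_apply _ MeasurableSet.univ, Measure.restrict_univ,
    ← ofReal_integral_eq_lintegral_ofReal hu (ae_of_all _ h0), h1, ENNReal.ofReal_one]

lemma IsDens.isProbabilityMeasure [IsProbabilityMeasure ν] {C : ℝ} (hu : IsDens ν C u) :
    IsProbabilityMeasure (ν.withDensity fun x => ENNReal.ofReal (u x)) :=
  isProbabilityMeasure_withDensity_ofReal hu.integrable hu.nonneg hu.int

lemma IsDens.withDensity_le {C : ℝ} (hu : IsDens ν C u) :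
    (ν.withDensity fun x => ENNReal.ofReal (u x)) ≤ ((C.toNNReal : ℝ≥0) : ℝ≥0∞) • ν :=
  withDensity_ofReal_le fun x => (hu.le x).trans (Real.le_coe_toNNReal C)

end Density

section Reference

variable {V : Euc n → ℝ} {γ : ℝ}

lemma exp_neg_sub_eq (x : Euc n) :
    Real.exp (-(V x - γ * logWeight x)) = Real.exp (-V x) * (1 + ‖x‖) ^ γ := by
  rw [← exp_mul_logWeight, ← Real.exp_add]
  congr 1; ring

lemma integrable_preDens (hVc : Continuous V) (hV : SuperLog V) (hγ : 0 ≤ γ) :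
    Integrable fun x => Real.exp (-(V x - γ * logWeight x)) := by
  simp_rw [exp_neg_sub_eq]
  exact hV.integrable hVc γ hγ

/-- The normalisation of the reference measure. -/
def refConst (V : Euc n → ℝ) (γ : ℝ) : ℝ := ∫ x, Real.exp (-(V x - γ * logWeight x))

lemma refConst_pos (hVc : Continuous V) (hV : SuperLog V) (hγ : 0 ≤ γ) : 0 < refConst V γ := by
  have := integral_exp_pos (μ := volume) (integrable_preDens hVc hV hγ)
  exact this

/-- The density of the reference measure. -/
def refDens (V : Euc n → ℝ) (γ : ℝ) (x : Euc n) : ℝ :=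
  Real.exp (-(V x - γ * logWeight x)) / refConst V γ

lemma measurable_refDens (hVc : Continuous V) : Measurable (refDens V γ) := by
  have := hVc.measurable
  unfold refDens
  fun_prop

lemma refDens_nonneg (hVc : Continuous V) (hV : SuperLog V) (hγ : 0 ≤ γ) (x : Euc n) :
    0 ≤ refDens V γ x :=
  div_nonneg (Real.exp_pos _).le (refConst_pos hVc hV hγ).le

lemma referenceMeasure_eq (hVc : Continuous V) (hV : SuperLog V) (hγ : 0 ≤ γ) :
    referenceMeasure V γ = volume.withDensity fun x => ENNReal.ofReal (refDens V γ x) := by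
  have hm : Measurable fun x => ENNReal.ofReal (Real.exp (-(V x - γ * logWeight x))) := by
    have := hVc.measurable
    fun_prop
  have hZ := refConst_pos hVc hV hγ
  have h1 : preReference V γ Set.univ = ENNReal.ofReal (refConst V γ) := by
    rw [preReference, withDensity_apply _ MeasurableSet.univ, Measure.restrict_univ,
      ← ofReal_integral_eq_lintegral_ofReal (integrable_preDens hVc hV hγ)
        (ae_of_all _ fun _ => (Real.exp_pos _).le)]
    rfl
  rw [referenceMeasure, h1, preReference, ← withDensity_smul _ hm]
  congr 1
  ext x
  rw [Pi.smul_apply, smul_eq_mul, ← ENNReal.ofReal_inv_of_pos hZ,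
    ← ENNReal.ofReal_mul (by positivity), refDens, inv_mul_eq_div]

lemma integrable_refDens (hVc : Continuous V) (hV : SuperLog V) (hγ : 0 ≤ γ) :
    Integrable (refDens V γ) := (integrable_preDens hVc hV hγ).div_const _

lemma isProbabilityMeasure_referenceMeasure (hVc : Continuous V) (hV : SuperLog V) (hγ : 0 ≤ γ) :
    IsProbabilityMeasure (referenceMeasure V γ) := by
  rw [referenceMeasure_eq hVc hV hγ]
  refine isProbabilityMeasure_withDensity_ofReal (integrable_refDens hVc hV hγ)
    (refDens_nonneg hVc hV hγ) ?_
  simp only [refDens]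
  rw [integral_div]
  exact div_self (refConst_pos hVc hV hγ).ne'

lemma exists_referenceMeasure_le (hVc : Continuous V) (hV : SuperLog V) (hγ : 0 ≤ γ) :
    ∃ A : ℝ≥0, referenceMeasure V γ ≤ (A : ℝ≥0∞) • volume := by
  obtain ⟨C, hC, h⟩ := hV.exists_exp_neg_le γ hγ
  have hZ := refConst_pos hVc hV hγ
  refine ⟨⟨C / refConst V γ, by positivity⟩, ?_⟩
  rw [referenceMeasure_eq hVc hV hγ]
  refine withDensity_ofReal_le fun x => ?_
  rw [refDens, exp_neg_sub_eq]
  exact div_le_div_of_nonneg_right (h x) hZ.le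

/-- `1 + ‖x‖` is `e^ϑ`: this is the exponential moment of the weight needed in entropy duality. -/
lemma integrable_norm_referenceMeasure (hVc : Continuous V) (hV : SuperLog V) (hγ : 0 ≤ γ) :
    Integrable (fun x => 1 + ‖x‖) (referenceMeasure V γ) := by
  rw [referenceMeasure_eq hVc hV hγ, integrable_withDensity_ofReal (measurable_refDens hVc)
    (refDens_nonneg hVc hV hγ)]
  have h := (hV.integrable hVc (γ + 1) (by linarith)).div_const (refConst V γ)
  refine h.congr (ae_of_all _ fun x => ?_)
  simp only [refDens]
  rw [exp_neg_sub_eq, Real.rpow_add_one (by positivity)]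
  ring

lemma integrable_logWeight_referenceMeasure (hVc : Continuous V) (hV : SuperLog V)
    (hγ : 0 ≤ γ) : Integrable logWeight (referenceMeasure V γ) :=
  (integrable_norm_referenceMeasure hVc hV hγ).mono' measurable_logWeight.aestronglyMeasurable
    (ae_of_all _ fun x => by
      rw [Real.norm_of_nonneg (logWeight_nonneg x), logWeight]
      have h0 := norm_nonneg x
      have h := Real.log_le_sub_one_of_pos (show 0 < 1 + ‖x‖ by positivity)
      linarith)

end Reference

/-! ### The weighted kernel -/

/-- The nonnegative kernel `g(x,z) + ϑ(x) + ϑ(z)`, as a real function. -/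
def wKer (x z : Euc n) : ℝ := logG x z + logWeight x + logWeight z

@[fun_prop]
lemma measurable_wKer : Measurable fun p : Euc n × Euc n => wKer p.1 p.2 := by
  unfold wKer
  fun_prop

lemma wKer_nonneg (x z : Euc n) : 0 ≤ wKer x z := by
  have := log_norm_sub_le x z
  rw [wKer, logG]
  linarith

lemma wKer_comm (x z : Euc n) : wKer x z = wKer z x := by
  rw [wKer, wKer, logG_comm]; ring

/-- From `1 + |x| ≤ (1 + |z|)(1 + |x - z|)`: the growth of `ϑ(x)` is compensated by `-log |x - z|`.
No weight of `x` survives, so the potential of a measure is bounded uniformly in `x`. -/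
lemma wKer_le (x z : Euc n) : wKer x z ≤ 2 * logWeight z + 2 * sing (x - z) := by
  rw [wKer, logG]
  rcases (norm_nonneg (x - z)).eq_or_lt with h | h
  · have hxz : x = z := by rw [← sub_eq_zero, ← norm_eq_zero]; exact h.symm
    have := sing_nonneg (x - z)
    rw [← h, Real.log_zero, hxz]
    rw [hxz] at this
    linarith
  · have h1 : logWeight x ≤ logWeight z + Real.log (1 + ‖x - z‖) := by
      have hz := one_le_one_add_norm z
      rw [logWeight, logWeight, ← Real.log_mul (by linarith) (by linarith)]
      refine Real.log_le_log (by positivity) ?_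
      have h2 : ‖x‖ ≤ ‖z‖ + ‖x - z‖ := by
        have := norm_add_le z (x - z)
        rwa [add_sub_cancel] at this
      nlinarith [norm_nonneg z]
    have h3 := log_one_add_inv_le (x - z) 1 zero_le_one
    have h4 : 1 + 1 * ‖x - z‖⁻¹ = (1 + ‖x - z‖) / ‖x - z‖ := by field_simp; ring
    rw [h4, Real.log_div (by positivity) h.ne'] at h3
    norm_num at h3
    linarith

lemma weightedKernel_eq {x z : Euc n} (h : x ≠ z) :
    weightedKernel x z = ENNReal.ofReal (wKer x z) := by
  rw [weightedKernel, logKernel, if_neg h, wKer, logG, Real.log_inv, ← EReal.coe_add,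
    ← EReal.coe_add, EReal.toENNReal_of_ne_top (EReal.coe_ne_top _), EReal.toReal_coe]

lemma integrable_wKer_prod {σ μ : Measure (Euc n)} [IsProbabilityMeasure σ]
    [IsProbabilityMeasure μ] (hσ : Integrable logWeight σ) (hμ : Integrable logWeight μ)
    (hG : Integrable (fun p : Euc n × Euc n => logG p.1 p.2) (σ.prod μ)) :
    Integrable (fun p : Euc n × Euc n => wKer p.1 p.2) (σ.prod μ) :=
  (hG.add (hσ.comp_fst μ)).add (hμ.comp_snd σ)

lemma integral_wKer_prod {σ μ : Measure (Euc n)} [IsProbabilityMeasure σ]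
    [IsProbabilityMeasure μ] (hσ : Integrable logWeight σ) (hμ : Integrable logWeight μ)
    (hG : Integrable (fun p : Euc n × Euc n => logG p.1 p.2) (σ.prod μ)) :
    ∫ p, wKer p.1 p.2 ∂(σ.prod μ) =
      ∫ p, logG p.1 p.2 ∂(σ.prod μ) + ∫ x, logWeight x ∂σ + ∫ z, logWeight z ∂μ := by
  have e1 := integral_add (hG.add (hσ.comp_fst μ)) (hμ.comp_snd σ)
  have e2 := integral_add hG (hσ.comp_fst μ)
  simp only [Pi.add_apply] at e1 e2
  have e3 : ∫ p : Euc n × Euc n, logWeight p.1 ∂(σ.prod μ) = ∫ x, logWeight x ∂σ := by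
    rw [integral_fun_fst]; simp
  have e4 : ∫ p : Euc n × Euc n, logWeight p.2 ∂(σ.prod μ) = ∫ x, logWeight x ∂μ := by
    rw [integral_fun_snd]; simp
  simp only [wKer]
  rw [e1, e2, e3, e4]

/-- Positivity of the weighted energy form. -/
lemma two_mul_integral_wKer_le [NeZero n] {σ μ : Measure (Euc n)} [IsProbabilityMeasure σ]
    [IsProbabilityMeasure μ] (hσ : Integrable logWeight σ) (hμ : Integrable logWeight μ)
    {A : ℝ≥0} (hA : μ ≤ (A : ℝ≥0∞) • volume) (hσ0 : ∀ x, σ {x} = 0)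
    (hσG : Integrable (fun p : Euc n × Euc n => logG p.1 p.2) (σ.prod σ)) :
    2 * ∫ p, wKer p.1 p.2 ∂(σ.prod μ) ≤
      ∫ p, wKer p.1 p.2 ∂(σ.prod σ) + ∫ p, wKer p.1 p.2 ∂(μ.prod μ) := by
  have h := two_mul_integral_logG_le hσ hμ hA hσ0 hσG
  rw [integral_wKer_prod hσ hμ (integrable_logG_prod hσ hμ hA), integral_wKer_prod hσ hσ hσG,
    integral_wKer_prod hμ hμ (integrable_logG_prod hμ hμ hA)]
  linarith

lemma integrable_of_le {ν : Measure (Euc n)} {c : ℝ≥0} {σ : Measure (Euc n)}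
    (h : σ ≤ (c : ℝ≥0∞) • ν) {f : Euc n → ℝ} (hf : Integrable f ν) : Integrable f σ :=
  (hf.smul_measure (by simp)).mono_measure h

lemma IsDens.withDensity_le_volume {ν : Measure (Euc n)} {A : ℝ≥0}
    {C : ℝ} {u : Euc n → ℝ} (hA : ν ≤ (A : ℝ≥0∞) • volume) (hu : IsDens ν C u) :
    (ν.withDensity fun x => ENNReal.ofReal (u x)) ≤
      ((C.toNNReal * A : ℝ≥0) : ℝ≥0∞) • volume := by
  refine hu.withDensity_le.trans ?_
  rw [ENNReal.coe_mul, mul_smul]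
  intro s
  simp only [Measure.smul_apply, smul_eq_mul]
  have := hA s
  simp only [Measure.smul_apply, smul_eq_mul] at this
  gcongr

section Kernel

variable [NeZero n] {ν : Measure (Euc n)} [IsProbabilityMeasure ν] {A : ℝ≥0}
  {C : ℝ} {u v : Euc n → ℝ}

lemma isMeanKernel_wKer (hA : ν ≤ (A : ℝ≥0∞) • volume) (hν : Integrable logWeight ν) :
    IsMeanKernel ν wKer (2 * ∫ z, logWeight z ∂ν + 2 * (A * singConst n + 1)) := by
  have hb : ∀ x, Integrable (fun z => 2 * logWeight z + 2 * sing (x - z)) ν := fun x =>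
    (hν.const_mul 2).add ((integrable_sing hA x).const_mul 2)
  have hi : ∀ x, Integrable (wKer x) ν := fun x =>
    (hb x).mono' (measurable_wKer.comp measurable_prodMk_left).aestronglyMeasurable
      (ae_of_all _ fun z => by rw [Real.norm_of_nonneg (wKer_nonneg x z)]; exact wKer_le x z)
  refine ⟨measurable_wKer, wKer_nonneg, wKer_comm, hi, fun x => ?_⟩
  refine (integral_mono (hi x) (hb x) (wKer_le x)).trans ?_
  rw [integral_add (hν.const_mul 2) ((integrable_sing hA x).const_mul 2), integral_const_mul,
    integral_const_mul]
  have := integral_sing_le hA x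
  linarith

lemma kform_eq_integral_wKer (hA : ν ≤ (A : ℝ≥0∞) • volume) (hν : Integrable logWeight ν)
    (hu : IsDens ν C u) (hv : IsDens ν C v) :
    kform ν wKer u v = ∫ p, wKer p.1 p.2 ∂((ν.withDensity fun x => ENNReal.ofReal (u x)).prod
      (ν.withDensity fun x => ENNReal.ofReal (v x))) := by
  have := hu.isProbabilityMeasure
  have := hv.isProbabilityMeasure
  have iu := integrable_of_le hu.withDensity_le hν
  have iv := integrable_of_le hv.withDensity_le hν
  rw [integral_prod _ (integrable_wKer_prod iu iv
    (integrable_logG_prod iu iv (hv.withDensity_le_volume hA))),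
    integral_withDensity_ofReal hu.meas hu.nonneg]
  refine integral_congr_ae (ae_of_all _ fun x => ?_)
  simp only
  rw [integral_withDensity_ofReal hv.meas hv.nonneg, kpot]
  simp only [mul_comm]

lemma measure_singleton_of_le {σ : Measure (Euc n)} (h : σ ≤ (A : ℝ≥0∞) • volume) (x : Euc n) :
    σ {x} = 0 := by
  have := nullSingletonClass_volume (n := n)
  have h := h {x}
  simpa using h

lemma kform_wKer_pos (hA : ν ≤ (A : ℝ≥0∞) • volume) (hν : Integrable logWeight ν)
    (hu : IsDens ν C u) (hv : IsDens ν C v) :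
    2 * kform ν wKer u v ≤ kform ν wKer u u + kform ν wKer v v := by
  have := hu.isProbabilityMeasure
  have := hv.isProbabilityMeasure
  have iu := integrable_of_le hu.withDensity_le hν
  have iv := integrable_of_le hv.withDensity_le hν
  rw [kform_eq_integral_wKer hA hν hu hv, kform_eq_integral_wKer hA hν hu hu,
    kform_eq_integral_wKer hA hν hv hv]
  exact two_mul_integral_wKer_le iu iv (hv.withDensity_le_volume hA)
    (measure_singleton_of_le (hu.withDensity_le_volume hA))
    (integrable_logG_prod iu iu (hu.withDensity_le_volume hA))

end Kernel

/-! ### The equilibrium measure -/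

section Equilibrium

open InformationTheory

/-- The two kernels differ on the diagonal, infinite for one and finite for the other; the diagonal
is null for a measure without atoms. -/
lemma weightedEnergy_eq {σ : Measure (Euc n)} [SFinite σ] (h0 : ∀ x, σ {x} = 0) :
    weightedEnergy σ = ∫⁻ p, ENNReal.ofReal (wKer p.1 p.2) ∂(σ.prod σ) := by
  rw [lintegral_prod _ (by fun_prop), weightedEnergy]
  refine lintegral_congr fun x => lintegral_congr_ae ?_
  have : ∀ᵐ z ∂σ, z ≠ x := by
    rw [ae_iff]
    simpa using h0 x
  filter_upwards [this] with z hz using weightedKernel_eq hz.symm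

/-- The Young inequality between `klFun` and its convex conjugate `e^b - 1`. -/
lemma mul_le_klFun_add {a b : ℝ} (ha : 0 ≤ a) : a * b ≤ klFun a + (Real.exp b - 1) := by
  have h := (mul_log_sub_nonneg ha (Real.exp_pos b)).1
  rw [Real.log_exp] at h
  rw [klFun]
  linarith

/-- Entropy duality with test function `ϑ`: finite entropy relative to a measure that integrates
`e^ϑ` forces `ϑ` to be integrable. -/
lemma integrable_logWeight_of_klDiv {σ ν : Measure (Euc n)} [IsProbabilityMeasure σ]
    [IsProbabilityMeasure ν] (hν : Integrable (fun x => 1 + ‖x‖) ν) (h : klDiv σ ν ≠ ∞) :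
    Integrable logWeight σ := by
  have hac := (klDiv_ne_top_iff.mp h).1
  have : σ.HaveLebesgueDecomposition ν :=
    Measure.haveLebesgueDecomposition_of_sigmaFinite σ ν
  refine ⟨measurable_logWeight.aestronglyMeasurable, ?_⟩
  rw [hasFiniteIntegral_iff_ofReal (ae_of_all _ logWeight_nonneg),
    ← lintegral_rnDeriv_mul (ν := ν) hac measurable_logWeight.ennreal_ofReal.aemeasurable]
  have hpt : ∀ᵐ x ∂ν, σ.rnDeriv ν x * ENNReal.ofReal (logWeight x) ≤
      ENNReal.ofReal (klFun (σ.rnDeriv ν x).toReal) + ENNReal.ofReal (1 + ‖x‖) := by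
    filter_upwards [σ.rnDeriv_lt_top ν] with x hx
    rw [← ENNReal.ofReal_toReal hx.ne, ← ENNReal.ofReal_mul ENNReal.toReal_nonneg,
      ENNReal.toReal_ofReal ENNReal.toReal_nonneg,
      ← ENNReal.ofReal_add (klFun_nonneg ENNReal.toReal_nonneg) (by positivity)]
    refine ENNReal.ofReal_le_ofReal ((mul_le_klFun_add ENNReal.toReal_nonneg).trans ?_)
    rw [exp_logWeight]
    linarith
  refine (lintegral_mono_ae hpt).trans_lt ?_
  rw [lintegral_add_right _ (by fun_prop), ← klDiv_eq_lintegral_klFun_of_ac hac]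
  refine ENNReal.add_lt_top.mpr ⟨h.lt_top, ?_⟩
  rw [← ofReal_integral_eq_lintegral_ofReal hν (ae_of_all _ fun x => by
    simp only [Pi.zero_apply]; positivity)]
  exact ENNReal.ofReal_lt_top

lemma toReal_weightedEnergy {σ : Measure (Euc n)} [IsProbabilityMeasure σ]
    (h0 : ∀ x, σ {x} = 0) :
    (weightedEnergy σ).toReal = ∫ p, wKer p.1 p.2 ∂(σ.prod σ) := by
  have hnn : ∀ p : Euc n × Euc n, 0 ≤ wKer p.1 p.2 := fun p => wKer_nonneg p.1 p.2
  rw [weightedEnergy_eq h0, integral_eq_lintegral_of_nonneg_ae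
    (f := fun p : Euc n × Euc n => wKer p.1 p.2) (ae_of_all _ hnn)
    measurable_wKer.aestronglyMeasurable]

lemma integrable_logG_of_weightedEnergy {σ : Measure (Euc n)} [IsProbabilityMeasure σ]
    (h0 : ∀ x, σ {x} = 0) (hσ : Integrable logWeight σ) (h : weightedEnergy σ ≠ ∞) :
    Integrable (fun p : Euc n × Euc n => logG p.1 p.2) (σ.prod σ) := by
  have hw : Integrable (fun p : Euc n × Euc n => wKer p.1 p.2) (σ.prod σ) := by
    have hnn : ∀ p : Euc n × Euc n, 0 ≤ wKer p.1 p.2 := fun p => wKer_nonneg p.1 p.2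
    refine ⟨measurable_wKer.aestronglyMeasurable, ?_⟩
    rw [hasFiniteIntegral_iff_ofReal (ae_of_all _ hnn), ← weightedEnergy_eq h0]
    exact h.lt_top
  refine (hw.sub (integrable_logWeight_add hσ hσ)).congr (ae_of_all _ fun p => ?_)
  simp only [Pi.sub_apply, wKer]
  ring

lemma toReal_logKernel (x z : Euc n) : (logKernel x z).toReal = logG x z := by
  rw [logKernel, logG]
  split_ifs with h
  · simp [h]
  · rw [EReal.toReal_coe, Real.log_inv]

lemma logPotential_eq (μ : Measure (Euc n)) (x : Euc n) :
    logPotential μ x = ∫ z, logG x z ∂μ := by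
  simp only [logPotential, toReal_logKernel]

variable [NeZero n] {V : Euc n → ℝ} {γ C : ℝ} {u : Euc n → ℝ}

/-- A solution of the self-consistent equation is the only probability measure whose free
energy is at most its own. -/
theorem eq_of_freeEnergy_le (hVc : Continuous V) (hV : SuperLog V) (hγ : 0 ≤ γ)
    (hC : 1 ≤ C) (hu : IsDens (referenceMeasure V γ) C u)
    (hfix : ∀ x, u x = IsMeanKernel.boltzDens (referenceMeasure V γ) wKer γ u x)
    (σ : Measure (Euc n)) [IsProbabilityMeasure σ]
    (hσ : freeEnergy V γ σ ≤ freeEnergy V γ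
      ((referenceMeasure V γ).withDensity fun x => ENNReal.ofReal (u x))) :
    σ = (referenceMeasure V γ).withDensity fun x => ENNReal.ofReal (u x) := by
  have hC0 : 0 ≤ C := by linarith
  have hprob := isProbabilityMeasure_referenceMeasure hVc hV hγ
  have hνϑ := integrable_logWeight_referenceMeasure hVc hV hγ
  obtain ⟨A, hA⟩ := exists_referenceMeasure_le hVc hV hγ
  have hνnorm := integrable_norm_referenceMeasure hVc hV hγ
  rw [freeEnergy, freeEnergy] at hσ
  set ν := referenceMeasure V γ with hν
  have hK := isMeanKernel_wKer hA hνϑ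
  set f : Euc n → ℝ := fun x => -(γ * kpot ν wKer u x) with hf
  set Z := ∫ x, Real.exp (f x) ∂ν with hZ
  set μ := ν.withDensity fun x => ENNReal.ofReal (u x) with hμdef
  -- The self-consistent equation says that `μ` is an exponential tilt of the reference measure,
  -- which makes all log-likelihood ratios explicit.
  have hμtilt : μ = ν.tilted f := by
    rw [hμdef, Measure.tilted]
    congr 1
    ext x
    rw [hfix x]
    rfl
  have hμprob : IsProbabilityMeasure μ := hu.isProbabilityMeasure
  have hexp : Integrable (fun x => Real.exp (f x)) ν := hK.integrable_exp_kpot hu hγ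
  have hμϑ : Integrable logWeight μ := integrable_of_le hu.withDensity_le hνϑ
  have hμA := hu.withDensity_le_volume hA
  have hμ0 := measure_singleton_of_le hμA
  have hμG := integrable_logG_prod hμϑ hμϑ hμA
  have hfm : Measurable f := ((hK.measurable_kpot hu).const_mul γ).neg
  have hfb : ∀ (ρ : Measure (Euc n)) [IsProbabilityMeasure ρ], Integrable f ρ := by
    intro ρ _
    refine (integrable_const (γ * ((2 * ∫ z, logWeight z ∂ν + 2 * (A * singConst n + 1)) * C))).mono'
      hfm.aestronglyMeasurable (ae_of_all _ fun x => ?_)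
    rw [hf, norm_neg, Real.norm_of_nonneg (mul_nonneg hγ (hK.kpot_nonneg hu x))]
    exact mul_le_mul_of_nonneg_left (hK.kpot_le hC0 hu x) hγ
  have hμν : μ ≪ ν := withDensity_absolutelyContinuous _ _
  have hllr : llr μ ν =ᵐ[μ] fun x => f x - Real.log Z := by
    have h := log_rnDeriv_tilted_left_self hexp
    rw [← hμtilt] at h
    exact hμν.ae_le h
  have hllri : Integrable (llr μ ν) μ :=
    ((hfb μ).sub (integrable_const _)).congr hllr.symm
  have hklμ : klDiv μ ν ≠ ∞ := klDiv_ne_top hμν hllri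
  have hfE : ∫ x, f x ∂μ = -(γ * kform ν wKer u u) := by
    rw [hμdef, integral_withDensity_ofReal hu.meas hu.nonneg, kform, ← integral_const_mul,
      ← integral_neg]
    exact integral_congr_ae (ae_of_all _ fun x => by simp only [hf]; ring)
  have hklμr : (klDiv μ ν).toReal = -(γ * kform ν wKer u u) - Real.log Z := by
    rw [toReal_klDiv_of_measure_eq hμν (by simp), integral_congr_ae hllr,
      integral_sub (hfb μ) (integrable_const _), hfE]
    simp
  have hWμ : weightedEnergy μ = ENNReal.ofReal (kform ν wKer u u) := by
    rw [weightedEnergy_eq hμ0, kform_eq_integral_wKer hA hνϑ hu hu,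
      ofReal_integral_eq_lintegral_ofReal (integrable_wKer_prod hμϑ hμϑ hμG)
        (ae_of_all _ fun p : Euc n × Euc n => wKer_nonneg p.1 p.2)]
  have hE0 := hK.kform_nonneg hu hu
  have hFμ : ENNReal.ofReal (γ / 2) * weightedEnergy μ + klDiv μ ν ≠ ∞ := by
    rw [hWμ]
    exact ENNReal.add_ne_top.mpr ⟨ENNReal.mul_ne_top (by simp) (by simp), hklμ⟩
  have hFσ := ne_top_of_le_ne_top hFμ hσ
  have hklσ : klDiv σ ν ≠ ∞ := (ENNReal.add_ne_top.mp hFσ).2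
  obtain ⟨hσν, hσllr⟩ := klDiv_ne_top_iff.mp hklσ
  have hσϑ := integrable_logWeight_of_klDiv hνnorm hklσ
  have hν0 := measure_singleton_of_le hA
  have hσ0 : ∀ x, σ {x} = 0 := fun x => hσν (hν0 x)
  have hle : γ / 2 * (weightedEnergy σ).toReal + (klDiv σ ν).toReal ≤
      γ / 2 * kform ν wKer u u + (-(γ * kform ν wKer u u) - Real.log Z) := by
    have h := (ENNReal.toReal_le_toReal hFσ hFμ).mpr hσ
    rw [ENNReal.toReal_add (ENNReal.add_ne_top.mp hFσ).1 hklσ,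
      ENNReal.toReal_add (ENNReal.add_ne_top.mp hFμ).1 hklμ, ENNReal.toReal_mul,
      ENNReal.toReal_mul, ENNReal.toReal_ofReal (by positivity), hWμ,
      ENNReal.toReal_ofReal hE0, hklμr] at h
    exact h
  -- Positivity of the energy form for `σ` and `μ`. The factor `γ` is kept because for `γ = 0` a
  -- finite free energy does not make the energy of `σ` finite.
  have hcross : γ * (2 * ∫ x, kpot ν wKer u x ∂σ) ≤
      γ * ((weightedEnergy σ).toReal + kform ν wKer u u) := by
    rcases hγ.eq_or_lt with h0 | hγ0
    · rw [← h0]; simp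
    refine mul_le_mul_of_nonneg_left ?_ hγ
    have hWσ : weightedEnergy σ ≠ ∞ := by
      intro htop
      refine (ENNReal.add_ne_top.mp hFσ).1 ?_
      rw [htop, ENNReal.mul_top]
      simpa using hγ0
    have hσG := integrable_logG_of_weightedEnergy hσ0 hσϑ hWσ
    have h := two_mul_integral_wKer_le hσϑ hμϑ hμA hσ0 hσG
    rw [toReal_weightedEnergy hσ0, kform_eq_integral_wKer hA hνϑ hu hu]
    refine le_trans (le_of_eq ?_) h
    rw [integral_prod _ (integrable_wKer_prod hσϑ hμϑ (integrable_logG_prod hσϑ hμϑ hμA))]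
    congr 1
    refine integral_congr_ae (ae_of_all _ fun x => ?_)
    simp only
    rw [hμdef, integral_withDensity_ofReal hu.meas hu.nonneg, kpot]
    simp only [mul_comm]
  have hσμ : σ ≪ μ := by
    rw [hμtilt]
    exact hσν.trans (absolutelyContinuous_tilted hexp)
  have hσllr' : Integrable (llr σ μ) σ := by
    rw [hμtilt]
    exact integrable_llr_tilted_right hσν (hfb σ) hσllr hexp
  have hfσ : ∫ x, f x ∂σ = -(γ * ∫ x, kpot ν wKer u x ∂σ) := by
    simp only [hf]
    rw [integral_neg, integral_const_mul]
  -- The entropy of `σ` relative to the tilt is `H(σ|ν) + γ ∫ kpot dσ + log Z`. By `hcross` this is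
  -- at most the free energy of `σ` minus that of `μ`.
  have hkl : (klDiv σ μ).toReal ≤ 0 := by
    have h1 : (klDiv σ μ).toReal = (klDiv σ ν).toReal - ∫ x, f x ∂σ + Real.log Z := by
      rw [toReal_klDiv_of_measure_eq hσμ (by simp), toReal_klDiv_of_measure_eq hσν (by simp)]
      have h := integral_llr_tilted_right hσν (hfb σ) hexp hσllr
      rw [← hμtilt] at h
      exact h
    rw [h1, hfσ]
    linarith
  have hzero : klDiv σ μ = 0 := by
    have h1 := le_antisymm hkl ENNReal.toReal_nonneg
    rcases (ENNReal.toReal_eq_zero_iff _).mp h1 with h2 | h2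
    · exact h2
    · exact absurd h2 (klDiv_ne_top hσμ hσllr')
  exact klDiv_eq_zero_iff.mp hzero

/-- Properties of a probability measure solving the self-consistent equation, with `L` the
normalising constant. -/
structure IsEquilibrium (V : Euc n → ℝ) (γ L : ℝ) (μ : Measure (Euc n)) : Prop where
  prob : IsProbabilityMeasure μ
  exists_le : ∃ A : ℝ≥0, μ ≤ (A : ℝ≥0∞) • volume
  integrable_logWeight : Integrable logWeight μ
  measurable_pot : Measurable fun x => ∫ z, logG x z ∂μ
  pos : 0 < L
  integrable : Integrable fun x => Real.exp (-(γ * ∫ z, logG x z ∂μ) - V x)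
  eq : ∫ x, Real.exp (-(γ * ∫ z, logG x z ∂μ) - V x) = L
  withDensity : μ = volume.withDensity fun x =>
    ENNReal.ofReal (Real.exp (-(γ * ∫ z, logG x z ∂μ) - V x) / L)

/-- The equilibrium measure solves the self-consistent equation. -/
theorem isEquilibrium_equilibriumMeasure (hVc : Continuous V) (hV : SuperLog V) (hγ : 0 ≤ γ) :
    IsEquilibrium V γ (eqConst V γ) (equilibriumMeasure V γ : Measure (Euc n)) := by
  have hprob := isProbabilityMeasure_referenceMeasure hVc hV hγ
  have hνϑ := integrable_logWeight_referenceMeasure hVc hV hγ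
  obtain ⟨A, hA⟩ := exists_referenceMeasure_le hVc hV hγ
  have hK := isMeanKernel_wKer hA hνϑ
  obtain ⟨C, u, hC, hu, hfix⟩ := hK.exists_fixedPoint hγ fun C u v hu hv =>
    kform_wKer_pos hA hνϑ hu hv
  have hμprob : IsProbabilityMeasure
      ((referenceMeasure V γ).withDensity fun x => ENNReal.ofReal (u x)) :=
    hu.isProbabilityMeasure
  have hex : ∃ μ : ProbabilityMeasure (Euc n), ∀ μ' : ProbabilityMeasure (Euc n),
      freeEnergy V γ (μ : Measure (Euc n)) ≤ freeEnergy V γ (μ' : Measure (Euc n)) := by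
    -- The fixed point is a global minimizer: a measure with smaller free energy would have to equal
    -- it.
    refine ⟨⟨_, hμprob⟩, fun μ' => ?_⟩
    by_contra h
    have h1 := eq_of_freeEnergy_le hVc hV hγ hC hu hfix (μ' : Measure (Euc n)) (not_le.mp h).le
    rw [h1] at h
    exact h le_rfl
  -- `Classical.epsilon` selects some minimizer; the uniqueness statement identifies it with the
  -- fixed point.
  have hspec := Classical.epsilon_spec hex ⟨_, hμprob⟩
  have heq : (equilibriumMeasure V γ : Measure (Euc n)) =
      (referenceMeasure V γ).withDensity fun x => ENNReal.ofReal (u x) :=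
    eq_of_freeEnergy_le hVc hV hγ hC hu hfix _ hspec
  have hL : eqConst V γ = ∫ x, Real.exp (-(γ * ∫ z, logG x z
      ∂((referenceMeasure V γ).withDensity fun x => ENNReal.ofReal (u x))) - V x) := by
    simp only [eqConst, logPotential_eq, heq]
  rw [heq, hL]
  set ν := referenceMeasure V γ with hν
  set μ := ν.withDensity fun x => ENNReal.ofReal (u x) with hμdef
  have hμϑ : Integrable logWeight μ := integrable_of_le hu.withDensity_le hνϑ
  have hμA : μ ≤ ((C.toNNReal * A : ℝ≥0) : ℝ≥0∞) • volume := hu.withDensity_le_volume hA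
  set m := ∫ z, logWeight z ∂μ
  -- The weighted potential is the logarithmic one plus `ϑ` plus a constant. In the density, `γ ϑ`
  -- cancels the tilt of the reference measure and the constant goes into the normalisation `c`.
  have hpot : ∀ x, kpot ν wKer u x = ∫ z, logG x z ∂μ + logWeight x + m := by
    intro x
    have h1 : kpot ν wKer u x = ∫ z, wKer x z ∂μ := by
      rw [hμdef, integral_withDensity_ofReal hu.meas hu.nonneg, kpot]
      simp only [mul_comm]
    rw [h1]
    simp only [wKer]
    have e1 := integral_add ((integrable_logG hμA hμϑ x).add (integrable_const (logWeight x))) hμϑ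
    have e2 := integral_add (integrable_logG hμA hμϑ x) (integrable_const (logWeight x))
    simp only [Pi.add_apply] at e1 e2
    rw [e1, e2]
    simp [m]
  set Z := ∫ y, Real.exp (-(γ * kpot ν wKer u y)) ∂ν with hZ
  have hZ0 : 0 < Z := hK.integral_exp_kpot_pos hC hu hγ
  have hR := refConst_pos hVc hV hγ
  set c := refConst V γ * Z * Real.exp (γ * m) with hc
  have hc0 : 0 < c := by positivity
  have hdens : ∀ x, refDens V γ x * u x =
      Real.exp (-(γ * ∫ z, logG x z ∂μ) - V x) / c := by
    intro x
    rw [hfix x, IsMeanKernel.boltzDens, ← hZ, hpot x, refDens, div_mul_div_comm, ← Real.exp_add,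
      hc, div_eq_div_iff (by positivity) (by positivity)]
    have e : Real.exp (-(γ * ∫ z, logG x z ∂μ) - V x) =
        Real.exp (-(V x - γ * logWeight x) + -(γ * (∫ z, logG x z ∂μ + logWeight x + m))) *
          Real.exp (γ * m) := by
      rw [← Real.exp_add]; congr 1; ring
    rw [e]
    ring
  have hdm : Measurable fun x => refDens V γ x * u x := (measurable_refDens hVc).mul hu.meas
  have hμvol : μ = volume.withDensity fun x => ENNReal.ofReal
      (Real.exp (-(γ * ∫ z, logG x z ∂μ) - V x) / c) := by
    have h1 : μ = volume.withDensity fun x => ENNReal.ofReal (refDens V γ x * u x) := by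
      conv_lhs => rw [hμdef, hν, referenceMeasure_eq hVc hV hγ]
      rw [← withDensity_mul _ (measurable_refDens hVc).ennreal_ofReal hu.meas.ennreal_ofReal]
      congr 1
      ext x
      rw [Pi.mul_apply, ENNReal.ofReal_mul (refDens_nonneg hVc hV hγ x)]
    simp_rw [hdens] at h1
    exact h1
  have hi1 : Integrable (fun x => refDens V γ x * u x) := by
    refine ((integrable_refDens hVc hV hγ).mul_const C).mono' hdm.aestronglyMeasurable
      (ae_of_all _ fun x => ?_)
    rw [norm_mul, Real.norm_of_nonneg (refDens_nonneg hVc hV hγ x)]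
    exact mul_le_mul_of_nonneg_left (hu.norm_le x) (refDens_nonneg hVc hV hγ x)
  have hint1 : ∫ x, refDens V γ x * u x = 1 := by
    have h := integral_withDensity_ofReal (ν := volume) (measurable_refDens hVc)
      (refDens_nonneg hVc hV hγ) u
    rw [← referenceMeasure_eq hVc hV hγ] at h
    rw [← h]
    exact hu.int
  have hpm : Measurable fun x => ∫ z, logG x z ∂μ := by
    have h : (fun x => ∫ z, logG x z ∂μ) = fun x => kpot ν wKer u x - logWeight x - m := by
      ext x; rw [hpot]; ring
    rw [h]
    exact ((hK.measurable_kpot hu).sub measurable_logWeight).sub_const m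
  have hi2 : Integrable fun x => Real.exp (-(γ * ∫ z, logG x z ∂μ) - V x) := by
    refine (hi1.mul_const c).congr (ae_of_all _ fun x => ?_)
    simp only [hdens]
    exact div_mul_cancel₀ _ hc0.ne'
  have hLc : ∫ x, Real.exp (-(γ * ∫ z, logG x z ∂μ) - V x) = c := by
    simp_rw [hdens] at hint1
    rw [integral_div, div_eq_one_iff_eq hc0.ne'] at hint1
    exact hint1
  rw [hLc]
  exact ⟨hμprob, ⟨_, hμA⟩, hμϑ, hpm, hc0, hi2, hLc, hμvol⟩

end Equilibrium

/-! ### The Boltzmann weight -/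

section Boltzmann

variable {V : Euc n → ℝ} {b : ℝ} {M : ℕ}

/-- The interaction factor `∏_j |y - x_j|^b` of a point `y` with a configuration `x`. -/
def inter (b : ℝ) (y : Euc n) (x : Fin M → Euc n) : ℝ := ∏ j, ‖y - x j‖ ^ b

/-- The Boltzmann weight as a real function. -/
def weight (V : Euc n → ℝ) (b : ℝ) (x : Fin M → Euc n) : ℝ :=
  (∏ i, ∏ j ∈ Finset.Ioi i, ‖x i - x j‖ ^ b) * ∏ j, Real.exp (-V (x j))

lemma inter_nonneg (b : ℝ) (y : Euc n) (x : Fin M → Euc n) : 0 ≤ inter b y x :=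
  Finset.prod_nonneg fun _ _ => Real.rpow_nonneg (norm_nonneg _) _

@[fun_prop]
lemma measurable_inter (b : ℝ) :
    Measurable fun p : Euc n × (Fin M → Euc n) => inter b p.1 p.2 := by
  unfold inter
  fun_prop

lemma measurable_weight (hVc : Continuous V) :
    Measurable fun x : Fin M → Euc n => weight V b x := by
  have := hVc.measurable
  unfold weight
  fun_prop

lemma EReal.coe_finset_sum' {ι : Type*} (s : Finset ι) (f : ι → ℝ) :
    ((∑ i ∈ s, f i : ℝ) : EReal) = ∑ i ∈ s, (f i : EReal) := by
  classical
  induction s using Finset.induction_on with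
  | empty => simp
  | insert i s hi ih => rw [Finset.sum_insert hi, Finset.sum_insert hi, EReal.coe_add, ih]

lemma EReal.sum_ne_bot {ι : Type*} (s : Finset ι) (f : ι → EReal) (h : ∀ i ∈ s, f i ≠ ⊥) :
    ∑ i ∈ s, f i ≠ ⊥ := by
  classical
  induction s using Finset.induction_on with
  | empty => simp
  | insert i s hi ih =>
    rw [Finset.sum_insert hi]
    exact EReal.add_ne_bot_iff.mpr ⟨h i (Finset.mem_insert_self i s),
      ih fun j hj => h j (Finset.mem_insert_of_mem hj)⟩

lemma EReal.sum_eq_top {ι : Type*} (s : Finset ι) (f : ι → EReal) (h : ∀ i ∈ s, f i ≠ ⊥)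
    {i : ι} (hi : i ∈ s) (hfi : f i = ⊤) : ∑ i ∈ s, f i = ⊤ := by
  classical
  rw [← Finset.add_sum_erase s f hi, hfi]
  exact EReal.top_add_of_ne_bot
    (EReal.sum_ne_bot _ _ fun j hj => h j (Finset.mem_of_mem_erase hj))

lemma logKernel_ne_bot (x z : Euc n) : logKernel x z ≠ ⊥ := by
  rw [logKernel]
  split_ifs
  · simp
  · exact EReal.coe_ne_bot _

/-- At coincident points the energy is `⊤`, and `e^{-⊤} = 0` agrees with `0 ^ b = 0` because `b >
0`. -/
lemma boltzmann_eq (hb : 0 < b) (x : Fin M → Euc n) :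
    boltzmann V b M x = ENNReal.ofReal (weight V b x) := by
  by_cases h : ∃ i, ∃ j ∈ Finset.Ioi i, x i = x j
  · obtain ⟨i, j, hj, hij⟩ := h
    have h1 : ∑ j ∈ Finset.Ioi i, logKernel (x i) (x j) = ⊤ :=
      EReal.sum_eq_top _ _ (fun _ _ => logKernel_ne_bot _ _) hj (by rw [logKernel, if_pos hij])
    have h2 : ∑ i : Fin M, ∑ j ∈ Finset.Ioi i, logKernel (x i) (x j) = ⊤ :=
      EReal.sum_eq_top _ _ (fun i _ => EReal.sum_ne_bot _ _ fun _ _ => logKernel_ne_bot _ _)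
        (Finset.mem_univ i) h1
    have h3 : weight V b x = 0 := by
      rw [weight, Finset.prod_eq_zero (Finset.mem_univ i), zero_mul]
      refine Finset.prod_eq_zero hj ?_
      rw [hij, sub_self, norm_zero, Real.zero_rpow hb.ne']
    rw [boltzmann, energy, h2, EReal.coe_mul_top_of_pos hb, EReal.top_add_of_ne_bot
      (EReal.sum_ne_bot _ _ fun _ _ => EReal.coe_ne_bot _), EReal.neg_top, EReal.exp_bot, h3,
      ENNReal.ofReal_zero]
  · push Not at h
    have h1 : energy V b M x = ((b * ∑ i : Fin M, ∑ j ∈ Finset.Ioi i, Real.log ‖x i - x j‖⁻¹ +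
        ∑ j, V (x j) : ℝ) : EReal) := by
      rw [energy, EReal.coe_add, EReal.coe_mul, EReal.coe_finset_sum', EReal.coe_finset_sum']
      congr 2
      refine Finset.sum_congr rfl fun i _ => ?_
      rw [EReal.coe_finset_sum']
      refine Finset.sum_congr rfl fun j hj => ?_
      rw [logKernel, if_neg (h i j hj)]
    rw [boltzmann, h1, ← EReal.coe_neg, EReal.exp_coe, weight]
    congr 1
    have e : -(b * ∑ i : Fin M, ∑ j ∈ Finset.Ioi i, Real.log ‖x i - x j‖⁻¹ + ∑ j, V (x j)) =
        (∑ i : Fin M, ∑ j ∈ Finset.Ioi i, b * Real.log ‖x i - x j‖) + ∑ j, -V (x j) := by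
      simp only [Real.log_inv, Finset.sum_neg_distrib, mul_neg, neg_add, neg_neg, Finset.mul_sum]
    rw [e, Real.exp_add, Real.exp_sum, Real.exp_sum]
    congr 1
    refine Finset.prod_congr rfl fun i _ => ?_
    rw [Real.exp_sum]
    refine Finset.prod_congr rfl fun j hj => ?_
    rw [Real.rpow_def_of_pos (norm_pos_iff.mpr (sub_ne_zero.mpr (h i j hj))),
      mul_comm]

/-- The symmetric form of the pair interaction. -/
lemma prod_Ioi_eq (x : Fin M → Euc n) :
    ∏ i, ∏ j ∈ Finset.Ioi i, ‖x i - x j‖ ^ b =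
      ∏ i, ∏ j, if j = i then 1 else ‖x j - x i‖ ^ (b / 2) := by
  have h := Finset.prod_prod_Ioi_mul_eq_prod_prod_off_diag
    (fun j i : Fin M => ‖x j - x i‖ ^ (b / 2))
  have h1 : ∀ i, ∏ j, (if j = i then 1 else ‖x j - x i‖ ^ (b / 2)) =
      ∏ j ∈ {i}ᶜ, ‖x j - x i‖ ^ (b / 2) := by
    intro i
    rw [← Finset.mul_prod_erase _ _ (Finset.mem_univ i), if_pos rfl, one_mul]
    have : Finset.univ.erase i = {i}ᶜ := by ext; simp
    rw [this]
    refine Finset.prod_congr rfl fun j hj => ?_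
    rw [if_neg (by simpa using hj)]
  simp_rw [h1]
  rw [← h]
  refine Finset.prod_congr rfl fun i _ => Finset.prod_congr rfl fun j hj => ?_
  rw [norm_sub_rev (x j) (x i)]
  rcases (norm_nonneg (x i - x j)).eq_or_lt with h0 | h0
  · rw [← h0]
    rcases eq_or_ne b 0 with rfl | hb
    · simp
    · rw [Real.zero_rpow hb, Real.zero_rpow (by positivity), mul_zero]
  · rw [← Real.rpow_add h0, add_halves]

/-- The product over `i < j` is first symmetrised, with exponent `b / 2` for each ordered pair. All
indices then play the same role, and the new particle may be inserted at any position. -/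
lemma weight_insertNth (i : Fin (M + 1)) (y : Euc n) (x : Fin M → Euc n) :
    weight V b (i.insertNth y x : Fin (M + 1) → Euc n) =
      Real.exp (-V y) * inter b y x * weight V b x := by
  rw [weight, weight, prod_Ioi_eq, prod_Ioi_eq, Fin.prod_univ_succAbove _ i,
    Fin.prod_univ_succAbove (fun j => Real.exp _) i, Fin.prod_univ_succAbove _ i]
  simp only [Fin.insertNth_apply_same, Fin.insertNth_apply_succAbove, if_true, one_mul]
  have h1 : ∀ k : Fin M, ∏ j, (if j = i.succAbove k then (1 : ℝ) else
      ‖(i.insertNth y x : Fin (M + 1) → Euc n) j - x k‖ ^ (b / 2)) =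
      ‖y - x k‖ ^ (b / 2) * ∏ j, (if j = k then 1 else ‖x j - x k‖ ^ (b / 2)) := by
    intro k
    rw [Fin.prod_univ_succAbove _ i]
    simp only [Fin.insertNth_apply_same, Fin.insertNth_apply_succAbove,
      (Fin.succAbove_right_injective).eq_iff]
    rw [if_neg (Fin.succAbove_ne i k).symm]
  simp_rw [h1]
  rw [Finset.prod_mul_distrib]
  have h2 : (∏ k : Fin M, if i.succAbove k = i then (1 : ℝ) else ‖x k - y‖ ^ (b / 2)) *
      ∏ k : Fin M, ‖y - x k‖ ^ (b / 2) = inter b y x := by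
    rw [← Finset.prod_mul_distrib, inter]
    refine Finset.prod_congr rfl fun k _ => ?_
    rw [if_neg (Fin.succAbove_ne i k), norm_sub_rev]
    rcases (norm_nonneg (y - x k)).eq_or_lt with h0 | h0
    · rw [← h0]
      rcases eq_or_ne b 0 with rfl | hb
      · simp
      · rw [Real.zero_rpow hb, Real.zero_rpow (by positivity), mul_zero]
    · rw [← Real.rpow_add h0, add_halves]
  rw [← h2]
  ring

lemma lintegral_pi_insertNth {μ : Measure (Euc n)} [SigmaFinite μ] (i : Fin (M + 1))
    {F : (Fin (M + 1) → Euc n) → ℝ≥0∞} (hF : Measurable F) :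
    ∫⁻ x, F x ∂(Measure.pi fun _ => μ) =
      ∫⁻ x : Fin M → Euc n, ∫⁻ y, F (i.insertNth y x) ∂μ ∂(Measure.pi fun _ => μ) := by
  have h := (measurePreserving_piFinSuccAbove (fun _ : Fin (M + 1) => μ) i).symm
  rw [← h.lintegral_comp hF, lintegral_prod_symm']
  · rfl
  · exact hF.comp (MeasurableEquiv.measurable _)

@[fun_prop]
lemma measurable_insertNth (i : Fin (M + 1)) :
    Measurable fun p : Euc n × (Fin M → Euc n) =>
      (i.insertNth p.1 p.2 : Fin (M + 1) → Euc n) :=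
  (MeasurableEquiv.piFinSuccAbove (fun _ : Fin (M + 1) => Euc n) i).symm.measurable

end Boltzmann

/-! ### The dominating measure -/

section Dominating

/-- Jensen's inequality, from the tangent line at the mean. When `exp ∘ u` is not integrable the
right-hand side is infinite. -/
lemma ofReal_exp_integral_le {X : Type*} [MeasurableSpace X] {m : Measure X}
    [IsProbabilityMeasure m] {u : X → ℝ} (hu : Integrable u m) :
    ENNReal.ofReal (Real.exp (∫ x, u x ∂m)) ≤ ∫⁻ x, ENNReal.ofReal (Real.exp (u x)) ∂m := by
  set a := ∫ x, u x ∂m with ha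
  by_cases hi : Integrable (fun x => Real.exp (u x)) m
  · rw [← ofReal_integral_eq_lintegral_ofReal hi (ae_of_all _ fun _ => (Real.exp_pos _).le)]
    refine ENNReal.ofReal_le_ofReal ?_
    have hpt : ∀ x, Real.exp a * (1 + (u x - a)) ≤ Real.exp (u x) := by
      intro x
      have h := Real.add_one_le_exp (u x - a)
      have h2 : Real.exp (u x) = Real.exp a * Real.exp (u x - a) := by
        rw [← Real.exp_add]; congr 1; ring
      rw [h2]
      exact mul_le_mul_of_nonneg_left (by linarith) (Real.exp_pos _).le
    have h3 : Integrable (fun x => u x - a) m := hu.sub (integrable_const _)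
    have h4 : Integrable (fun x => 1 + (u x - a)) m := (integrable_const _).add h3
    have h5 := integral_mono (h4.const_mul (Real.exp a)) hi hpt
    rw [integral_const_mul, integral_add (integrable_const _) h3,
      integral_sub hu (integrable_const _), ← ha] at h5
    simpa using h5
  · have : ∫⁻ x, ENNReal.ofReal (Real.exp (u x)) ∂m = ∞ := by
      by_contra hne
      refine hi ⟨(hu.aestronglyMeasurable.aemeasurable.exp).aestronglyMeasurable, ?_⟩
      rw [hasFiniteIntegral_iff_ofReal (ae_of_all _ fun _ => (Real.exp_pos _).le)]
      exact lt_top_iff_ne_top.mpr hne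
    rw [this]
    exact le_top

variable {V : Euc n → ℝ}

/-- For `|y| < 1` one has `1 + |x| ≤ 2 + |y - x|`, so the difference of the two logarithms is at
most `log(1 + 2/|y - x|)`. -/
lemma logWeight_le_of_mem_ball {x y : Euc n} (hy : ‖y‖ < 1) (hxy : y ≠ x) :
    logWeight x - 4 * sing (y - x) ≤ Real.log ‖y - x‖ := by
  have h0 : 0 < ‖y - x‖ := norm_pos_iff.mpr (sub_ne_zero.mpr hxy)
  have h1 := log_one_add_inv_le (y - x) 2 (by norm_num)
  have h2 : 1 + 2 * ‖y - x‖⁻¹ = (‖y - x‖ + 2) / ‖y - x‖ := by field_simp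
  rw [h2, Real.log_div (by positivity) h0.ne'] at h1
  have h3 : logWeight x ≤ Real.log (‖y - x‖ + 2) := by
    refine Real.log_le_log (by positivity) ?_
    have := norm_sub_norm_le x y
    rw [norm_sub_rev x y] at this
    linarith
  have h4 : (2 : ℝ) ^ (1 / 2 : ℝ) ≤ 2 := by
    conv_rhs => rw [← Real.rpow_one 2]
    exact Real.rpow_le_rpow_of_exponent_le (by norm_num) (by norm_num)
  have h5 : 2 * (2 : ℝ) ^ (1 / 2 : ℝ) * sing (y - x) ≤ 4 * sing (y - x) :=
    mul_le_mul_of_nonneg_right (by linarith) (sing_nonneg _)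
  linarith

/-- A lower bound for the integrated interaction: Jensen's inequality on the unit ball. -/
lemma exists_le_lintegral_inter [NeZero n] (hVc : Continuous V) (Γ : ℝ) :
    ∃ c : ℝ, 0 < c ∧ ∀ (M : ℕ) (b : ℝ), 0 ≤ b → b * M ≤ Γ → ∀ x : Fin M → Euc n,
      ENNReal.ofReal (c * ∏ j, (1 + ‖x j‖) ^ b) ≤
        ∫⁻ y, ENNReal.ofReal (Real.exp (-V y) * inter b y x) := by
  set B := Metric.ball (0 : Euc n) 1 with hB
  have hBpos : volume B ≠ 0 := (Metric.measure_ball_pos volume 0 one_pos).ne'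
  have hBfin : volume B ≠ ∞ := measure_ball_lt_top.ne
  set A : ℝ≥0 := (volume B)⁻¹.toNNReal with hA
  have hAc : (A : ℝ≥0∞) = (volume B)⁻¹ := ENNReal.coe_toNNReal (ENNReal.inv_ne_top.mpr hBpos)
  -- Jensen is applied under the uniform law on the unit ball, where the mean of `log |y - x|` is at
  -- least `ϑ(x) - C₁` for every `x`.
  set m : Measure (Euc n) := (volume B)⁻¹ • volume.restrict B with hm
  have hmp : IsProbabilityMeasure m := ⟨by
    rw [hm, Measure.smul_apply, Measure.restrict_apply_univ, smul_eq_mul,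
      ENNReal.inv_mul_cancel hBpos hBfin]⟩
  have hmA : m ≤ (A : ℝ≥0∞) • volume := by
    rw [hm, hAc]
    intro s
    simp only [Measure.smul_apply, smul_eq_mul]
    gcongr
    exact Measure.restrict_le_self
  have hmB : ∀ᵐ y ∂m, y ∈ B := by
    exact Measure.ae_smul_measure (ae_restrict_mem measurableSet_ball) _
  have hmϑ : Integrable logWeight m := by
    refine (integrable_const (1 : ℝ)).mono' measurable_logWeight.aestronglyMeasurable ?_
    filter_upwards [hmB] with y hy
    rw [Real.norm_of_nonneg (logWeight_nonneg y), logWeight]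
    have h1 : ‖y‖ < 1 := by simpa [hB] using hy
    have h2 := Real.log_le_sub_one_of_pos (show 0 < 1 + ‖y‖ by positivity)
    linarith
  set C₁ : ℝ := 4 * (A * singConst n + 1) with hC₁
  have hlog : ∀ x : Euc n, logWeight x - C₁ ≤ ∫ y, Real.log ‖y - x‖ ∂m := by
    intro x
    have hi : Integrable (fun y => Real.log ‖y - x‖) m := by
      have := integrable_log_norm_sub hmA hmϑ x
      refine this.congr (ae_of_all _ fun y => ?_)
      simp only
      rw [norm_sub_rev]
    have hs : Integrable (fun y => sing (y - x)) m := by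
      refine (integrable_sing hmA x).congr (ae_of_all _ fun y => ?_)
      simp only [sing]
      rw [norm_sub_rev]
    have hsle : ∫ y, sing (y - x) ∂m ≤ A * singConst n + 1 := by
      refine le_trans (le_of_eq ?_) (integral_sing_le hmA x)
      refine integral_congr_ae (ae_of_all _ fun y => ?_)
      simp only [sing]
      rw [norm_sub_rev]
    have hne : ∀ᵐ y ∂m, y ≠ x := by
      rw [ae_iff]
      simpa using measure_singleton_of_le hmA x
    have h := integral_mono_ae (((integrable_const (logWeight x)).sub (hs.const_mul 4))) hi (by
      filter_upwards [hmB, hne] with y hy hyx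
      exact logWeight_le_of_mem_ball (by simpa [hB] using hy) hyx)
    refine le_trans ?_ h
    simp only [Pi.sub_apply]
    rw [integral_sub (integrable_const _) (hs.const_mul 4), integral_const_mul]
    simp only [integral_const, probReal_univ, one_smul]
    linarith
  obtain ⟨y₀, -, hy₀⟩ := (isCompact_closedBall (0 : Euc n) 1).exists_isMaxOn
    ⟨0, by simp⟩ hVc.continuousOn
  set q₀ := Real.exp (-V y₀)
  have hq₀ : ∀ y ∈ B, q₀ ≤ Real.exp (-V y) := by
    intro y hy
    have := hy₀ (Metric.ball_subset_closedBall hy)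
    simp only [Set.mem_ofPred_eq] at this
    exact Real.exp_le_exp.mpr (by linarith)
  set v := (volume B).toReal with hv
  have hv0 : 0 < v := ENNReal.toReal_pos hBpos hBfin
  have hC₁0 : 0 ≤ C₁ := by positivity
  -- A lower bound for `e^{-V}` on the ball, the volume of the ball, and the total loss `b M C₁ ≤ Γ
  -- C₁` over the `M` particles.
  refine ⟨q₀ * v * Real.exp (-(Γ * C₁)), by positivity, fun M b hb hbM x => ?_⟩
  have hint : ∀ j, Integrable (fun y => Real.log ‖y - x j‖) m := fun j => by
    have := integrable_log_norm_sub hmA hmϑ (x j)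
    refine this.congr (ae_of_all _ fun y => ?_)
    simp only
    rw [norm_sub_rev]
  have hui : Integrable (fun y => ∑ j, b * Real.log ‖y - x j‖) m :=
    integrable_finsetSum _ fun j _ => (hint j).const_mul b
  have hJ := ofReal_exp_integral_le hui
  have hexp : ∀ᵐ y ∂m, Real.exp (∑ j, b * Real.log ‖y - x j‖) = inter b y x := by
    have hne : ∀ᵐ y ∂m, ∀ j, y ≠ x j := by
      rw [ae_all_iff]
      intro j
      rw [ae_iff]
      simpa using measure_singleton_of_le hmA (x j)
    filter_upwards [hne] with y hy
    rw [Real.exp_sum, inter]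
    refine Finset.prod_congr rfl fun j _ => ?_
    rw [Real.rpow_def_of_pos (norm_pos_iff.mpr (sub_ne_zero.mpr (hy j))), mul_comm]
  have hlow : Real.exp (-(Γ * C₁)) * ∏ j, (1 + ‖x j‖) ^ b ≤
      Real.exp (∫ y, ∑ j, b * Real.log ‖y - x j‖ ∂m) := by
    rw [integral_finsetSum _ fun j _ => (hint j).const_mul b]
    simp_rw [integral_const_mul, ← exp_mul_logWeight]
    rw [← Real.exp_sum, ← Real.exp_add, Real.exp_le_exp]
    have h1 : ∑ j, b * (logWeight (x j) - C₁) ≤ ∑ j, b * ∫ y, Real.log ‖y - x j‖ ∂m :=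
      Finset.sum_le_sum fun j _ => mul_le_mul_of_nonneg_left (hlog (x j)) hb
    have h2 : ∑ j, b * (logWeight (x j) - C₁) = ∑ j, b * logWeight (x j) - b * M * C₁ := by
      simp_rw [mul_sub]
      rw [Finset.sum_sub_distrib]
      simp
      ring
    have h3 : b * M * C₁ ≤ Γ * C₁ := mul_le_mul_of_nonneg_right hbM hC₁0
    linarith
  calc ENNReal.ofReal (q₀ * v * Real.exp (-(Γ * C₁)) * ∏ j, (1 + ‖x j‖) ^ b)
      ≤ ENNReal.ofReal (q₀ * v) * ∫⁻ y, ENNReal.ofReal (inter b y x) ∂m := by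
        rw [mul_assoc, ENNReal.ofReal_mul (by positivity)]
        gcongr
        refine (ENNReal.ofReal_le_ofReal hlow).trans (hJ.trans (le_of_eq ?_))
        refine lintegral_congr_ae ?_
        filter_upwards [hexp] with y hy
        rw [hy]
    _ = ∫⁻ y in B, ENNReal.ofReal (q₀ * inter b y x) := by
        have h1 : ∀ y, ENNReal.ofReal (q₀ * inter b y x) =
            ENNReal.ofReal q₀ * ENNReal.ofReal (inter b y x) := fun y =>
          ENNReal.ofReal_mul (Real.exp_pos _).le
        simp_rw [h1]
        rw [lintegral_const_mul' _ _ ENNReal.ofReal_ne_top, hm, lintegral_smul_measure,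
          ENNReal.ofReal_mul (Real.exp_pos _).le, hv, ENNReal.ofReal_toReal hBfin, smul_eq_mul,
          mul_assoc, ← mul_assoc (volume B), ENNReal.mul_inv_cancel hBpos hBfin, one_mul]
    _ ≤ ∫⁻ y in B, ENNReal.ofReal (Real.exp (-V y) * inter b y x) := by
        refine setLIntegral_mono' measurableSet_ball fun y hy => ?_
        exact ENNReal.ofReal_le_ofReal
          (mul_le_mul_of_nonneg_right (hq₀ y hy) (inter_nonneg _ _ _))
    _ ≤ _ := setLIntegral_le_lintegral _ _

end Dominating

/-! ### One-particle domination, partition functions and moments of the Gibbs measures. -/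

section Gibbs

variable {V : Euc n → ℝ} {b Γ : ℝ} {M : ℕ}

/-- A measure that dominates the law of one particle given the others, for inverse temperatures
`b` and numbers `M` of other particles such that `b M ≤ Γ`. -/
structure IsDominating (V : Euc n → ℝ) (Γ : ℝ) (lam : Measure (Euc n)) : Prop where
  moment : ∀ κ : ℝ, 0 ≤ κ → Integrable (fun x => (1 + ‖x‖) ^ κ) lam
  exists_le : ∃ A : ℝ≥0, (lam.withDensity fun x => ENNReal.ofReal (1 + ‖x‖)) ≤
    (A : ℝ≥0∞) • volume
  dom : ∀ (M : ℕ) (b : ℝ), 0 ≤ b → b * M ≤ Γ → ∀ x : Fin M → Euc n, ∀ φ : Euc n → ℝ≥0∞,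
    Measurable φ → ∫⁻ y, ENNReal.ofReal (Real.exp (-V y) * inter b y x) * φ y ≤
      (∫⁻ y, ENNReal.ofReal (Real.exp (-V y) * inter b y x)) * ∫⁻ y, φ y ∂lam

lemma inter_le (hb : 0 ≤ b) (y : Euc n) (x : Fin M → Euc n) :
    inter b y x ≤ (1 + ‖y‖) ^ (b * M) * ∏ j, (1 + ‖x j‖) ^ b := by
  have h1 : inter b y x ≤ ∏ j, ((1 + ‖y‖) * (1 + ‖x j‖)) ^ b :=
    Finset.prod_le_prod (fun _ _ => Real.rpow_nonneg (norm_nonneg _) _) fun j _ =>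
      Real.rpow_le_rpow (norm_nonneg _) (norm_sub_le_mul y (x j)) hb
  refine h1.trans (le_of_eq ?_)
  have h2 : ∀ j, ((1 + ‖y‖) * (1 + ‖x j‖)) ^ b = (1 + ‖y‖) ^ b * (1 + ‖x j‖) ^ b := fun j =>
    Real.mul_rpow (by positivity) (by positivity)
  simp_rw [h2]
  rw [Finset.prod_mul_distrib, Finset.prod_const, Finset.card_univ, Fintype.card_fin,
    Real.rpow_mul_natCast (by positivity)]

/-- The density of one particle given the others is at most `e^{-V(y)} (1 + |y|)^Γ ∏_j (1 +
|x_j|)^b` before normalisation, and its normalisation is at least `c ∏_j (1 + |x_j|)^b`. The product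
over the other particles cancels. -/
lemma exists_isDominating [NeZero n] (hVc : Continuous V) (hV : SuperLog V) (hΓ : 0 ≤ Γ) :
    ∃ lam, IsDominating V Γ lam := by
  obtain ⟨c, hc, h⟩ := exists_le_lintegral_inter hVc Γ
  set ρ : Euc n → ℝ := fun y => c⁻¹ * (Real.exp (-V y) * (1 + ‖y‖) ^ Γ) with hρ
  have hρm : Measurable ρ := by
    have := hVc.measurable
    simp only [hρ]
    fun_prop
  have hρ0 : ∀ y, 0 ≤ ρ y := fun y => by simp only [hρ]; positivity
  refine ⟨volume.withDensity fun y => ENNReal.ofReal (ρ y), ⟨fun κ hκ => ?_, ?_, ?_⟩⟩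
  · rw [integrable_withDensity_ofReal hρm hρ0]
    refine ((hV.integrable hVc (Γ + κ) (by positivity)).const_mul c⁻¹).congr
      (ae_of_all _ fun x => ?_)
    simp only [hρ]
    rw [Real.rpow_add (by positivity)]
    ring
  · obtain ⟨C, hC, hCle⟩ := hV.exists_exp_neg_le (Γ + 1) (by positivity)
    refine ⟨⟨c⁻¹ * C, by positivity⟩, ?_⟩
    have h1 : (volume.withDensity fun y => ENNReal.ofReal (ρ y)).withDensity
        (fun x => ENNReal.ofReal (1 + ‖x‖)) =
        volume.withDensity fun y => ENNReal.ofReal (ρ y * (1 + ‖y‖)) := by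
      rw [← withDensity_mul _ hρm.ennreal_ofReal (by fun_prop)]
      congr 1
      ext y
      rw [Pi.mul_apply, ENNReal.ofReal_mul (hρ0 y)]
    rw [h1]
    refine withDensity_ofReal_le fun y => ?_
    simp only [hρ]
    have h2 := hCle y
    rw [Real.rpow_add_one (by positivity), ← mul_assoc] at h2
    rw [mul_assoc]
    exact mul_le_mul_of_nonneg_left h2 (inv_nonneg.mpr hc.le)
  · intro M b hb hbM x φ hφ
    set D := ∫⁻ y, ENNReal.ofReal (Real.exp (-V y) * inter b y x) with hD
    have hpt : ∀ y, ENNReal.ofReal (Real.exp (-V y) * inter b y x) * φ y ≤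
        D * (ENNReal.ofReal (ρ y) * φ y) := by
      intro y
      rw [← mul_assoc]
      gcongr
      refine le_trans ?_ (mul_le_mul_left (h M b hb hbM x) _)
      rw [← ENNReal.ofReal_mul (by positivity)]
      refine ENNReal.ofReal_le_ofReal ?_
      have h1 : (1 + ‖y‖) ^ (b * M) ≤ (1 + ‖y‖) ^ Γ :=
        Real.rpow_le_rpow_of_exponent_le (one_le_one_add_norm y) hbM
      have h2 : (0 : ℝ) ≤ ∏ j, (1 + ‖x j‖) ^ b := Finset.prod_nonneg fun _ _ => by positivity
      calc Real.exp (-V y) * inter b y x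
          ≤ Real.exp (-V y) * ((1 + ‖y‖) ^ Γ * ∏ j, (1 + ‖x j‖) ^ b) := by
            gcongr
            exact (inter_le hb y x).trans (mul_le_mul_of_nonneg_right h1 h2)
        _ = c * (∏ j, (1 + ‖x j‖) ^ b) * ρ y := by
            simp only [hρ]
            field_simp
    refine (lintegral_mono hpt).trans (le_of_eq ?_)
    have hm : Measurable fun y => ENNReal.ofReal (ρ y) * φ y := hρm.ennreal_ofReal.mul hφ
    rw [lintegral_withDensity_eq_lintegral_mul _ hρm.ennreal_ofReal hφ, lintegral_const_mul _ hm]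
    rfl

lemma IsDominating.exists_le' {lam : Measure (Euc n)} (h : IsDominating V Γ lam) :
    ∃ A : ℝ≥0, lam ≤ (A : ℝ≥0∞) • volume := by
  obtain ⟨A, hA⟩ := h.exists_le
  refine ⟨A, le_trans ?_ hA⟩
  conv_lhs => rw [← withDensity_one (μ := lam)]
  refine withDensity_mono (ae_of_all _ fun x => ?_)
  simp only [Pi.one_apply]
  rw [ENNReal.one_le_ofReal]
  exact one_le_one_add_norm x

lemma IsDominating.isFiniteMeasure {lam : Measure (Euc n)} (h : IsDominating V Γ lam) :
    IsFiniteMeasure lam := by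
  have := h.moment 0 le_rfl
  simp only [Real.rpow_zero] at this
  rw [integrable_const_iff] at this
  simpa using this

lemma IsDominating.integrable_logWeight {lam : Measure (Euc n)} (h : IsDominating V Γ lam) :
    Integrable logWeight lam := by
  refine (h.moment 1 zero_le_one).mono' measurable_logWeight.aestronglyMeasurable
    (ae_of_all _ fun x => ?_)
  rw [Real.norm_of_nonneg (logWeight_nonneg x), logWeight, Real.rpow_one]
  have := norm_nonneg x
  have h := Real.log_le_sub_one_of_pos (show 0 < 1 + ‖x‖ by positivity)
  linarith

/-- The integral `∫ e^{-V(y)} ∏_j |y - x_j|^b dy` of the interaction with a configuration. -/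
def interMass (V : Euc n → ℝ) (b : ℝ) (x : Fin M → Euc n) : ℝ≥0∞ :=
  ∫⁻ y, ENNReal.ofReal (Real.exp (-V y) * inter b y x)

lemma partitionFunction_eq (hb : 0 < b) :
    partitionFunction V b M = ∫⁻ x : Fin M → Euc n, ENNReal.ofReal (weight V b x) := by
  simp only [partitionFunction, boltzmann_eq hb]

lemma measurable_exp_inter (hVc : Continuous V) : Measurable fun p : Euc n × (Fin M → Euc n) =>
    ENNReal.ofReal (Real.exp (-V p.1) * inter b p.1 p.2) := by
  have := hVc.measurable
  fun_prop

lemma lintegral_weight_succ (hVc : Continuous V) (i : Fin (M + 1))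
    {F : (Fin (M + 1) → Euc n) → ℝ≥0∞} (hF : Measurable F) :
    ∫⁻ x, ENNReal.ofReal (weight V b x) * F x = ∫⁻ x : Fin M → Euc n,
      ENNReal.ofReal (weight V b x) * ∫⁻ y, ENNReal.ofReal (Real.exp (-V y) * inter b y x) *
        F (i.insertNth y x) := by
  have hm : Measurable fun x : Fin (M + 1) → Euc n => ENNReal.ofReal (weight V b x) * F x :=
    (measurable_weight hVc).ennreal_ofReal.mul hF
  rw [volume_pi, lintegral_pi_insertNth i hm]
  refine lintegral_congr fun x => ?_
  rw [← lintegral_const_mul']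
  · refine lintegral_congr fun y => ?_
    rw [weight_insertNth, ENNReal.ofReal_mul (mul_nonneg (Real.exp_pos _).le (inter_nonneg _ _ _)),
      mul_comm (ENNReal.ofReal (Real.exp _ * _)), mul_assoc]
  · exact ENNReal.ofReal_ne_top

/-- Induction on `M`: integrating out the added particle multiplies the weight by at least the
constant `c` of the Jensen bound. -/
lemma partitionFunction_ne_zero [NeZero n] (hVc : Continuous V) (hb : 0 < b) (M : ℕ) :
    partitionFunction V b M ≠ 0 := by
  rw [partitionFunction_eq hb]
  induction M with
  | zero =>
    rw [volume_pi, Measure.pi_of_empty _ (fun i => i.elim0)]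
    rw [lintegral_dirac]
    simp [weight]
  | succ M ih =>
    obtain ⟨c, hc, h⟩ := exists_le_lintegral_inter hVc (b * M)
    have h1 := lintegral_weight_succ (b := b) hVc (0 : Fin (M + 1)) (F := fun _ => 1)
      measurable_const
    simp only [mul_one] at h1
    rw [h1]
    have h2 : ENNReal.ofReal c * ∫⁻ x : Fin M → Euc n, ENNReal.ofReal (weight V b x) ≤
        ∫⁻ x : Fin M → Euc n, ENNReal.ofReal (weight V b x) *
          ∫⁻ y, ENNReal.ofReal (Real.exp (-V y) * inter b y x) := by
      rw [← lintegral_const_mul' _ _ ENNReal.ofReal_ne_top]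
      refine lintegral_mono fun x => ?_
      rw [mul_comm]
      gcongr
      refine le_trans (ENNReal.ofReal_le_ofReal ?_) (h M b hb.le le_rfl x)
      refine le_mul_of_one_le_right hc.le ?_
      calc (1 : ℝ) = ∏ _j : Fin M, (1 : ℝ) := by simp
        _ ≤ _ := Finset.prod_le_prod (fun _ _ => zero_le_one) fun j _ =>
          Real.one_le_rpow (one_le_one_add_norm _) hb.le
    intro h0
    rw [h0, nonpos_iff_eq_zero, mul_eq_zero] at h2
    rcases h2 with h2 | h2
    · exact absurd h2 (by simpa using hc)
    · exact ih h2

/-- The moments are part of the induction hypothesis because integrating out a particle leaves a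
factor `(1 + |x_j|)^b` on each of the others, so that `κ` becomes `b + κ`. -/
lemma lintegral_weight_ne_top (hVc : Continuous V) (hV : SuperLog V) (hb : 0 ≤ b) (M : ℕ) :
    ∀ κ : ℝ, 0 ≤ κ → ∫⁻ x : Fin M → Euc n, ENNReal.ofReal (weight V b x) *
      ENNReal.ofReal (∏ j, (1 + ‖x j‖) ^ κ) ≠ ∞ := by
  induction M with
  | zero =>
    intro κ _
    rw [volume_pi, Measure.pi_of_empty _ (fun i => i.elim0)]
    rw [lintegral_dirac]
    simp [weight]
  | succ M ih =>
    intro κ hκ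
    rw [lintegral_weight_succ hVc 0 (by fun_prop)]
    have hi := hV.integrable hVc (b * M + κ) (by positivity)
    have hpt : ∀ x : Fin M → Euc n, ENNReal.ofReal (weight V b x) *
        ∫⁻ y, ENNReal.ofReal (Real.exp (-V y) * inter b y x) *
          ENNReal.ofReal (∏ j, (1 + ‖(Fin.insertNth 0 y x : Fin (M + 1) → Euc n) j‖) ^ κ) ≤
        (∫⁻ y, ENNReal.ofReal (Real.exp (-V y) * (1 + ‖y‖) ^ (b * M + κ))) *
          (ENNReal.ofReal (weight V b x) * ENNReal.ofReal (∏ j, (1 + ‖x j‖) ^ (b + κ))) := by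
      intro x
      rw [mul_left_comm]
      gcongr
      rw [← lintegral_mul_const' _ _ ENNReal.ofReal_ne_top]
      refine lintegral_mono fun y => ?_
      rw [Fin.prod_univ_succAbove _ 0]
      simp only [Fin.insertNth_apply_same, Fin.insertNth_apply_succAbove]
      rw [← ENNReal.ofReal_mul (mul_nonneg (Real.exp_pos _).le (inter_nonneg _ _ _)),
        ← ENNReal.ofReal_mul (by positivity)]
      refine ENNReal.ofReal_le_ofReal ?_
      have h3 : ∏ j, (1 + ‖x j‖) ^ (b + κ) = (∏ j, (1 + ‖x j‖) ^ b) * ∏ j, (1 + ‖x j‖) ^ κ := by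
        rw [← Finset.prod_mul_distrib]
        exact Finset.prod_congr rfl fun j _ => Real.rpow_add (by positivity) _ _
      rw [h3, Real.rpow_add (by positivity)]
      have h4 : (0 : ℝ) ≤ ∏ j, (1 + ‖x j‖) ^ κ := Finset.prod_nonneg fun _ _ => by positivity
      calc Real.exp (-V y) * inter b y x * ((1 + ‖y‖) ^ κ * ∏ j, (1 + ‖x j‖) ^ κ)
          ≤ Real.exp (-V y) * ((1 + ‖y‖) ^ (b * M) * ∏ j, (1 + ‖x j‖) ^ b) *
            ((1 + ‖y‖) ^ κ * ∏ j, (1 + ‖x j‖) ^ κ) := by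
            gcongr
            exact inter_le hb y x
        _ = _ := by ring
    refine ne_top_of_le_ne_top ?_ (lintegral_mono hpt)
    have hfin : ∫⁻ y, ENNReal.ofReal (Real.exp (-V y) * (1 + ‖y‖) ^ (b * M + κ)) ≠ ∞ := by
      rw [← ofReal_integral_eq_lintegral_ofReal hi (ae_of_all _ fun y => by
        simp only [Pi.zero_apply]; positivity)]
      exact ENNReal.ofReal_ne_top
    rw [lintegral_const_mul' _ _ hfin]
    exact ENNReal.mul_ne_top hfin (ih (b + κ) (by positivity))

lemma partitionFunction_ne_top (hVc : Continuous V) (hV : SuperLog V) (hb : 0 < b) (M : ℕ) :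
    partitionFunction V b M ≠ ∞ := by
  have h := lintegral_weight_ne_top hVc hV hb.le M 0 le_rfl
  rw [partitionFunction_eq hb]
  simpa using h

lemma lintegral_gibbs (hVc : Continuous V) (hb : 0 < b) {F : (Fin M → Euc n) → ℝ≥0∞}
    (hF : Measurable F) : ∫⁻ x, F x ∂(gibbs V b M) =
      (partitionFunction V b M)⁻¹ * ∫⁻ x, ENNReal.ofReal (weight V b x) * F x := by
  have hB : boltzmann V b M = fun x => ENNReal.ofReal (weight V b x) := by
    ext x; exact boltzmann_eq hb x
  rw [gibbs, lintegral_smul_measure, hB, lintegral_withDensity_eq_lintegral_mul _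
    (measurable_weight hVc).ennreal_ofReal hF]
  rfl

lemma isProbabilityMeasure_gibbs [NeZero n] (hVc : Continuous V) (hV : SuperLog V) (hb : 0 < b)
    (M : ℕ) : IsProbabilityMeasure (gibbs V b M) := by
  constructor
  rw [← lintegral_one, lintegral_gibbs hVc hb measurable_const]
  simp only [mul_one]
  rw [← partitionFunction_eq hb, ENNReal.inv_mul_cancel (partitionFunction_ne_zero hVc hb M)
    (partitionFunction_ne_top hVc hV hb M)]

/-- The ratio `Z_{M+1} / Z_M` of partition functions. -/
def ratio (V : Euc n → ℝ) (b : ℝ) (M : ℕ) : ℝ≥0∞ :=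
  ∫⁻ x : Fin M → Euc n, interMass V b x ∂(gibbs V b M)

lemma measurable_interMass (hVc : Continuous V) :
    Measurable (interMass V b : (Fin M → Euc n) → ℝ≥0∞) :=
  (measurable_exp_inter hVc).lintegral_prod_left'

lemma ratio_eq (hVc : Continuous V) (hb : 0 < b) (M : ℕ) :
    ratio V b M = (partitionFunction V b M)⁻¹ * partitionFunction V b (M + 1) := by
  rw [ratio, lintegral_gibbs hVc hb (measurable_interMass hVc), partitionFunction_eq hb,
    partitionFunction_eq hb]
  have h1 := lintegral_weight_succ (b := b) hVc (0 : Fin (M + 1)) (F := fun _ => 1)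
    measurable_const
  simp only [mul_one] at h1
  rw [h1]
  rfl

lemma ratio_ne_zero [NeZero n] (hVc : Continuous V) (hV : SuperLog V) (hb : 0 < b) (M : ℕ) :
    ratio V b M ≠ 0 := by
  rw [ratio_eq hVc hb]
  exact mul_ne_zero (ENNReal.inv_ne_zero.mpr (partitionFunction_ne_top hVc hV hb M))
    (partitionFunction_ne_zero hVc hb _)

lemma ratio_ne_top [NeZero n] (hVc : Continuous V) (hV : SuperLog V) (hb : 0 < b) (M : ℕ) :
    ratio V b M ≠ ∞ := by
  rw [ratio_eq hVc hb]
  exact ENNReal.mul_ne_top (ENNReal.inv_ne_top.mpr (partitionFunction_ne_zero hVc hb _))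
    (partitionFunction_ne_top hVc hV hb _)

/-- Integration of one particle: the Gibbs measure with `M + 1` particles in terms of the one
with `M` particles. -/
lemma lintegral_gibbs_succ [NeZero n] (hVc : Continuous V) (hV : SuperLog V) (hb : 0 < b)
    (i : Fin (M + 1)) {F : (Fin (M + 1) → Euc n) → ℝ≥0∞} (hF : Measurable F) :
    ∫⁻ x, F x ∂(gibbs V b (M + 1)) = (ratio V b M)⁻¹ * ∫⁻ x : Fin M → Euc n,
      ∫⁻ y, ENNReal.ofReal (Real.exp (-V y) * inter b y x) * F (i.insertNth y x)
        ∂volume ∂(gibbs V b M) := by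
  have hm : Measurable fun x : Fin M → Euc n =>
      ∫⁻ y, ENNReal.ofReal (Real.exp (-V y) * inter b y x) * F (i.insertNth y x) :=
    ((measurable_exp_inter hVc).mul (hF.comp (measurable_insertNth i))).lintegral_prod_left'
  have h0 := partitionFunction_ne_zero hVc hb M
  have ht := partitionFunction_ne_top hVc hV hb M
  rw [lintegral_gibbs hVc hb hF, lintegral_gibbs hVc hb hm, lintegral_weight_succ hVc i hF,
    ratio_eq hVc hb, ENNReal.mul_inv (Or.inl (ENNReal.inv_ne_zero.mpr ht))
      (Or.inl (ENNReal.inv_ne_top.mpr h0)), inv_inv, ← mul_assoc,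
    mul_comm (partitionFunction V b M), mul_assoc _ (partitionFunction V b M),
    ENNReal.mul_inv_cancel h0 ht, mul_one]

variable {lam : Measure (Euc n)}

/-- The law of one particle given the others is dominated by `lam`. -/
lemma lintegral_gibbs_mul_le [NeZero n] (hVc : Continuous V) (hV : SuperLog V) (hb : 0 < b)
    (hl : IsDominating V Γ lam) (hbM : b * M ≤ Γ) (i : Fin M) {φ : Euc n → ℝ≥0∞}
    (hφ : Measurable φ) {F : (Fin M → Euc n) → ℝ≥0∞} (hF : Measurable F)
    (hFi : ∀ x y, F (Function.update x i y) = F x) :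
    ∫⁻ x, φ (x i) * F x ∂(gibbs V b M) ≤ (∫⁻ y, φ y ∂lam) * ∫⁻ x, F x ∂(gibbs V b M) := by
  obtain _ | M := M
  · exact i.elim0
  rw [lintegral_gibbs_succ hVc hV hb i (by fun_prop), lintegral_gibbs_succ hVc hV hb i hF,
    mul_left_comm]
  gcongr
  -- `F` does not see coordinate `i`. Freezing that coordinate at `0` lets `F` leave the integral
  -- over the particle `i`.
  have hG : ∀ (x : Fin M → Euc n) y, F (i.insertNth y x) = F (i.insertNth 0 x) := by
    intro x y
    have h := Fin.update_insertNth (α := fun _ => Euc n) i 0 y x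
    rw [← h, hFi]
  have hbM' : b * M ≤ Γ := by
    refine le_trans ?_ hbM
    push_cast
    nlinarith
  calc _ ≤ ∫⁻ x : Fin M → Euc n, (∫⁻ y, φ y ∂lam) *
        ∫⁻ y, ENNReal.ofReal (Real.exp (-V y) * inter b y x) * F (i.insertNth y x)
          ∂volume ∂(gibbs V b M) := by
        refine lintegral_mono fun x => ?_
        have hm : Measurable fun y => ENNReal.ofReal (Real.exp (-V y) * inter b y x) :=
          (measurable_exp_inter hVc).comp measurable_prodMk_right
        simp only [hG, Fin.insertNth_apply_same]
        simp_rw [← mul_assoc]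
        have hm' : Measurable fun y => ENNReal.ofReal (Real.exp (-V y) * inter b y x) * φ y :=
          hm.mul hφ
        rw [lintegral_mul_const _ hm', lintegral_mul_const _ hm, ← mul_assoc]
        gcongr
        rw [mul_comm (∫⁻ y, φ y ∂lam)]
        exact hl.dom M b hb.le hbM' x φ hφ
    _ = _ := by
        rw [lintegral_const_mul]
        exact ((measurable_exp_inter hVc).mul
          (hF.comp (measurable_insertNth i))).lintegral_prod_left'

lemma lintegral_gibbs_sum_le [NeZero n] (hVc : Continuous V) (hV : SuperLog V) (hb : 0 < b)
    (hl : IsDominating V Γ lam) (hbM : b * M ≤ Γ) {φ : Euc n → ℝ≥0∞} (hφ : Measurable φ) :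
    ∫⁻ x, ∑ j, φ (x j) ∂(gibbs V b M) ≤ M * ∫⁻ y, φ y ∂lam := by
  have hP := isProbabilityMeasure_gibbs hVc hV hb M
  rw [lintegral_finsetSum (f := fun j (x : Fin M → Euc n) => φ (x j)) _
    fun j _ => hφ.comp (measurable_pi_apply j)]
  calc _ ≤ ∑ _j : Fin M, ∫⁻ y, φ y ∂lam := by
        refine Finset.sum_le_sum fun j _ => ?_
        have h := lintegral_gibbs_mul_le hVc hV hb hl hbM j hφ (F := fun _ => 1)
          measurable_const (fun _ _ => rfl)
        simpa using h
    _ = _ := by simp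

/-- The particles are not independent, but domination is conditional on all the others, so they can
be integrated out one at a time as if they were. The induction runs over subsets of indices. -/
lemma lintegral_gibbs_prod_le [NeZero n] (hVc : Continuous V) (hV : SuperLog V) (hb : 0 < b)
    (hl : IsDominating V Γ lam) (hbM : b * M ≤ Γ) {h : Euc n → ℝ≥0∞} (hh : Measurable h) :
    ∫⁻ x, ∏ j, (1 + h (x j)) ∂(gibbs V b M) ≤ (1 + ∫⁻ y, h y ∂lam) ^ M := by
  have hP := isProbabilityMeasure_gibbs hVc hV hb M
  have key : ∀ S : Finset (Fin M), ∫⁻ x, ∏ j ∈ S, (1 + h (x j)) ∂(gibbs V b M) ≤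
      (1 + ∫⁻ y, h y ∂lam) ^ S.card := by
    intro S
    induction S using Finset.induction_on with
    | empty => simp
    | insert i S hi ih =>
      simp only [Finset.prod_insert hi, Finset.card_insert_of_notMem hi]
      have hF : Measurable fun x : Fin M → Euc n => ∏ j ∈ S, (1 + h (x j)) := by fun_prop
      have h1 := lintegral_gibbs_mul_le hVc hV hb hl hbM i hh hF (fun x y => by
        refine Finset.prod_congr rfl fun j hj => ?_
        rw [Function.update_of_ne (fun e : j = i => hi (e ▸ hj))])
      simp_rw [add_mul, one_mul]
      rw [lintegral_add_left hF, pow_succ, mul_add, mul_one]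
      refine add_le_add ih (h1.trans ?_)
      rw [mul_comm]
      gcongr
  have := key Finset.univ
  simpa using this

/-- The bound is linear in `b`: each particle contributes `1 + O(b)`, and `M` particles a bounded
factor when `b M ≤ Γ`. -/
lemma rpow_sub_one_le {b Γ : ℝ} (hb : 0 ≤ b) (hbΓ : b ≤ Γ) (x : Euc n) :
    (1 + ‖x‖) ^ (2 * b) - 1 ≤ 2 * b * (1 + ‖x‖) ^ (2 * Γ + 1) := by
  have hx := one_le_one_add_norm x
  have h0 := Real.add_one_le_exp (-(2 * b * logWeight x))
  have h1 : (1 + ‖x‖) ^ (2 * b) * (1 - 2 * b * logWeight x) ≤ 1 := by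
    rw [← exp_mul_logWeight]
    calc _ ≤ Real.exp (2 * b * logWeight x) * Real.exp (-(2 * b * logWeight x)) :=
          mul_le_mul_of_nonneg_left (by linarith) (Real.exp_pos _).le
      _ = 1 := by rw [← Real.exp_add]; simp
  have h2 : logWeight x ≤ 1 + ‖x‖ := by
    have := norm_nonneg x
    have := Real.log_le_sub_one_of_pos (show 0 < 1 + ‖x‖ by linarith)
    rw [logWeight]
    linarith
  have h3 : (1 + ‖x‖) ^ (2 * b) ≤ (1 + ‖x‖) ^ (2 * Γ) :=
    Real.rpow_le_rpow_of_exponent_le hx (by linarith)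
  have h4 : 0 ≤ logWeight x := logWeight_nonneg x
  rw [Real.rpow_add_one (by positivity)]
  calc (1 + ‖x‖) ^ (2 * b) - 1 ≤ 2 * b * ((1 + ‖x‖) ^ (2 * b) * logWeight x) := by linarith
    _ ≤ 2 * b * ((1 + ‖x‖) ^ (2 * Γ) * (1 + ‖x‖)) := by gcongr

/-- Uniform bound for the second moment of `∏_j (1 + |x_j|)^b`. -/
lemma exists_lintegral_gibbs_rpow_le [NeZero n] (hVc : Continuous V) (hV : SuperLog V)
    (hΓ : 0 ≤ Γ) (hl : IsDominating V Γ lam) :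
    ∃ C : ℝ, 0 < C ∧ ∀ (M : ℕ) (b : ℝ), 0 < b → b * M ≤ Γ →
      ∫⁻ x : Fin M → Euc n, ENNReal.ofReal (∏ j, (1 + ‖x j‖) ^ (2 * b)) ∂(gibbs V b M) ≤
        ENNReal.ofReal C := by
  set D := ∫ x, (1 + ‖x‖) ^ (2 * Γ + 1) ∂lam with hD
  have hD0 : 0 ≤ D := integral_nonneg fun x => by positivity
  refine ⟨Real.exp (2 * Γ * D), Real.exp_pos _, fun M b hb hbM => ?_⟩
  have hP := isProbabilityMeasure_gibbs hVc hV hb M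
  rcases Nat.eq_zero_or_pos M with rfl | hM
  · simp
    positivity
  have hbΓ : b ≤ Γ := by
    refine le_trans ?_ hbM
    exact le_mul_of_one_le_right hb.le (by exact_mod_cast hM)
  set h : Euc n → ℝ≥0∞ := fun x => ENNReal.ofReal ((1 + ‖x‖) ^ (2 * b) - 1)
  have hh : Measurable h := by fun_prop
  have hone : ∀ x : Euc n, 0 ≤ (1 + ‖x‖) ^ (2 * b) - 1 := fun x =>
    sub_nonneg.mpr (Real.one_le_rpow (one_le_one_add_norm x) (by positivity))
  have h1 : ∀ x : Fin M → Euc n, ENNReal.ofReal (∏ j, (1 + ‖x j‖) ^ (2 * b)) =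
      ∏ j, (1 + h (x j)) := by
    intro x
    rw [ENNReal.ofReal_prod_of_nonneg fun _ _ => by positivity]
    refine Finset.prod_congr rfl fun j _ => ?_
    simp only [h]
    rw [← ENNReal.ofReal_one, ← ENNReal.ofReal_add zero_le_one (hone _), add_sub_cancel]
  have h2 : ∫⁻ x, h x ∂lam ≤ ENNReal.ofReal (2 * b * D) := by
    rw [hD, ← integral_const_mul, ofReal_integral_eq_lintegral_ofReal
      ((hl.moment _ (by positivity)).const_mul _) (ae_of_all _ fun x => by
        simp only [Pi.zero_apply]; positivity)]
    exact lintegral_mono fun x => ENNReal.ofReal_le_ofReal (rpow_sub_one_le hb.le hbΓ x)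
  simp_rw [h1]
  refine (lintegral_gibbs_prod_le hVc hV hb hl hbM hh).trans ?_
  calc (1 + ∫⁻ y, h y ∂lam) ^ M ≤ (1 + ENNReal.ofReal (2 * b * D)) ^ M := by gcongr
    _ = ENNReal.ofReal ((1 + 2 * b * D) ^ M) := by
        rw [ENNReal.ofReal_pow (by positivity), ENNReal.ofReal_add zero_le_one (by positivity),
          ENNReal.ofReal_one]
    _ ≤ ENNReal.ofReal (Real.exp (2 * Γ * D)) := by
        refine ENNReal.ofReal_le_ofReal ?_
        calc (1 + 2 * b * D) ^ M ≤ (Real.exp (2 * b * D)) ^ M := by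
              gcongr
              have := Real.add_one_le_exp (2 * b * D)
              linarith
          _ = Real.exp (M * (2 * b * D)) := (Real.exp_nat_mul _ _).symm
          _ ≤ Real.exp (2 * Γ * D) := by
              rw [Real.exp_le_exp]
              have := mul_le_mul_of_nonneg_right hbM hD0
              linarith

end Gibbs

/-! ### Comparison of the Gibbs measure with the product of equilibrium measures. -/

section Energy

variable {V : Euc n → ℝ} {γ L b : ℝ} {μ : Measure (Euc n)} {M : ℕ}

/-- The potential of a measure. -/
def pot (μ : Measure (Euc n)) (x : Euc n) : ℝ := ∫ z, logG x z ∂μ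

lemma lintegral_pi_withDensity {ν : Measure (Euc n)} [SigmaFinite ν] {f : Euc n → ℝ≥0∞}
    (hf : Measurable f) [SigmaFinite (ν.withDensity f)] (M : ℕ) :
    ∀ F : (Fin M → Euc n) → ℝ≥0∞, Measurable F →
      ∫⁻ x, F x ∂(Measure.pi fun _ => ν.withDensity f) =
        ∫⁻ x, (∏ j, f (x j)) * F x ∂(Measure.pi fun _ => ν) := by
  induction M with
  | zero =>
    intro F hF
    rw [Measure.pi_of_empty _ (fun i => i.elim0), Measure.pi_of_empty _ (fun i => i.elim0),
      lintegral_dirac, lintegral_dirac]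
    simp
  | succ M ih =>
    intro F hF
    have hG : Measurable fun p : Euc n × (Fin M → Euc n) =>
        F (Fin.insertNth (α := fun _ => Euc n) 0 p.1 p.2) := hF.comp (measurable_insertNth 0)
    have hm : Measurable fun x : Fin (M + 1) → Euc n => (∏ j, f (x j)) * F x := by fun_prop
    rw [lintegral_pi_insertNth 0 hF, lintegral_pi_insertNth 0 hm, ih _ hG.lintegral_prod_left']
    refine lintegral_congr fun x => ?_
    have hG' : Measurable fun y => F (Fin.insertNth (α := fun _ => Euc n) 0 y x) :=
      hG.comp measurable_prodMk_right
    have hG'' : Measurable fun y => f y * F (Fin.insertNth (α := fun _ => Euc n) 0 y x) :=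
      hf.mul hG'
    rw [lintegral_withDensity_eq_lintegral_mul _ hf hG']
    simp only [Fin.prod_univ_succAbove _ (0 : Fin (M + 1)), Fin.insertNth_apply_same,
      Fin.insertNth_apply_succAbove, Pi.mul_apply]
    rw [← lintegral_const_mul _ hG'']
    refine lintegral_congr fun y => ?_
    ring

lemma two_mul_sum_Ioi {k : Euc n → Euc n → ℝ} (hk : ∀ x z, k x z = k z x) (x : Fin M → Euc n) :
    2 * ∑ i, ∑ j ∈ Finset.Ioi i, k (x i) (x j) =
      ∑ i, ∑ j, k (x i) (x j) - ∑ i, k (x i) (x i) := by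
  have h := Finset.sum_sum_Ioi_add_eq_sum_sum_off_diag fun i j => k (x i) (x j)
  have h1 : ∀ i, ∑ j ∈ {i}ᶜ, k (x j) (x i) = ∑ j, k (x i) (x j) - k (x i) (x i) := by
    intro i
    rw [← Finset.sum_compl_add_sum {i} fun j => k (x i) (x j), Finset.sum_singleton,
      add_sub_cancel_right]
    exact Finset.sum_congr rfl fun j _ => hk _ _
  simp only [h1, Finset.sum_sub_distrib] at h
  rw [← h, Finset.mul_sum]
  refine Finset.sum_congr rfl fun i _ => ?_
  rw [Finset.mul_sum]
  refine Finset.sum_congr rfl fun j _ => ?_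
  rw [hk (x j) (x i)]
  ring

lemma two_mul_sum_card_Ioi (M : ℕ) :
    2 * ∑ i : Fin M, ∑ _j ∈ Finset.Ioi i, (1 : ℝ) = M * (M - 1) := by
  have h := two_mul_sum_Ioi (n := 0) (k := fun _ _ => 1) (fun _ _ => rfl) (fun _ : Fin M => 0)
  rw [h]
  simp
  ring

/-- The empirical measure of a configuration. -/
def empirical (x : Fin M → Euc n) : Measure (Euc n) :=
  (M : ℝ≥0∞)⁻¹ • ∑ j, Measure.dirac (x j)

lemma integral_empirical (x : Fin M → Euc n) (f : Euc n → ℝ) :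
    ∫ z, f z ∂(empirical x) = (M : ℝ)⁻¹ * ∑ j, f (x j) := by
  rw [empirical, integral_smul_measure, integral_finsetSum_measure fun j _ =>
    integrable_dirac (by simp)]
  simp

lemma integrable_empirical (hM : 0 < M) (x : Fin M → Euc n) (f : Euc n → ℝ) :
    Integrable f (empirical x) := by
  refine Integrable.smul_measure ?_ (by simp [hM.ne'])
  exact (integrable_finsetSum_measure).mpr fun j _ => integrable_dirac (by simp)

lemma isProbabilityMeasure_empirical (hM : 0 < M) (x : Fin M → Euc n) :
    IsProbabilityMeasure (empirical x) := by
  constructor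
  rw [empirical, Measure.smul_apply, Measure.finsetSum_apply]
  simp only [measure_univ, Finset.sum_const, Finset.card_univ, Fintype.card_fin, nsmul_eq_mul,
    mul_one, smul_eq_mul]
  exact ENNReal.inv_mul_cancel (by simp [hM.ne']) (by simp)

/-- Positivity of the modulated regularised energy of a configuration. -/
lemma two_mul_sum_pot_le [IsProbabilityMeasure μ] (hμ : Integrable logWeight μ) {a : ℝ}
    (ha : 0 < a) (ha1 : a ≤ 1) (hM : 0 < M) (x : Fin M → Euc n) :
    2 * M * ∑ j, ∫ z, gReg a (x j) z ∂μ ≤ ∑ i, ∑ j, gReg a (x i) (x j) +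
      M ^ 2 * ∫ p, gReg a p.1 p.2 ∂(μ.prod μ) := by
  have hσ := isProbabilityMeasure_empirical hM x
  have hσϑ := integrable_empirical hM x logWeight
  have h := two_mul_integral_gReg_le hσϑ hμ ha
  rw [integral_prod _ (integrable_gReg hσϑ hμ ha ha1),
    integral_prod _ (integrable_gReg hσϑ hσϑ ha ha1), integral_empirical, integral_empirical] at h
  simp only [integral_empirical] at h
  have hM' : (0 : ℝ) < M := by exact_mod_cast hM
  rw [← Finset.mul_sum] at h
  have h2 := mul_le_mul_of_nonneg_left h (sq_nonneg (M : ℝ))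
  have e1 : (M : ℝ) ^ 2 * (2 * ((M : ℝ)⁻¹ * ∑ j, ∫ z, gReg a (x j) z ∂μ)) =
      2 * M * ∑ j, ∫ z, gReg a (x j) z ∂μ := by
    field_simp
  have e2 : (M : ℝ) ^ 2 * ((M : ℝ)⁻¹ * ((M : ℝ)⁻¹ * ∑ i, ∑ j, gReg a (x i) (x j)) +
      ∫ p, gReg a p.1 p.2 ∂(μ.prod μ)) = ∑ i, ∑ j, gReg a (x i) (x j) +
      M ^ 2 * ∫ p, gReg a p.1 p.2 ∂(μ.prod μ) := by
    field_simp
  rw [← e1, ← e2]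
  exact h2

lemma norm_rpow_le_exp_gReg (hb : 0 ≤ b) {a : ℝ} (ha : 0 < a) (x z : Euc n) :
    ‖x - z‖ ^ b ≤ Real.exp (-(b * gReg a x z)) := by
  have h0 : 0 < ‖x - z‖ ^ 2 + a := by positivity
  have h1 : ‖x - z‖ ^ b = (‖x - z‖ ^ 2) ^ (b / 2) := by
    rw [← Real.rpow_natCast, ← Real.rpow_mul (norm_nonneg _)]
    congr 1
    push_cast
    ring
  rw [h1]
  refine (Real.rpow_le_rpow (by positivity) (show ‖x - z‖ ^ 2 ≤ ‖x - z‖ ^ 2 + a by linarith)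
    (by positivity)).trans (le_of_eq ?_)
  rw [Real.rpow_def_of_pos h0, gReg]
  congr 1
  ring

/-- The pair interaction `∏_{i<j} |x_i - x_j|^b`. -/
def pairProd (b : ℝ) (x : Fin M → Euc n) : ℝ := ∏ i, ∏ j ∈ Finset.Ioi i, ‖x i - x j‖ ^ b

@[fun_prop]
lemma measurable_pairProd (b : ℝ) : Measurable fun x : Fin M → Euc n => pairProd b x := by
  unfold pairProd
  fun_prop

/-- The regularised kernel is finite on the diagonal, so the sum over pairs can be completed to the
self-energy of the empirical measure. The diagonal contributes the term in `M log a`. -/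
lemma pairProd_le (hb : 0 ≤ b) {a : ℝ} (ha : 0 < a) (x : Fin M → Euc n) :
    pairProd b x ≤ Real.exp (-(b / 2) * (∑ i, ∑ j, gReg a (x i) (x j) + M * Real.log a / 2)) := by
  have hcomm : ∀ x z : Euc n, gReg a x z = gReg a z x := fun x z => by
    rw [gReg, gReg, norm_sub_rev]
  have hdiag : ∀ i, gReg a (x i) (x i) = -(Real.log a / 2) := fun i => by
    rw [gReg, sub_self, norm_zero]
    ring_nf
  have h2 := two_mul_sum_Ioi hcomm x
  simp only [hdiag, Finset.sum_const, Finset.card_univ, Fintype.card_fin, nsmul_eq_mul] at h2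
  have h3 : pairProd b x ≤ ∏ i, ∏ j ∈ Finset.Ioi i, Real.exp (-(b * gReg a (x i) (x j))) :=
    Finset.prod_le_prod (fun _ _ => Finset.prod_nonneg fun _ _ =>
      Real.rpow_nonneg (norm_nonneg _) _) fun i _ => Finset.prod_le_prod
        (fun _ _ => Real.rpow_nonneg (norm_nonneg _) _) fun j _ => norm_rpow_le_exp_gReg hb ha _ _
  refine h3.trans (le_of_eq ?_)
  simp only [← Real.exp_sum, Finset.sum_neg_distrib, ← Finset.mul_sum]
  congr 1
  linear_combination (-(b / 2)) * h2

/-- `C` controls the growth of the potential and `c` the regularisation error. Both are uniform in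
`x` because `μ` has a bounded density and an integrable weight. -/
lemma IsEquilibrium.exists_pot_bounds [NeZero n] (h : IsEquilibrium V γ L μ) :
    ∃ C c : ℝ, 0 ≤ C ∧ 0 ≤ c ∧ (∀ x, |pot μ x| ≤ C + logWeight x) ∧
      ∀ δ : ℝ, 0 < δ → δ ≤ 1 → ∀ x, pot μ x - ∫ z, gReg (δ ^ 4) x z ∂μ ≤ 2 * δ * c := by
  have hp := h.prob
  obtain ⟨A, hA⟩ := h.exists_le
  have hϑ := h.integrable_logWeight
  have hs := fun x => integral_sing_le hA x
  have h0 : 0 ≤ ∫ z, logWeight z ∂μ := integral_nonneg logWeight_nonneg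
  refine ⟨∫ z, logWeight z ∂μ + 2 * (A * singConst n + 1), A * singConst n + 1, by positivity,
    by positivity, fun x => ?_, fun δ hδ hδ1 x => ?_⟩
  · have hi1 : Integrable (fun z => logWeight x + logWeight z) μ := (integrable_const _).add hϑ
    have hi2 : Integrable (fun z => 2 * sing (x - z)) μ := (integrable_sing hA x).const_mul 2
    calc |pot μ x| ≤ ∫ z, |logG x z| ∂μ := abs_integral_le_integral_abs
      _ ≤ ∫ z, (logWeight x + logWeight z + 2 * sing (x - z)) ∂μ :=
          integral_mono (integrable_logG hA hϑ x).abs (hi1.add hi2) fun z => abs_logG_le x z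
      _ = logWeight x + ∫ z, logWeight z ∂μ + 2 * ∫ z, sing (x - z) ∂μ := by
          rw [integral_add hi1 hi2, integral_add (integrable_const _) hϑ, integral_const_mul]
          simp
      _ ≤ _ := by linarith [hs x]
  · have ha : 0 < δ ^ 4 := by positivity
    rw [pot, ← integral_sub (integrable_logG hA hϑ x)
      (integrable_gReg_right hϑ ha (pow_le_one₀ hδ.le hδ1) x)]
    calc ∫ z, (logG x z - gReg (δ ^ 4) x z) ∂μ ≤ ∫ z, 2 * δ * sing (x - z) ∂μ :=
          integral_mono ((integrable_logG hA hϑ x).sub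
            (integrable_gReg_right hϑ ha (pow_le_one₀ hδ.le hδ1) x))
            ((integrable_sing hA x).const_mul _) fun z => logG_sub_gReg_le hδ hδ1 x z
      _ = 2 * δ * ∫ z, sing (x - z) ∂μ := integral_const_mul _ _
      _ ≤ _ := by
          have := hs x
          gcongr

lemma IsEquilibrium.integral_gReg_le [NeZero n] (h : IsEquilibrium V γ L μ) {a : ℝ} (ha : 0 < a)
    (ha1 : a ≤ 1) :
    ∫ p, gReg a p.1 p.2 ∂(μ.prod μ) ≤ ∫ p, logG p.1 p.2 ∂(μ.prod μ) := by
  have hp := h.prob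
  obtain ⟨A, hA⟩ := h.exists_le
  have hϑ := h.integrable_logWeight
  refine integral_mono_ae (integrable_gReg hϑ hϑ ha ha1) (integrable_logG_prod hϑ hϑ hA) ?_
  filter_upwards [ae_prod_ne (σ := μ) (measure_singleton_of_le hA)] with p hp
  exact gReg_le_logG ha hp

/-- Pointwise upper bound for the density of the Gibbs measure with respect to the product of
the equilibrium measure. -/
lemma IsEquilibrium.pairProd_mul_exp_le [NeZero n] (h : IsEquilibrium V γ L μ)
    {C c δ : ℝ} (hC : ∀ x, |pot μ x| ≤ C + logWeight x)
    (hc : ∀ x, pot μ x - ∫ z, gReg (δ ^ 4) x z ∂μ ≤ 2 * δ * c) (hδ : 0 < δ) (hδ1 : δ ≤ 1)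
    (hb : 0 ≤ b) (hM : 0 < M) (x : Fin M → Euc n) :
    pairProd b x * Real.exp (γ * ∑ j, pot μ (x j)) ≤
      Real.exp (|γ - b * M| * ∑ j, (C + logWeight (x j)) + b * M * (M * (2 * δ * c)) +
        b / 2 * (M ^ 2 * ∫ p, logG p.1 p.2 ∂(μ.prod μ)) - b * M * Real.log δ) := by
  have hp := h.prob
  have ha : 0 < δ ^ 4 := by positivity
  have ha1 : δ ^ 4 ≤ 1 := pow_le_one₀ hδ.le hδ1
  have h1 := pairProd_le hb ha x
  have h2 := two_mul_sum_pot_le h.integrable_logWeight ha ha1 hM x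
  have h3 := h.integral_gReg_le ha ha1
  have h4 : ∑ j, pot μ (x j) - ∑ j, ∫ z, gReg (δ ^ 4) (x j) z ∂μ ≤ M * (2 * δ * c) := by
    rw [← Finset.sum_sub_distrib]
    refine (Finset.sum_le_sum fun j _ => hc (x j)).trans (le_of_eq ?_)
    simp
  have h5 : |∑ j, pot μ (x j)| ≤ ∑ j, (C + logWeight (x j)) :=
    (Finset.abs_sum_le_sum_abs _ _).trans (Finset.sum_le_sum fun j _ => hC (x j))
  have h6 : (γ - b * M) * ∑ j, pot μ (x j) ≤ |γ - b * M| * ∑ j, (C + logWeight (x j)) := by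
    refine (le_abs_self _).trans ?_
    rw [abs_mul]
    gcongr
  -- Positivity (`h2`) replaces the regularised self-energy of the configuration by `M` times its
  -- interaction with `μ`, up to the energy of `μ`. After `h4` this interaction is `-b M ∑_j pot`,
  -- which cancels `γ ∑_j pot` up to `|γ - b M|`. The term `b M log δ` comes from the diagonal with
  -- `a = δ⁴`.
  refine (mul_le_mul_of_nonneg_right h1 (Real.exp_pos _).le).trans ?_
  rw [← Real.exp_add, Real.exp_le_exp, Real.log_pow]
  have h7 : (0 : ℝ) ≤ b * M := by positivity
  have h8 := mul_le_mul_of_nonneg_left h4 h7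
  have h9 := mul_le_mul_of_nonneg_left h2 (show 0 ≤ b / 2 by positivity)
  have h10 := mul_le_mul_of_nonneg_left h3 (show 0 ≤ b / 2 * (M : ℝ) ^ 2 by positivity)
  push_cast
  linarith

lemma map_pair_pi [IsProbabilityMeasure μ] {i j : Fin M} (hij : i ≠ j) :
    (Measure.pi fun _ : Fin M => μ).map (fun x => (x i, x j)) = μ.prod μ := by
  have h1 : ProbabilityTheory.iIndepFun (fun (k : Fin M) (x : Fin M → Euc n) => x k)
      (Measure.pi fun _ => μ) :=
    ProbabilityTheory.iIndepFun_pi (X := fun _ => id) fun _ => aemeasurable_id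
  have h2 := h1.indepFun hij
  rw [ProbabilityTheory.indepFun_iff_map_prod_eq_prod_map_map
    (measurable_pi_apply i).aemeasurable (measurable_pi_apply j).aemeasurable] at h2
  have h3 : ∀ k, (Measure.pi fun _ : Fin M => μ).map (fun x => x k) = μ := fun k =>
    (measurePreserving_eval (fun _ : Fin M => μ) k).map_eq
  rw [h2, h3, h3]

lemma integrable_pair [IsProbabilityMeasure μ] {i j : Fin M} (hij : i ≠ j)
    {k : Euc n × Euc n → ℝ} (hk : Integrable k (μ.prod μ)) :
    Integrable (fun x : Fin M → Euc n => k (x i, x j)) (Measure.pi fun _ => μ) := by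
  rw [← map_pair_pi hij] at hk
  exact hk.comp_measurable (by fun_prop)

lemma integral_pair [IsProbabilityMeasure μ] {i j : Fin M} (hij : i ≠ j)
    {k : Euc n × Euc n → ℝ} (hk : Measurable k) :
    ∫ x : Fin M → Euc n, k (x i, x j) ∂(Measure.pi fun _ => μ) = ∫ p, k p ∂(μ.prod μ) := by
  rw [← map_pair_pi hij, integral_map (by fun_prop) hk.aestronglyMeasurable]

lemma integral_eval [IsProbabilityMeasure μ] (i : Fin M) {f : Euc n → ℝ} (hf : Measurable f) :
    ∫ x : Fin M → Euc n, f (x i) ∂(Measure.pi fun _ => μ) = ∫ y, f y ∂μ := by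
  conv_rhs => rw [← (measurePreserving_eval (fun _ : Fin M => μ) i).map_eq]
  rw [integral_map (measurable_pi_apply i).aemeasurable hf.aestronglyMeasurable]

lemma IsEquilibrium.measurable_pot' (h : IsEquilibrium V γ L μ) : Measurable (pot μ) :=
  h.measurable_pot

/-- Change of reference measure: by the self-consistent equation `e^{-V}` is `L e^{γ U}` times the
density of `μ`. -/
lemma IsEquilibrium.lintegral_weight [NeZero n] (h : IsEquilibrium V γ L μ)
    (hVc : Continuous V) {F : (Fin M → Euc n) → ℝ≥0∞} (hF : Measurable F) :
    ∫⁻ x, ENNReal.ofReal (weight V b x) * F x =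
      ENNReal.ofReal (L ^ M) * ∫⁻ x, ENNReal.ofReal (pairProd b x *
        Real.exp (γ * ∑ j, pot μ (x j))) * F x ∂(Measure.pi fun _ => μ) := by
  have hp := h.prob
  have hpm := h.measurable_pot'
  have hVm := hVc.measurable
  set f : Euc n → ℝ := fun x => Real.exp (-(γ * pot μ x) - V x) / L with hf
  have hfm : Measurable f := by simp only [hf]; fun_prop
  have hμ : μ = volume.withDensity fun x => ENNReal.ofReal (f x) := h.withDensity
  have hL := h.pos
  have hsf : SigmaFinite (volume.withDensity fun x => ENNReal.ofReal (f x)) := by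
    rw [← hμ]; infer_instance
  have hm : Measurable fun x : Fin M → Euc n => ENNReal.ofReal (pairProd b x *
        Real.exp (γ * ∑ j, pot μ (x j))) * F x := by fun_prop
  have hpi : (Measure.pi fun _ : Fin M => μ) =
      Measure.pi fun _ => volume.withDensity fun x => ENNReal.ofReal (f x) := by
    congr 1
    ext1
    exact hμ
  rw [hpi, lintegral_pi_withDensity hfm.ennreal_ofReal M _ hm, ← lintegral_const_mul' _ _
    ENNReal.ofReal_ne_top, ← volume_pi]
  refine lintegral_congr fun x => ?_
  rw [← ENNReal.ofReal_prod_of_nonneg fun _ _ => by simp only [hf]; positivity, ← mul_assoc,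
    ← mul_assoc, ← ENNReal.ofReal_mul (by positivity), ← ENNReal.ofReal_mul (by
      have : 0 ≤ ∏ j, f (x j) := Finset.prod_nonneg fun _ _ => by simp only [hf]; positivity
      positivity)]
  congr 2
  rw [weight, pairProd]
  have h1 : ∏ j, Real.exp (-V (x j)) =
      L ^ M * (∏ j, f (x j)) * Real.exp (γ * ∑ j, pot μ (x j)) := by
    have h2 : L ^ M = ∏ _j : Fin M, L := by simp
    rw [Finset.mul_sum, Real.exp_sum, h2, ← Finset.prod_mul_distrib, ← Finset.prod_mul_distrib]
    refine Finset.prod_congr rfl fun j _ => ?_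
    simp only [hf]
    rw [mul_div_cancel₀ _ hL.ne', ← Real.exp_add]
    congr 1
    ring
  rw [h1]
  ring

/-- Lower bound for the partition function. -/
lemma IsEquilibrium.le_partitionFunction [NeZero n] (h : IsEquilibrium V γ L μ)
    (hVc : Continuous V) (hb : 0 < b) (M : ℕ) :
    ENNReal.ofReal (L ^ M) * ENNReal.ofReal (Real.exp
      ((γ * M - b / 2 * (M * (M - 1))) * ∫ p, logG p.1 p.2 ∂(μ.prod μ))) ≤
        partitionFunction V b M := by
  have hp := h.prob
  obtain ⟨A, hA⟩ := h.exists_le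
  have hϑ := h.integrable_logWeight
  have hpm := h.measurable_pot'
  have hG := integrable_logG_prod hϑ hϑ hA
  have hGm : Measurable fun p : Euc n × Euc n => logG p.1 p.2 := measurable_logG
  set I := ∫ p, logG p.1 p.2 ∂(μ.prod μ) with hI
  have hpotI : ∫ x, pot μ x ∂μ = I := (integral_prod _ hG).symm
  have hpoti : Integrable (pot μ) μ := hG.integral_prod_left
  have h1 := h.lintegral_weight (b := b) (M := M) hVc (F := fun _ => 1) measurable_const
  simp only [mul_one] at h1
  rw [partitionFunction_eq hb, h1]
  gcongr
  -- The logarithm of the density with respect to the product of the `μ`. Jensen reduces the lower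
  -- bound to its mean, which only involves the self-energy `I`.
  set u : (Fin M → Euc n) → ℝ := fun x =>
    γ * ∑ j, pot μ (x j) - b * ∑ i, ∑ j ∈ Finset.Ioi i, logG (x i) (x j) with hu
  have hi1 : ∀ i : Fin M, Integrable (fun x : Fin M → Euc n => pot μ (x i))
      (Measure.pi fun _ => μ) := fun i => integrable_comp_eval (μ := fun _ : Fin M => μ) hpoti
  have hi2 : ∀ i : Fin M, ∀ j ∈ Finset.Ioi i, Integrable (fun x : Fin M → Euc n =>
      logG (x i) (x j)) (Measure.pi fun _ => μ) := fun i j hij =>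
    integrable_pair (Finset.mem_Ioi.mp hij).ne hG
  have hi3 : Integrable (fun x : Fin M → Euc n => γ * ∑ j, pot μ (x j))
      (Measure.pi fun _ => μ) := (integrable_finsetSum _ fun i _ => hi1 i).const_mul γ
  have hi4 : Integrable (fun x : Fin M → Euc n =>
      b * ∑ i, ∑ j ∈ Finset.Ioi i, logG (x i) (x j)) (Measure.pi fun _ => μ) :=
    (integrable_finsetSum _ fun i _ => integrable_finsetSum _ fun j hj => hi2 i j hj).const_mul b
  have hui : ∫ x, u x ∂(Measure.pi fun _ => μ) = (γ * M - b / 2 * (M * (M - 1))) * I := by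
    simp only [hu]
    rw [integral_sub hi3 hi4, integral_const_mul, integral_const_mul,
      integral_finsetSum _ fun i _ => hi1 i, integral_finsetSum _ fun i _ =>
      integrable_finsetSum _ fun j hj => hi2 i j hj]
    have e1 : ∀ i, ∫ x : Fin M → Euc n, ∑ j ∈ Finset.Ioi i, logG (x i) (x j)
        ∂(Measure.pi fun _ => μ) = (∑ _j ∈ Finset.Ioi i, (1 : ℝ)) * I := by
      intro i
      rw [integral_finsetSum _ fun j hj => hi2 i j hj, Finset.sum_mul]
      refine Finset.sum_congr rfl fun j hj => ?_
      rw [one_mul]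
      exact integral_pair (k := fun p => logG p.1 p.2) (Finset.mem_Ioi.mp hj).ne hGm
    simp only [e1, integral_eval _ hpm, hpotI]
    rw [← Finset.sum_mul, ← two_mul_sum_card_Ioi]
    simp only [Finset.sum_const, Finset.card_univ, Fintype.card_fin, nsmul_eq_mul]
    ring
  rw [← hui]
  refine (ofReal_exp_integral_le (hi3.sub hi4)).trans (lintegral_mono_ae ?_)
  have hne : ∀ i j : Fin M, i ≠ j →
      ∀ᵐ x ∂(Measure.pi fun _ : Fin M => μ), x i ≠ x j := by
    intro i j hij
    have h2 := ae_prod_ne (σ := μ) (measure_singleton_of_le hA)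
    rw [← map_pair_pi hij] at h2
    exact ae_of_ae_map (f := fun x : Fin M → Euc n => (x i, x j)) (by fun_prop) h2
  have hne' : ∀ᵐ x ∂(Measure.pi fun _ : Fin M => μ), ∀ i j : Fin M, i ≠ j → x i ≠ x j := by
    simp only [ae_all_iff]
    exact hne
  filter_upwards [hne'] with x hx
  refine ENNReal.ofReal_le_ofReal (le_of_eq ?_)
  rw [Pi.sub_apply, sub_eq_add_neg, Real.exp_add, mul_comm]
  congr 1
  rw [pairProd, Finset.mul_sum, ← Finset.sum_neg_distrib, Real.exp_sum]
  refine Finset.prod_congr rfl fun i _ => ?_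
  rw [Finset.mul_sum, ← Finset.sum_neg_distrib, Real.exp_sum]
  refine Finset.prod_congr rfl fun j hj => ?_
  have hpos : 0 < ‖x i - x j‖ :=
    norm_pos_iff.mpr (sub_ne_zero.mpr (hx i j (Finset.mem_Ioi.mp hj).ne))
  rw [Real.rpow_def_of_pos hpos, logG]
  congr 1
  ring

/-- The Gibbs measure is dominated by the product of the equilibrium measure, up to a factor
which is subexponential in the number of particles. -/
theorem IsEquilibrium.eventually_lintegral_gibbs_le [NeZero n] (h : IsEquilibrium V γ L μ)
    (hVc : Continuous V) {b : ℕ → ℝ} (hb : ∀ M, 0 < b M)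
    (hbγ : Tendsto (fun M : ℕ => b M * M) atTop (𝓝 γ)) {ε : ℝ} (hε : 0 < ε) :
    ∀ᶠ M : ℕ in atTop, ∀ F : (Fin M → Euc n) → ℝ≥0∞, Measurable F →
      ∫⁻ x, F x ∂(gibbs V (b M) M) ≤ ENNReal.ofReal (Real.exp (ε * M)) *
        ∫⁻ x, ENNReal.ofReal (Real.exp (ε * ∑ j, logWeight (x j))) * F x
          ∂(Measure.pi fun _ => μ) := by
  obtain ⟨C, c, hC0, hc0, hC, hc⟩ := h.exists_pot_bounds
  set I := ∫ p, logG p.1 p.2 ∂(μ.prod μ) with hI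
  have hL := h.pos
  have hγ0 : 0 ≤ γ := ge_of_tendsto hbγ (Eventually.of_forall fun M => by
    have := hb M
    positivity)
  -- With `b M ≤ γ + 1`, the regularisation error `b M · M · 2δc` is at most `εM/3`. Then `δ` is
  -- fixed, and the diagonal term `b M |log δ|` stays bounded as `M` grows.
  obtain ⟨δ, hδ, hδ1, hδε⟩ : ∃ δ : ℝ, 0 < δ ∧ δ ≤ 1 ∧ (γ + 1) * (2 * δ * c) ≤ ε / 3 := by
    refine ⟨min 1 (ε / (6 * (γ + 1) * (c + 1))), by positivity, min_le_left _ _, ?_⟩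
    have h1 := min_le_right 1 (ε / (6 * (γ + 1) * (c + 1)))
    calc (γ + 1) * (2 * min 1 (ε / (6 * (γ + 1) * (c + 1))) * c)
        ≤ (γ + 1) * (2 * (ε / (6 * (γ + 1) * (c + 1))) * (c + 1)) := by
          gcongr
          linarith
      _ = ε / 3 := by field_simp; norm_num
  have hsub : Tendsto (fun M : ℕ => |γ - b M * M|) atTop (𝓝 0) := by
    have h1 := (tendsto_const_nhds (x := γ)).sub hbγ
    rw [sub_self] at h1
    simpa using h1.abs
  have hev1 : ∀ᶠ M : ℕ in atTop, |γ - b M * M| * (1 + C + |I|) < ε / 3 := by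
    have h1 := hsub.mul_const (1 + C + |I|)
    rw [zero_mul] at h1
    exact h1.eventually (gt_mem_nhds (by positivity))
  have hev2 : ∀ᶠ M : ℕ in atTop, b M * M < γ + 1 := hbγ.eventually (gt_mem_nhds (by linarith))
  have hev3 : ∀ᶠ M : ℕ in atTop, (γ + 1) * (|I| / 2 + |Real.log δ|) ≤ ε / 3 * M := by
    have h1 : Tendsto (fun M : ℕ => ε / 3 * (M : ℝ)) atTop atTop :=
      tendsto_natCast_atTop_atTop.const_mul_atTop (by positivity)
    exact h1.eventually_ge_atTop _
  have hev4 : ∀ᶠ M : ℕ in atTop, |γ - b M * M| < ε := hsub.eventually (gt_mem_nhds hε)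
  filter_upwards [hev1, hev2, hev3, hev4, eventually_gt_atTop 0] with M h1 h2 h3 h4 hM F hF
  have hbM : 0 ≤ b M * M := by have := hb M; positivity
  -- The exponent in the lower bound for the partition function. The energy term `b M² I / 2` of the
  -- upper bound differs from it by `(b M - γ) M I - b M I / 2`, which is `o(M)`.
  set ℓ : ℝ := (γ * M - b M / 2 * (M * (M - 1))) * I with hℓ
  have hZ := h.le_partitionFunction hVc (hb M) M
  rw [lintegral_gibbs hVc (hb M) hF, h.lintegral_weight hVc hF]
  have hpt : ∀ x : Fin M → Euc n, ENNReal.ofReal (pairProd (b M) x *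
      Real.exp (γ * ∑ j, pot μ (x j))) * F x ≤ ENNReal.ofReal (Real.exp ℓ) *
        (ENNReal.ofReal (Real.exp (ε * M)) *
          (ENNReal.ofReal (Real.exp (ε * ∑ j, logWeight (x j))) * F x)) := by
    intro x
    rw [← mul_assoc, ← mul_assoc]
    gcongr
    rw [← ENNReal.ofReal_mul (by positivity), ← ENNReal.ofReal_mul (by positivity)]
    refine ENNReal.ofReal_le_ofReal ((h.pairProd_mul_exp_le hC (hc δ hδ hδ1) hδ hδ1 (hb M).le hM
      x).trans ?_)
    rw [← Real.exp_add, ← Real.exp_add, Real.exp_le_exp, Finset.sum_add_distrib, ← hI, hℓ]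
    simp only [Finset.sum_const, Finset.card_univ, Fintype.card_fin, nsmul_eq_mul]
    have hS : 0 ≤ ∑ j, logWeight (x j) := Finset.sum_nonneg fun j _ => logWeight_nonneg _
    have hM' : (0 : ℝ) < M := by exact_mod_cast hM
    have e1 := mul_le_mul_of_nonneg_right h4.le hS
    have e2 : b M * M * (M * (2 * δ * c)) ≤ ε / 3 * M := by
      calc b M * M * (M * (2 * δ * c)) ≤ (γ + 1) * (M * (2 * δ * c)) := by gcongr
        _ = (γ + 1) * (2 * δ * c) * M := by ring
        _ ≤ _ := by gcongr
    have e3 : |γ - b M * M| * (M * C) + (b M * M - γ) * M * I ≤ ε / 3 * M := by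
      have e4 : (b M * M - γ) * I ≤ |γ - b M * M| * |I| := by
        rw [abs_sub_comm, ← abs_mul]
        exact le_abs_self _
      have e5 := abs_nonneg (γ - b M * M)
      calc |γ - b M * M| * (M * C) + (b M * M - γ) * M * I
          = (|γ - b M * M| * C + (b M * M - γ) * I) * M := by ring
        _ ≤ (ε / 3) * M := by
          gcongr
          nlinarith
    have e6 : -(b M * M) / 2 * I - b M * M * Real.log δ ≤ ε / 3 * M := by
      refine le_trans ?_ h3
      have e7 := neg_abs_le I
      have e8 := neg_abs_le (Real.log δ)
      calc -(b M * M) / 2 * I - b M * M * Real.log δ = b M * M * (-I / 2 + -Real.log δ) := by ring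
        _ ≤ b M * M * (|I| / 2 + |Real.log δ|) := by
          gcongr
          · linarith
          · linarith
        _ ≤ _ := by gcongr
    linarith
  set J := ∫⁻ x, ENNReal.ofReal (Real.exp (ε * ∑ j, logWeight (x j))) * F x
          ∂(Measure.pi fun _ => μ) with hJ
  calc (partitionFunction V (b M) M)⁻¹ * (ENNReal.ofReal (L ^ M) *
        ∫⁻ x, ENNReal.ofReal (pairProd (b M) x * Real.exp (γ * ∑ j, pot μ (x j))) * F x
          ∂(Measure.pi fun _ => μ))
      ≤ (partitionFunction V (b M) M)⁻¹ * (ENNReal.ofReal (L ^ M) *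
        (ENNReal.ofReal (Real.exp ℓ) * (ENNReal.ofReal (Real.exp (ε * M)) * J))) := by
        gcongr
        rw [hJ, ← lintegral_const_mul' _ _ ENNReal.ofReal_ne_top, ← lintegral_const_mul' _ _
          ENNReal.ofReal_ne_top]
        exact lintegral_mono hpt
    _ = (partitionFunction V (b M) M)⁻¹ * (ENNReal.ofReal (L ^ M) *
        ENNReal.ofReal (Real.exp ℓ)) * (ENNReal.ofReal (Real.exp (ε * M)) * J) := by ring
    _ ≤ 1 * (ENNReal.ofReal (Real.exp (ε * M)) * J) := by
        gcongr
        refine (mul_le_mul_right hZ _).trans ?_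
        exact ENNReal.inv_mul_le_one _
    _ = _ := one_mul _

end Energy

/-! ### Law of large numbers under the Gibbs measures. -/

section LLN

variable {V : Euc n → ℝ} {γ Γ L : ℝ} {μ lam : Measure (Euc n)} {M : ℕ}

lemma lintegral_pi_exp_sum [IsProbabilityMeasure μ] {f : Euc n → ℝ} (hf : Measurable f) (M : ℕ) :
    ∫⁻ x : Fin M → Euc n, ENNReal.ofReal (Real.exp (∑ j, f (x j))) ∂(Measure.pi fun _ => μ) =
      (∫⁻ y, ENNReal.ofReal (Real.exp (f y)) ∂μ) ^ M := by
  induction M with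
  | zero =>
    rw [Measure.pi_of_empty _ (fun i => i.elim0), lintegral_dirac]
    simp
  | succ M ih =>
    rw [lintegral_pi_insertNth 0 (by fun_prop)]
    simp only [Fin.sum_univ_succAbove _ (0 : Fin (M + 1)), Fin.insertNth_apply_same,
      Fin.insertNth_apply_succAbove, Real.exp_add, ENNReal.ofReal_mul (Real.exp_pos _).le]
    have h1 : ∀ x : Fin M → Euc n, ∫⁻ y, ENNReal.ofReal (Real.exp (f y)) *
        ENNReal.ofReal (Real.exp (∑ j, f (x j))) ∂μ =
        (∫⁻ y, ENNReal.ofReal (Real.exp (f y)) ∂μ) *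
          ENNReal.ofReal (Real.exp (∑ j, f (x j))) := fun x =>
      lintegral_mul_const' _ _ ENNReal.ofReal_ne_top
    simp only [h1]
    rw [lintegral_const_mul _ (by fun_prop), ih, pow_succ']

lemma exp_mul_add_le {δ s K : ℝ} (hδ : 0 < δ) (hδ1 : δ ≤ 1) (hs : |s| ≤ K) (hK : K ≤ 1)
    (y : Euc n) :
    Real.exp (s + δ * logWeight y) ≤ 1 + s + K ^ 2 + 3 * δ * (1 + ‖y‖) ^ (2 : ℝ) := by
  have h1 : Real.exp s ≤ 1 + s + K ^ 2 := by
    have h2 := (abs_le.mp (Real.abs_exp_sub_one_sub_id_le (hs.trans hK))).2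
    have h3 : s ^ 2 ≤ K ^ 2 := sq_le_sq' (by linarith [(abs_le.mp hs).1]) (abs_le.mp hs).2
    linarith
  have h4 : Real.exp s ≤ 3 := by
    have h5 := Real.exp_le_exp.mpr ((abs_le.mp (hs.trans hK)).2)
    have h6 := Real.exp_one_lt_d9
    linarith
  have h7 := rpow_sub_one_le (b := δ / 2) (Γ := 1 / 2) (by linarith) (by linarith) y
  rw [show 2 * (δ / 2) = δ by ring, show (2 * (1 / 2 : ℝ) + 1) = 2 by norm_num,
    ← exp_mul_logWeight] at h7
  have h8 : 0 ≤ Real.exp (δ * logWeight y) - 1 :=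
    sub_nonneg.mpr (Real.one_le_exp (mul_nonneg hδ.le (logWeight_nonneg y)))
  rw [Real.exp_add]
  calc Real.exp s * Real.exp (δ * logWeight y)
      = Real.exp s + Real.exp s * (Real.exp (δ * logWeight y) - 1) := by ring
    _ ≤ (1 + s + K ^ 2) + 3 * (δ * (1 + ‖y‖) ^ (2 : ℝ)) := by gcongr
    _ = _ := by ring

/-- As `φ` is centred, the term linear in `t` disappears. What remains is quadratic in `t`, plus a
cost linear in `δ` for the weight. -/
lemma lintegral_exp_mul_add_le [IsProbabilityMeasure μ] {D : ℝ}
    (hD : ∫ y, (1 + ‖y‖) ^ (2 : ℝ) ∂μ ≤ D)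
    (hDi : Integrable (fun y : Euc n => (1 + ‖y‖) ^ (2 : ℝ)) μ) {φ : Euc n → ℝ} {δ t K : ℝ}
    (hφm : Measurable φ) (hφK : ∀ y, |φ y| ≤ K) (hφ0 : ∫ y, φ y ∂μ = 0)
    (hδ : 0 < δ) (hδ1 : δ ≤ 1) (htK : |t| * K ≤ 1) :
    ∫⁻ y, ENNReal.ofReal (Real.exp (t * φ y + δ * logWeight y)) ∂μ ≤
      ENNReal.ofReal (Real.exp ((|t| * K) ^ 2 + 3 * δ * D)) := by
  have hφi : Integrable φ μ := Integrable.of_bound hφm.aestronglyMeasurable K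
    (ae_of_all _ hφK)
  have hi0 : Integrable (fun y => 1 + t * φ y) μ := (integrable_const _).add (hφi.const_mul t)
  have hi1 : Integrable (fun y => 1 + t * φ y + (|t| * K) ^ 2) μ := hi0.add (integrable_const _)
  have hi2 := hDi.const_mul (3 * δ)
  have hs : ∀ y, |t * φ y| ≤ |t| * K := fun y => by
    rw [abs_mul]
    exact mul_le_mul_of_nonneg_left (hφK y) (abs_nonneg _)
  calc ∫⁻ y, ENNReal.ofReal (Real.exp (t * φ y + δ * logWeight y)) ∂μ
      ≤ ∫⁻ y, ENNReal.ofReal (1 + t * φ y + (|t| * K) ^ 2 + 3 * δ * (1 + ‖y‖) ^ (2 : ℝ)) ∂μ :=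
        lintegral_mono fun y => ENNReal.ofReal_le_ofReal (exp_mul_add_le hδ hδ1 (hs y) htK y)
    _ = ENNReal.ofReal (∫ y, (1 + t * φ y + (|t| * K) ^ 2 + 3 * δ * (1 + ‖y‖) ^ (2 : ℝ)) ∂μ) := by
        refine (ofReal_integral_eq_lintegral_ofReal (hi1.add hi2) (ae_of_all _ fun y => ?_)).symm
        exact (Real.exp_pos _).le.trans (exp_mul_add_le hδ hδ1 (hs y) htK y)
    _ ≤ _ := by
        refine ENNReal.ofReal_le_ofReal ?_
        rw [integral_add hi1 hi2, integral_add hi0 (integrable_const _), integral_add (integrable_const _) (hφi.const_mul t),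
          integral_const_mul, integral_const_mul, hφ0]
        simp only [integral_const, probReal_univ, smul_eq_mul, one_mul, mul_zero, add_zero]
        have h1 := Real.add_one_le_exp ((|t| * K) ^ 2 + 3 * δ * D)
        have h2 := mul_le_mul_of_nonneg_left hD (show 0 ≤ 3 * δ by linarith)
        linarith

/-- The potential grows at most like `ϑ`, so the density of `μ` is at most a multiple of `e^{-V} (1
+ |x|)^γ`. -/
lemma IsEquilibrium.integrable_rpow [NeZero n] (h : IsEquilibrium V γ L μ)
    (hVc : Continuous V) (hV : SuperLog V) (hγ : 0 ≤ γ) {κ : ℝ} (hκ : 0 ≤ κ) :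
    Integrable (fun y => (1 + ‖y‖) ^ κ) μ := by
  obtain ⟨C, c, hC0, hc0, hC, hc⟩ := h.exists_pot_bounds
  have hpm := h.measurable_pot'
  have hVm := hVc.measurable
  have hL := h.pos
  rw [h.withDensity, integrable_withDensity_ofReal (by have := h.measurable_pot; fun_prop)
    (fun x => by positivity)]
  have hi := (hV.integrable hVc (γ + κ) (by positivity)).const_mul (Real.exp (γ * C) / L)
  refine hi.mono' ?_ (ae_of_all _ fun x => ?_)
  · have := h.measurable_pot
    exact (by fun_prop : Measurable fun x => Real.exp (-(γ * ∫ z, logG x z ∂μ) - V x) / L *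
      (1 + ‖x‖) ^ κ).aestronglyMeasurable
  · rw [Real.norm_of_nonneg (by positivity), Real.rpow_add (by positivity), ← exp_mul_logWeight γ]
    have h1 : Real.exp (-(γ * ∫ z, logG x z ∂μ) - V x) ≤
        Real.exp (γ * C) * (Real.exp (-V x) * Real.exp (γ * logWeight x)) := by
      rw [← Real.exp_add, ← Real.exp_add, Real.exp_le_exp]
      have h2 := mul_le_mul_of_nonneg_left (neg_le_of_abs_le (hC x)) hγ
      rw [pot] at h2
      linarith
    calc _ ≤ Real.exp (γ * C) * (Real.exp (-V x) * Real.exp (γ * logWeight x)) / L *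
          (1 + ‖x‖) ^ κ := by gcongr
      _ = _ := by ring

/-- The exponential Chebyshev inequality in `L¹` form, from `u ≤ e^u` and `e^{|u|} ≤ e^u + e^{-u}`.
-/
lemma abs_le_add_exp {S t c m : ℝ} (ht : 0 < t) (hm : 0 < m) :
    m⁻¹ * |S| ≤ c + (t * m)⁻¹ * Real.exp (-(t * c * m)) * (Real.exp (t * S) +
      Real.exp (-t * S)) := by
  have h1 := Real.add_one_le_exp (t * |S| - t * c * m)
  have h2 : Real.exp (t * |S|) ≤ Real.exp (t * S) + Real.exp (-t * S) := by
    rcases abs_cases S with ⟨h, _⟩ | ⟨h, _⟩ <;> rw [h]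
    · linarith [Real.exp_pos (-t * S)]
    · rw [show t * -S = -t * S by ring]
      linarith [Real.exp_pos (t * S)]
  have h3 : t * |S| ≤ t * c * m + Real.exp (-(t * c * m)) *
      (Real.exp (t * S) + Real.exp (-t * S)) := by
    have h4 : Real.exp (t * |S| - t * c * m) = Real.exp (-(t * c * m)) * Real.exp (t * |S|) := by
      rw [← Real.exp_add]; congr 1; ring
    have h5 := mul_le_mul_of_nonneg_left h2 (Real.exp_pos (-(t * c * m))).le
    linarith
  have h6 := mul_le_mul_of_nonneg_left h3 (show 0 ≤ (t * m)⁻¹ by positivity)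
  calc m⁻¹ * |S| = (t * m)⁻¹ * (t * |S|) := by field_simp
    _ ≤ _ := h6
    _ = _ := by field_simp

variable {b : ℕ → ℝ}

/-- Law of large numbers for bounded centred functions. -/
lemma IsEquilibrium.tendsto_lintegral_gibbs_bounded [NeZero n] (h : IsEquilibrium V γ L μ)
    (hVc : Continuous V) (hV : SuperLog V) (hb : ∀ M, 0 < b M)
    (hbγ : Tendsto (fun M : ℕ => b M * M) atTop (𝓝 γ)) {φ : Euc n → ℝ} (hφm : Measurable φ)
    {K : ℝ} (hφK : ∀ y, |φ y| ≤ K) (hφ0 : ∫ y, φ y ∂μ = 0) :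
    Tendsto (fun M : ℕ => ∫⁻ x, ENNReal.ofReal ((M : ℝ)⁻¹ * |∑ j, φ (x j)|)
      ∂(gibbs V (b M) M)) atTop (𝓝 0) := by
  have hp := h.prob
  have hγ0 : 0 ≤ γ := ge_of_tendsto hbγ (Eventually.of_forall fun M => by
    have := hb M
    positivity)
  wlog hK1 : 1 ≤ K generalizing K
  · exact this (fun y => (hφK y).trans (le_max_left K 1)) (le_max_right _ _)
  have hDi := h.integrable_rpow hVc hV hγ0 (κ := 2) zero_le_two
  set D := ∫ y, (1 + ‖y‖) ^ (2 : ℝ) ∂μ with hD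
  have hD0 : 0 ≤ D := integral_nonneg fun y => by positivity
  rw [ENNReal.tendsto_nhds_zero]
  intro ε' hε'
  obtain ⟨ε, hε, hε1, hεε⟩ : ∃ ε : ℝ, 0 < ε ∧ ε ≤ 1 ∧ ENNReal.ofReal (2 * ε) ≤ ε' := by
    rcases eq_or_ne ε' ∞ with rfl | h'
    · exact ⟨1, one_pos, le_rfl, le_top⟩
    · have hpos := ENNReal.toReal_pos hε'.ne' h'
      refine ⟨min 1 (ε'.toReal / 2), by positivity, min_le_left _ _, ?_⟩
      rw [ENNReal.ofReal_le_iff_le_toReal h']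
      linarith [min_le_right 1 (ε'.toReal / 2)]
  -- For this `t` the quadratic cost `(tK)²` equals `tε/2`, half of the Chebyshev gain `tε`. The
  -- parameter `δ` below is chosen so that the change of measure uses at most the other half.
  set t : ℝ := ε / (2 * K ^ 2) with ht
  have ht0 : 0 < t := by positivity
  have htK : |t| * K ≤ 1 := by
    rw [abs_of_pos ht0, ht, div_mul_eq_mul_div, div_le_one (by positivity)]
    nlinarith
  set δ : ℝ := min 1 (ε * t / (2 * (1 + 3 * D))) with hδ
  have hδ0 : 0 < δ := by positivity
  have hδ1 : δ ≤ 1 := min_le_left _ _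
  have hδ2 : δ * (1 + 3 * D) ≤ ε * t / 2 := by
    calc δ * (1 + 3 * D) ≤ ε * t / (2 * (1 + 3 * D)) * (1 + 3 * D) := by
          gcongr
          exact min_le_right _ _
      _ = _ := by field_simp
  have hexp : -(t * ε) + δ + ((|t| * K) ^ 2 + 3 * δ * D) ≤ 0 := by
    have e1 : (|t| * K) ^ 2 = t * ε / 2 := by
      rw [abs_of_pos ht0, ht]
      field_simp
    rw [e1]
    linarith
  have hev : ∀ᶠ M : ℕ in atTop, 2 * (t * M)⁻¹ ≤ ε := by
    have h1 : Tendsto (fun M : ℕ => 2 * (t * (M : ℝ))⁻¹) atTop (𝓝 (2 * 0)) :=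
      ((tendsto_natCast_atTop_atTop.const_mul_atTop ht0).inv_tendsto_atTop).const_mul 2
    rw [mul_zero] at h1
    exact h1.eventually (Iic_mem_nhds hε)
  filter_upwards [h.eventually_lintegral_gibbs_le hVc hb hbγ hδ0, hev, eventually_gt_atTop 0] with
    M hM hMε hM0
  have hP := isProbabilityMeasure_gibbs hVc hV (hb M) M
  have hM0' : (0 : ℝ) < M := by exact_mod_cast hM0
  refine le_trans ?_ hεε
  -- Both signs of the exponent are handled at once. Under the product measure the exponential
  -- moment factorises, and `hexp` absorbs the subexponential comparison factor.
  have hside : ∀ s : ℝ, |s| = |t| → ∫⁻ x, ENNReal.ofReal (Real.exp (s * ∑ j, φ (x j)))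
      ∂(gibbs V (b M) M) ≤ ENNReal.ofReal (Real.exp (t * ε * M)) := by
    intro s hs
    refine (hM _ (by fun_prop)).trans ?_
    have e1 : ∀ x : Fin M → Euc n, ENNReal.ofReal (Real.exp (δ * ∑ j, logWeight (x j))) *
        ENNReal.ofReal (Real.exp (s * ∑ j, φ (x j))) =
        ENNReal.ofReal (Real.exp (∑ j, (s * φ (x j) + δ * logWeight (x j)))) := by
      intro x
      rw [← ENNReal.ofReal_mul (Real.exp_pos _).le, ← Real.exp_add, Finset.sum_add_distrib,
        ← Finset.mul_sum, ← Finset.mul_sum, add_comm]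
    simp only [e1]
    have hmϑ := measurable_logWeight (n := n)
    rw [lintegral_pi_exp_sum (f := fun y => s * φ y + δ * logWeight y) (by fun_prop)]
    have h2 := lintegral_exp_mul_add_le hD.ge hDi hφm hφK hφ0 hδ0 hδ1 (t := s) (by rwa [hs])
    rw [hs] at h2
    calc _ ≤ ENNReal.ofReal (Real.exp (δ * M)) *
          ENNReal.ofReal (Real.exp ((|t| * K) ^ 2 + 3 * δ * D)) ^ M := by gcongr
      _ = ENNReal.ofReal (Real.exp ((δ + ((|t| * K) ^ 2 + 3 * δ * D)) * M)) := by
          rw [← ENNReal.ofReal_pow (Real.exp_pos _).le, ← Real.exp_nat_mul,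
            ← ENNReal.ofReal_mul (Real.exp_pos _).le, ← Real.exp_add]
          congr 2
          ring
      _ ≤ _ := by
          refine ENNReal.ofReal_le_ofReal (Real.exp_le_exp.mpr ?_)
          exact mul_le_mul_of_nonneg_right (by linarith) hM0'.le
  set q : ℝ := (t * M)⁻¹ * Real.exp (-(t * ε * M)) with hq
  have hq0 : 0 ≤ q := by positivity
  calc ∫⁻ x, ENNReal.ofReal ((M : ℝ)⁻¹ * |∑ j, φ (x j)|) ∂(gibbs V (b M) M)
      ≤ ∫⁻ x, (ENNReal.ofReal ε + ENNReal.ofReal q *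
        (ENNReal.ofReal (Real.exp (t * ∑ j, φ (x j))) +
          ENNReal.ofReal (Real.exp (-t * ∑ j, φ (x j))))) ∂(gibbs V (b M) M) := by
        refine lintegral_mono fun x => ?_
        rw [← ENNReal.ofReal_add (Real.exp_pos _).le (Real.exp_pos _).le, ← ENNReal.ofReal_mul hq0,
          ← ENNReal.ofReal_add hε.le (by positivity)]
        exact ENNReal.ofReal_le_ofReal (abs_le_add_exp ht0 hM0')
    _ = ENNReal.ofReal ε + ENNReal.ofReal q *
        (∫⁻ x, ENNReal.ofReal (Real.exp (t * ∑ j, φ (x j))) ∂(gibbs V (b M) M) +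
          ∫⁻ x, ENNReal.ofReal (Real.exp (-t * ∑ j, φ (x j))) ∂(gibbs V (b M) M)) := by
        rw [lintegral_add_left measurable_const, lintegral_const_mul _ (by fun_prop),
          lintegral_add_left (by fun_prop)]
        simp
    _ ≤ ENNReal.ofReal ε + ENNReal.ofReal q *
        (ENNReal.ofReal (Real.exp (t * ε * M)) + ENNReal.ofReal (Real.exp (t * ε * M))) := by
        gcongr
        · exact hside t rfl
        · exact hside (-t) (abs_neg t)
    _ = ENNReal.ofReal (ε + 2 * (t * M)⁻¹) := by
        rw [← ENNReal.ofReal_add (Real.exp_pos _).le (Real.exp_pos _).le, ← ENNReal.ofReal_mul hq0,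
          ← ENNReal.ofReal_add hε.le (by positivity), hq]
        congr 2
        have h3 : Real.exp (-(t * ε * M)) * Real.exp (t * ε * M) = 1 := by
          rw [← Real.exp_add]; simp
        linear_combination 2 * (t * M)⁻¹ * h3
    _ ≤ _ := ENNReal.ofReal_le_ofReal (by linarith)

/-- Truncation at level `K`. -/
def trunc (K u : ℝ) : ℝ := max (-K) (min K u)

lemma abs_trunc_le {K u : ℝ} (hK : 0 ≤ K) : |trunc K u| ≤ K := by
  rw [trunc, abs_le]
  exact ⟨le_max_left _ _, max_le (by linarith) (min_le_left _ _)⟩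

lemma abs_sub_trunc_le {K u : ℝ} (hK : 0 ≤ K) : |u - trunc K u| ≤ |u| := by
  rw [trunc]
  rcases le_total (-K) (min K u) with h1 | h1
  · rw [max_eq_right h1]
    rcases le_total K u with h2 | h2
    · rw [min_eq_left h2, abs_of_nonneg (by linarith), abs_of_nonneg (by linarith)]
      linarith
    · rw [min_eq_right h2, sub_self, abs_zero]
      exact abs_nonneg u
  · rw [max_eq_left h1]
    rcases le_total K u with h2 | h2
    · rw [min_eq_left h2] at h1
      rw [show K = 0 by linarith]
      simp
    · rw [min_eq_right h2] at h1
      rw [abs_of_nonpos (by linarith), abs_of_nonpos (by linarith)]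
      linarith

lemma trunc_eq {K u : ℝ} (h : |u| ≤ K) : trunc K u = u := by
  have := abs_le.mp h
  rw [trunc, min_eq_right this.2, max_eq_right this.1]

lemma tendsto_integral_abs_sub_trunc {ν : Measure (Euc n)} {φ : Euc n → ℝ}
    (hφm : Measurable φ) (hφ : Integrable φ ν) :
    Tendsto (fun K : ℕ => ∫ y, |φ y - trunc K (φ y)| ∂ν) atTop (𝓝 0) := by
  have h1 : Tendsto (fun K : ℕ => ∫ y, |φ y - trunc K (φ y)| ∂ν) atTop
      (𝓝 (∫ _y, (0 : ℝ) ∂ν)) := by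
    refine tendsto_integral_of_dominated_convergence (fun y => |φ y|) (fun K => ?_) hφ.abs
      (fun K => ae_of_all _ fun y => ?_) (ae_of_all _ fun y => ?_)
    · unfold trunc
      exact (by fun_prop : Measurable fun y => |φ y - max (-(K : ℝ)) (min (K : ℝ) (φ y))|)
        |>.aestronglyMeasurable
    · rw [Real.norm_eq_abs, abs_abs]
      exact abs_sub_trunc_le K.cast_nonneg
    · refine tendsto_const_nhds.congr' ?_
      filter_upwards [eventually_ge_atTop ⌈|φ y|⌉₊] with K hK
      rw [trunc_eq ((Nat.le_ceil _).trans (by exact_mod_cast hK))]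
      simp
  simpa using h1

/-- Law of large numbers for the Gibbs measures. -/
theorem IsEquilibrium.tendsto_lintegral_gibbs [NeZero n] (h : IsEquilibrium V γ L μ)
    (hVc : Continuous V) (hV : SuperLog V) (hl : IsDominating V Γ lam) (hb : ∀ M, 0 < b M)
    (hbγ : Tendsto (fun M : ℕ => b M * M) atTop (𝓝 γ)) (hbΓ : ∀ᶠ M : ℕ in atTop, b M * M ≤ Γ)
    {φ : Euc n → ℝ} (hφm : Measurable φ) (hφμ : Integrable φ μ) (hφl : Integrable φ lam) :
    Tendsto (fun M : ℕ => ∫⁻ x, ENNReal.ofReal |(M : ℝ)⁻¹ * ∑ j, φ (x j) - ∫ y, φ y ∂μ|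
      ∂(gibbs V (b M) M)) atTop (𝓝 0) := by
  have hp := h.prob
  rw [ENNReal.tendsto_nhds_zero]
  intro ε' hε'
  obtain ⟨ε, hε, hεε⟩ : ∃ ε : ℝ, 0 < ε ∧ ENNReal.ofReal (3 * ε) ≤ ε' := by
    rcases eq_or_ne ε' ∞ with rfl | h'
    · exact ⟨1, one_pos, le_top⟩
    · refine ⟨ε'.toReal / 3, by have := ENNReal.toReal_pos hε'.ne' h'; positivity, ?_⟩
      rw [ENNReal.ofReal_le_iff_le_toReal h']
      linarith
  -- The truncation has to be harmless twice: under `μ` for the centring constant, and under `lam`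
  -- because one-particle domination bounds the truncated part of the empirical mean.
  obtain ⟨K, hK1, hK2⟩ := ((tendsto_integral_abs_sub_trunc hφm hφμ).eventually
    (gt_mem_nhds hε)).and ((tendsto_integral_abs_sub_trunc hφm hφl).eventually
    (gt_mem_nhds hε)) |>.exists
  have hK0 : (0 : ℝ) ≤ K := K.cast_nonneg
  set τ : Euc n → ℝ := fun y => trunc K (φ y) with hτ
  have hτm : Measurable τ := by
    simp only [hτ, trunc]
    fun_prop
  have hτi : Integrable τ μ := Integrable.of_bound hτm.aestronglyMeasurable K
    (ae_of_all _ fun y => abs_trunc_le hK0)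
  set m := ∫ y, τ y ∂μ with hm
  have hmK : |m| ≤ K := by
    refine (abs_integral_le_integral_abs).trans ?_
    calc ∫ y, |τ y| ∂μ ≤ ∫ _y, (K : ℝ) ∂μ :=
          integral_mono hτi.abs (integrable_const _) fun y => abs_trunc_le hK0
      _ = K := by simp
  have hψ := h.tendsto_lintegral_gibbs_bounded hVc hV hb hbγ (φ := fun y => τ y - m)
    (by fun_prop) (K := K + K) (fun y => (abs_sub _ _).trans (add_le_add (abs_trunc_le hK0) hmK))
    (by rw [integral_sub hτi (integrable_const _)]; simp [hm])
  have hψ' := (ENNReal.tendsto_nhds_zero.mp hψ) (ENNReal.ofReal ε) (by simpa using hε)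
  filter_upwards [hψ', hbΓ, eventually_gt_atTop 0] with M hM hMΓ hM0
  have hP := isProbabilityMeasure_gibbs hVc hV (hb M) M
  have hM0' : (0 : ℝ) < M := by exact_mod_cast hM0
  refine le_trans ?_ hεε
  have hpt : ∀ x : Fin M → Euc n, |(M : ℝ)⁻¹ * ∑ j, φ (x j) - ∫ y, φ y ∂μ| ≤
      (M : ℝ)⁻¹ * |∑ j, (τ (x j) - m)| + (M : ℝ)⁻¹ * ∑ j, |φ (x j) - τ (x j)| + ε := by
    intro x
    have e1 : (M : ℝ)⁻¹ * ∑ j, φ (x j) - ∫ y, φ y ∂μ = (M : ℝ)⁻¹ * (∑ j, (τ (x j) - m)) +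
        (M : ℝ)⁻¹ * (∑ j, (φ (x j) - τ (x j))) + (m - ∫ y, φ y ∂μ) := by
      simp only [Finset.sum_sub_distrib, Finset.sum_const, Finset.card_univ, Fintype.card_fin,
        nsmul_eq_mul]
      field_simp
      ring
    have e2 : |m - ∫ y, φ y ∂μ| ≤ ε := by
      rw [hm, ← integral_sub hτi hφμ]
      refine (abs_integral_le_integral_abs).trans ?_
      simp only [abs_sub_comm (τ _)]
      exact hK1.le
    rw [e1]
    refine (abs_add_three _ _ _).trans ?_
    rw [abs_mul, abs_mul, abs_of_pos (inv_pos.mpr hM0')]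
    gcongr
    exact Finset.abs_sum_le_sum_abs _ _
  calc ∫⁻ x, ENNReal.ofReal |(M : ℝ)⁻¹ * ∑ j, φ (x j) - ∫ y, φ y ∂μ| ∂(gibbs V (b M) M)
      ≤ ∫⁻ x, (ENNReal.ofReal ((M : ℝ)⁻¹ * |∑ j, (τ (x j) - m)|) + (M : ℝ≥0∞)⁻¹ *
          ∑ j, ENNReal.ofReal |φ (x j) - τ (x j)| + ENNReal.ofReal ε) ∂(gibbs V (b M) M) := by
        refine lintegral_mono fun x => ?_
        refine (ENNReal.ofReal_le_ofReal (hpt x)).trans (le_of_eq ?_)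
        rw [ENNReal.ofReal_add (by positivity) hε.le, ENNReal.ofReal_add (by positivity)
          (by positivity), ENNReal.ofReal_mul (by positivity : (0 : ℝ) ≤ (M : ℝ)⁻¹)
            (q := ∑ j, |φ (x j) - τ (x j)|),
          ENNReal.ofReal_inv_of_pos hM0', ENNReal.ofReal_natCast,
          ENNReal.ofReal_sum_of_nonneg fun _ _ => abs_nonneg _]
    _ = ∫⁻ x, ENNReal.ofReal ((M : ℝ)⁻¹ * |∑ j, (τ (x j) - m)|) ∂(gibbs V (b M) M) +
        (M : ℝ≥0∞)⁻¹ * ∫⁻ x, ∑ j, ENNReal.ofReal |φ (x j) - τ (x j)| ∂(gibbs V (b M) M) +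
          ENNReal.ofReal ε := by
        rw [lintegral_add_left (by fun_prop), lintegral_add_left (by fun_prop),
          lintegral_const_mul _ (by fun_prop)]
        simp
    _ ≤ ENNReal.ofReal ε + (M : ℝ≥0∞)⁻¹ * (M * ENNReal.ofReal ε) + ENNReal.ofReal ε := by
        gcongr
        refine (lintegral_gibbs_sum_le hVc hV (hb M) hl hMΓ
          (φ := fun y => ENNReal.ofReal |φ y - τ y|) (by fun_prop)).trans ?_
        gcongr
        rw [← ofReal_integral_eq_lintegral_ofReal]
        · exact ENNReal.ofReal_le_ofReal hK2.le
        · refine hφl.abs.mono' (by fun_prop : Measurable fun y => |φ y - τ y|).aestronglyMeasurable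
            (ae_of_all _ fun y => ?_)
          rw [Real.norm_eq_abs, abs_abs]
          exact abs_sub_trunc_le hK0
        · exact ae_of_all _ fun y => abs_nonneg _
    _ = ENNReal.ofReal (3 * ε) := by
        rw [← mul_assoc, ENNReal.inv_mul_cancel (by simp [hM0.ne']) (by simp), one_mul,
          ← ENNReal.ofReal_add hε.le hε.le, ← ENNReal.ofReal_add (by positivity) hε.le]
        congr 1
        ring

end LLN

/-! ### Limits of the interaction factor in the bulk and at the edge, and of the ratio of partition
functions. -/

section Interaction

variable {V : Euc n → ℝ} {γ Γ L : ℝ} {μ lam : Measure (Euc n)} {M : ℕ} {b : ℝ}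

/-- Below the level `R` the exponential is Lipschitz; above it, the square pays. Convergence of
exponents in `L¹` and a bounded second moment thus give convergence of the exponentials in `L¹`. -/
lemma abs_exp_sub_exp_le {u v R : ℝ} (hv : v ≤ R) :
    |Real.exp u - Real.exp v| ≤ Real.exp (-R) * Real.exp u ^ 2 + Real.exp R * |u - v| := by
  rcases le_total u R with hu | hu
  · have key : ∀ s t : ℝ, s ≤ R → Real.exp s - Real.exp t ≤ Real.exp R * |s - t| := by
      intro s t hs
      have h1 := Real.add_one_le_exp (t - s)
      have h2 : Real.exp t = Real.exp s * Real.exp (t - s) := by rw [← Real.exp_add]; congr 1; ring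
      calc Real.exp s - Real.exp t = Real.exp s * (1 - Real.exp (t - s)) := by rw [h2]; ring
        _ ≤ Real.exp s * |s - t| := by
            gcongr
            linarith [le_abs_self (s - t)]
        _ ≤ _ := by gcongr
    have h1 := key u v hu
    have h2 := key v u hv
    rw [abs_sub_comm v u] at h2
    have h3 : 0 ≤ Real.exp (-R) * Real.exp u ^ 2 := by positivity
    rw [abs_le]
    constructor <;> linarith
  · have h1 : Real.exp u ≤ Real.exp (-R) * Real.exp u ^ 2 := by
      rw [sq, ← mul_assoc, ← Real.exp_add]
      exact le_mul_of_one_le_left (Real.exp_pos _).le (Real.one_le_exp (by linarith))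
    have h2 := Real.exp_le_exp.mpr (hv.trans hu)
    rw [abs_of_nonneg (by linarith)]
    have h3 : 0 ≤ Real.exp R * |u - v| := by positivity
    linarith [Real.exp_pos v]

/-- At a coincidence the interaction factor vanishes while `exp (b ∑ log ‖y - x_j‖)` does not, as
`log 0 = 0`. Coincidences are null because the dominating measure has no atoms. -/
lemma ae_gibbs_ne [NeZero n] (hVc : Continuous V) (hV : SuperLog V) (hb : 0 < b)
    (hl : IsDominating V Γ lam) (hbM : b * M ≤ Γ) (y : Euc n) :
    ∀ᵐ x : Fin M → Euc n ∂(gibbs V b M), ∀ j, y ≠ x j := by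
  obtain ⟨A, hA⟩ := hl.exists_le'
  have h0 := measure_singleton_of_le hA y
  have h1 := lintegral_gibbs_sum_le hVc hV hb hl hbM (φ := Set.indicator {y} 1)
    (measurable_one.indicator (measurableSet_singleton y))
  rw [lintegral_indicator_one (measurableSet_singleton y), h0, mul_zero, nonpos_iff_eq_zero] at h1
  have hm : Measurable fun x : Fin M → Euc n =>
      ∑ j, Set.indicator {y} (1 : Euc n → ℝ≥0∞) (x j) :=
    Finset.measurable_sum _ fun j _ =>
      (measurable_one.indicator (measurableSet_singleton y)).comp (measurable_pi_apply j)
  rw [lintegral_eq_zero_iff hm] at h1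
  filter_upwards [h1] with x hx j hj
  simp only [Pi.zero_apply, Finset.sum_eq_zero_iff, Finset.mem_univ, true_implies] at hx
  have := hx j
  simp [hj] at this

lemma measurable_inter_right (b : ℝ) (y : Euc n) :
    Measurable fun x : Fin M → Euc n => inter b y x := by
  unfold inter
  fun_prop

lemma inter_eq_exp {y : Euc n} {x : Fin M → Euc n} (h : ∀ j, y ≠ x j) :
    inter b y x = Real.exp (b * ∑ j, Real.log ‖y - x j‖) := by
  rw [inter, Finset.mul_sum, Real.exp_sum]
  refine Finset.prod_congr rfl fun j _ => ?_
  rw [Real.rpow_def_of_pos (norm_pos_iff.mpr (sub_ne_zero.mpr (h j)))]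
  congr 1
  ring

lemma inter_sq (b : ℝ) (y : Euc n) (x : Fin M → Euc n) :
    inter b y x ^ 2 = inter (2 * b) y x := by
  rw [inter, inter, ← Finset.prod_pow]
  refine Finset.prod_congr rfl fun j _ => ?_
  rw [← Real.rpow_natCast, ← Real.rpow_mul (norm_nonneg _)]
  congr 1
  push_cast
  ring

/-- Uniform second moment bound for the interaction factor. -/
lemma exists_lintegral_inter_sq_le [NeZero n] (hVc : Continuous V) (hV : SuperLog V)
    (hΓ : 0 ≤ Γ) (hl : IsDominating V Γ lam) :
    ∃ C : ℝ, 0 < C ∧ ∀ (M : ℕ) (b : ℝ), 0 < b → b * M ≤ Γ → ∀ y : Euc n,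
      ∫⁻ x : Fin M → Euc n, ENNReal.ofReal (inter b y x ^ 2) ∂(gibbs V b M) ≤
        ENNReal.ofReal (C * (1 + ‖y‖) ^ (2 * (b * M))) := by
  obtain ⟨C, hC, h⟩ := exists_lintegral_gibbs_rpow_le hVc hV hΓ hl
  refine ⟨C, hC, fun M b hb hbM y => ?_⟩
  calc _ ≤ ∫⁻ x : Fin M → Euc n, ENNReal.ofReal ((1 + ‖y‖) ^ (2 * (b * M))) *
        ENNReal.ofReal (∏ j, (1 + ‖x j‖) ^ (2 * b)) ∂(gibbs V b M) := by
        refine lintegral_mono fun x => ?_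
        rw [← ENNReal.ofReal_mul (by positivity), inter_sq, ← mul_assoc]
        exact ENNReal.ofReal_le_ofReal (inter_le (by positivity) y x)
    _ ≤ ENNReal.ofReal ((1 + ‖y‖) ^ (2 * (b * M))) * ENNReal.ofReal C := by
        rw [lintegral_const_mul' _ _ ENNReal.ofReal_ne_top]
        gcongr
        exact h M b hb hbM
    _ = _ := by rw [← ENNReal.ofReal_mul (by positivity), mul_comm]

/-- Serves two regimes: `ℓ = 0` and `v = -γ U(y)` for a fixed `y`, and `ℓ = log r`, `v = 0` near the
edge, at distance of order `r` from the origin. -/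
lemma lintegral_abs_inter_sub_le [NeZero n] (hVc : Continuous V) (hV : SuperLog V)
    (hl : IsDominating V Γ lam) {C : ℝ} (hC : ∀ (M : ℕ) (b : ℝ), 0 < b → b * M ≤ Γ →
      ∀ y : Euc n, ∫⁻ x : Fin M → Euc n, ENNReal.ofReal (inter b y x ^ 2) ∂(gibbs V b M) ≤
        ENNReal.ofReal (C * (1 + ‖y‖) ^ (2 * (b * M))))
    (hb : 0 < b) (hbM : b * M ≤ Γ) (y : Euc n) (ℓ : ℝ) {v R : ℝ} (hv : v ≤ R) :
    ∫⁻ x : Fin M → Euc n, ENNReal.ofReal |inter b y x * Real.exp (-(b * M * ℓ)) - Real.exp v|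
      ∂(gibbs V b M) ≤ ENNReal.ofReal (Real.exp (-R) * (Real.exp (-(b * M * ℓ)) ^ 2 *
        (C * (1 + ‖y‖) ^ (2 * (b * M))))) + ENNReal.ofReal (Real.exp R) *
      ∫⁻ x : Fin M → Euc n, ENNReal.ofReal |b * ∑ j, (Real.log ‖y - x j‖ - ℓ) - v|
        ∂(gibbs V b M) := by
  have hm1 := measurable_inter_right (M := M) b y
  calc _ ≤ ∫⁻ x : Fin M → Euc n, (ENNReal.ofReal (Real.exp (-R) * Real.exp (-(b * M * ℓ)) ^ 2) *
        ENNReal.ofReal (inter b y x ^ 2) + ENNReal.ofReal (Real.exp R) *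
        ENNReal.ofReal |b * ∑ j, (Real.log ‖y - x j‖ - ℓ) - v|) ∂(gibbs V b M) := by
        refine lintegral_mono_ae ?_
        filter_upwards [ae_gibbs_ne hVc hV hb hl hbM y] with x hx
        rw [← ENNReal.ofReal_mul (by positivity), ← ENNReal.ofReal_mul (by positivity),
          ← ENNReal.ofReal_add (by positivity) (by positivity)]
        refine ENNReal.ofReal_le_ofReal ?_
        have e1 : inter b y x * Real.exp (-(b * M * ℓ)) =
            Real.exp (b * ∑ j, (Real.log ‖y - x j‖ - ℓ)) := by
          rw [inter_eq_exp hx, ← Real.exp_add, Finset.sum_sub_distrib]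
          simp only [Finset.sum_const, Finset.card_univ, Fintype.card_fin, nsmul_eq_mul]
          congr 1
          ring
        rw [e1]
        refine (abs_exp_sub_exp_le hv).trans (le_of_eq ?_)
        rw [← e1]
        ring
    _ = ENNReal.ofReal (Real.exp (-R) * Real.exp (-(b * M * ℓ)) ^ 2) *
        ∫⁻ x, ENNReal.ofReal (inter b y x ^ 2) ∂(gibbs V b M) + ENNReal.ofReal (Real.exp R) *
        ∫⁻ x : Fin M → Euc n, ENNReal.ofReal |b * ∑ j, (Real.log ‖y - x j‖ - ℓ) - v|
          ∂(gibbs V b M) := by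
        rw [lintegral_add_left (by fun_prop), lintegral_const_mul' _ _ ENNReal.ofReal_ne_top,
          lintegral_const_mul' _ _ ENNReal.ofReal_ne_top]
    _ ≤ _ := by
        refine add_le_add_left ?_ _
        rw [← mul_assoc, ENNReal.ofReal_mul
          (p := Real.exp (-R) * Real.exp (-(b * M * ℓ)) ^ 2) (by positivity)]
        exact mul_le_mul_right (hC M b hb hbM y) _

/-- A double limit: first `M → ∞` at a fixed level `R`, then `R → ∞`. -/
lemma ENNReal.tendsto_zero_of_forall_le {u : ℕ → ℝ≥0∞} {f : ℕ → ℝ} {D : ℝ} (r₀ : ℝ)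
    (h : ∀ R : ℝ, r₀ ≤ R → ∃ w : ℕ → ℝ≥0∞, Tendsto w atTop (𝓝 0) ∧
      ∀ᶠ M in atTop, u M ≤ ENNReal.ofReal (Real.exp (-R) * f M) + w M)
    (hf : ∀ᶠ M in atTop, f M ≤ D) : Tendsto u atTop (𝓝 0) := by
  rw [ENNReal.tendsto_nhds_zero]
  intro ε hε
  have h1 : Tendsto (fun R : ℝ => ENNReal.ofReal (Real.exp (-R) * D)) atTop (𝓝 0) := by
    have h2 := (Real.tendsto_exp_neg_atTop_nhds_zero.mul_const D)
    rw [zero_mul] at h2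
    simpa using ENNReal.tendsto_ofReal h2
  have hε2 : 0 < ε / 2 := ENNReal.half_pos hε.ne'
  obtain ⟨R, hR1, hR2⟩ := ((ENNReal.tendsto_nhds_zero.mp h1 _ hε2).and
    (eventually_ge_atTop r₀)).exists
  obtain ⟨w, hw, hu⟩ := h R hR2
  filter_upwards [hu, hf, ENNReal.tendsto_nhds_zero.mp hw _ hε2] with M h1 h2 h3
  calc u M ≤ ENNReal.ofReal (Real.exp (-R) * f M) + w M := h1
    _ ≤ ENNReal.ofReal (Real.exp (-R) * D) + w M := by gcongr
    _ ≤ ε / 2 + ε / 2 := add_le_add hR1 h3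
    _ = ε := ENNReal.add_halves ε

variable {b : ℕ → ℝ}

/-- The interaction factor converges in `L¹` to `e^{-γ U(y)}`. -/
lemma IsEquilibrium.tendsto_lintegral_inter [NeZero n] (h : IsEquilibrium V γ L μ)
    (hVc : Continuous V) (hV : SuperLog V) (hΓ : 0 ≤ Γ) (hl : IsDominating V Γ lam)
    (hb : ∀ M, 0 < b M)
    (hbγ : Tendsto (fun M : ℕ => b M * M) atTop (𝓝 γ)) (hbΓ : ∀ᶠ M : ℕ in atTop, b M * M ≤ Γ)
    (y : Euc n) :
    Tendsto (fun M : ℕ => ∫⁻ x : Fin M → Euc n,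
      ENNReal.ofReal |inter (b M) y x - Real.exp (-(γ * pot μ y))| ∂(gibbs V (b M) M))
      atTop (𝓝 0) := by
  have hp := h.prob
  obtain ⟨A, hA⟩ := h.exists_le
  obtain ⟨A', hA'⟩ := hl.exists_le'
  have hfin := hl.isFiniteMeasure
  obtain ⟨C, hC, hCle⟩ := exists_lintegral_inter_sq_le hVc hV hΓ hl
  have hφm : Measurable fun z : Euc n => Real.log ‖y - z‖ := by fun_prop
  have hLLN := h.tendsto_lintegral_gibbs hVc hV hl hb hbγ hbΓ hφm
    (integrable_log_norm_sub hA h.integrable_logWeight y)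
    (integrable_log_norm_sub hA' hl.integrable_logWeight y)
  set m := ∫ z, Real.log ‖y - z‖ ∂μ with hm
  -- The kernel is minus the logarithm, so the exponent `γ m` is `-γ U(y)`.
  have hpot : pot μ y = -m := by
    rw [hm, ← integral_neg]
    rfl
  refine ENNReal.tendsto_zero_of_forall_le (f := fun M => C * (1 + ‖y‖) ^ (2 * (b M * M)))
    (D := C * (1 + ‖y‖) ^ (2 * Γ)) (-(γ * pot μ y)) (fun R hR => ?_) ?_
  · refine ⟨fun M => ENNReal.ofReal (Real.exp R) * (ENNReal.ofReal (b M * M) *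
      (∫⁻ x : Fin M → Euc n, ENNReal.ofReal |(M : ℝ)⁻¹ * ∑ j, Real.log ‖y - x j‖ - m|
        ∂(gibbs V (b M) M)) + ENNReal.ofReal (|b M * M - γ| * |m|)), ?_, ?_⟩
    · have h1 : Tendsto (fun M : ℕ => |b M * M - γ| * |m|) atTop (𝓝 0) := by
        have h2 := (hbγ.sub_const γ).abs.mul_const |m|
        simpa using h2
      have h3 := ENNReal.Tendsto.mul (ENNReal.tendsto_ofReal hbγ) (Or.inr ENNReal.zero_ne_top)
        hLLN (Or.inr ENNReal.ofReal_ne_top)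
      have h4 := (h3.add (ENNReal.tendsto_ofReal h1))
      have h5 := ENNReal.Tendsto.const_mul h4 (a := ENNReal.ofReal (Real.exp R))
        (Or.inr ENNReal.ofReal_ne_top)
      simpa using h5
    · filter_upwards [hbΓ, eventually_gt_atTop 0] with M hM hM0
      have hP := isProbabilityMeasure_gibbs hVc hV (hb M) M
      have hM0' : (0 : ℝ) < M := by exact_mod_cast hM0
      have hbM : 0 ≤ b M * M := by have := hb M; positivity
      have h1 := lintegral_abs_inter_sub_le hVc hV hl hCle (hb M) hM y 0 hR
      simp only [mul_zero, neg_zero, Real.exp_zero, mul_one, sub_zero, one_pow, one_mul] at h1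
      refine h1.trans ?_
      gcongr
      calc ∫⁻ x : Fin M → Euc n, ENNReal.ofReal |b M * ∑ j, Real.log ‖y - x j‖ - -(γ * pot μ y)|
            ∂(gibbs V (b M) M)
          ≤ ∫⁻ x : Fin M → Euc n, (ENNReal.ofReal (b M * M) *
            ENNReal.ofReal |(M : ℝ)⁻¹ * ∑ j, Real.log ‖y - x j‖ - m| +
            ENNReal.ofReal (|b M * M - γ| * |m|)) ∂(gibbs V (b M) M) := by
            refine lintegral_mono fun x => ?_
            rw [← ENNReal.ofReal_mul hbM, ← ENNReal.ofReal_add (by positivity) (by positivity)]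
            refine ENNReal.ofReal_le_ofReal ?_
            have e1 : b M * ∑ j, Real.log ‖y - x j‖ - -(γ * pot μ y) =
                b M * M * ((M : ℝ)⁻¹ * ∑ j, Real.log ‖y - x j‖ - m) + (b M * M - γ) * m := by
              rw [hpot]
              field_simp
              ring
            rw [e1]
            refine (abs_add_le _ _).trans (le_of_eq ?_)
            rw [abs_mul (b M * M), abs_mul (b M * M - γ), abs_of_nonneg hbM]
        _ = _ := by
            rw [lintegral_add_right _ measurable_const, lintegral_const_mul' _ _
              ENNReal.ofReal_ne_top]
            simp
  · filter_upwards [hbΓ] with M hM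
    have := one_le_one_add_norm y
    gcongr

/-- A crude bound, from `s ≤ 1 + s²`, which supplies the integrable domination in `y`. -/
lemma lintegral_abs_inter_sub_le' [NeZero n] (hVc : Continuous V) (hV : SuperLog V)
    {b : ℝ} (hb : 0 < b) (y : Euc n) {v D : ℝ} (hv : 0 ≤ v) (hD : 0 ≤ D)
    (h : ∫⁻ x : Fin M → Euc n, ENNReal.ofReal (inter b y x ^ 2) ∂(gibbs V b M) ≤
      ENNReal.ofReal D) :
    ∫⁻ x : Fin M → Euc n, ENNReal.ofReal |inter b y x - v| ∂(gibbs V b M) ≤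
      ENNReal.ofReal (1 + D + v) := by
  have hP := isProbabilityMeasure_gibbs hVc hV hb M
  calc _ ≤ ∫⁻ x : Fin M → Euc n, (ENNReal.ofReal (inter b y x ^ 2) + ENNReal.ofReal (1 + v))
        ∂(gibbs V b M) := by
        refine lintegral_mono fun x => ?_
        rw [← ENNReal.ofReal_add (by positivity) (by positivity)]
        refine ENNReal.ofReal_le_ofReal ?_
        have e0 := inter_nonneg b y x
        have e1 : inter b y x ≤ 1 + inter b y x ^ 2 := by nlinarith
        have e2 := sq_nonneg (inter b y x)
        rw [abs_le]
        constructor <;> linarith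
    _ ≤ ENNReal.ofReal D + ENNReal.ofReal (1 + v) := by
        rw [lintegral_add_right _ measurable_const, lintegral_const, measure_univ, mul_one]
        exact add_le_add_left h _
    _ = _ := by
        rw [← ENNReal.ofReal_add hD (by positivity)]
        congr 1
        ring

lemma measurable_lintegral_abs_inter_sub [NeZero n] (hVc : Continuous V) (hV : SuperLog V)
    {b : ℝ} (hb : 0 < b) (M : ℕ) {v : Euc n → ℝ} (hv : Measurable v) :
    Measurable fun y => ENNReal.ofReal (Real.exp (-V y)) *
      ∫⁻ x : Fin M → Euc n, ENNReal.ofReal |inter b y x - v y| ∂(gibbs V b M) := by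
  have hP := isProbabilityMeasure_gibbs hVc hV hb M
  have hVm := hVc.measurable
  have hm : Measurable fun p : Euc n × (Fin M → Euc n) =>
      ENNReal.ofReal |inter b p.1 p.2 - v p.1| := by fun_prop
  have hm' : Measurable fun y => ∫⁻ x : Fin M → Euc n, ENNReal.ofReal |inter b y x - v y|
      ∂(gibbs V b M) := hm.lintegral_prod_right'
  exact (Real.measurable_exp.comp hVm.neg).ennreal_ofReal.mul hm'

/-- The interaction factor converges to `e^{-γ U}` in the mean, with respect to `e^{-V}`. -/
lemma IsEquilibrium.tendsto_lintegral_lintegral_inter [NeZero n] (h : IsEquilibrium V γ L μ)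
    (hVc : Continuous V) (hV : SuperLog V) (hΓ : 0 ≤ Γ) (hl : IsDominating V Γ lam)
    (hb : ∀ M, 0 < b M)
    (hbγ : Tendsto (fun M : ℕ => b M * M) atTop (𝓝 γ)) (hbΓ : ∀ᶠ M : ℕ in atTop, b M * M ≤ Γ) :
    Tendsto (fun M : ℕ => ∫⁻ y, ENNReal.ofReal (Real.exp (-V y)) * ∫⁻ x : Fin M → Euc n,
      ENNReal.ofReal |inter (b M) y x - Real.exp (-(γ * pot μ y))| ∂(gibbs V (b M) M))
      atTop (𝓝 0) := by
  have hp := h.prob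
  have hγ0 : 0 ≤ γ := ge_of_tendsto hbγ (Eventually.of_forall fun M => by
    have := hb M
    positivity)
  have hpm := h.measurable_pot'
  have hVm := hVc.measurable
  obtain ⟨C, hC, hCle⟩ := exists_lintegral_inter_sq_le hVc hV hΓ hl
  obtain ⟨C', c, hC0, -, hpot, -⟩ := h.exists_pot_bounds
  have hlim : ∀ y, Tendsto (fun M : ℕ => ENNReal.ofReal (Real.exp (-V y)) *
      ∫⁻ x : Fin M → Euc n, ENNReal.ofReal |inter (b M) y x - Real.exp (-(γ * pot μ y))|
        ∂(gibbs V (b M) M)) atTop (𝓝 0) := fun y => by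
    have h1 := ENNReal.Tendsto.const_mul (h.tendsto_lintegral_inter hVc hV hΓ hl hb hbγ hbΓ y)
      (a := ENNReal.ofReal (Real.exp (-V y))) (Or.inr ENNReal.ofReal_ne_top)
    rwa [mul_zero] at h1
  have hi1 := hV.integrable hVc 0 le_rfl
  have hi2 := (hV.integrable hVc (2 * Γ) (by positivity)).const_mul C
  have hi3 := (hV.integrable hVc γ hγ0).const_mul (Real.exp (γ * C'))
  have hi := (hi1.add hi2).add hi3
  have key := tendsto_lintegral_filter_of_dominated_convergence (μ := volume) (l := atTop)
    (F := fun (M : ℕ) y => ENNReal.ofReal (Real.exp (-V y)) *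
      ∫⁻ x : Fin M → Euc n, ENNReal.ofReal |inter (b M) y x - Real.exp (-(γ * pot μ y))|
        ∂(gibbs V (b M) M)) (f := fun _ => 0)
    (fun y => ENNReal.ofReal (Real.exp (-V y) * (1 + ‖y‖) ^ (0 : ℝ) +
      C * (Real.exp (-V y) * (1 + ‖y‖) ^ (2 * Γ)) +
      Real.exp (γ * C') * (Real.exp (-V y) * (1 + ‖y‖) ^ γ))) ?_ ?_ ?_ ?_
  · simpa using key
  · exact Eventually.of_forall fun M =>
      measurable_lintegral_abs_inter_sub hVc hV (hb M) M (by fun_prop)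
  · filter_upwards [hbΓ] with M hM
    refine ae_of_all _ fun y => ?_
    have h0 : C * (1 + ‖y‖) ^ (2 * (b M * M)) ≤ C * (1 + ‖y‖) ^ (2 * Γ) :=
      mul_le_mul_of_nonneg_left (Real.rpow_le_rpow_of_exponent_le (one_le_one_add_norm y)
        (by linarith)) hC.le
    have h1 := lintegral_abs_inter_sub_le' hVc hV (hb M) y (Real.exp_pos (-(γ * pot μ y))).le
      (by positivity) ((hCle M (b M) (hb M) hM y).trans (ENNReal.ofReal_le_ofReal h0))
    have e2 : Real.exp (-(γ * pot μ y)) ≤ Real.exp (γ * C') * (1 + ‖y‖) ^ γ := by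
      rw [← exp_mul_logWeight, ← Real.exp_add, Real.exp_le_exp]
      have := mul_le_mul_of_nonneg_left (neg_le_of_abs_le (hpot y)) hγ0
      linarith
    refine (mul_le_mul_right h1 _).trans ?_
    rw [← ENNReal.ofReal_mul (Real.exp_pos _).le, Real.rpow_zero]
    refine ENNReal.ofReal_le_ofReal ?_
    have e3 := mul_le_mul_of_nonneg_left e2 (Real.exp_pos (-V y)).le
    linarith
  · exact hi.lintegral_lt_top.ne
  · exact ae_of_all _ hlim

/-- The ratio of partition functions converges to `L`. -/
theorem IsEquilibrium.tendsto_ratio [NeZero n] (h : IsEquilibrium V γ L μ)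
    (hVc : Continuous V) (hV : SuperLog V) (hΓ : 0 ≤ Γ) (hl : IsDominating V Γ lam)
    (hb : ∀ M, 0 < b M)
    (hbγ : Tendsto (fun M : ℕ => b M * M) atTop (𝓝 γ)) (hbΓ : ∀ᶠ M : ℕ in atTop, b M * M ≤ Γ) :
    Tendsto (fun M : ℕ => ratio V (b M) M) atTop (𝓝 (ENNReal.ofReal L)) := by
  have hp := h.prob
  have hpm := h.measurable_pot'
  have hVm := hVc.measurable
  have herr := h.tendsto_lintegral_lintegral_inter hVc hV hΓ hl hb hbγ hbΓ
  have hL : ENNReal.ofReal L = ∫⁻ y, ENNReal.ofReal (Real.exp (-V y)) *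
      ENNReal.ofReal (Real.exp (-(γ * pot μ y))) := by
    rw [← h.eq, ofReal_integral_eq_lintegral_ofReal h.integrable
      (ae_of_all _ fun y => (Real.exp_pos _).le)]
    refine lintegral_congr fun y => ?_
    rw [← ENNReal.ofReal_mul (Real.exp_pos _).le, ← Real.exp_add]
    congr 2
    rw [pot]
    ring
  -- By Tonelli the ratio is the `e^{-V}`-integral of the mean interaction factor, to be compared
  -- with `L = ∫ e^{-V} e^{-γ U}`.
  have hR : ∀ M : ℕ, ratio V (b M) M = ∫⁻ y, ENNReal.ofReal (Real.exp (-V y)) *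
      ∫⁻ x : Fin M → Euc n, ENNReal.ofReal (inter (b M) y x) ∂(gibbs V (b M) M) := by
    intro M
    have hP := isProbabilityMeasure_gibbs hVc hV (hb M) M
    simp only [ratio, interMass]
    have hsw : Measurable (Function.uncurry fun (x : Fin M → Euc n) (y : Euc n) =>
        ENNReal.ofReal (Real.exp (-V y) * inter (b M) y x)) :=
      (measurable_exp_inter hVc).comp measurable_swap
    rw [lintegral_lintegral_swap hsw.aemeasurable]
    refine lintegral_congr fun y => ?_
    rw [← lintegral_const_mul' _ _ ENNReal.ofReal_ne_top]
    refine lintegral_congr fun x => ?_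
    rw [ENNReal.ofReal_mul (Real.exp_pos _).le]
  set e : ℕ → ℝ≥0∞ := fun M => ∫⁻ y, ENNReal.ofReal (Real.exp (-V y)) * ∫⁻ x : Fin M → Euc n,
      ENNReal.ofReal |inter (b M) y x - Real.exp (-(γ * pot μ y))| ∂(gibbs V (b M) M) with he
  have hmA : ∀ M : ℕ, Measurable fun y => ENNReal.ofReal (Real.exp (-V y)) *
      ∫⁻ x : Fin M → Euc n, ENNReal.ofReal |inter (b M) y x - Real.exp (-(γ * pot μ y))|
        ∂(gibbs V (b M) M) := fun M =>
    measurable_lintegral_abs_inter_sub hVc hV (hb M) M (by fun_prop)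
  have hup : ∀ M, ratio V (b M) M ≤ ENNReal.ofReal L + e M := by
    intro M
    have hP := isProbabilityMeasure_gibbs hVc hV (hb M) M
    rw [hR, hL, he]
    rw [← lintegral_add_right _ (hmA M)]
    refine lintegral_mono fun y => ?_
    rw [← mul_add]
    refine mul_le_mul_right ?_ _
    calc _ ≤ ∫⁻ x : Fin M → Euc n, (ENNReal.ofReal (Real.exp (-(γ * pot μ y))) +
          ENNReal.ofReal |inter (b M) y x - Real.exp (-(γ * pot μ y))|) ∂(gibbs V (b M) M) := by
          refine lintegral_mono fun x => ?_
          rw [← ENNReal.ofReal_add (Real.exp_pos _).le (abs_nonneg _)]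
          refine ENNReal.ofReal_le_ofReal ?_
          linarith [le_abs_self (inter (b M) y x - Real.exp (-(γ * pot μ y)))]
      _ = _ := by
          rw [lintegral_add_left measurable_const]
          simp
  have hlow : ∀ M, ENNReal.ofReal L ≤ ratio V (b M) M + e M := by
    intro M
    have hP := isProbabilityMeasure_gibbs hVc hV (hb M) M
    rw [hR, hL, he]
    rw [← lintegral_add_right _ (hmA M)]
    refine lintegral_mono fun y => ?_
    rw [← mul_add]
    refine mul_le_mul_right ?_ _
    calc ENNReal.ofReal (Real.exp (-(γ * pot μ y)))
        = ∫⁻ _x : Fin M → Euc n, ENNReal.ofReal (Real.exp (-(γ * pot μ y)))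
          ∂(gibbs V (b M) M) := by simp
      _ ≤ ∫⁻ x : Fin M → Euc n, (ENNReal.ofReal (inter (b M) y x) +
          ENNReal.ofReal |inter (b M) y x - Real.exp (-(γ * pot μ y))|) ∂(gibbs V (b M) M) := by
          refine lintegral_mono fun x => ?_
          rw [← ENNReal.ofReal_add (inter_nonneg _ _ _) (abs_nonneg _)]
          refine ENNReal.ofReal_le_ofReal ?_
          linarith [neg_abs_le (inter (b M) y x - Real.exp (-(γ * pot μ y)))]
      _ = _ := by
          rw [lintegral_add_left (measurable_inter_right (b M) y).ennreal_ofReal]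
  have h1 : Tendsto (fun M => ENNReal.ofReal L + e M) atTop (𝓝 (ENNReal.ofReal L)) := by
    have := (tendsto_const_nhds (x := ENNReal.ofReal L)).add herr
    rwa [add_zero] at this
  have h2 : Tendsto (fun M => ENNReal.ofReal L - e M) atTop (𝓝 (ENNReal.ofReal L)) := by
    have := ENNReal.Tendsto.sub (tendsto_const_nhds (x := ENNReal.ofReal L) (f := atTop)) herr
      (Or.inl ENNReal.ofReal_ne_top)
    rwa [tsub_zero] at this
  exact tendsto_of_tendsto_of_tendsto_of_le_of_le h2 h1
    (fun M => tsub_le_iff_right.mpr (hlow M)) hup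

/-- The gain is the factor `‖y‖⁻¹`. If `|x| ≤ |y|/2` the logarithm of the ratio is `O(|x|/|y|)`;
otherwise `1 ≤ 2|x|/|y|` may multiply a crude bound. The singularity then carries a factor `1 +
|x|`, which is why `IsDominating` asks for a bounded density after weighting by `1 + |x|`. -/
lemma abs_log_norm_sub_sub_le {y : Euc n} (hy : y ≠ 0) (x : Euc n) :
    |Real.log ‖y - x‖ - Real.log ‖y‖| ≤
      ‖y‖⁻¹ * (4 * (1 + ‖x‖) ^ (2 : ℝ) + 4 * ((1 + ‖x‖) * sing (y - x))) := by
  have hy0 : 0 < ‖y‖ := norm_pos_iff.mpr hy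
  rcases eq_or_ne y x with rfl | hne
  · rw [sub_self, norm_zero, Real.log_zero, zero_sub, abs_neg]
    have h1 := Real.log_le_sub_one_of_pos hy0
    have h2 := Real.log_le_sub_one_of_pos (inv_pos.mpr hy0)
    rw [Real.log_inv] at h2
    have h3 : ‖y‖⁻¹ * (4 * (1 + ‖y‖) ^ (2 : ℝ)) = 4 * ‖y‖⁻¹ + 8 + 4 * ‖y‖ := by
      rw [Real.rpow_two]
      field_simp
      ring
    have h4 : 0 ≤ ‖y‖⁻¹ * (4 * ((1 + ‖y‖) * sing (0 : Euc n))) := by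
      have := sing_nonneg (0 : Euc n)
      positivity
    have h5 := inv_pos.mpr hy0
    rw [mul_add, h3, abs_le]
    constructor <;> linarith
  have hs := sing_nonneg (y - x)
  have hx0 := norm_nonneg x
  have hd0 : 0 < ‖y - x‖ := norm_pos_iff.mpr (sub_ne_zero.mpr hne)
  rw [Real.rpow_two]
  have hϑ : logWeight x ≤ ‖x‖ := by
    have := Real.log_le_sub_one_of_pos (show 0 < 1 + ‖x‖ by linarith)
    rw [logWeight]
    linarith
  rw [abs_le]
  constructor
  · have h1 : Real.log ‖y‖ - Real.log ‖y - x‖ ≤ Real.log (1 + ‖x‖ * ‖y - x‖⁻¹) := by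
      rw [← Real.log_div hy0.ne' hd0.ne']
      refine Real.log_le_log (by positivity) ?_
      rw [div_le_iff₀ hd0, add_mul, one_mul, mul_assoc, inv_mul_cancel₀ hd0.ne', mul_one]
      have := norm_add_le (y - x) x
      rwa [sub_add_cancel] at this
    rw [neg_le, neg_sub]
    refine h1.trans ?_
    rcases le_total (2 * ‖x‖) ‖y‖ with h2 | h2
    · have h3 : ‖y‖ / 2 ≤ ‖y - x‖ := by
        have := norm_sub_norm_le y x
        linarith
      have h4 := Real.log_le_sub_one_of_pos (show 0 < 1 + ‖x‖ * ‖y - x‖⁻¹ by positivity)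
      have h5 : ‖x‖ * ‖y - x‖⁻¹ ≤ ‖x‖ * (‖y‖ / 2)⁻¹ := by gcongr
      calc _ ≤ ‖x‖ * (‖y‖ / 2)⁻¹ := by linarith
        _ = ‖y‖⁻¹ * (2 * ‖x‖) := by rw [inv_div]; ring
        _ ≤ _ := by
            gcongr
            nlinarith [mul_nonneg (show 0 ≤ 1 + ‖x‖ by linarith) hs]
    · have h3 : Real.log (1 + ‖x‖ * ‖y - x‖⁻¹) ≤ logWeight x + 2 * sing (y - x) := by
        have h4 := log_one_add_inv_le (y - x) 1 zero_le_one
        rw [Real.one_rpow, one_mul, mul_one] at h4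
        have h5 : Real.log (1 + ‖x‖ * ‖y - x‖⁻¹) ≤
            Real.log ((1 + ‖x‖) * (1 + ‖y - x‖⁻¹)) := by
          refine Real.log_le_log (by positivity) ?_
          have := inv_pos.mpr hd0
          nlinarith
        rw [Real.log_mul (by positivity) (by positivity)] at h5
        rw [logWeight]
        linarith
      refine h3.trans ?_
      have h6 : 1 ≤ ‖y‖⁻¹ * (2 * ‖x‖) := by
        rw [← div_eq_inv_mul, one_le_div hy0]
        exact h2
      calc logWeight x + 2 * sing (y - x)
          ≤ ‖y‖⁻¹ * (2 * ‖x‖) * (‖x‖ + 2 * sing (y - x)) := by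
            have : 0 ≤ ‖x‖ + 2 * sing (y - x) := by positivity
            nlinarith
        _ = ‖y‖⁻¹ * (2 * ‖x‖ * (‖x‖ + 2 * sing (y - x))) := by ring
        _ ≤ _ := by
            gcongr
            nlinarith
  · have h1 : Real.log ‖y - x‖ - Real.log ‖y‖ ≤ ‖y‖⁻¹ * ‖x‖ := by
      rw [← Real.log_div hd0.ne' hy0.ne']
      have h2 := Real.log_le_sub_one_of_pos (show 0 < ‖y - x‖ / ‖y‖ by positivity)
      have h3 : ‖y - x‖ / ‖y‖ ≤ 1 + ‖y‖⁻¹ * ‖x‖ := by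
        rw [div_le_iff₀ hy0, add_mul, one_mul, mul_comm, ← mul_assoc, mul_inv_cancel₀ hy0.ne',
          one_mul]
        exact norm_sub_le y x
      linarith
    refine h1.trans ?_
    gcongr
    nlinarith [mul_nonneg (show 0 ≤ 1 + ‖x‖ by linarith) hs]

lemma IsDominating.exists_lintegral_abs_log_le [NeZero n] (hl : IsDominating V Γ lam) :
    ∃ C : ℝ, 0 ≤ C ∧ ∀ y : Euc n, y ≠ 0 →
      ∫⁻ x, ENNReal.ofReal |Real.log ‖y - x‖ - Real.log ‖y‖| ∂lam ≤ ENNReal.ofReal (C * ‖y‖⁻¹) := by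
  obtain ⟨A, hA⟩ := hl.exists_le
  have hi2 := hl.moment 2 zero_le_two
  have hi1 := hl.moment 1 zero_le_one
  simp only [Real.rpow_one] at hi1
  set lam' := lam.withDensity fun x => ENNReal.ofReal (1 + ‖x‖) with hlam'
  have hfin : IsFiniteMeasure lam' := isFiniteMeasure_withDensity_ofReal hi1.2
  set D := ∫ x, (1 + ‖x‖) ^ (2 : ℝ) ∂lam with hD
  have hD0 : 0 ≤ D := integral_nonneg fun x => by positivity
  set D' : ℝ := A * singConst n + lam'.real Set.univ with hD'
  have hD'0 : 0 ≤ D' := by positivity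
  refine ⟨4 * D + 4 * D', by positivity, fun y hy => ?_⟩
  have hsing : ∫⁻ x, ENNReal.ofReal ((1 + ‖x‖) * sing (y - x)) ∂lam ≤ ENNReal.ofReal D' := by
    have h1 := lintegral_sing_le hA y
    rw [hlam', lintegral_withDensity_eq_lintegral_mul _ (by fun_prop) (by fun_prop)] at h1
    have h2 : (A : ℝ≥0∞) * singConst n + lam' Set.univ = ENNReal.ofReal D' := by
      rw [hD', ENNReal.ofReal_add (by positivity) (by positivity), measureReal_def,
        ENNReal.ofReal_toReal (measure_ne_top _ _), ← NNReal.coe_mul, ENNReal.ofReal_coe_nnreal,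
        ENNReal.coe_mul]
    rw [← h2]
    refine le_trans (le_of_eq (lintegral_congr fun x => ?_)) h1
    rw [Pi.mul_apply, ENNReal.ofReal_mul (by positivity)]
  calc _ ≤ ∫⁻ x, ENNReal.ofReal ‖y‖⁻¹ * (ENNReal.ofReal (4 * (1 + ‖x‖) ^ (2 : ℝ)) +
        ENNReal.ofReal 4 * ENNReal.ofReal ((1 + ‖x‖) * sing (y - x))) ∂lam := by
        refine lintegral_mono fun x => ?_
        have hs := sing_nonneg (y - x)
        rw [← ENNReal.ofReal_mul (by norm_num), ← ENNReal.ofReal_add (by positivity)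
          (by positivity), ← ENNReal.ofReal_mul (by positivity)]
        exact ENNReal.ofReal_le_ofReal (abs_log_norm_sub_sub_le hy x)
    _ = ENNReal.ofReal ‖y‖⁻¹ * (ENNReal.ofReal (4 * D) +
        ENNReal.ofReal 4 * ∫⁻ x, ENNReal.ofReal ((1 + ‖x‖) * sing (y - x)) ∂lam) := by
        rw [lintegral_const_mul' _ _ ENNReal.ofReal_ne_top, lintegral_add_left (by fun_prop),
          lintegral_const_mul' _ _ ENNReal.ofReal_ne_top, hD, ← integral_const_mul,
          ofReal_integral_eq_lintegral_ofReal (hi2.const_mul 4)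
            (ae_of_all _ fun x => by simp only [Pi.zero_apply]; positivity)]
    _ ≤ ENNReal.ofReal ‖y‖⁻¹ * (ENNReal.ofReal (4 * D) + ENNReal.ofReal 4 * ENNReal.ofReal D') :=
        mul_le_mul_right (add_le_add_right (mul_le_mul_right hsing _) _) _
    _ = _ := by
        rw [← ENNReal.ofReal_mul (by norm_num), ← ENNReal.ofReal_add (by positivity)
          (by positivity), ← ENNReal.ofReal_mul (by positivity), mul_comm]

lemma abs_log_sub_log_le {s r ρ : ℝ} (hr : 0 < r) (hρ : ρ ≤ 1 / 2) (h : |s - r| ≤ ρ * r) :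
    |Real.log s - Real.log r| ≤ 2 * ρ := by
  have hρ0 : 0 ≤ ρ := by
    by_contra! hneg
    have := abs_nonneg (s - r)
    nlinarith
  have h' := abs_le.mp h
  have hs : r / 2 ≤ s := by nlinarith
  have hs0 : 0 < s := by linarith
  rw [abs_le]
  constructor
  · have h1 := Real.log_le_sub_one_of_pos (show 0 < r / s by positivity)
    rw [Real.log_div hr.ne' hs0.ne'] at h1
    have h2 : r / s - 1 ≤ 2 * ρ := by
      rw [sub_le_iff_le_add, div_le_iff₀ hs0]
      nlinarith
    linarith
  · have h1 := Real.log_le_sub_one_of_pos (show 0 < s / r by positivity)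
    rw [Real.log_div hs0.ne' hr.ne'] at h1
    have h2 : s / r - 1 ≤ ρ := by
      rw [sub_le_iff_le_add, div_le_iff₀ hr]
      nlinarith
    linarith

/-- Near the edge the interaction factor is equivalent to a constant, in `L¹`. -/
theorem tendsto_lintegral_inter_edge [NeZero n] (hVc : Continuous V) (hV : SuperLog V)
    (hΓ : 0 ≤ Γ) (hl : IsDominating V Γ lam) (hb : ∀ M, 0 < b M)
    (hbΓ : ∀ᶠ M : ℕ in atTop, b M * M ≤ Γ) {r ρ : ℕ → ℝ} (hr : Tendsto r atTop atTop)
    (hρ : Tendsto ρ atTop (𝓝 0)) {y : ℕ → Euc n} (hy : ∀ᶠ M in atTop, |‖y M‖ - r M| ≤ ρ M * r M) :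
    Tendsto (fun M : ℕ => ∫⁻ x : Fin M → Euc n, ENNReal.ofReal
      |inter (b M) (y M) x * Real.exp (-(b M * M * Real.log (r M))) - 1| ∂(gibbs V (b M) M))
      atTop (𝓝 0) := by
  have hfin := hl.isFiniteMeasure
  obtain ⟨C, hC, hCle⟩ := exists_lintegral_inter_sq_le hVc hV hΓ hl
  obtain ⟨C', hC', hlog⟩ := hl.exists_lintegral_abs_log_le
  have hr1 := hr.eventually_ge_atTop 1
  have hρ1 : ∀ᶠ M in atTop, ρ M ≤ 1 / 2 := hρ.eventually (Iic_mem_nhds (by norm_num))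
  refine ENNReal.tendsto_zero_of_forall_le
    (f := fun M => Real.exp (-(b M * M * Real.log (r M))) ^ 2 *
      (C * (1 + ‖y M‖) ^ (2 * (b M * M)))) (D := C * 3 ^ (2 * Γ)) 0 (fun R hR => ?_) ?_
  -- The first term is the mean of `|log ‖y - x‖ - log ‖y‖|` under `lam`, the second the replacement
  -- of `log ‖y‖` by `log r`.
  · refine ⟨fun M => ENNReal.ofReal (Real.exp R * (Γ * (C' * (2 * (r M)⁻¹) +
      2 * ρ M * lam.real Set.univ))), ?_, ?_⟩
    · have h1 : Tendsto (fun M => Real.exp R * (Γ * (C' * (2 * (r M)⁻¹) +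
          2 * ρ M * lam.real Set.univ))) atTop (𝓝 (Real.exp R * (Γ * (C' * (2 * 0) +
          2 * 0 * lam.real Set.univ)))) :=
        (((hr.inv_tendsto_atTop.const_mul 2).const_mul C').add
          ((hρ.const_mul 2).mul_const _)).const_mul Γ |>.const_mul _
      simpa using ENNReal.tendsto_ofReal h1
    · filter_upwards [hbΓ, eventually_gt_atTop 0, hr1, hρ1, hy] with M hM hM0 hrM hρM hyM
      have hP := isProbabilityMeasure_gibbs hVc hV (hb M) M
      have hbM : 0 ≤ b M * M := by have := hb M; positivity
      have hr0 : 0 < r M := by linarith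
      have hyr : r M / 2 ≤ ‖y M‖ := by
        have := (abs_le.mp hyM).1
        nlinarith
      have hy0 : y M ≠ 0 := norm_pos_iff.mp (by linarith)
      have h1 := lintegral_abs_inter_sub_le hVc hV hl hCle (hb M) hM (y M) (Real.log (r M)) hR
      rw [Real.exp_zero] at h1
      refine h1.trans (add_le_add_right ?_ _)
      rw [ENNReal.ofReal_mul (Real.exp_pos _).le]
      refine mul_le_mul_right ?_ _
      have hρ0 : 0 ≤ ρ M := by
        by_contra! hneg
        have := abs_nonneg (‖y M‖ - r M)
        nlinarith
      have hlog2 := abs_log_sub_log_le hr0 hρM hyM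
      have hm : Measurable fun z : Euc n =>
          ENNReal.ofReal |Real.log ‖y M - z‖ - Real.log (r M)| := by fun_prop
      have hin : ∫⁻ z, ENNReal.ofReal |Real.log ‖y M - z‖ - Real.log (r M)| ∂lam ≤
          ENNReal.ofReal (C' * (2 * (r M)⁻¹) + 2 * ρ M * lam.real Set.univ) := by
        calc _ ≤ ∫⁻ z, (ENNReal.ofReal |Real.log ‖y M - z‖ - Real.log ‖y M‖| +
              ENNReal.ofReal (2 * ρ M)) ∂lam := by
              refine lintegral_mono fun z => ?_
              rw [← ENNReal.ofReal_add (abs_nonneg _) (by positivity)]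
              refine ENNReal.ofReal_le_ofReal ((abs_sub_le _ (Real.log ‖y M‖) _).trans ?_)
              linarith
          _ ≤ ENNReal.ofReal (C' * ‖y M‖⁻¹) + ENNReal.ofReal (2 * ρ M * lam.real Set.univ) := by
              rw [lintegral_add_right _ measurable_const, lintegral_const,
                ENNReal.ofReal_mul (by positivity : 0 ≤ 2 * ρ M), measureReal_def,
                ENNReal.ofReal_toReal (measure_ne_top _ _)]
              exact add_le_add_left (hlog _ hy0) _
          _ ≤ ENNReal.ofReal (C' * (2 * (r M)⁻¹)) +
              ENNReal.ofReal (2 * ρ M * lam.real Set.univ) := by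
              refine add_le_add_left (ENNReal.ofReal_le_ofReal ?_) _
              refine mul_le_mul_of_nonneg_left ?_ hC'
              rw [← div_eq_mul_inv, ← inv_div]
              exact inv_anti₀ (by positivity) hyr
          _ = _ := (ENNReal.ofReal_add (by positivity) (by positivity)).symm
      -- No law of large numbers is needed here: a sum of `M` one-particle errors, each `O(1/r +
      -- ρ)`, is multiplied by `b`, and `b M ≤ Γ`.
      calc _ ≤ ∫⁻ x : Fin M → Euc n, ENNReal.ofReal (b M) *
            ∑ j, ENNReal.ofReal |Real.log ‖y M - x j‖ - Real.log (r M)| ∂(gibbs V (b M) M) := by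
            refine lintegral_mono fun x => ?_
            rw [← ENNReal.ofReal_sum_of_nonneg fun _ _ => abs_nonneg _,
              ← ENNReal.ofReal_mul (hb M).le, sub_zero, abs_mul, abs_of_pos (hb M)]
            exact ENNReal.ofReal_le_ofReal
              (mul_le_mul_of_nonneg_left (Finset.abs_sum_le_sum_abs _ _) (hb M).le)
        _ ≤ ENNReal.ofReal (b M) * (M *
            ENNReal.ofReal (C' * (2 * (r M)⁻¹) + 2 * ρ M * lam.real Set.univ)) := by
            rw [lintegral_const_mul' _ _ ENNReal.ofReal_ne_top]
            exact mul_le_mul_right ((lintegral_gibbs_sum_le hVc hV (hb M) hl hM hm).trans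
              (mul_le_mul_right hin _)) _
        _ ≤ _ := by
            rw [← mul_assoc, ← ENNReal.ofReal_natCast M, ← ENNReal.ofReal_mul (hb M).le,
              ← ENNReal.ofReal_mul hbM]
            refine ENNReal.ofReal_le_ofReal (mul_le_mul_of_nonneg_right hM (by positivity))
  · filter_upwards [hbΓ, hr1, hρ1, hy] with M hM hrM hρM hyM
    have hbM : 0 ≤ b M * M := by have := hb M; positivity
    have hr0 : 0 < r M := by linarith
    have hyr : 1 + ‖y M‖ ≤ 3 * r M := by
      have := (abs_le.mp hyM).2
      nlinarith
    have e1 : Real.exp (-(b M * M * Real.log (r M))) ^ 2 = ((r M) ^ (2 * (b M * M)))⁻¹ := by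
      rw [Real.rpow_def_of_pos hr0, ← Real.exp_neg, ← Real.exp_nat_mul]
      congr 1
      push_cast
      ring
    have e2 : (1 + ‖y M‖) ^ (2 * (b M * M)) ≤ 3 ^ (2 * (b M * M)) * (r M) ^ (2 * (b M * M)) := by
      rw [← Real.mul_rpow (by norm_num) hr0.le]
      exact Real.rpow_le_rpow (by positivity) hyr (by positivity)
    have e3 : (3 : ℝ) ^ (2 * (b M * M)) ≤ 3 ^ (2 * Γ) :=
      Real.rpow_le_rpow_of_exponent_le (by norm_num) (by linarith)
    have e4 : 0 < (r M) ^ (2 * (b M * M)) := Real.rpow_pos_of_pos hr0 _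
    rw [e1]
    calc _ ≤ ((r M) ^ (2 * (b M * M)))⁻¹ *
          (C * (3 ^ (2 * (b M * M)) * (r M) ^ (2 * (b M * M)))) := by
          refine mul_le_mul_of_nonneg_left ?_ (inv_nonneg.mpr e4.le)
          exact mul_le_mul_of_nonneg_left e2 hC.le
      _ = C * 3 ^ (2 * (b M * M)) := by field_simp
      _ ≤ _ := mul_le_mul_of_nonneg_left e3 hC.le

end Interaction

/-! ### Interpolation by removal of one particle, and the quantitative Poisson approximation. -/

section Removal

variable {V : Euc n → ℝ} {b : ℝ} {M : ℕ}

/-- The density of the last particle together with the others. -/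
def joint (V : Euc n → ℝ) (b : ℝ) (p : (Fin M → Euc n) × Euc n) : ℝ :=
  Real.exp (-V p.2) * inter b p.2 p.1

lemma joint_nonneg (p : (Fin M → Euc n) × Euc n) : 0 ≤ joint V b p :=
  mul_nonneg (Real.exp_pos _).le (inter_nonneg _ _ _)

lemma measurable_joint (hVc : Continuous V) :
    Measurable (joint V b : (Fin M → Euc n) × Euc n → ℝ) := by
  have hVm := hVc.measurable
  have h := (measurable_inter (n := n) (M := M) b).comp measurable_swap
  exact (Real.measurable_exp.comp (hVm.comp measurable_snd).neg).mul h

lemma lintegral_joint [NeZero n] (hVc : Continuous V) (hV : SuperLog V) (hb : 0 < b) (M : ℕ) :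
    ∫⁻ p, ENNReal.ofReal (joint V b p) ∂((gibbs V b M).prod volume) = ratio V b M := by
  have hP := isProbabilityMeasure_gibbs hVc hV hb M
  rw [lintegral_prod _ (measurable_joint hVc).ennreal_ofReal.aemeasurable]
  rfl

lemma integrable_joint [NeZero n] (hVc : Continuous V) (hV : SuperLog V) (hb : 0 < b) (M : ℕ) :
    Integrable (joint V b) ((gibbs V b M).prod volume) := by
  refine ⟨(measurable_joint hVc).aestronglyMeasurable, ?_⟩
  rw [hasFiniteIntegral_iff_ofReal (ae_of_all _ joint_nonneg), lintegral_joint hVc hV hb]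
  exact (ratio_ne_top hVc hV hb M).lt_top

lemma measurable_insertNth_swap (i : Fin (M + 1)) :
    Measurable fun p : (Fin M → Euc n) × Euc n =>
      (i.insertNth p.2 p.1 : Fin (M + 1) → Euc n) :=
  (measurable_insertNth i).comp measurable_swap

/-- The one-particle integration formula as an identity of measures, so that it also transports
Bochner integrals of signed functions. -/
lemma gibbs_succ_eq [NeZero n] (hVc : Continuous V) (hV : SuperLog V) (hb : 0 < b)
    (i : Fin (M + 1)) : gibbs V b (M + 1) = (ratio V b M)⁻¹ •
      (((gibbs V b M).prod volume).withDensity fun p => ENNReal.ofReal (joint V b p)).map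
        fun p => (i.insertNth p.2 p.1 : Fin (M + 1) → Euc n) := by
  have hP := isProbabilityMeasure_gibbs hVc hV hb M
  refine Measure.ext_of_lintegral _ fun F hF => ?_
  have hG : Measurable fun p : (Fin M → Euc n) × Euc n =>
      F (i.insertNth p.2 p.1 : Fin (M + 1) → Euc n) := hF.comp (measurable_insertNth_swap i)
  have hm := (measurable_joint (M := M) (b := b) hVc).ennreal_ofReal
  rw [lintegral_smul_measure, lintegral_map hF (measurable_insertNth_swap i),
    lintegral_withDensity_eq_lintegral_mul _ hm hG, lintegral_prod _ (hm.mul hG).aemeasurable,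
    lintegral_gibbs_succ hVc hV hb i hF]
  rfl

lemma integral_gibbs_succ [NeZero n] (hVc : Continuous V) (hV : SuperLog V) (hb : 0 < b)
    (i : Fin (M + 1)) {F : (Fin (M + 1) → Euc n) → ℝ} (hF : Measurable F) :
    ∫ x, F x ∂(gibbs V b (M + 1)) = ((ratio V b M).toReal)⁻¹ *
      ∫ p, joint V b p * F (i.insertNth p.2 p.1) ∂((gibbs V b M).prod volume) := by
  rw [gibbs_succ_eq hVc hV hb i, integral_smul_measure,
    integral_map (measurable_insertNth_swap i).aemeasurable hF.aestronglyMeasurable,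
    integral_withDensity_ofReal (measurable_joint hVc) joint_nonneg, ENNReal.toReal_inv]
  rfl

variable {k : Euc n → ℝ}

/-- The product `∏_j (1 - s k(x_j))`. -/
def thin (k : Euc n → ℝ) (s : ℝ) (x : Fin M → Euc n) : ℝ := ∏ j, (1 - s * k (x j))

lemma measurable_thin (hk : Measurable k) (s : ℝ) :
    Measurable (thin k s : (Fin M → Euc n) → ℝ) := by
  unfold thin
  fun_prop

lemma one_sub_mul_mem (h0 : ∀ y, 0 ≤ k y) (h1 : ∀ y, k y ≤ 1) {s : ℝ} (hs : s ∈ Set.Icc (0 : ℝ) 1)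
    (y : Euc n) : 0 ≤ 1 - s * k y ∧ 1 - s * k y ≤ 1 := by
  have h2 := mul_nonneg hs.1 (h0 y)
  have h3 := mul_le_one₀ hs.2 (h0 y) (h1 y)
  constructor <;> linarith

lemma thin_nonneg (h0 : ∀ y, 0 ≤ k y) (h1 : ∀ y, k y ≤ 1) {s : ℝ} (hs : s ∈ Set.Icc (0 : ℝ) 1)
    (x : Fin M → Euc n) : 0 ≤ thin k s x :=
  Finset.prod_nonneg fun _ _ => (one_sub_mul_mem h0 h1 hs _).1

lemma thin_le_one (h0 : ∀ y, 0 ≤ k y) (h1 : ∀ y, k y ≤ 1) {s : ℝ} (hs : s ∈ Set.Icc (0 : ℝ) 1)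
    (x : Fin M → Euc n) : thin k s x ≤ 1 :=
  Finset.prod_le_one (fun _ _ => (one_sub_mul_mem h0 h1 hs _).1)
    fun _ _ => (one_sub_mul_mem h0 h1 hs _).2

lemma thin_insertNth (i : Fin (M + 1)) (y : Euc n) (s : ℝ) (x : Fin M → Euc n) :
    thin k s (i.insertNth y x : Fin (M + 1) → Euc n) = (1 - s * k y) * thin k s x := by
  rw [thin, Fin.prod_univ_succAbove _ i]
  simp [thin]

lemma prod_erase_insertNth (i : Fin (M + 1)) (y : Euc n) (s : ℝ) (x : Fin M → Euc n) :
    ∏ j ∈ Finset.univ.erase i, (1 - s * k ((i.insertNth y x : Fin (M + 1) → Euc n) j)) =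
      thin k s x := by
  rw [← Finset.compl_singleton, ← Fin.image_succAbove_univ,
    Finset.prod_image fun a _ c _ h => Fin.succAbove_right_injective h]
  simp [thin]

/-- The derivative of `s ↦ E ∏_j (1 - s k(x_j))`. -/
lemma hasDerivAt_integral_thin [NeZero n] (hVc : Continuous V) (hV : SuperLog V) (hb : 0 < b)
    (hk : Measurable k) (h0 : ∀ y, 0 ≤ k y) (h1 : ∀ y, k y ≤ 1) (s : ℝ) :
    HasDerivAt (fun s => ∫ x, thin k s x ∂(gibbs V b (M + 1)))
      (-((M + 1) * ((ratio V b M).toReal)⁻¹ *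
        ∫ p, joint V b p * (k p.2 * thin k s p.1) ∂((gibbs V b M).prod volume))) s := by
  have hP := isProbabilityMeasure_gibbs hVc hV hb (M + 1)
  have hd : ∀ (x : Fin (M + 1) → Euc n) (u : ℝ), HasDerivAt (fun s => thin k s x)
      (∑ i, (∏ j ∈ Finset.univ.erase i, (1 - u * k (x j))) * (-(k (x i)))) u := by
    intro x u
    have h2 : ∀ i ∈ (Finset.univ : Finset (Fin (M + 1))),
        HasDerivAt (fun s : ℝ => 1 - s * k (x i)) (-(k (x i))) u := by
      intro i _
      have := ((hasDerivAt_id u).mul_const (k (x i))).const_sub 1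
      simpa using this
    simpa [thin, smul_eq_mul] using HasDerivAt.fun_finsetProd h2
  have hmd : ∀ (i : Fin (M + 1)) (u : ℝ), Measurable fun x : Fin (M + 1) → Euc n =>
      (∏ j ∈ Finset.univ.erase i, (1 - u * k (x j))) * (-(k (x i))) := by
    intro i u
    fun_prop
  have hmd' : ∀ u : ℝ, Measurable fun x : Fin (M + 1) → Euc n =>
      ∑ i, (∏ j ∈ Finset.univ.erase i, (1 - u * k (x j))) * (-(k (x i))) := by
    intro u
    fun_prop
  have hkabs : ∀ (u : ℝ) (y : Euc n), |1 - u * k y| ≤ 1 + |u| := by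
    intro u y
    have h3 : |u * k y| ≤ |u| := by
      rw [abs_mul, abs_of_nonneg (h0 y)]
      exact mul_le_of_le_one_right (abs_nonneg _) (h1 y)
    calc |1 - u * k y| ≤ |1| + |u * k y| := abs_sub _ _
      _ ≤ 1 + |u| := by rw [abs_one]; linarith
  have hprodabs : ∀ (S : Finset (Fin (M + 1))) (u : ℝ) (x : Fin (M + 1) → Euc n),
      |∏ j ∈ S, (1 - u * k (x j))| ≤ (1 + |u|) ^ (M + 1) := by
    intro S u x
    rw [Finset.abs_prod]
    calc _ ≤ ∏ _j ∈ S, (1 + |u|) :=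
          Finset.prod_le_prod (fun _ _ => abs_nonneg _) fun j _ => hkabs u _
      _ = (1 + |u|) ^ S.card := by rw [Finset.prod_const]
      _ ≤ _ := pow_le_pow_right₀ (by linarith [abs_nonneg u])
          ((Finset.card_le_univ S).trans (by simp))
  have hterm : ∀ (i : Fin (M + 1)) (u : ℝ) (x : Fin (M + 1) → Euc n),
      ‖(∏ j ∈ Finset.univ.erase i, (1 - u * k (x j))) * (-(k (x i)))‖ ≤ (1 + |u|) ^ (M + 1) := by
    intro i u x
    rw [norm_mul, Real.norm_eq_abs, Real.norm_eq_abs, abs_neg, abs_of_nonneg (h0 _)]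
    exact (mul_le_of_le_one_right (abs_nonneg _) (h1 _)).trans (hprodabs _ u x)
  have key := (hasDerivAt_integral_of_dominated_loc_of_deriv_le (μ := gibbs V b (M + 1))
    (F := fun s x => thin k s x) (F' := fun u x =>
      ∑ i, (∏ j ∈ Finset.univ.erase i, (1 - u * k (x j))) * (-(k (x i))))
    (bound := fun _ => ∑ _i : Fin (M + 1), (1 + (|s| + 1)) ^ (M + 1)) (x₀ := s)
    (s := Metric.ball s 1) (Metric.ball_mem_nhds s one_pos)
    (Eventually.of_forall fun u => (measurable_thin hk u).aestronglyMeasurable)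
    (Integrable.of_bound (measurable_thin hk s).aestronglyMeasurable _
      (ae_of_all _ fun x => hprodabs Finset.univ s x))
    (hmd' s).aestronglyMeasurable
    (ae_of_all _ fun x u hu => ?_) (integrable_const _)
    (ae_of_all _ fun x u _ => hd x u)).2
  · refine key.congr_deriv ?_
    rw [integral_finsetSum _ fun i _ => Integrable.of_bound (hmd i s).aestronglyMeasurable _
      (ae_of_all _ fun x => hterm i s x)]
    -- The singled-out particle is the removed one, and removal takes the same form at every index,
    -- so the `M + 1` terms are equal.
    have e1 : ∀ i : Fin (M + 1), ∫ x : Fin (M + 1) → Euc n,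
        (∏ j ∈ Finset.univ.erase i, (1 - s * k (x j))) * (-(k (x i))) ∂(gibbs V b (M + 1)) =
        -(((ratio V b M).toReal)⁻¹ *
          ∫ p, joint V b p * (k p.2 * thin k s p.1) ∂((gibbs V b M).prod volume)) := by
      intro i
      rw [integral_gibbs_succ hVc hV hb i (hmd i s), ← mul_neg, ← integral_neg]
      congr 1
      refine integral_congr_ae (ae_of_all _ fun p => ?_)
      simp only [prod_erase_insertNth, Fin.insertNth_apply_same]
      ring
    simp only [e1, Finset.sum_const, Finset.card_univ, Fintype.card_fin, nsmul_eq_mul]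
    push_cast
    ring
  · refine (norm_sum_le _ _).trans (Finset.sum_le_sum fun i _ => (hterm i u x).trans ?_)
    have : |u| ≤ |s| + 1 := by
      have h3 := Metric.mem_ball.mp hu
      rw [Real.dist_eq] at h3
      linarith [abs_sub_abs_le_abs_sub u s]
    gcongr

/-- A factor between `0` and `1` does not increase an `L¹` error. Hence the product over the other
particles never has to be decoupled by hand. -/
lemma abs_integral_mul_sub_le {X : Type*} [MeasurableSpace X] {m : Measure X} {f g S : X → ℝ}
    (hf : Integrable f m) (hg : Integrable g m) (hSm : Measurable S) (hS0 : ∀ x, 0 ≤ S x)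
    (hS1 : ∀ x, S x ≤ 1) :
    |∫ x, f x * S x ∂m - ∫ x, g x * S x ∂m| ≤ ∫ x, |f x - g x| ∂m := by
  have hSb : ∀ᵐ x ∂m, ‖S x‖ ≤ 1 := ae_of_all _ fun x => by
    rw [Real.norm_of_nonneg (hS0 x)]; exact hS1 x
  have hfS := hf.mul_bdd (c := 1) hSm.aestronglyMeasurable hSb
  have hgS := hg.mul_bdd (c := 1) hSm.aestronglyMeasurable hSb
  rw [← integral_sub hfS hgS]
  refine (abs_integral_le_integral_abs).trans (integral_mono (hfS.sub hgS).abs (hf.sub hg).abs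
    fun x => ?_)
  beta_reduce
  rw [← sub_mul, abs_mul, abs_of_nonneg (hS0 x)]
  exact mul_le_of_le_one_right (abs_nonneg _) (hS1 x)

/-- Quantitative Poisson approximation of `E ∏_j (1 - k(x_j))`. -/
theorem abs_integral_thin_sub_le [NeZero n] (hVc : Continuous V) (hV : SuperLog V) (hb : 0 < b)
    (hk : Measurable k) (h0 : ∀ y, 0 ≤ k y) (h1 : ∀ y, k y ≤ 1) {t Θ L e₁ e₃ c R : ℝ}
    {w : Euc n → ℝ} (ht : 0 ≤ t) (hΘ : 0 ≤ Θ) (hL : 0 < L)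
    (hqi : Integrable fun y => Real.exp (-V y)) (hw : Integrable w) (hwL : ∫ y, w y = L)
    (hR : R = (ratio V b M).toReal)
    (hc : c = (M + 1) * R⁻¹ * t * ∫ y, Real.exp (-V y) * k y)
    (he₁ : (M + 1) * R⁻¹ * ∫ p : (Fin M → Euc n) × Euc n, Real.exp (-V p.2) * k p.2 *
      |inter b p.2 p.1 - t| ∂((gibbs V b M).prod volume) ≤ e₁)
    (he₃ : ∫ p : (Fin M → Euc n) × Euc n, |joint V b p - w p.2|
      ∂((gibbs V b M).prod volume) ≤ e₃) :
    |∫ x, thin k 1 x ∂(gibbs V b (M + 1)) - Real.exp (-Θ)| ≤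
      e₁ + |c - Θ| + Θ * (L⁻¹ * (e₃ + R * (c + e₁) / (M + 1) + |R - L|)) := by
  have hP := isProbabilityMeasure_gibbs hVc hV hb M
  have hP' := isProbabilityMeasure_gibbs hVc hV hb (M + 1)
  have hR0 : 0 < R := by
    rw [hR]
    exact ENNReal.toReal_pos (ratio_ne_zero hVc hV hb M) (ratio_ne_top hVc hV hb M)
  have hVm := hVc.measurable
  set m := (gibbs V b M).prod (volume : Measure (Euc n)) with hm
  have hJ := integrable_joint hVc hV hb M
  set q : Euc n → ℝ := fun y => Real.exp (-V y) with hq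
  have hqk : Integrable fun y => q y * k y := hqi.mul_bdd (c := 1) hk.aestronglyMeasurable
    (ae_of_all _ fun y => by rw [Real.norm_of_nonneg (h0 y)]; exact h1 y)
  have hqk0 : 0 ≤ ∫ y, q y * k y := integral_nonneg fun y =>
    mul_nonneg (Real.exp_pos _).le (h0 y)
  have hc0 : 0 ≤ c := by
    rw [hc]
    have := inv_pos.mpr hR0
    positivity
  have hkm2 : Measurable fun p : (Fin M → Euc n) × Euc n => k p.2 := hk.comp measurable_snd
  have hJk : Integrable (fun p => joint V b p * k p.2) m := hJ.mul_bdd (c := 1)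
    hkm2.aestronglyMeasurable
    (ae_of_all _ fun p => by rw [Real.norm_of_nonneg (h0 _)]; exact h1 _)
  have hprodi : ∀ {v : Euc n → ℝ}, Integrable v →
      Integrable (fun p : (Fin M → Euc n) × Euc n => v p.2) m := by
    intro v hv
    have := (integrable_const (1 : ℝ) (μ := gibbs V b M)).mul_prod hv
    simpa using this
  have hprod : ∀ (v : Euc n → ℝ) (S : (Fin M → Euc n) → ℝ),
      ∫ p, v p.2 * S p.1 ∂m = (∫ x, S x ∂(gibbs V b M)) * ∫ y, v y := by
    intro v S
    rw [← integral_prod_mul]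
    refine integral_congr_ae (ae_of_all _ fun p => ?_)
    simp only
    ring
  set G : ℝ → ℝ := fun s => ∫ x, thin k s x ∂(gibbs V b (M + 1)) with hG
  set T : ℝ → ℝ := fun s => (M + 1) * R⁻¹ * ∫ p, joint V b p * (k p.2 * thin k s p.1) ∂m with hT
  have hderiv : ∀ s, HasDerivAt G (-T s) s := fun s => by
    have := hasDerivAt_integral_thin (M := M) hVc hV hb hk h0 h1 s
    rwa [← hR] at this
  set ε := e₁ + |c - Θ| + Θ * (L⁻¹ * (e₃ + R * (c + e₁) / (M + 1) + |R - L|)) with hε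
  have hM1 : (0 : ℝ) < M + 1 := by positivity
  -- The differential inequality `|G' + Θ G| ≤ ε`, uniformly along the interpolation.
  have hbound : ∀ s ∈ Set.Icc (0 : ℝ) 1, |T s - Θ * G s| ≤ ε := by
    intro s hs
    have hSm : Measurable fun p : (Fin M → Euc n) × Euc n => thin k s p.1 :=
      (measurable_thin hk s).comp measurable_fst
    have hS0 : ∀ p : (Fin M → Euc n) × Euc n, 0 ≤ thin k s p.1 := fun p => thin_nonneg h0 h1 hs _
    have hS1 : ∀ p : (Fin M → Euc n) × Euc n, thin k s p.1 ≤ 1 := fun p => thin_le_one h0 h1 hs _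
    set ES := ∫ x, thin k s x ∂(gibbs V b M) with hES
    have hES0 : 0 ≤ ES := integral_nonneg fun x => thin_nonneg h0 h1 hs x
    have hES1 : ES ≤ 1 := by
      calc ES ≤ ∫ _x, (1 : ℝ) ∂(gibbs V b M) := integral_mono_of_nonneg
            (ae_of_all _ fun x => thin_nonneg h0 h1 hs x) (integrable_const _)
            (ae_of_all _ fun x => thin_le_one h0 h1 hs x)
        _ = 1 := by simp
    have hG0 : 0 ≤ G s := integral_nonneg fun x => thin_nonneg h0 h1 hs x
    have hG1 : G s ≤ 1 := by
      calc G s ≤ ∫ _x, (1 : ℝ) ∂(gibbs V b (M + 1)) := integral_mono_of_nonneg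
            (ae_of_all _ fun x => thin_nonneg h0 h1 hs x) (integrable_const _)
            (ae_of_all _ fun x => thin_le_one h0 h1 hs x)
        _ = 1 := by simp
    -- On the support of `k` the interaction factor is replaced by the constant `t`; the integral
    -- then splits into `c` times the mean over `M` particles.
    have hTc : |T s - c * ES| ≤ e₁ := by
      have h2 := abs_integral_mul_sub_le hJk (hprodi (hqk.const_mul t)) hSm hS0 hS1
      rw [hprod (fun y => t * (q y * k y)) (thin k s), integral_const_mul] at h2
      have h3 : T s - c * ES = (M + 1) * R⁻¹ * (∫ p, joint V b p * k p.2 * thin k s p.1 ∂m -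
          ES * (t * ∫ y, q y * k y)) := by
        simp only [hT, hc, mul_assoc]
        ring
      rw [h3, abs_mul, abs_of_pos (by have := inv_pos.mpr hR0; positivity)]
      refine le_trans (mul_le_mul_of_nonneg_left (h2.trans (le_of_eq ?_))
        (by have := inv_pos.mpr hR0; positivity)) he₁
      refine integral_congr_ae (ae_of_all _ fun p => ?_)
      simp only [joint, hq]
      rw [show Real.exp (-V p.2) * inter b p.2 p.1 * k p.2 - t * (Real.exp (-V p.2) * k p.2) =
        Real.exp (-V p.2) * k p.2 * (inter b p.2 p.1 - t) by ring, abs_mul,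
        abs_of_nonneg (mul_nonneg (Real.exp_pos _).le (h0 _))]
    have hT0 : 0 ≤ T s := by
      have := inv_pos.mpr hR0
      have h2 : 0 ≤ ∫ p, joint V b p * (k p.2 * thin k s p.1) ∂m := integral_nonneg fun p =>
        mul_nonneg (joint_nonneg p) (mul_nonneg (h0 _) (hS0 p))
      simp only [hT]
      positivity
    have hTle : T s ≤ c + e₁ := by
      have h2 := (abs_le.mp hTc).2
      have h3 := mul_le_of_le_one_right hc0 hES1
      linarith
    have hJS : |∫ p, joint V b p * thin k s p.1 ∂m - L * ES| ≤ e₃ := by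
      have h2 := abs_integral_mul_sub_le hJ (hprodi hw) hSm hS0 hS1
      rw [hprod w (thin k s), hwL, mul_comm] at h2
      exact h2.trans he₃
    -- `G` has one factor `1 - s k(y)` more than the product over `M` particles. Its second term
    -- costs `R T / (M + 1)`, of order `1/M`.
    have hRG : R * G s = ∫ p, joint V b p * thin k s p.1 ∂m - s * (R * T s / (M + 1)) := by
      have hSb : ∀ᵐ p ∂m, ‖thin k s p.1‖ ≤ 1 := ae_of_all _ fun p => by
        rw [Real.norm_of_nonneg (hS0 p)]; exact hS1 p
      simp only [hG, hT]
      rw [integral_gibbs_succ hVc hV hb 0 (measurable_thin hk s), ← hR, ← mul_assoc,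
        mul_inv_cancel₀ hR0.ne', one_mul]
      have h2 : s * (R * ((M + 1) * R⁻¹ * ∫ p, joint V b p * (k p.2 * thin k s p.1) ∂m) / (M + 1))
          = ∫ p, s * (joint V b p * k p.2 * thin k s p.1) ∂m := by
        rw [integral_const_mul]
        simp only [mul_assoc]
        field_simp
      rw [h2, ← integral_sub (hJ.mul_bdd (c := 1) hSm.aestronglyMeasurable hSb)
        ((hJk.mul_bdd (c := 1) hSm.aestronglyMeasurable hSb).const_mul s)]
      refine integral_congr_ae (ae_of_all _ fun p => ?_)
      simp only [thin_insertNth]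
      ring
    -- Since `joint` is close to `w`, which depends on the added particle only, the integral in
    -- `hRG` is close to `L · ES`; and `R` is close to `L`.
    have hdiff : |ES - G s| ≤ L⁻¹ * (e₃ + R * (c + e₁) / (M + 1) + |R - L|) := by
      have h2 : L * (ES - G s) = -(∫ p, joint V b p * thin k s p.1 ∂m - L * ES) +
          s * (R * T s / (M + 1)) + (R - L) * G s := by linarith
      have h3 : |s * (R * T s / (M + 1))| ≤ R * (c + e₁) / (M + 1) := by
        rw [abs_of_nonneg (by have := hs.1; positivity)]
        calc _ ≤ 1 * (R * T s / (M + 1)) := by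
              gcongr
              exact hs.2
          _ ≤ _ := by
              rw [one_mul]
              gcongr
      have h4 : |(R - L) * G s| ≤ |R - L| := by
        rw [abs_mul, abs_of_nonneg hG0]
        exact mul_le_of_le_one_right (abs_nonneg _) hG1
      have h5 : L * |ES - G s| ≤ e₃ + R * (c + e₁) / (M + 1) + |R - L| := by
        rw [← abs_of_pos hL, ← abs_mul, abs_of_pos hL, h2]
        refine (abs_add_three _ _ _).trans ?_
        rw [abs_neg]
        linarith
      rw [← div_eq_inv_mul, le_div_iff₀ hL]
      linarith
    have h6 : T s - Θ * G s = (T s - c * ES) + (c - Θ) * ES + Θ * (ES - G s) := by ring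
    rw [h6]
    refine (abs_add_three _ _ _).trans ?_
    rw [abs_mul, abs_mul, abs_of_nonneg hΘ, abs_of_nonneg hES0]
    have h7 := mul_le_of_le_one_right (abs_nonneg (c - Θ)) hES1
    have h8 := mul_le_mul_of_nonneg_left hdiff hΘ
    linarith
  -- Integrating factor, normalised to be at most `1` on `[0, 1]`: the function goes from `e^{-Θ}`
  -- at `0` to `G(1)` at `1`, with derivative at most `ε` in absolute value.
  have hg : ∀ s, HasDerivAt (fun s => Real.exp (Θ * (s - 1)) * G s)
      (Real.exp (Θ * (s - 1)) * (Θ * G s - T s)) s := by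
    intro s
    have h2 : HasDerivAt (fun s => Real.exp (Θ * (s - 1))) (Real.exp (Θ * (s - 1)) * Θ) s := by
      have := (((hasDerivAt_id s).sub_const 1).const_mul Θ).exp
      simpa using this
    have h3 := h2.mul (hderiv s)
    exact h3.congr_deriv (by ring)
  have hfin := norm_image_sub_le_of_norm_deriv_le_segment_01'
    (f := fun s => Real.exp (Θ * (s - 1)) * G s) (C := ε)
    (fun s hs => (hg s).hasDerivWithinAt) (fun s hs => by
      rw [norm_mul, Real.norm_of_nonneg (Real.exp_pos _).le, Real.norm_eq_abs, abs_sub_comm]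
      have hs' : s ∈ Set.Icc (0 : ℝ) 1 := ⟨hs.1, hs.2.le⟩
      refine (mul_le_of_le_one_left (abs_nonneg _) ?_).trans (hbound s hs')
      rw [Real.exp_le_one_iff]
      nlinarith [hs.2])
  have hG0 : G 0 = 1 := by simp [hG, thin]
  simp only [sub_self, mul_zero, Real.exp_zero, one_mul, zero_sub, mul_neg, mul_one, hG0,
    Real.norm_eq_abs] at hfin
  exact hfin

end Removal

/-! ### The zoom map: expansion of the potential and change of variables. -/

section Zoom

variable {V : Euc n → ℝ} {e : Euc n} {a : ℝ}
  {ψ : Diffeomorph 𝓘(ℝ, Euc n) 𝓘(ℝ, Euc n) (Euc n) (Euc n) 1}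

/-- The mean value inequality on the ball, applied first to the derivative and then to `V`. -/
lemma abs_taylor_le (hV : ContDiff ℝ 2 V) {S δ : ℝ}
    (hS : ∀ y ∈ Metric.closedBall e δ, ‖fderiv ℝ (fderiv ℝ V) y‖ ≤ S) {z : Euc n}
    (hz : ‖z‖ ≤ δ) : |V (e + z) - V e - fderiv ℝ V e z| ≤ S * δ ^ 2 := by
  have hδ : 0 ≤ δ := (norm_nonneg z).trans hz
  have hconv := convex_closedBall e δ
  have he : e ∈ Metric.closedBall e δ := Metric.mem_closedBall_self hδ
  have hS0 : 0 ≤ S := (norm_nonneg (fderiv ℝ (fderiv ℝ V) e)).trans (hS e he)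
  have hz' : e + z ∈ Metric.closedBall e δ := by simpa [dist_eq_norm] using hz
  have hD : Differentiable ℝ (fderiv ℝ V) :=
    (hV.fderiv_right (m := 1) (by norm_num)).differentiable (by norm_num)
  have hDV : Differentiable ℝ V := hV.differentiable (by norm_num)
  have h1 : ∀ y ∈ Metric.closedBall e δ, ‖fderiv ℝ V y - fderiv ℝ V e‖ ≤ S * δ := by
    intro y hy
    refine (hconv.norm_image_sub_le_of_norm_fderiv_le (fun x _ => hD x) hS he hy).trans ?_
    gcongr
    rwa [← dist_eq_norm]
  have h2 := hconv.norm_image_sub_le_of_norm_fderiv_le' (fun x _ => hDV x) h1 he hz'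
  rw [add_sub_cancel_left, Real.norm_eq_abs] at h2
  calc _ ≤ S * δ * ‖z‖ := h2
    _ ≤ S * δ * δ := by gcongr
    _ = _ := by ring

/-- First order expansion of the potential in the zoomed coordinates. -/
lemma abs_zoom_sub_le (hV : ContDiff ℝ 2 V) (ha : 0 < a) {υ : Euc n}
    (hgrad : gradient V e = a • υ) {ρ : ℝ} {x : Euc n} (hx : ‖ψ x‖ ≤ ρ) :
    |V (zoom e a ψ x) - V e - inner ℝ υ (ψ x)| ≤ (a ^ 2)⁻¹ *
      sSup ((fun x => ‖fderiv ℝ (fderiv ℝ V) (zoom e a ψ x)‖) ''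
        (ψ.symm '' Metric.closedBall 0 ρ)) * ρ ^ 2 := by
  set S := sSup ((fun x => ‖fderiv ℝ (fderiv ℝ V) (zoom e a ψ x)‖) ''
        (ψ.symm '' Metric.closedBall 0 ρ)) with hSdef
  have hK : IsCompact (ψ.symm '' Metric.closedBall (0 : Euc n) ρ) :=
    (isCompact_closedBall _ _).image ψ.symm.continuous
  have hD : Continuous (fderiv ℝ (fderiv ℝ V)) :=
    (hV.fderiv_right (m := 1) (by norm_num)).continuous_fderiv (by norm_num)
  have hz : Continuous (zoom e a ψ) := by
    unfold zoom
    have := ψ.continuous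
    fun_prop
  have hDz : Continuous fun x => ‖fderiv ℝ (fderiv ℝ V) (zoom e a ψ x)‖ := by
    have := hD.comp hz
    exact Continuous.norm (E := Euc n →L[ℝ] Euc n →L[ℝ] ℝ) this
  have hbdd := (hK.image hDz).bddAbove
  -- The Hessian is controlled along the zoom of compact sets. The zoom maps the compact set `ψ⁻¹`
  -- of a ball of radius `ρ` onto a ball around `e`, where convexity is available.
  have hS : ∀ y ∈ Metric.closedBall e (a⁻¹ * ρ), ‖fderiv ℝ (fderiv ℝ V) y‖ ≤ S := by
    intro y hy
    refine le_csSup hbdd ⟨zoomInv e a ψ y, ⟨a • (y - e), ?_, rfl⟩, ?_⟩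
    · rw [mem_closedBall_zero_iff, norm_smul, Real.norm_of_nonneg ha.le, ← dist_eq_norm]
      have := mul_le_mul_of_nonneg_left (Metric.mem_closedBall.mp hy) ha.le
      rwa [← mul_assoc, mul_inv_cancel₀ ha.ne', one_mul] at this
    · simp only [zoom_zoomInv e ha ψ]
  have hn : ‖a⁻¹ • ψ x‖ ≤ a⁻¹ * ρ := by
    rw [norm_smul, Real.norm_of_nonneg (inv_nonneg.mpr ha.le)]
    gcongr
  have h1 := abs_taylor_le hV hS hn
  have h2 : fderiv ℝ V e (a⁻¹ • ψ x) = inner ℝ υ (ψ x) := by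
    have h3 : fderiv ℝ V e (ψ x) = inner ℝ (gradient V e) (ψ x) := by
      rw [gradient, InnerProductSpace.toDual_symm_apply]
    rw [map_smul, h3, hgrad, inner_smul_left, smul_eq_mul]
    simp [← mul_assoc, inv_mul_cancel₀ ha.ne']
  rw [h2] at h1
  refine h1.trans (le_of_eq ?_)
  rw [mul_pow, inv_pow]
  ring

lemma continuous_zoomInv (e : Euc n) (a : ℝ)
    (ψ : Diffeomorph 𝓘(ℝ, Euc n) 𝓘(ℝ, Euc n) (Euc n) (Euc n) 1) :
    Continuous (zoomInv e a ψ) := by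
  unfold zoomInv
  exact ψ.symm.continuous.comp (by fun_prop)

/-- Change of variables by the zoom map. -/
lemma integral_eq_integral_zoom (ha : 0 < a) (hψ : ∀ x, |(fderiv ℝ ψ x).det| = 1)
    (g : Euc n → ℝ) : ∫ y, g y = (a ^ n)⁻¹ * ∫ x, g (zoom e a ψ x) := by
  have hd : ∀ x ∈ (Set.univ : Set (Euc n)),
      HasFDerivWithinAt (zoom e a ψ) (a⁻¹ • fderiv ℝ ψ x) Set.univ x := by
    intro x _
    have h1 : DifferentiableAt ℝ ψ x :=
      (ψ.contMDiff.contDiff.differentiable (by norm_num)).differentiableAt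
    exact ((h1.hasFDerivAt.const_smul a⁻¹).const_add e).hasFDerivWithinAt
  have hinj : Set.InjOn (zoom e a ψ) Set.univ := fun x _ y _ h => by
    rw [← zoomInv_zoom e ha ψ x, h, zoomInv_zoom e ha ψ]
  have himg : zoom e a ψ '' Set.univ = Set.univ :=
    Set.eq_univ_of_forall fun y => ⟨zoomInv e a ψ y, trivial, zoom_zoomInv e ha ψ y⟩
  have h := integral_image_eq_integral_abs_det_fderiv_smul volume MeasurableSet.univ hd hinj g
  rw [himg, setIntegral_univ, setIntegral_univ] at h
  rw [h, ← integral_const_mul]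
  refine integral_congr_ae (ae_of_all _ fun x => ?_)
  have hdet : |(a⁻¹ • fderiv ℝ ψ x).det| = (a ^ n)⁻¹ := by
    rw [ContinuousLinearMap.det, ContinuousLinearMap.toLinearMap_smul, LinearMap.det_smul,
      abs_mul]
    have := hψ x
    rw [ContinuousLinearMap.det] at this
    rw [this, mul_one, finrank_euclideanSpace, Fintype.card_fin, abs_of_pos (by positivity),
      inv_pow]
  simp only [hdet, smul_eq_mul]

end Zoom

/-! ### Asymptotics at the edge points. -/

section EdgeAsymptotics

variable {V : Euc n → ℝ} {γ L : ℝ} {β : ℕ → ℝ} {E : ℕ → Euc n} {α : ℕ → ℝ}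

/-- The edge condition makes `N e^{-V(E)} |E|^{β N}` comparable to `L α^n`, which is at least `L
|E|^{-n}` once `α |E| ≥ 1`. As `e^{-V}` decays faster than any power, `|E|` grows at most linearly
in `N`. -/
lemma exists_eventually_norm_le (hV : SuperLog V) (hγ : 0 ≤ γ) (hL : 0 < L)
    (hβγ : Tendsto (fun N : ℕ => β N * (N : ℝ)) atTop (𝓝 γ))
    (hE : Tendsto (fun N => ‖E N‖) atTop atTop) (hα : ∀ N, 0 < α N)
    (hEdge : Tendsto (fun N : ℕ => (N : ℝ) * Real.exp (-V (E N) + β N * (N : ℝ) *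
      Real.log ‖E N‖) / (L * α N ^ n)) atTop (𝓝 1))
    (hαE : Tendsto (fun N => α N * ‖E N‖) atTop atTop) :
    ∃ C : ℝ, 0 < C ∧ ∀ᶠ N : ℕ in atTop, ‖E N‖ ≤ C * N := by
  -- The exponent pays for `β N ≤ γ + 1`, for `α^{-n} ≤ |E|^n`, and for the one power of `|E|` to be
  -- bounded.
  obtain ⟨C, hC, hCle⟩ := hV.exists_exp_neg_le (γ + 1 + n + 1) (by positivity)
  refine ⟨2 * C / L, by positivity, ?_⟩
  filter_upwards [hEdge.eventually_const_le (show (1 : ℝ) / 2 < 1 by norm_num),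
    hE.eventually_ge_atTop 1, hαE.eventually_ge_atTop 1,
    hβγ.eventually_le_const (show γ < γ + 1 by linarith)] with N h1 h2 h3 h4
  have hαN := hα N
  have hr : 0 < ‖E N‖ := by linarith
  rw [le_div_iff₀ (by positivity)] at h1
  have h5 : Real.exp (-V (E N) + β N * (N : ℝ) * Real.log ‖E N‖) ≤
      Real.exp (-V (E N)) * ‖E N‖ ^ (γ + 1) := by
    rw [Real.exp_add, Real.rpow_def_of_pos hr]
    have := Real.log_nonneg h2
    refine mul_le_mul_of_nonneg_left (Real.exp_le_exp.mpr ?_) (Real.exp_pos _).le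
    rw [mul_comm (Real.log _)]
    exact mul_le_mul_of_nonneg_right h4 this
  have h6 : ‖E N‖ ^ (γ + 1) * ‖E N‖ ^ n * ‖E N‖ ≤ (1 + ‖E N‖) ^ (γ + 1 + n + 1) := by
    rw [← Real.rpow_natCast, ← Real.rpow_add hr, ← Real.rpow_add_one hr.ne']
    exact Real.rpow_le_rpow hr.le (by linarith) (by positivity)
  have h7 : 1 ≤ α N ^ n * ‖E N‖ ^ n := by
    rw [← mul_pow]
    exact one_le_pow₀ h3
  have h8 : L / 2 * ‖E N‖ ≤ N * C := by
    calc L / 2 * ‖E N‖ ≤ L / 2 * ‖E N‖ * (α N ^ n * ‖E N‖ ^ n) :=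
          le_mul_of_one_le_right (by positivity) h7
      _ = 1 / 2 * (L * α N ^ n) * (‖E N‖ ^ n * ‖E N‖) := by ring
      _ ≤ N * (Real.exp (-V (E N)) * ‖E N‖ ^ (γ + 1)) * (‖E N‖ ^ n * ‖E N‖) := by
          refine mul_le_mul_of_nonneg_right ?_ (by positivity)
          exact h1.trans (mul_le_mul_of_nonneg_left h5 (Nat.cast_nonneg N))
      _ = N * (Real.exp (-V (E N)) * (‖E N‖ ^ (γ + 1) * ‖E N‖ ^ n * ‖E N‖)) := by ring
      _ ≤ N * (Real.exp (-V (E N)) * (1 + ‖E N‖) ^ (γ + 1 + n + 1)) := by gcongr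
      _ ≤ N * C := by
          gcongr
          exact hCle _
  rw [div_mul_eq_mul_div, le_div_iff₀ hL]
  linarith

/-- `β` is of order at most `1/N` and `log |E|` of order at most `log N`. This makes the factor
`|E|^β`, by which `N` and `N - 1` particles differ, harmless. -/
lemma tendsto_mul_log_norm (hβ : ∀ N, 0 < β N)
    (hβγ : Tendsto (fun N : ℕ => β N * (N : ℝ)) atTop (𝓝 γ))
    (hE : Tendsto (fun N => ‖E N‖) atTop atTop) {C : ℝ} (hC : 0 < C)
    (h : ∀ᶠ N : ℕ in atTop, ‖E N‖ ≤ C * N) :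
    Tendsto (fun N => β N * Real.log ‖E N‖) atTop (𝓝 0) := by
  have h1 : Tendsto (fun N : ℕ => Real.log N / (N : ℝ)) atTop (𝓝 0) :=
    Real.isLittleO_log_id_atTop.tendsto_div_nhds_zero.comp tendsto_natCast_atTop_atTop
  have h2 : Tendsto (fun N : ℕ => Real.log C / (N : ℝ)) atTop (𝓝 0) :=
    tendsto_natCast_atTop_atTop.const_div_atTop _
  have h3 : Tendsto (fun N : ℕ => β N * N * (Real.log C / N + Real.log N / N)) atTop (𝓝 0) := by
    have := hβγ.mul (h2.add h1)
    simpa using this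
  refine squeeze_zero' ?_ ?_ h3
  · filter_upwards [hE.eventually_ge_atTop 1] with N hN
    exact mul_nonneg (hβ N).le (Real.log_nonneg hN)
  · filter_upwards [h, hE.eventually_ge_atTop 1, eventually_gt_atTop 0] with N hN hN1 hN0
    have hN0' : (0 : ℝ) < N := by exact_mod_cast hN0
    have h4 : Real.log ‖E N‖ ≤ Real.log C + Real.log N := by
      rw [← Real.log_mul hC.ne' hN0'.ne']
      exact Real.log_le_log (by linarith) hN
    have h5 := mul_le_mul_of_nonneg_left h4 (hβ N).le
    refine h5.trans (le_of_eq ?_)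
    field_simp

/-- Convergence of the rescaled one-particle weights to the intensity. -/
lemma tendsto_integral_zoom {υN : ℕ → Euc n} {υ : Euc n}
    {ψ : Diffeomorph 𝓘(ℝ, Euc n) 𝓘(ℝ, Euc n) (Euc n) (Euc n) 1}
    (hV : ContDiff ℝ 2 V) (hgrad : ∀ N, gradient V (E N) = α N • υN N) (hα : ∀ N, 0 < α N)
    (hυN : ∀ N, ‖υN N‖ = 1) (hυ : Tendsto υN atTop (𝓝 υ))
    (hHess : ∀ K : Set (Euc n), IsCompact K →
      Tendsto (fun N : ℕ => (α N ^ 2)⁻¹ *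
          sSup ((fun x => ‖fderiv ℝ (fderiv ℝ V) (zoom (E N) (α N) ψ x)‖) '' K))
        atTop (𝓝 0)) {h : Euc n → ℝ} (hc : Continuous h) (hcs : HasCompactSupport h)
    {ρ : ℝ} (hρ : ∀ x, h x ≠ 0 → ‖ψ x‖ ≤ ρ) :
    Tendsto (fun N => ∫ x, Real.exp (-(V (zoom (E N) (α N) ψ x) - V (E N))) * h x) atTop
      (𝓝 (∫ x, Real.exp (-(inner ℝ υ (ψ x))) * h x)) := by
  have hK : IsCompact (ψ.symm '' Metric.closedBall (0 : Euc n) ρ) :=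
    (isCompact_closedBall _ _).image ψ.symm.continuous
  have hS := (hHess _ hK).mul_const (ρ ^ 2)
  rw [zero_mul] at hS
  set S : ℕ → ℝ := fun N => (α N ^ 2)⁻¹ *
    sSup ((fun x => ‖fderiv ℝ (fderiv ℝ V) (zoom (E N) (α N) ψ x)‖) ''
      (ψ.symm '' Metric.closedBall 0 ρ)) * ρ ^ 2 with hSdef
  have hkey : ∀ N x, ‖ψ x‖ ≤ ρ →
      |V (zoom (E N) (α N) ψ x) - V (E N) - inner ℝ (υN N) (ψ x)| ≤ S N := fun N x hx =>
    abs_zoom_sub_le hV (hα N) (hgrad N) hx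
  have hzc : ∀ N, Continuous (zoom (E N) (α N) ψ) := fun N => by
    unfold zoom
    have := ψ.continuous
    fun_prop
  have hVc := hV.continuous
  refine tendsto_integral_filter_of_dominated_convergence (fun x => Real.exp (1 + ρ) * ‖h x‖)
    (Eventually.of_forall fun N => ?_) ?_ ((hc.integrable_of_hasCompactSupport hcs).norm.const_mul _)
    (ae_of_all _ fun x => ?_)
  · have := hzc N
    exact (by fun_prop : Continuous fun x =>
      Real.exp (-(V (zoom (E N) (α N) ψ x) - V (E N))) * h x).aestronglyMeasurable
  · filter_upwards [hS.eventually_le_const zero_lt_one] with N hN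
    refine ae_of_all _ fun x => ?_
    rcases eq_or_ne (h x) 0 with h0 | h0
    · simp [h0]
    · rw [norm_mul, Real.norm_of_nonneg (Real.exp_pos _).le]
      gcongr
      have h1 := (abs_le.mp (hkey N x (hρ x h0))).1
      have h2 := (abs_le.mp (abs_real_inner_le_norm (υN N) (ψ x))).1
      rw [hυN, one_mul] at h2
      have h3 := hρ x h0
      linarith
  · rcases eq_or_ne (h x) 0 with h0 | h0
    · simp [h0]
    · refine Tendsto.mul_const _ ?_
      have h1 : Tendsto (fun N => inner ℝ (υN N) (ψ x)) atTop (𝓝 (inner ℝ υ (ψ x))) :=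
        hυ.inner tendsto_const_nhds
      have h2 : Tendsto (fun N => V (zoom (E N) (α N) ψ x) - V (E N) - inner ℝ (υN N) (ψ x))
          atTop (𝓝 0) := squeeze_zero_norm (fun N => hkey N x (hρ x h0)) hS
      have h3 := h2.add h1
      simp only [sub_add_cancel, zero_add] at h3
      exact (Real.continuous_exp.tendsto _).comp h3.neg

/-- Uniformity in `y` from the statement about sequences: for each `M` pick a violating point if
there is one, and apply that statement to the chosen points. -/
lemma eventually_forall_lintegral_inter_edge [NeZero n] {Γ : ℝ} {lam : Measure (Euc n)}
    (hVc : Continuous V) (hV : SuperLog V)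
    (hΓ : 0 ≤ Γ) (hl : IsDominating V Γ lam) {b : ℕ → ℝ} (hb : ∀ M, 0 < b M)
    (hbΓ : ∀ᶠ M : ℕ in atTop, b M * M ≤ Γ) (hE : Tendsto (fun N => ‖E N‖) atTop atTop)
    {ρ : ℕ → ℝ} (hρ : Tendsto ρ atTop (𝓝 0)) (hρ0 : ∀ N, 0 ≤ ρ N) {ε : ℝ≥0∞} (hε : 0 < ε) :
    ∀ᶠ M : ℕ in atTop, ∀ y : Euc n, |‖y‖ - ‖E M‖| ≤ ρ M * ‖E M‖ →
      ∫⁻ x : Fin M → Euc n, ENNReal.ofReal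
        |inter (b M) y x * Real.exp (-(b M * M * Real.log ‖E M‖)) - 1| ∂(gibbs V (b M) M) ≤ ε := by
  have h : ∀ M : ℕ, ∃ z : Euc n, |‖z‖ - ‖E M‖| ≤ ρ M * ‖E M‖ ∧
      ((∫⁻ x : Fin M → Euc n, ENNReal.ofReal |inter (b M) z x *
        Real.exp (-(b M * M * Real.log ‖E M‖)) - 1| ∂(gibbs V (b M) M) ≤ ε) →
      ∀ y : Euc n, |‖y‖ - ‖E M‖| ≤ ρ M * ‖E M‖ →
      ∫⁻ x : Fin M → Euc n, ENNReal.ofReal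
        |inter (b M) y x * Real.exp (-(b M * M * Real.log ‖E M‖)) - 1|
          ∂(gibbs V (b M) M) ≤ ε) := by
    intro M
    by_cases hM : ∀ y : Euc n, |‖y‖ - ‖E M‖| ≤ ρ M * ‖E M‖ → ∫⁻ x : Fin M → Euc n,
        ENNReal.ofReal |inter (b M) y x * Real.exp (-(b M * M * Real.log ‖E M‖)) - 1|
          ∂(gibbs V (b M) M) ≤ ε
    · refine ⟨E M, ?_, fun _ => hM⟩
      rw [sub_self, abs_zero]
      exact mul_nonneg (hρ0 M) (norm_nonneg _)
    · push Not at hM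
      obtain ⟨z, hz1, hz2⟩ := hM
      exact ⟨z, hz1, fun hle => absurd hle (not_le.mpr hz2)⟩
  choose z hz1 hz2 using h
  have hlim := tendsto_lintegral_inter_edge hVc hV hΓ hl hb hbΓ hE hρ
    (Eventually.of_forall hz1)
  filter_upwards [ENNReal.tendsto_nhds_zero.mp hlim ε hε] with M hM
  exact hz2 M hM

end EdgeAsymptotics

/-! ### Convergence of the Laplace functionals. -/

section Convergence

variable {V : Euc n → ℝ} {γ Γ L : ℝ} {μ lam : Measure (Euc n)}

/-- After one particle is removed, `M` particles remain at the inverse temperature `β (M + 1)` of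
the original system. -/
lemma tendsto_shift_mul {β : ℕ → ℝ}
    (hβγ : Tendsto (fun N : ℕ => β N * (N : ℝ)) atTop (𝓝 γ)) :
    Tendsto (fun M : ℕ => β (M + 1) * (M : ℝ)) atTop (𝓝 γ) := by
  have h1 := (tendsto_add_atTop_iff_nat 1).mpr hβγ
  have h2 := h1.mul (tendsto_natCast_div_add_atTop (1 : ℝ))
  rw [mul_one] at h2
  refine h2.congr fun M => ?_
  push_cast
  have : (M : ℝ) + 1 ≠ 0 := by positivity
  field_simp

lemma IsEquilibrium.tendsto_integral_abs_joint_sub [NeZero n] (h : IsEquilibrium V γ L μ)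
    (hVc : Continuous V) (hV : SuperLog V) (hΓ : 0 ≤ Γ) (hl : IsDominating V Γ lam)
    {b : ℕ → ℝ} (hb : ∀ M, 0 < b M)
    (hbγ : Tendsto (fun M : ℕ => b M * M) atTop (𝓝 γ)) (hbΓ : ∀ᶠ M : ℕ in atTop, b M * M ≤ Γ) :
    Tendsto (fun M : ℕ => ∫ p : (Fin M → Euc n) × Euc n,
      |joint V (b M) p - Real.exp (-(γ * pot μ p.2) - V p.2)|
        ∂((gibbs V (b M) M).prod volume)) atTop (𝓝 0) := by
  have hlim := h.tendsto_lintegral_lintegral_inter hVc hV hΓ hl hb hbγ hbΓ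
  have hpm := h.measurable_pot'
  have hVm := hVc.measurable
  have h2 := (ENNReal.tendsto_toReal ENNReal.zero_ne_top).comp hlim
  rw [ENNReal.toReal_zero] at h2
  refine h2.congr fun M => ?_
  have hP := isProbabilityMeasure_gibbs hVc hV (hb M) M
  have hm := measurable_joint (M := M) (b := b M) hVc
  have hm' : Measurable fun p : (Fin M → Euc n) × Euc n =>
      |joint V (b M) p - Real.exp (-(γ * pot μ p.2) - V p.2)| := by fun_prop
  rw [integral_eq_lintegral_of_nonneg_ae (ae_of_all _ fun p => abs_nonneg _)
    hm'.aestronglyMeasurable, lintegral_prod_symm' _ hm'.ennreal_ofReal, Function.comp_apply]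
  congr 1
  refine lintegral_congr fun y => ?_
  rw [← lintegral_const_mul' _ _ ENNReal.ofReal_ne_top]
  refine lintegral_congr fun x => ?_
  rw [← ENNReal.ofReal_mul (Real.exp_pos _).le]
  congr 1
  rw [joint, sub_eq_add_neg (-(γ * pot μ y)), add_comm (-(γ * pot μ y)), Real.exp_add, ← mul_sub,
    abs_mul, abs_of_pos (Real.exp_pos _)]

/-- A relative error for the interaction factor, needed only where `k ≠ 0`, becomes a relative error
for the integrated intensity. -/
lemma integral_mul_abs_inter_sub_le [NeZero n] (hVc : Continuous V) (hV : SuperLog V)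
    {b t ε : ℝ} (hb : 0 < b) (ht : 0 < t) (hε : 0 ≤ ε) {M : ℕ} {k : Euc n → ℝ}
    (hk : Measurable k) (h0 : ∀ y, 0 ≤ k y)
    (hqk : Integrable fun y => Real.exp (-V y) * k y)
    (h : ∀ y, k y ≠ 0 → ∫⁻ x : Fin M → Euc n, ENNReal.ofReal |inter b y x * t⁻¹ - 1|
      ∂(gibbs V b M) ≤ ENNReal.ofReal ε) :
    ∫ p : (Fin M → Euc n) × Euc n, Real.exp (-V p.2) * k p.2 * |inter b p.2 p.1 - t|
      ∂((gibbs V b M).prod volume) ≤ t * (∫ y, Real.exp (-V y) * k y) * ε := by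
  have hP := isProbabilityMeasure_gibbs hVc hV hb M
  have hVm := hVc.measurable
  have hm' : Measurable fun p : (Fin M → Euc n) × Euc n => |inter b p.2 p.1 - t| :=
    (((measurable_inter b).comp measurable_swap).sub_const t).abs
  have hm : Measurable fun p : (Fin M → Euc n) × Euc n =>
      Real.exp (-V p.2) * k p.2 * |inter b p.2 p.1 - t| := by fun_prop
  have hqk0 : ∀ y, 0 ≤ Real.exp (-V y) * k y := fun y => mul_nonneg (Real.exp_pos _).le (h0 y)
  have hI0 : 0 ≤ ∫ y, Real.exp (-V y) * k y := integral_nonneg hqk0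
  rw [integral_eq_lintegral_of_nonneg_ae (ae_of_all _ fun p =>
    mul_nonneg (hqk0 _) (abs_nonneg _)) hm.aestronglyMeasurable,
    lintegral_prod_symm' _ hm.ennreal_ofReal]
  refine ENNReal.toReal_le_of_le_ofReal (by positivity) ?_
  calc _ ≤ ∫⁻ y, ENNReal.ofReal (t * ε) * ENNReal.ofReal (Real.exp (-V y) * k y) := by
        refine lintegral_mono fun y => ?_
        beta_reduce
        rcases eq_or_ne (k y) 0 with hy | hy
        · simp [hy]
        · have e1 : ∀ x : Fin M → Euc n, ENNReal.ofReal (Real.exp (-V y) * k y *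
              |inter b y x - t|) = ENNReal.ofReal (Real.exp (-V y) * k y * t) *
                ENNReal.ofReal |inter b y x * t⁻¹ - 1| := by
            intro x
            rw [← ENNReal.ofReal_mul (mul_nonneg (hqk0 y) ht.le)]
            congr 1
            rw [mul_assoc _ t, ← abs_of_pos ht, ← abs_mul, abs_of_pos ht, mul_sub, mul_one,
              mul_comm (inter b y x), ← mul_assoc, mul_inv_cancel₀ ht.ne', one_mul]
          simp only [e1]
          rw [lintegral_const_mul' _ _ ENNReal.ofReal_ne_top]
          refine (mul_le_mul_right (h y hy) _).trans (le_of_eq ?_)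
          rw [← ENNReal.ofReal_mul (mul_nonneg (hqk0 y) ht.le),
            ← ENNReal.ofReal_mul (by positivity)]
          congr 1
          ring
    _ = ENNReal.ofReal (t * (∫ y, Real.exp (-V y) * k y) * ε) := by
        rw [lintegral_const_mul' _ _ ENNReal.ofReal_ne_top,
          ← ofReal_integral_eq_lintegral_ofReal hqk (ae_of_all _ hqk0),
          ← ENNReal.ofReal_mul (by positivity)]
        congr 1
        ring

/-- Convergence of the Laplace functionals of the zoomed log-gas. -/
theorem IsEquilibrium.tendsto_integral_thin [NeZero n] (h : IsEquilibrium V γ L μ)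
    (hV : ContDiff ℝ 2 V) (hVs : SuperLog V) {β : ℕ → ℝ} (hβ : ∀ N, 0 < β N)
    (hβγ : Tendsto (fun N : ℕ => β N * (N : ℝ)) atTop (𝓝 γ))
    {E : ℕ → Euc n} {α : ℕ → ℝ} {υN : ℕ → Euc n} {υ : Euc n}
    (hE : Tendsto (fun N => ‖E N‖) atTop atTop)
    (hgrad : ∀ N, gradient V (E N) = α N • υN N)
    (hα : ∀ N, 0 < α N)
    (hυN : ∀ N, ‖υN N‖ = 1)
    (hEdge : Tendsto (fun N : ℕ => (N : ℝ) * Real.exp (-V (E N) + β N * (N : ℝ) *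
      Real.log ‖E N‖) / (L * α N ^ n)) atTop (𝓝 1))
    (hυ : Tendsto υN atTop (𝓝 υ))
    (hαE : Tendsto (fun N => α N * ‖E N‖) atTop atTop)
    {ψ : Diffeomorph 𝓘(ℝ, Euc n) 𝓘(ℝ, Euc n) (Euc n) (Euc n) 1}
    (hψ : ∀ x, |(fderiv ℝ ψ x).det| = 1)
    (hHess : ∀ K : Set (Euc n), IsCompact K →
      Tendsto (fun N : ℕ => (α N ^ 2)⁻¹ *
          sSup ((fun x => ‖fderiv ℝ (fderiv ℝ V) (zoom (E N) (α N) ψ x)‖) '' K))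
        atTop (𝓝 0))
    {f : Euc n → ℝ} (hf : Continuous f) (hfs : HasCompactSupport f) (hf0 : ∀ x, 0 ≤ f x)
    (hf1 : ∀ x, f x ≤ 1) :
    Tendsto (fun N : ℕ => ∫ x : Fin N → Euc n,
      thin (fun y => f (zoomInv (E N) (α N) ψ y)) 1 x ∂(gibbs V (β N) N)) atTop
      (𝓝 (Real.exp (-∫ x, Real.exp (-(inner ℝ υ (ψ x))) * f x))) := by
  have hVc := hV.continuous
  have hL := h.pos
  have hγ0 : 0 ≤ γ := ge_of_tendsto hβγ (Eventually.of_forall fun M => by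
    have := hβ M
    positivity)
  have hΓ : 0 ≤ γ + 1 := by linarith
  obtain ⟨lam, hl⟩ := exists_isDominating hVc hVs hΓ
  obtain ⟨ρ, hρ⟩ : ∃ ρ, ∀ x, f x ≠ 0 → ‖ψ x‖ ≤ ρ := by
    obtain ⟨ρ, hρ⟩ := (hfs.isCompact.image ψ.continuous).isBounded.exists_norm_le
    exact ⟨ρ, fun x hx => hρ _ ⟨x, subset_tsupport f hx, rfl⟩⟩
  have hΘ := tendsto_integral_zoom hV hgrad hα hυN hυ hHess hf hfs hρ
  set Θ := ∫ x, Real.exp (-(inner ℝ υ (ψ x))) * f x with hΘdef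
  have hΘ0 : 0 ≤ Θ := integral_nonneg fun x => mul_nonneg (Real.exp_pos _).le (hf0 x)
  obtain ⟨C, hC, hEC⟩ := exists_eventually_norm_le hVs hγ0 hL hβγ hE hα hEdge hαE
  have hlog := tendsto_mul_log_norm hβ hβγ hE hC hEC
  set b : ℕ → ℝ := fun M => β (M + 1) with hb
  have hb0 : ∀ M, 0 < b M := fun M => hβ _
  have hbγ : Tendsto (fun M : ℕ => b M * M) atTop (𝓝 γ) := tendsto_shift_mul hβγ
  have hbΓ : ∀ᶠ M : ℕ in atTop, b M * M ≤ γ + 1 :=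
    hbγ.eventually_le_const (show γ < γ + 1 by linarith)
  rw [← tendsto_add_atTop_iff_nat 1]
  set e : ℕ → Euc n := fun M => E (M + 1) with he
  set a : ℕ → ℝ := fun M => α (M + 1) with ha
  have ha0 : ∀ M, 0 < a M := fun M => hα _
  have hE' : Tendsto (fun M => ‖e M‖) atTop atTop := (tendsto_add_atTop_iff_nat 1).mpr hE
  have hαE' : Tendsto (fun M => a M * ‖e M‖) atTop atTop :=
    (tendsto_add_atTop_iff_nat 1).mpr hαE
  have hEdge' : Tendsto (fun M : ℕ => ((M + 1 : ℕ) : ℝ) * Real.exp (-V (e M) +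
      b M * ((M + 1 : ℕ) : ℝ) * Real.log ‖e M‖) / (L * a M ^ n)) atTop (𝓝 1) :=
    (tendsto_add_atTop_iff_nat 1).mpr hEdge
  have hlog' : Tendsto (fun M => b M * Real.log ‖e M‖) atTop (𝓝 0) :=
    (tendsto_add_atTop_iff_nat 1).mpr hlog
  have hΘ' : Tendsto (fun M => ∫ x, Real.exp (-(V (zoom (e M) (a M) ψ x) - V (e M))) * f x)
      atTop (𝓝 Θ) := (tendsto_add_atTop_iff_nat 1).mpr hΘ
  set k : ℕ → Euc n → ℝ := fun M y => f (zoomInv (e M) (a M) ψ y) with hk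
  have hkm : ∀ M, Measurable (k M) := fun M => (hf.comp (continuous_zoomInv _ _ ψ)).measurable
  set R : ℕ → ℝ := fun M => (ratio V (b M) M).toReal with hR
  have hRlim : Tendsto R atTop (𝓝 L) := by
    have h1 := (ENNReal.tendsto_toReal ENNReal.ofReal_ne_top).comp
      (h.tendsto_ratio hVc hVs hΓ hl hb0 hbγ hbΓ)
    rwa [ENNReal.toReal_ofReal hL.le] at h1
  have hR0 : ∀ M, 0 < R M := fun M => ENNReal.toReal_pos (ratio_ne_zero hVc hVs (hb0 M) M)
    (ratio_ne_top hVc hVs (hb0 M) M)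
  -- The interaction factor with all `M` other particles at distance `|E|`.
  set t : ℕ → ℝ := fun M => Real.exp (b M * M * Real.log ‖e M‖) with ht
  have hqi : Integrable fun y => Real.exp (-V y) := by
    simpa using hVs.integrable hVc 0 le_rfl
  have hqk : ∀ M, Integrable fun y => Real.exp (-V y) * k M y := fun M =>
    hqi.mul_bdd (c := 1) (hkm M).aestronglyMeasurable
      (ae_of_all _ fun y => by rw [Real.norm_of_nonneg (hf0 _)]; exact hf1 _)
  set c : ℕ → ℝ := fun M => (M + 1) * (R M)⁻¹ * t M * ∫ y, Real.exp (-V y) * k M y with hc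
  have hclim : Tendsto c atTop (𝓝 Θ) := by
    have h1 : Tendsto (fun M => L / R M) atTop (𝓝 1) := by
      have := (tendsto_const_nhds (x := L)).div hRlim hL.ne'
      rwa [div_self hL.ne'] at this
    -- The edge condition contains `|E|^{β N}` while `t` has the exponent `β (N - 1)`; this is the
    -- missing factor.
    have h2 : Tendsto (fun M => Real.exp (-(b M * Real.log ‖e M‖))) atTop (𝓝 1) := by
      have := (Real.continuous_exp.tendsto _).comp hlog'.neg
      rwa [neg_zero, Real.exp_zero] at this
    have h3 := ((hEdge'.mul h1).mul h2).mul hΘ'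
    rw [one_mul, one_mul, one_mul] at h3
    refine h3.congr fun M => ?_
    have h4 : ∫ y, Real.exp (-V y) * k M y = (a M ^ n)⁻¹ * (Real.exp (-V (e M)) *
        ∫ x, Real.exp (-(V (zoom (e M) (a M) ψ x) - V (e M))) * f x) := by
      rw [integral_eq_integral_zoom (e := e M) (ha0 M) hψ]
      congr 1
      rw [← integral_const_mul]
      refine integral_congr_ae (ae_of_all _ fun x => ?_)
      simp only [hk]
      rw [zoomInv_zoom _ (ha0 M), ← mul_assoc, ← Real.exp_add]
      congr 2
      ring
    have h5 : Real.exp (-V (e M) + b M * ((M + 1 : ℕ) : ℝ) * Real.log ‖e M‖) *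
        Real.exp (-(b M * Real.log ‖e M‖)) = t M * Real.exp (-V (e M)) := by
      rw [ht, ← Real.exp_add, ← Real.exp_add]
      congr 1
      push_cast
      ring
    have hRM := hR0 M
    have haM := ha0 M
    simp only [hc, h4]
    set J := ∫ x, Real.exp (-(V (zoom (e M) (a M) ψ x) - V (e M))) * f x
    calc _ = ((M + 1 : ℕ) : ℝ) * (Real.exp (-V (e M) + b M * ((M + 1 : ℕ) : ℝ) * Real.log ‖e M‖) *
        Real.exp (-(b M * Real.log ‖e M‖))) / a M ^ n / R M * J := by
          field_simp
      _ = _ := by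
          rw [h5]
          push_cast
          field_simp
  set e₁ : ℕ → ℝ := fun M => (M + 1) * (R M)⁻¹ * ∫ p : (Fin M → Euc n) × Euc n,
    Real.exp (-V p.2) * k M p.2 * |inter (b M) p.2 p.1 - t M| ∂((gibbs V (b M) M).prod volume)
    with he₁
  have he₁lim : Tendsto e₁ atTop (𝓝 0) := by
    have hnn : ∀ M, 0 ≤ e₁ M := fun M => by
      have h1 := inv_pos.mpr (hR0 M)
      have h2 : 0 ≤ ∫ p : (Fin M → Euc n) × Euc n, Real.exp (-V p.2) * k M p.2 *
          |inter (b M) p.2 p.1 - t M| ∂((gibbs V (b M) M).prod volume) := integral_nonneg fun p =>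
        mul_nonneg (mul_nonneg (Real.exp_pos _).le (hf0 _)) (abs_nonneg _)
      simp only [he₁]
      positivity
    -- The zoomed support lies within `ρ/α` of `E`, so this is the relative variation of the norm on
    -- it. The absolute value covers `f = 0`, where `ρ` may be negative.
    have hρlim : Tendsto (fun M => |ρ| / (a M * ‖e M‖)) atTop (𝓝 0) := hαE'.const_div_atTop _
    rw [Metric.tendsto_nhds]
    intro ε hε
    -- The relative error gets multiplied by `c ≤ Θ + 1`.
    have hε' : 0 < ε / (2 * (Θ + 1)) := by positivity
    have hedge := eventually_forall_lintegral_inter_edge hVc hVs hΓ hl hb0 hbΓ hE' hρlim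
      (fun M => by have := ha0 M; positivity) (ENNReal.ofReal_pos.mpr hε')
    have hc1 := hclim.eventually_le_const (show Θ < Θ + 1 by linarith)
    filter_upwards [hedge, hc1, hE'.eventually_ge_atTop 1] with M h1 h2 h3
    rw [Real.dist_eq, sub_zero, abs_of_nonneg (hnn M)]
    have haM := ha0 M
    have hclose : ∀ y, k M y ≠ 0 → |‖y‖ - ‖e M‖| ≤ |ρ| / (a M * ‖e M‖) * ‖e M‖ := by
      intro y hy
      refine (abs_norm_sub_norm_le _ _).trans ?_
      have h4 := hρ _ hy
      have h5 : ψ (zoomInv (e M) (a M) ψ y) = a M • (y - e M) := by simp [zoomInv]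
      rw [h5, norm_smul, Real.norm_of_nonneg haM.le] at h4
      have h6 : |ρ| / (a M * ‖e M‖) * ‖e M‖ = |ρ| / a M := by
        have : ‖e M‖ ≠ 0 := by positivity
        field_simp
      rw [h6, le_div_iff₀ haM, mul_comm]
      exact h4.trans (le_abs_self ρ)
    have h7 := integral_mul_abs_inter_sub_le hVc hVs (hb0 M) (Real.exp_pos _) hε'.le
      (hkm M) (fun y => hf0 _) (hqk M) (t := t M) (fun y hy => by
        have := h1 y (hclose y hy)
        rwa [Real.exp_neg] at this)
    have h8 : e₁ M ≤ c M * (ε / (2 * (Θ + 1))) := by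
      have h9 := mul_le_mul_of_nonneg_left h7
        (show 0 ≤ (M + 1) * (R M)⁻¹ by have := inv_pos.mpr (hR0 M); positivity)
      refine h9.trans (le_of_eq ?_)
      simp only [hc]
      ring
    calc e₁ M ≤ c M * (ε / (2 * (Θ + 1))) := h8
      _ ≤ (Θ + 1) * (ε / (2 * (Θ + 1))) := by gcongr
      _ = ε / 2 := by field_simp
      _ < ε := by linarith
  set e₃ : ℕ → ℝ := fun M => ∫ p : (Fin M → Euc n) × Euc n,
    |joint V (b M) p - Real.exp (-(γ * pot μ p.2) - V p.2)| ∂((gibbs V (b M) M).prod volume)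
    with he₃
  have he₃lim : Tendsto e₃ atTop (𝓝 0) :=
    h.tendsto_integral_abs_joint_sub hVc hVs hΓ hl hb0 hbγ hbΓ
  have hbound : ∀ M : ℕ, |∫ x, thin (k M) 1 x ∂(gibbs V (b M) (M + 1)) - Real.exp (-Θ)| ≤
      e₁ M + |c M - Θ| + Θ * (L⁻¹ * (e₃ M + R M * (c M + e₁ M) / (M + 1) + |R M - L|)) :=
    fun M => abs_integral_thin_sub_le hVc hVs (hb0 M) (hkm M) (fun y => hf0 _) (fun y => hf1 _)
      (Real.exp_pos _).le hΘ0 hL hqi h.integrable h.eq rfl rfl le_rfl le_rfl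
  have hN : Tendsto (fun M : ℕ => R M * (c M + e₁ M) / ((M : ℝ) + 1)) atTop (𝓝 0) := by
    have h1 : Tendsto (fun M : ℕ => (M : ℝ) + 1) atTop atTop :=
      tendsto_atTop_add_const_right _ _ tendsto_natCast_atTop_atTop
    exact (hRlim.mul (hclim.add he₁lim)).div_atTop h1
  have hzero : Tendsto (fun M : ℕ => e₁ M + |c M - Θ| +
      Θ * (L⁻¹ * (e₃ M + R M * (c M + e₁ M) / (M + 1) + |R M - L|))) atTop (𝓝 0) := by
    have h1 := (hclim.sub_const Θ).abs
    have h2 := (hRlim.sub_const L).abs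
    have h3 := (he₁lim.add h1).add ((((he₃lim.add hN).add h2).const_mul L⁻¹).const_mul Θ)
    simpa using h3
  rw [tendsto_iff_norm_sub_tendsto_zero]
  exact squeeze_zero (fun M => norm_nonneg _) hbound hzero

end Convergence

/-! ### Construction of the Poisson process and its Laplace functional. -/

section Poisson

open ProbabilityTheory

/-- The function `s ↦ e^{-s}` on `[0, ∞]`. -/
def expNeg (s : ℝ≥0∞) : ℝ≥0∞ := EReal.exp (-(s : EReal))

@[simp]
lemma expNeg_zero : expNeg 0 = 1 := by simp [expNeg]

lemma expNeg_eq_inv (s : ℝ≥0∞) : expNeg s = (EReal.exp s)⁻¹ := by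
  rw [expNeg, EReal.exp_neg]

lemma expNeg_le_one (s : ℝ≥0∞) : expNeg s ≤ 1 := by
  rw [expNeg, EReal.exp_le_one_iff, EReal.neg_le_zero]
  exact EReal.coe_ennreal_nonneg s

lemma expNeg_add (s t : ℝ≥0∞) : expNeg (s + t) = expNeg s * expNeg t := by
  have h : ∀ u : ℝ≥0∞, EReal.exp (u : EReal) ≠ 0 := fun u => by
    have : 1 ≤ EReal.exp (u : EReal) := EReal.one_le_exp_iff.mpr (EReal.coe_ennreal_nonneg u)
    exact (lt_of_lt_of_le one_pos this).ne'
  rw [expNeg_eq_inv, expNeg_eq_inv, expNeg_eq_inv, EReal.coe_ennreal_add, EReal.exp_add,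
    ENNReal.mul_inv (Or.inl (h s)) (Or.inr (h t))]

lemma expNeg_sum {ι : Type*} (s : Finset ι) (g : ι → ℝ≥0∞) :
    expNeg (∑ i ∈ s, g i) = ∏ i ∈ s, expNeg (g i) := by
  classical
  induction s using Finset.induction_on with
  | empty => simp
  | insert i s hi ih => rw [Finset.sum_insert hi, Finset.prod_insert hi, expNeg_add, ih]

lemma continuous_expNeg : Continuous expNeg :=
  ENNReal.continuous_exp.comp (continuous_neg.comp continuous_coe_ennreal_ereal)

@[fun_prop]
lemma measurable_expNeg : Measurable expNeg := continuous_expNeg.measurable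

lemma expNeg_ofReal {r : ℝ} (hr : 0 ≤ r) :
    expNeg (ENNReal.ofReal r) = ENNReal.ofReal (Real.exp (-r)) := by
  rw [expNeg, EReal.coe_ennreal_ofReal, max_eq_left hr, ← EReal.coe_neg, EReal.exp_coe]

lemma expNeg_coe (r : ℝ≥0) : expNeg r = ENNReal.ofReal (Real.exp (-(r : ℝ))) := by
  rw [← expNeg_ofReal r.coe_nonneg, ENNReal.ofReal_coe_nnreal]

/-- The annulus `k ≤ |x| < k + 1`. -/
def annulus (n k : ℕ) : Set (Euc n) := {x | (k : ℝ) ≤ ‖x‖ ∧ ‖x‖ < k + 1}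

lemma measurableSet_annulus (k : ℕ) : MeasurableSet (annulus n k) :=
  (measurableSet_le measurable_const measurable_norm).inter
    (measurableSet_lt measurable_norm measurable_const)

lemma eq_floor_of_mem_annulus {k : ℕ} {x : Euc n} (h : x ∈ annulus n k) : ⌊‖x‖⌋₊ = k :=
  (Nat.floor_eq_iff (norm_nonneg x)).mpr h

lemma pairwise_disjoint_annulus : Pairwise (Function.onFun Disjoint (annulus n)) := by
  intro k l hkl
  refine Set.disjoint_left.mpr fun x hk hl => hkl ?_
  rw [← eq_floor_of_mem_annulus hk, eq_floor_of_mem_annulus hl]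

lemma iUnion_annulus : ⋃ k, annulus n k = Set.univ :=
  Set.eq_univ_of_forall fun x => Set.mem_iUnion.mpr
    ⟨⌊‖x‖⌋₊, Nat.floor_le (norm_nonneg x), Nat.lt_floor_add_one _⟩

/-- The law of a point of the annulus. -/
def markMeasure (θ : Measure (Euc n)) (k : ℕ) : Measure (Euc n) :=
  (θ (annulus n k))⁻¹ • θ.restrict (annulus n k)

/-- The law of the number of points in an annulus, and of their positions. -/
def blockMeasure (θ : Measure (Euc n)) (k : ℕ) : Measure (ℕ × (ℕ → Euc n)) :=
  (poissonMeasure (θ (annulus n k)).toNNReal).prod (Measure.infinitePi fun _ => markMeasure θ k)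

/-- The law of the independent points in all annuli. -/
def configMeasure (θ : Measure (Euc n)) : Measure (ℕ → ℕ × (ℕ → Euc n)) :=
  Measure.infinitePi (blockMeasure θ)

/-- The point process: in the annulus `k`, the first `(ω k).1` points of the sequence `(ω k).2`. -/
def config (ω : ℕ → ℕ × (ℕ → Euc n)) : Measure (Euc n) :=
  Measure.sum fun p : ℕ × ℕ =>
    if p.2 < (ω p.1).1 then Measure.dirac ((ω p.1).2 p.2) else 0

/-- The sum of a function over the points of a block. -/
def blockSum (f : Euc n → ℝ≥0∞) (p : ℕ × (ℕ → Euc n)) : ℝ≥0∞ :=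
  ∑ i ∈ Finset.range p.1, f (p.2 i)

lemma measurable_blockSum {f : Euc n → ℝ≥0∞} (hf : Measurable f) : Measurable (blockSum f) :=
  measurable_from_prod_countable_right fun N => by
    simp only [blockSum]
    fun_prop

lemma lintegral_config {f : Euc n → ℝ≥0∞} (hf : Measurable f) (ω : ℕ → ℕ × (ℕ → Euc n)) :
    ∫⁻ x, f x ∂(config ω) = ∑' k, blockSum f (ω k) := by
  rw [config, lintegral_sum_measure, ENNReal.tsum_prod']
  refine tsum_congr fun k => ?_
  rw [blockSum, tsum_eq_sum (s := Finset.range (ω k).1)]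
  · refine Finset.sum_congr rfl fun i hi => ?_
    rw [if_pos (Finset.mem_range.mp hi), lintegral_dirac' _ hf]
  · intro i hi
    rw [if_neg (by simpa using hi), lintegral_zero_measure]

lemma measurable_config : Measurable (config : (ℕ → ℕ × (ℕ → Euc n)) → Measure (Euc n)) := by
  refine Measure.measurable_of_measurable_coe _ fun s hs => ?_
  have h : ∀ ω : ℕ → ℕ × (ℕ → Euc n), config ω s = ∑' k, blockSum (s.indicator 1) (ω k) := by
    intro ω
    rw [← lintegral_config (measurable_one.indicator hs), lintegral_indicator_one hs]
  simp only [h]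
  exact Measurable.tsum fun k =>
    (measurable_blockSum (measurable_one.indicator hs)).comp (measurable_pi_apply k)

lemma lintegral_poisson_pow (m : ℝ≥0) {a : ℝ} (ha0 : 0 ≤ a) :
    ∫⁻ N, ENNReal.ofReal a ^ N ∂(poissonMeasure m) =
      ENNReal.ofReal (Real.exp (-(m * (1 - a)))) := by
  rw [poissonMeasure, lintegral_sum_measure]
  have h1 : ∀ N : ℕ, ∫⁻ N, ENNReal.ofReal a ^ N ∂(ENNReal.ofReal
      (Real.exp (-m) * m ^ N / (N.factorial : ℝ)) • (Measure.dirac N : Measure ℕ)) =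
      ENNReal.ofReal (Real.exp (-m) * ((m * a) ^ N / (N.factorial : ℝ))) := by
    intro N
    rw [lintegral_smul_measure, lintegral_dirac, smul_eq_mul, ← ENNReal.ofReal_pow ha0,
      ← ENNReal.ofReal_mul (by positivity)]
    congr 1
    rw [mul_pow]
    ring
  have h2 : HasSum (fun N : ℕ => Real.exp (-m) * ((m * a) ^ N / (N.factorial : ℝ)))
      (Real.exp (-m) * Real.exp (m * a)) := by
    rw [Real.exp_eq_exp_ℝ]
    exact (NormedSpace.expSeries_div_hasSum_exp ((m : ℝ) * a)).mul_left _
  rw [tsum_congr h1, ← ENNReal.ofReal_tsum_of_nonneg (fun N => by positivity) h2.summable,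
    h2.tsum_eq, ← Real.exp_add]
  congr 2
  ring

variable {θ : Measure (Euc n)}

lemma isProbabilityMeasure_markMeasure (h0 : ∀ k, θ (annulus n k) ≠ 0)
    (hfin : ∀ k, θ (annulus n k) ≠ ∞) (k : ℕ) : IsProbabilityMeasure (markMeasure θ k) := by
  constructor
  rw [markMeasure, Measure.smul_apply, Measure.restrict_apply_univ, smul_eq_mul,
    ENNReal.inv_mul_cancel (h0 k) (hfin k)]

lemma isProbabilityMeasure_blockMeasure (h0 : ∀ k, θ (annulus n k) ≠ 0)
    (hfin : ∀ k, θ (annulus n k) ≠ ∞) (k : ℕ) : IsProbabilityMeasure (blockMeasure θ k) := by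
  have := isProbabilityMeasure_markMeasure h0 hfin k
  rw [blockMeasure]
  infer_instance

lemma isProbabilityMeasure_configMeasure (h0 : ∀ k, θ (annulus n k) ≠ 0)
    (hfin : ∀ k, θ (annulus n k) ≠ ∞) : IsProbabilityMeasure (configMeasure θ) := by
  have := isProbabilityMeasure_blockMeasure h0 hfin
  rw [configMeasure]
  infer_instance

/-- The Laplace functional of a block. -/
lemma lintegral_expNeg_blockSum (h0 : ∀ k, θ (annulus n k) ≠ 0)
    (hfin : ∀ k, θ (annulus n k) ≠ ∞) (k : ℕ) {f : Euc n → ℝ≥0} (hf : Measurable f) :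
    ∫⁻ p, expNeg (blockSum (fun x => (f x : ℝ≥0∞)) p) ∂(blockMeasure θ k) =
      expNeg (∫⁻ x in annulus n k, ENNReal.ofReal (1 - Real.exp (-(f x : ℝ))) ∂θ) := by
  have hmark := isProbabilityMeasure_markMeasure h0 hfin k
  have hfm : Measurable fun x => (f x : ℝ≥0∞) := hf.coe_nnreal_ennreal
  have hfr : Measurable fun x => (f x : ℝ) := hf.coe_nnreal_real
  set a := ∫⁻ x, expNeg (f x) ∂(markMeasure θ k) with ha
  set d := ∫⁻ x in annulus n k, ENNReal.ofReal (1 - Real.exp (-(f x : ℝ))) ∂θ with hd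
  have hN : ∀ N : ℕ, ∫⁻ x, expNeg (blockSum (fun x => (f x : ℝ≥0∞)) (N, x))
      ∂(Measure.infinitePi fun _ => markMeasure θ k) = a ^ N := by
    intro N
    simp only [blockSum, expNeg_sum]
    rw [lintegral_prod_eq_prod_lintegral_of_indepFun (Finset.range N)
      (fun i (x : ℕ → Euc n) => expNeg (f (x i)))
      (iIndepFun_infinitePi (X := fun _ x => expNeg (f x)) fun _ => by fun_prop)
      (fun i => by fun_prop)]
    have h1 : ∀ i : ℕ, ∫⁻ x : ℕ → Euc n, expNeg (f (x i))
        ∂(Measure.infinitePi fun _ => markMeasure θ k) = a := fun i =>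
      (measurePreserving_eval_infinitePi (fun _ : ℕ => markMeasure θ k) i).lintegral_comp
        (f := fun x => expNeg (f x)) (by fun_prop)
    simp [h1]
  have ha1 : a ≤ 1 := by
    calc a ≤ ∫⁻ _x, 1 ∂(markMeasure θ k) := lintegral_mono fun x => expNeg_le_one _
      _ = 1 := by simp
  -- One point of the annulus has Laplace transform `1 - d / θ(A_k)`. Inserted in the generating
  -- function of a Poisson number of mean `θ(A_k)`, it gives `e^{-d}`.
  have hsum : a + (θ (annulus n k))⁻¹ * d = 1 := by
    have h1 : (θ (annulus n k))⁻¹ * d =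
        ∫⁻ x, ENNReal.ofReal (1 - Real.exp (-(f x : ℝ))) ∂(markMeasure θ k) := by
      rw [markMeasure, lintegral_smul_measure, smul_eq_mul]
    rw [h1, ha, ← lintegral_add_left (by fun_prop)]
    have h2 : ∀ x, expNeg (f x) + ENNReal.ofReal (1 - Real.exp (-(f x : ℝ))) = 1 := by
      intro x
      rw [expNeg_coe, ← ENNReal.ofReal_add (Real.exp_pos _).le, add_sub_cancel,
        ENNReal.ofReal_one]
      exact sub_nonneg.mpr (Real.exp_le_one_iff.mpr (by simp))
    simp [h2]
  have hat : a ≠ ∞ := ne_top_of_le_ne_top ENNReal.one_ne_top ha1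
  have hdt : d ≠ ∞ := by
    intro h
    rw [h, ENNReal.mul_top (ENNReal.inv_ne_zero.mpr (hfin k)), add_top] at hsum
    exact ENNReal.top_ne_one hsum
  have hreal : d.toReal = (θ (annulus n k)).toReal * (1 - a.toReal) := by
    have h1 := congrArg ENNReal.toReal hsum
    rw [ENNReal.toReal_add hat (ENNReal.mul_ne_top (ENNReal.inv_ne_top.mpr (h0 k)) hdt),
      ENNReal.toReal_mul, ENNReal.toReal_inv, ENNReal.toReal_one] at h1
    have h2 : 0 < (θ (annulus n k)).toReal := ENNReal.toReal_pos (h0 k) (hfin k)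
    field_simp at h1
    linarith
  have hm : Measurable fun p : ℕ × (ℕ → Euc n) => expNeg (blockSum (fun x => (f x : ℝ≥0∞)) p) :=
    measurable_expNeg.comp (measurable_blockSum hfm)
  rw [blockMeasure, lintegral_prod _ hm.aemeasurable]
  simp only [hN]
  rw [← ENNReal.ofReal_toReal hat, lintegral_poisson_pow _ ENNReal.toReal_nonneg,
    ← ENNReal.ofReal_toReal hdt, expNeg_ofReal ENNReal.toReal_nonneg, hreal]
  rfl

/-- The Laplace functional of the Poisson process. -/
lemma laplace_config (h0 : ∀ k, θ (annulus n k) ≠ 0)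
    (hfin : ∀ k, θ (annulus n k) ≠ ∞) {f : Euc n → ℝ≥0} (hf : Measurable f) :
    laplace (configMeasure θ) config f =
      expNeg (∫⁻ x, ENNReal.ofReal (1 - Real.exp (-(f x : ℝ))) ∂θ) := by
  have hblock := isProbabilityMeasure_blockMeasure h0 hfin
  have hconf := isProbabilityMeasure_configMeasure h0 hfin
  have hfm : Measurable fun x => (f x : ℝ≥0∞) := hf.coe_nnreal_ennreal
  set g : ℕ × (ℕ → Euc n) → ℝ≥0∞ := blockSum fun x => (f x : ℝ≥0∞) with hg
  have hgm : Measurable g := measurable_blockSum hfm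
  set d : ℕ → ℝ≥0∞ := fun k =>
    ∫⁻ x in annulus n k, ENNReal.ofReal (1 - Real.exp (-(f x : ℝ))) ∂θ with hd
  have hdsum : ∑' k, d k = ∫⁻ x, ENNReal.ofReal (1 - Real.exp (-(f x : ℝ))) ∂θ := by
    rw [← setLIntegral_univ, ← iUnion_annulus,
      lintegral_iUnion measurableSet_annulus pairwise_disjoint_annulus]
  have hfinite : ∀ K : ℕ, ∫⁻ ω : ℕ → ℕ × (ℕ → Euc n), expNeg (∑ k ∈ Finset.range K, g (ω k))
      ∂(configMeasure θ) = expNeg (∑ k ∈ Finset.range K, d k) := by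
    intro K
    simp only [expNeg_sum]
    rw [configMeasure, lintegral_prod_eq_prod_lintegral_of_indepFun (Finset.range K)
      (fun k (ω : ℕ → ℕ × (ℕ → Euc n)) => expNeg (g (ω k)))
      (iIndepFun_infinitePi (X := fun _ p => expNeg (g p)) fun _ => by fun_prop)
      (fun i => by fun_prop)]
    refine Finset.prod_congr rfl fun k _ => ?_
    rw [← lintegral_expNeg_blockSum h0 hfin k hf]
    exact (measurePreserving_eval_infinitePi (blockMeasure θ) k).lintegral_comp
      (f := fun p => expNeg (g p)) (by fun_prop)
  have hlap : laplace (configMeasure θ) config f =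
      ∫⁻ ω, expNeg (∑' k, g (ω k)) ∂(configMeasure θ) := by
    rw [laplace]
    refine lintegral_congr fun ω => ?_
    rw [lintegral_config hfm]
    rfl
  have hlim1 : Tendsto (fun K => ∫⁻ ω : ℕ → ℕ × (ℕ → Euc n),
      expNeg (∑ k ∈ Finset.range K, g (ω k)) ∂(configMeasure θ)) atTop
      (𝓝 (∫⁻ ω, expNeg (∑' k, g (ω k)) ∂(configMeasure θ))) := by
    -- `expNeg` is bounded and continuous on `[0, ∞]` including at `∞`, so no finiteness of the sum
    -- is required.
    refine tendsto_lintegral_of_dominated_convergence (fun _ => 1) (fun K => by fun_prop)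
      (fun K => ae_of_all _ fun ω => expNeg_le_one _) (by simp) (ae_of_all _ fun ω => ?_)
    exact (continuous_expNeg.tendsto _).comp (ENNReal.tendsto_nat_tsum _)
  simp only [hfinite] at hlim1
  have hlim2 : Tendsto (fun K => expNeg (∑ k ∈ Finset.range K, d k)) atTop
      (𝓝 (expNeg (∑' k, d k))) :=
    (continuous_expNeg.tendsto _).comp (ENNReal.tendsto_nat_tsum _)
  rw [hlap, tendsto_nhds_unique hlim1 hlim2, hdsum]

/-- Simplicity of the process: points of different blocks lie in disjoint annuli, and two
independent points of the same block coincide with probability zero as `θ` has no atoms. -/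
lemma ae_config (h0 : ∀ k, θ (annulus n k) ≠ 0) (hfin : ∀ k, θ (annulus n k) ≠ ∞)
    (hat : ∀ x, θ {x} = 0) : ∀ᵐ ω ∂(configMeasure θ),
      (∀ k i, (ω k).2 i ∈ annulus n k) ∧ ∀ k i j, i ≠ j → (ω k).2 i ≠ (ω k).2 j := by
  have hmark := isProbabilityMeasure_markMeasure h0 hfin
  have hblock := isProbabilityMeasure_blockMeasure h0 hfin
  have hpres : ∀ k, MeasurePreserving (fun ω : ℕ → ℕ × (ℕ → Euc n) => (ω k).2)
      (configMeasure θ) (Measure.infinitePi fun _ => markMeasure θ k) := fun k =>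
    measurePreserving_snd.comp (measurePreserving_eval_infinitePi (blockMeasure θ) k)
  have hmem : ∀ k, ∀ᵐ x ∂(markMeasure θ k), x ∈ annulus n k := fun k =>
    Measure.ae_smul_measure (ae_restrict_mem (measurableSet_annulus k)) _
  have hatm : ∀ k x, markMeasure θ k {x} = 0 := by
    intro k x
    rw [markMeasure, Measure.smul_apply, smul_eq_mul, mul_eq_zero]
    exact Or.inr (le_antisymm ((Measure.restrict_apply_le _ _).trans (hat x).le) zero_le)
  refine Filter.Eventually.and ?_ ?_
  · simp only [ae_all_iff]
    intro k i
    exact ((measurePreserving_eval_infinitePi (fun _ : ℕ => markMeasure θ k) i).comp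
      (hpres k)).quasiMeasurePreserving.ae (hmem k)
  · simp only [ae_all_iff]
    intro k i j hij
    have h1 := ae_prod_ne (σ := markMeasure θ k) (hatm k)
    rw [← Measure.infinitePi_map_eval_prod (P := fun _ : ℕ => markMeasure θ k) hij] at h1
    exact (hpres k).quasiMeasurePreserving.ae
      (ae_of_ae_map (f := fun x : ℕ → Euc n => (x i, x j)) (by fun_prop) h1)

lemma isPointProcess_config (h0 : ∀ k, θ (annulus n k) ≠ 0) (hfin : ∀ k, θ (annulus n k) ≠ ∞)
    (hat : ∀ x, θ {x} = 0) : IsPointProcess (configMeasure θ) (config (n := n)) := by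
  refine ⟨measurable_config, ?_⟩
  filter_upwards [ae_config h0 hfin hat] with ω hω
  obtain ⟨hmem, hne⟩ := hω
  set I : Set (ℕ × ℕ) := {p | p.2 < (ω p.1).1} with hI
  set F : I → Euc n := fun p => (ω p.1.1).2 p.1.2 with hF
  have hinj : Function.Injective F := by
    rintro ⟨⟨k, i⟩, hp⟩ ⟨⟨l, j⟩, hq⟩ h
    simp only [hF] at h
    have h1 : k = l := by
      have h2 := eq_floor_of_mem_annulus (hmem k i)
      have h3 := eq_floor_of_mem_annulus (hmem l j)
      rw [← h] at h3
      exact h2.symm.trans h3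
    subst h1
    have h4 : i = j := by
      by_contra hij
      exact hne k i j hij h
    subst h4
    rfl
  refine ⟨Set.range F, fun K hK => ?_, ?_⟩
  -- A bounded set meets finitely many annuli, each with finitely many points.
  · obtain ⟨r, hr⟩ := hK.isBounded.exists_norm_le
    have hfinite : (⋃ k ∈ Set.Iic ⌊r⌋₊, (fun i => (ω k).2 i) '' Set.Iio (ω k).1).Finite :=
      (Set.finite_Iic _).biUnion fun k _ => (Set.finite_Iio _).image _
    refine hfinite.subset ?_
    rintro y ⟨⟨⟨⟨k, i⟩, hp⟩, rfl⟩, hy⟩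
    simp only [Set.mem_iUnion]
    refine ⟨k, ?_, i, hp, rfl⟩
    exact Nat.le_floor ((hmem k i).1.trans (hr _ hy))
  · refine Measure.ext fun s hs => ?_
    rw [config, Measure.sum_apply _ hs, Measure.sum_apply _ hs]
    have h1 : ∀ p : ℕ × ℕ, (if p.2 < (ω p.1).1 then Measure.dirac ((ω p.1).2 p.2)
        else (0 : Measure (Euc n))) s =
        I.indicator (fun p => Measure.dirac ((ω p.1).2 p.2) s) p := by
      intro p
      by_cases hp : p.2 < (ω p.1).1
      · rw [if_pos hp, Set.indicator_of_mem (show p ∈ I from hp)]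
      · rw [if_neg hp, Set.indicator_of_notMem (show p ∉ I from hp), Measure.coe_zero,
          Pi.zero_apply]
    rw [tsum_congr h1, ← tsum_subtype, ← (Equiv.ofInjective F hinj).tsum_eq]
    rfl

theorem isPoissonProcess_config (h0 : ∀ k, θ (annulus n k) ≠ 0)
    (hfin : ∀ k, θ (annulus n k) ≠ ∞) (hat : ∀ x, θ {x} = 0) :
    IsPoissonProcess (configMeasure θ) (config (n := n)) θ :=
  ⟨isPointProcess_config h0 hfin hat, fun _ hf => laplace_config h0 hfin hf⟩

end Poisson

/-! ### Laplace functionals of the edge process and of its limit -/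

lemma volume_annulus_pos [NeZero n] (k : ℕ) : 0 < (volume : Measure (Euc n)) (annulus n k) := by
  have := nontrivial_euc (n := n)
  have hopen : IsOpen {x : Euc n | (k : ℝ) < ‖x‖ ∧ ‖x‖ < k + 1} :=
    (isOpen_lt continuous_const continuous_norm).inter
      (isOpen_lt continuous_norm continuous_const)
  obtain ⟨x, hx⟩ := exists_norm_eq (Euc n) (show (0 : ℝ) ≤ k + 1 / 2 by positivity)
  refine (hopen.measure_pos volume ⟨x, ?_⟩).trans_le (measure_mono fun y hy => ⟨hy.1.le, hy.2⟩)
  constructor <;> rw [hx] <;> linarith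

section withDensity

variable {ρ : Euc n → ℝ}

/-- The construction normalises the intensity on each annulus, so every annulus needs positive mass.
-/
lemma withDensity_annulus_ne_zero [NeZero n] (hρ : Continuous ρ) (hρ0 : ∀ x, 0 < ρ x) (k : ℕ) :
    (volume.withDensity fun x => ENNReal.ofReal (ρ x)) (annulus n k) ≠ 0 := fun h =>
  (volume_annulus_pos k).ne' (withDensity_absolutelyContinuous'
    hρ.measurable.ennreal_ofReal.aemeasurable
    (ae_of_all _ fun x => (ENNReal.ofReal_pos.mpr (hρ0 x)).ne') h)

lemma withDensity_annulus_ne_top (hρ : Continuous ρ) (k : ℕ) :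
    (volume.withDensity fun x => ENNReal.ofReal (ρ x)) (annulus n k) ≠ ∞ := by
  have h1 : IsLocallyFiniteMeasure ((volume : Measure (Euc n)).withDensity
      fun x => ENNReal.ofReal (ρ x)) :=
    IsLocallyFiniteMeasure.withDensity_ofReal hρ
  refine ((measure_mono ?_).trans_lt (isCompact_closedBall (0 : Euc n) (k + 1)).measure_lt_top).ne
  intro x hx
  simpa using hx.2.le

lemma withDensity_singleton [NeZero n] (x : Euc n) :
    (volume.withDensity fun x => ENNReal.ofReal (ρ x)) {x} = 0 := by
  have := nullSingletonClass_volume (n := n)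
  exact withDensity_absolutelyContinuous _ _ (measure_singleton x)

lemma expNeg_lintegral_withDensity (hρ : Continuous ρ) (hρ0 : ∀ x, 0 < ρ x) {h : Euc n → ℝ}
    (hh : Continuous h) (hs : HasCompactSupport h) (h0 : ∀ x, 0 ≤ h x) :
    expNeg (∫⁻ x, ENNReal.ofReal (h x) ∂(volume.withDensity fun x => ENNReal.ofReal (ρ x))) =
      ENNReal.ofReal (Real.exp (-∫ x, ρ x * h x)) := by
  have hnn : ∀ x, 0 ≤ ρ x * h x := fun x => mul_nonneg (hρ0 x).le (h0 x)
  rw [lintegral_withDensity_eq_lintegral_mul _ hρ.measurable.ennreal_ofReal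
    hh.measurable.ennreal_ofReal]
  simp only [Pi.mul_apply, ← ENNReal.ofReal_mul (hρ0 _).le]
  rw [← ofReal_integral_eq_lintegral_ofReal (f := fun x => ρ x * h x)
    ((hρ.mul hh).integrable_of_hasCompactSupport hs.mul_left) (ae_of_all _ hnn),
    expNeg_ofReal (integral_nonneg hnn)]

end withDensity

/-- `e^{-Ξ(f)}` is the product of the `e^{-f(φ⁻¹(x_j))} = 1 - k(x_j)`, that is, the endpoint `s = 1`
of the interpolation. -/
lemma laplace_edgeProcess {V : Euc n → ℝ} {b : ℝ} {N : ℕ} [IsProbabilityMeasure (gibbs V b N)]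
    (e : Euc n) (a : ℝ) (ψ : Diffeomorph 𝓘(ℝ, Euc n) 𝓘(ℝ, Euc n) (Euc n) (Euc n) 1)
    {f : Euc n → ℝ≥0} (hf : Continuous f) :
    laplace (gibbs V b N) (edgeProcess e a ψ N) f = ENNReal.ofReal (∫ x : Fin N → Euc n,
      thin (fun y => 1 - Real.exp (-(f (zoomInv e a ψ y) : ℝ))) 1 x ∂(gibbs V b N)) := by
  set k : Euc n → ℝ := fun y => 1 - Real.exp (-(f (zoomInv e a ψ y) : ℝ)) with hk
  have hkc : Continuous k := by
    have := continuous_zoomInv e a ψ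
    fun_prop
  have hk0 : ∀ y, 0 ≤ k y := fun y =>
    sub_nonneg.mpr (Real.exp_le_one_iff.mpr (neg_nonpos.mpr (NNReal.coe_nonneg _)))
  have hk1 : ∀ y, k y ≤ 1 := fun y => sub_le_self _ (Real.exp_pos _).le
  have h1 : (1 : ℝ) ∈ Set.Icc (0 : ℝ) 1 := ⟨zero_le_one, le_rfl⟩
  have hint : Integrable (thin k 1) (gibbs V b N) :=
    Integrable.of_bound (measurable_thin hkc.measurable 1).aestronglyMeasurable 1
      (ae_of_all _ fun x => by
        rw [Real.norm_of_nonneg (thin_nonneg hk0 hk1 h1 x)]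
        exact thin_le_one hk0 hk1 h1 x)
  rw [ofReal_integral_eq_lintegral_ofReal hint (ae_of_all _ fun x => thin_nonneg hk0 hk1 h1 x)]
  refine lintegral_congr fun x => ?_
  change expNeg _ = _
  rw [edgeProcess, lintegral_finsetSum_measure, expNeg_sum]
  simp only [lintegral_dirac' _ hf.measurable.coe_nnreal_ennreal, expNeg_coe, thin, hk, one_mul,
    sub_sub_cancel]
  exact (ENNReal.ofReal_prod_of_nonneg fun _ _ => (Real.exp_pos _).le).symm

end LogGas

end

/-! ### Poisson limit at the edge. -/

theorem mainTheorem8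
    -- dimension, potential, temperature
    (n : ℕ) (hn : n = 1 ∨ n = 2)
    (V : LogGas.Euc n → ℝ) (hV : ContDiff ℝ 2 V)
    (hVinf : ∀ κ : ℝ, 0 ≤ κ → BddBelow (Set.range fun x => V x - κ * LogGas.logWeight x))
    (hVint : ∀ κ : ℝ, 0 ≤ κ → Integrable fun x : LogGas.Euc n => ‖x‖ ^ κ * Real.exp (-V x))
    (γ : ℝ) (hγ : 0 ≤ γ)
    (β : ℕ → ℝ) (hβ : ∀ N, 0 < β N)
    (hβγ : Tendsto (fun N : ℕ => β N * (N : ℝ)) atTop (𝓝 γ))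
    -- the edge points `E_N`, with `∇V(E_N) = α_N υ_N`
    (E : ℕ → LogGas.Euc n) (α : ℕ → ℝ) (υN : ℕ → LogGas.Euc n) (υ : LogGas.Euc n)
    (hE : Tendsto (fun N => ‖E N‖) atTop atTop)
    (hgrad : ∀ N, gradient V (E N) = α N • υN N)
    (hα : ∀ N, 0 < α N)
    (hυN : ∀ N, ‖υN N‖ = 1)
    (hEdge : Tendsto (fun N : ℕ =>
        (N : ℝ) * Real.exp (-V (E N) + β N * (N : ℝ) * Real.log ‖E N‖)
          / (LogGas.eqConst V γ * α N ^ n)) atTop (𝓝 1))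
    (hυ : Tendsto υN atTop (𝓝 υ))
    (hlogα : Tendsto (fun N : ℕ => (N : ℝ)⁻¹ * Real.log (α N)) atTop (𝓝 0))
    (hαE : Tendsto (fun N => α N * ‖E N‖) atTop atTop)
    -- the diffeomorphism `ψ`, with unit Jacobian, and the Hessian condition
    (ψ : Diffeomorph 𝓘(ℝ, LogGas.Euc n) 𝓘(ℝ, LogGas.Euc n) (LogGas.Euc n) (LogGas.Euc n) 1)
    (hψ : ∀ x, |(fderiv ℝ ψ x).det| = 1)
    (hHess : ∀ K : Set (LogGas.Euc n), IsCompact K →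
      Tendsto (fun N : ℕ => (α N ^ 2)⁻¹ *
          sSup ((fun x => ‖fderiv ℝ (fderiv ℝ V) (LogGas.zoom (E N) (α N) ψ x)‖) '' K))
        atTop (𝓝 0)) :
    ∃ (Ω : Type) (_ : MeasurableSpace Ω) (Q : Measure Ω) (Ξ : Ω → Measure (LogGas.Euc n)),
      IsProbabilityMeasure Q ∧
      LogGas.IsPoissonProcess Q Ξ
        (volume.withDensity fun x => ENNReal.ofReal (Real.exp (-(inner ℝ υ (ψ x))))) ∧
      LogGas.ConvergesInDistribution
        (fun N => LogGas.gibbs V (β N) N)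
        (fun N => LogGas.edgeProcess (E N) (α N) ψ N) Q Ξ := by
  have : NeZero n := ⟨by omega⟩
  have hρ : Continuous fun x => Real.exp (-(inner ℝ υ (ψ x))) := by
    have := ψ.continuous
    fun_prop
  have hρ0 : ∀ x, 0 < Real.exp (-(inner ℝ υ (ψ x))) := fun x => Real.exp_pos _
  have h0 := LogGas.withDensity_annulus_ne_zero hρ hρ0
  have hfin := LogGas.withDensity_annulus_ne_top hρ
  have hpoisson := LogGas.isPoissonProcess_config h0 hfin LogGas.withDensity_singleton
  refine ⟨_, inferInstance, _, LogGas.config,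
    LogGas.isProbabilityMeasure_configMeasure h0 hfin, hpoisson, fun f hf hfs => ?_⟩
  -- The convergence theorem is applied to `1 - e^{-f}`, which is continuous and compactly supported
  -- with values in `[0, 1]`, and whose integral against the intensity is the Poisson exponent.
  have hf' : Continuous fun x => 1 - Real.exp (-(f x : ℝ)) := by fun_prop
  have hfs' : HasCompactSupport fun x => 1 - Real.exp (-(f x : ℝ)) :=
    hfs.comp_left (g := fun r : ℝ≥0 => 1 - Real.exp (-(r : ℝ))) (by simp)
  have hf0 : ∀ x, 0 ≤ 1 - Real.exp (-(f x : ℝ)) := fun x =>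
    sub_nonneg.mpr (Real.exp_le_one_iff.mpr (neg_nonpos.mpr (NNReal.coe_nonneg _)))
  have hf1 : ∀ x, 1 - Real.exp (-(f x : ℝ)) ≤ 1 := fun x => sub_le_self _ (Real.exp_pos _).le
  have hlim := (LogGas.isEquilibrium_equilibriumMeasure hV.continuous hVinf hγ).tendsto_integral_thin
    hV hVinf hβ hβγ hE hgrad hα hυN hEdge hυ hαE hψ hHess hf' hfs' hf0 hf1
  rw [hpoisson.2 f hf.measurable]
  change Tendsto _ _ (𝓝 (LogGas.expNeg _))
  rw [LogGas.expNeg_lintegral_withDensity hρ hρ0 hf' hfs' hf0]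
  refine (ENNReal.tendsto_ofReal hlim).congr fun N => ?_
  have := LogGas.isProbabilityMeasure_gibbs hV.continuous hVinf (hβ N) N
  exact (LogGas.laplace_edgeProcess (E N) (α N) ψ hf).symm
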